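/- In the List Disjointness problem one is given (random read-only access to) two lists $x,y\in[m]^n$, where $m$ is at most a fixed polynomial in $n$, and has to determine whether there are indices $i,j$ with $x_i=y_j$. There is a Monte Carlo algorithm that takes as input such an instance $x,y$, a positive integer $s$, and a positive integer $p$ with $$\sum_{v=1}^m \bigl(|x^{-1}(v)|^2+|y^{-1}(v)|^2\bigr)\le p ,$$ and that solves the instance in time $O(T\cdot\mathrm{polylog}(T))$, where $T=n\sqrt{p/s}$, using $O(s\log n)$ bits of working space, for any $s\le n^2/p$. The algorithm assumes random read-only access to a uniformly random function $h:[m]\to[n]$. Here ``Monte Carlo'' means that the algorithm never errs on instances without a common value, and that on an instance with a common value it answers YES with at least a constant positive probability (over $h$ and its own coin tosses); whenever it answers YES it outputs a pair $(i,j)$ with $x_i=y_j$. The time and space bounds hold for every outcome of the randomness; the constants hidden in them may depend on the polynomial that bounds $m$ in terms of $n$. -/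

import Mathlib

/-!
# Randomized random access machines with logarithmic cost

The machine has a work memory of cells, addressed by natural numbers and holding natural numbers,
read-only random access to two lists `x`, `y` and to a function `h`, and a source of fair coins
that can only be read one after the other.  Programs are finite and do not depend on the input.
Time and space are counted in bits (logarithmic cost criterion).
-/

namespace RAM

/-- Binary operations on memory cells; `sub` is truncated subtraction. -/
inductive Op where
  | add | sub | mul | div | mod | lt | eq

/-- The result of an operation. -/
def Op.eval : Op → ℕ → ℕ → ℕ
  | .add, u, v => u + v
  | .sub, u, v => u - v
  | .mul, u, v => u * v
  | .div, u, v => u / v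
  | .mod, u, v => u % v
  | .lt, u, v => if u < v then 1 else 0
  | .eq, u, v => if u = v then 1 else 0

/-- The time for an operation: linear in the bit lengths of the operands, and the product of the
bit lengths for multiplication and division. -/
def Op.cost : Op → ℕ → ℕ → ℕ
  | .mul, u, v => (1 + u.size) * (1 + v.size)
  | .div, u, v => (1 + u.size) * (1 + v.size)
  | .mod, u, v => (1 + u.size) * (1 + v.size)
  | _, u, v => 1 + u.size + v.size

/-- The primitive instructions.  All arguments are addresses of memory cells, except the literal
`c` in `const d c`.  With `M` for the memory:
* `const d c`: `M[d] := c`;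
* `op o d a b`: `M[d] := M[a] o M[b]`;
* `load d a`: `M[d] := M[M[a]]`;
* `store a b`: `M[M[a]] := M[b]`;
* `readX d a`: `M[d] := x[M[a]]`, and likewise for `readY` and `readH`;
* `flip d`: `M[d] :=` the next fair coin. -/
inductive Instr where
  | const (d c : ℕ)
  | op (o : Op) (d a b : ℕ)
  | load (d a : ℕ)
  | store (a b : ℕ)
  | readX (d a : ℕ)
  | readY (d a : ℕ)
  | readH (d a : ℕ)
  | flip (d : ℕ)

/-- Programs.  The tests of `ite` and `loop` ask whether the cell with the given address is
nonzero; `loop a c` is `while M[a] ≠ 0 do c`. -/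
inductive Prog where
  | skip
  | instr (i : Instr)
  | seq (c₁ c₂ : Prog)
  | ite (a : ℕ) (c₁ c₂ : Prog)
  | loop (a : ℕ) (c : Prog)

/-- What a program can read but not write: the lists `x`, `y`, the function `h`, and the sequence of
coins. -/
structure Env where
  x : ℕ → ℕ
  y : ℕ → ℕ
  h : ℕ → ℕ
  coins : ℕ → Bool

/-- The work memory (all but finitely many cells are zero), and the number of coins that have been
used so far. -/
structure State where
  mem : ℕ →₀ ℕ
  used : ℕ

/-- The space in bits that a memory content takes: for every nonzero cell, the bit length of its
address plus the bit length of its content. -/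
def State.bits (σ : State) : ℕ := σ.mem.sum fun a v => a.size + v.size

/-- Write `v` into cell `d`. -/
noncomputable def State.write (σ : State) (d v : ℕ) : State := ⟨σ.mem.update d v, σ.used⟩

/-- The effect of an instruction. -/
noncomputable def Instr.eval (E : Env) : Instr → State → State
  | .const d c, σ => σ.write d c
  | .op o d a b, σ => σ.write d (o.eval (σ.mem a) (σ.mem b))
  | .load d a, σ => σ.write d (σ.mem (σ.mem a))
  | .store a b, σ => σ.write (σ.mem a) (σ.mem b)
  | .readX d a, σ => σ.write d (E.x (σ.mem a))
  | .readY d a, σ => σ.write d (E.y (σ.mem a))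
  | .readH d a, σ => σ.write d (E.h (σ.mem a))
  | .flip d, σ => ⟨σ.mem.update d (if E.coins σ.used then 1 else 0), σ.used + 1⟩

/-- The time that an instruction takes: one plus the bit lengths of the addresses and values it
handles. -/
def Instr.cost (E : Env) : Instr → State → ℕ
  | .const _ c, _ => 1 + c.size
  | .op o _ a b, σ => o.cost (σ.mem a) (σ.mem b)
  | .load _ a, σ => 1 + (σ.mem a).size + (σ.mem (σ.mem a)).size
  | .store a b, σ => 1 + (σ.mem a).size + (σ.mem b).size
  | .readX _ a, σ => 1 + (σ.mem a).size + (E.x (σ.mem a)).size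
  | .readY _ a, σ => 1 + (σ.mem a).size + (E.y (σ.mem a)).size
  | .readH _ a, σ => 1 + (σ.mem a).size + (E.h (σ.mem a)).size
  | .flip _, _ => 1

/-- `Exec E c σ σ' t b`: started in state `σ`, the program `c` halts in state `σ'`, after time `t`,
and `b` is the largest number of bits that the memory takes in the course of the execution. -/
inductive Exec (E : Env) : Prog → State → State → ℕ → ℕ → Prop
  | skip (σ : State) : Exec E .skip σ σ 1 σ.bits
  | instr (i : Instr) (σ : State) :
      Exec E (.instr i) σ (i.eval E σ) (i.cost E σ) (max σ.bits (i.eval E σ).bits)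
  | seq {c₁ c₂ : Prog} {σ σ₁ σ₂ : State} {t₁ t₂ b₁ b₂ : ℕ}
      (h₁ : Exec E c₁ σ σ₁ t₁ b₁) (h₂ : Exec E c₂ σ₁ σ₂ t₂ b₂) :
      Exec E (.seq c₁ c₂) σ σ₂ (t₁ + t₂) (max b₁ b₂)
  | ite_true {a : ℕ} {c₁ c₂ : Prog} {σ σ' : State} {t b : ℕ}
      (ha : σ.mem a ≠ 0) (h₁ : Exec E c₁ σ σ' t b) :
      Exec E (.ite a c₁ c₂) σ σ' (1 + (σ.mem a).size + t) b
  | ite_false {a : ℕ} {c₁ c₂ : Prog} {σ σ' : State} {t b : ℕ}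
      (ha : σ.mem a = 0) (h₂ : Exec E c₂ σ σ' t b) :
      Exec E (.ite a c₁ c₂) σ σ' (1 + t) b
  | loop_false {a : ℕ} {c : Prog} {σ : State} (ha : σ.mem a = 0) :
      Exec E (.loop a c) σ σ 1 σ.bits
  | loop_true {a : ℕ} {c : Prog} {σ σ₁ σ₂ : State} {t₁ t₂ b₁ b₂ : ℕ}
      (ha : σ.mem a ≠ 0) (h₁ : Exec E c σ σ₁ t₁ b₁) (h₂ : Exec E (.loop a c) σ₁ σ₂ t₂ b₂) :
      Exec E (.loop a c) σ σ₂ (1 + (σ.mem a).size + t₁ + t₂) (max b₁ b₂)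

/-- Executions are deterministic (once the coins are fixed). -/
theorem Exec.det {E : Env} {c : Prog} {σ σ₁ σ₂ : State} {t₁ t₂ b₁ b₂ : ℕ}
    (h₁ : Exec E c σ σ₁ t₁ b₁) (h₂ : Exec E c σ σ₂ t₂ b₂) : σ₁ = σ₂ ∧ t₁ = t₂ ∧ b₁ = b₂ := by
  induction h₁ generalizing σ₂ t₂ b₂ with
  | skip σ => cases h₂; simp
  | instr i σ => cases h₂; simp
  | seq _ _ ih₁ ih₂ =>
    cases h₂ with
    | seq k₁ k₂ =>
      obtain ⟨rfl, rfl, rfl⟩ := ih₁ k₁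
      obtain ⟨rfl, rfl, rfl⟩ := ih₂ k₂
      simp
  | ite_true ha _ ih =>
    cases h₂ with
    | ite_true _ k => obtain ⟨rfl, rfl, rfl⟩ := ih k; simp
    | ite_false ha' _ => exact absurd ha' ha
  | ite_false ha _ ih =>
    cases h₂ with
    | ite_true ha' _ => exact absurd ha ha'
    | ite_false _ k => obtain ⟨rfl, rfl, rfl⟩ := ih k; simp
  | loop_false ha =>
    cases h₂ with
    | loop_false _ => simp
    | loop_true ha' _ _ => exact absurd ha ha'
  | loop_true ha _ _ ih₁ ih₂ =>
    cases h₂ with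
    | loop_false ha' => exact absurd ha' ha
    | loop_true _ k₁ k₂ =>
      obtain ⟨rfl, rfl, rfl⟩ := ih₁ k₁
      obtain ⟨rfl, rfl, rfl⟩ := ih₂ k₂
      simp

end RAM

namespace ListDisjointness

open RAM MeasureTheory ProbabilityTheory

/-- A function on `{0, …, a - 1}` with values in `{0, …, b - 1}`, as the machine reads it; reading
outside the range gives `0`. -/
def oracle {a b : ℕ} (f : Fin a → Fin b) (i : ℕ) : ℕ :=
  if hi : i < a then (f ⟨i, hi⟩ : ℕ) else 0

/-- The numbers `n`, `m`, `s`, `p` are given to the program in the cells `0`, `1`, `2`, `3`. -/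
noncomputable def initial (n m s p : ℕ) : State :=
  ⟨Finsupp.single 0 n + Finsupp.single 1 m + Finsupp.single 2 s + Finsupp.single 3 p, 0⟩

/-- `Runs P x y s p h ω σ t b`: on the input `x`, `y`, `s`, `p`, with read-only random access to
`h` and with the coins `ω`, the program `P` halts in state `σ` after time `t`, and its memory
never takes more than `b` bits (and takes `b` bits at some moment). -/
def Runs (P : Prog) {n m : ℕ} (x y : Fin n → Fin m) (s p : ℕ) (h : Fin m → Fin n) (ω : ℕ → Bool)
    (σ : State) (t b : ℕ) : Prop :=
  Exec ⟨oracle x, oracle y, oracle h, ω⟩ P (initial n m s p) σ t b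

/-- The answer of the program, read off its final state: "disjoint" (`none`) if cell `0` is zero,
and otherwise the pair of indices in the cells `1` and `2`, which is claimed to be a solution. -/
def answer (σ : State) : Option (ℕ × ℕ) :=
  if σ.mem 0 = 0 then none else some (σ.mem 1, σ.mem 2)

/-- `(a, b)` is a pair of indices at which the lists `x` and `y` have the same value. -/
def IsSolution {n m : ℕ} (x y : Fin n → Fin m) (ab : ℕ × ℕ) : Prop :=
  ∃ i j : Fin n, (i : ℕ) = ab.1 ∧ (j : ℕ) = ab.2 ∧ x i = y j

/-- The sum of the squared frequencies of the entries in the two lists. -/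
def sqFreq {n m : ℕ} (x y : Fin n → Fin m) : ℕ :=
  ∑ v : Fin m, ((Finset.univ.filter fun i => x i = v).card ^ 2 +
    (Finset.univ.filter fun i => y i = v).card ^ 2)

/-- The law of an infinite sequence of independent fair coins. -/
noncomputable def coinLaw : Measure (ℕ → Bool) :=
  Measure.infinitePi fun _ : ℕ => uniformOn (Set.univ : Set Bool)

/-- The joint law of a uniformly random function `h` and an independent sequence of fair coins. -/
noncomputable def law (n m : ℕ) : Measure ((Fin m → Fin n) × (ℕ → Bool)) :=
  (uniformOn (Set.univ : Set (Fin m → Fin n))).prod coinLaw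

end ListDisjointness

/-! # Structured programs and their compilation -/

namespace RAM

/-! Collisions are found by walks in a random functional graph. Fix a bit position and an
orientation, and let `z u` be the entry at index `u` of `x` or of `y`, depending on that bit of `u`.
The walk `u ↦ h (z u) + shift (z u)` modulo `n` sees only the value `z u`, so equal values at two
different indices make walks merge. If the bit separates the indices of a solution, this solution
becomes such a merging point (`exists_sides`). Solutions with two equal indices have no separating
bit and are searched for directly. Mixing the lists at most doubles the sum of squared frequencies
(`freqSum_entryAt_le`).

Let `τ` be the least positive integer with `n² < 64² τ² s p`. A round makes about `s / 64` walks of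
at most `2τ` steps, each of which stops when it enters an interval of length about `n / (16τ)`. The
start of a stopped walk is stored in a table with `s` cells, at the end point modulo `s`, and
compared with the previous content of the cell. Walks that have merged stop at the same point.
Repeating them in step, after the longer one has been shortened, exhibits the two indices where they
merge (`mergeStep_inv`, `compareCmd_found`). Every candidate is verified before it is recorded, so
there are no false positives.

For the success probability of a round fix an index `j` and a set `I` of indices with the same
value. A `Pattern` prescribes the two walks, the index `i ∈ I`, the numbers of steps before `i` and
`j` and the number of steps to the common end. It demands that no other walk visits `j`, and that no
walk between the two ends in their cell. These demands make patterns with different data mutually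
exclusive (`Pattern.unique`), so lower bounds for their probabilities may be added
(`le_expect_hasPattern`). A single pattern is bounded by fixing all its vertices: the random
function then has prescribed values at distinct arguments. Any other walk that does harm must enter
a small set by a fresh query, which is bounded by resampling the answer (`expect_resample`,
`expect_hit_le`). The parameters are such that all error terms together stay below one half
(`pattern_condition`).

All rounds use the same `h`, so they are not independent. Each round adds its own random shift to
`h`, an almost pairwise independent hash of the value (`expect_shift₂_le`). Given the success of one
round, another one rarely visits `j`, and even more rarely both `i` and `j`
(`expect_blockVisits_le`, `expect_blockVisits₂_le`). The second moment method
(`le_expect_exists_of_sq_le`) then shows that about `n² / (sτ)²` rounds succeed with constant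
probability. There are two cases. If the value of `j` is rare, then all pairs of walks and a single
`i` are used. If it is frequent, then only pairs of nearby walks are used, but all of `I`. Since the
right bit, orientation and interval are unknown, the rounds run through all of them, at the cost of
a factor `6 log n`.

The walks cost about `n² / (sτ) + sτ` steps up to logarithms. Both terms are `O(n √(p / s))` by the
choice of `τ` (`prog_steps_le`). All of this is carried out by a program in a small structured
language, whose compilation to the machine respects time and space (`Cmd.reach`). -/

theorem State.write_mem (σ : State) (d v a : ℕ) :
    (σ.write d v).mem a = if a = d then v else σ.mem a := by
  simp only [State.write, Finsupp.coe_update, Function.update_apply]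

@[simp] theorem State.write_used (σ : State) (d v : ℕ) : (σ.write d v).used = σ.used := rfl

/-- All nonzero cells have addresses below `A` and contents at most `N`. -/
structure State.Fits (A N : ℕ) (σ : State) : Prop where
  zero : ∀ a, A ≤ a → σ.mem a = 0
  le : ∀ a, σ.mem a ≤ N

theorem State.Fits.bits_le {A N : ℕ} {σ : State} (h : σ.Fits A N) :
    σ.bits ≤ A * (A.size + N.size) := by
  have hsub : σ.mem.support ⊆ Finset.range A := by
    intro a ha
    rw [Finset.mem_range]
    by_contra hA
    exact (Finsupp.mem_support_iff.1 ha) (h.zero a (not_lt.1 hA))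
  calc σ.bits = ∑ a ∈ σ.mem.support, (a.size + (σ.mem a).size) := rfl
    _ ≤ ∑ a ∈ Finset.range A, (a.size + (σ.mem a).size) :=
        Finset.sum_le_sum_of_subset hsub
    _ ≤ ∑ _a ∈ Finset.range A, (A.size + N.size) := by
        refine Finset.sum_le_sum fun a ha => ?_
        exact Nat.add_le_add (Nat.size_le_size (Finset.mem_range.1 ha).le)
          (Nat.size_le_size (h.le a))
    _ = A * (A.size + N.size) := by simp

theorem State.Fits.write {A N : ℕ} {σ : State} (h : σ.Fits A N) {d v : ℕ} (hd : d < A)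
    (hv : v ≤ N) : (σ.write d v).Fits A N where
  zero a ha := by
    rw [State.write_mem, if_neg (by omega)]
    exact h.zero a ha
  le a := by
    rw [State.write_mem]
    split_ifs
    · exact hv
    · exact h.le a

/-- `c` leads from `σ` to `σ'` within `k` steps whose costs are those of operations on numbers that
are at most `N`, and in the space of `A` cells with such numbers. -/
def Reach (E : Env) (A N : ℕ) (c : Prog) (σ : State) (k : ℕ) (σ' : State) : Prop :=
  ∃ t b, Exec E c σ σ' t b ∧ t ≤ k * (1 + N.size) ^ 2 ∧ b ≤ A * (A.size + N.size)

section Reach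

variable {E : Env} {A N : ℕ}

theorem Reach.mono {c : Prog} {σ σ' : State} {k k' : ℕ} (h : Reach E A N c σ k σ')
    (hk : k ≤ k') : Reach E A N c σ k' σ' := by
  obtain ⟨t, b, h₁, h₂, h₃⟩ := h
  exact ⟨t, b, h₁, h₂.trans (Nat.mul_le_mul_right _ hk), h₃⟩

theorem Reach.skip {σ : State} (h : σ.Fits A N) : Reach E A N .skip σ 1 σ :=
  ⟨_, _, .skip σ, by nlinarith [Nat.zero_le N.size], h.bits_le⟩

theorem Reach.seq {c₁ c₂ : Prog} {σ σ₁ σ₂ : State} {k₁ k₂ : ℕ} (h₁ : Reach E A N c₁ σ k₁ σ₁)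
    (h₂ : Reach E A N c₂ σ₁ k₂ σ₂) : Reach E A N (.seq c₁ c₂) σ (k₁ + k₂) σ₂ := by
  obtain ⟨t₁, b₁, h₁, ht₁, hb₁⟩ := h₁
  obtain ⟨t₂, b₂, h₂, ht₂, hb₂⟩ := h₂
  exact ⟨_, _, .seq h₁ h₂, by rw [add_mul]; exact Nat.add_le_add ht₁ ht₂, max_le hb₁ hb₂⟩

theorem Reach.instr {i : Instr} {σ : State} (h : σ.Fits A N) (h' : (i.eval E σ).Fits A N)
    (hc : i.cost E σ ≤ (1 + N.size) ^ 2) : Reach E A N (.instr i) σ 1 (i.eval E σ) :=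
  ⟨_, _, .instr i σ, by simpa using hc, max_le h.bits_le h'.bits_le⟩

theorem one_add_size_le (N : ℕ) {u : ℕ} (hu : u ≤ N) : 1 + u.size ≤ (1 + N.size) ^ 2 := by
  have := Nat.size_le_size hu
  nlinarith

theorem one_add_size_add_size_le (N : ℕ) {u v : ℕ} (hu : u ≤ N) (hv : v ≤ N) :
    1 + u.size + v.size ≤ (1 + N.size) ^ 2 := by
  have := Nat.size_le_size hu
  have := Nat.size_le_size hv
  nlinarith

/-- Multiplication and division, with the product of the bit lengths, are the most expensive
operations. This is why `Reach` charges a square for every step. -/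
theorem Op.cost_le (o : Op) {u v : ℕ} (hu : u ≤ N) (hv : v ≤ N) :
    o.cost u v ≤ (1 + N.size) ^ 2 := by
  have h₁ := one_add_size_add_size_le N hu hv
  have h₂ : (1 + u.size) * (1 + v.size) ≤ (1 + N.size) ^ 2 := by
    rw [sq]
    exact Nat.mul_le_mul (by have := Nat.size_le_size hu; omega)
      (by have := Nat.size_le_size hv; omega)
  cases o <;> first | exact h₁ | exact h₂

theorem Reach.const {σ : State} (h : σ.Fits A N) {d c : ℕ} (hd : d < A) (hc : c ≤ N) :
    Reach E A N (.instr (.const d c)) σ 1 (σ.write d c) :=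
  Reach.instr h (h.write hd hc) (one_add_size_le N hc)

theorem Reach.op {σ : State} (h : σ.Fits A N) {o : Op} {d a b : ℕ} (hd : d < A)
    (hv : o.eval (σ.mem a) (σ.mem b) ≤ N) :
    Reach E A N (.instr (.op o d a b)) σ 1 (σ.write d (o.eval (σ.mem a) (σ.mem b))) :=
  Reach.instr h (h.write hd hv) (o.cost_le (h.le a) (h.le b))

theorem Reach.load {σ : State} (h : σ.Fits A N) {d a : ℕ} (hd : d < A) :
    Reach E A N (.instr (.load d a)) σ 1 (σ.write d (σ.mem (σ.mem a))) :=
  Reach.instr h (h.write hd (h.le _)) (one_add_size_add_size_le N (h.le a) (h.le _))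

theorem Reach.store {σ : State} (h : σ.Fits A N) {a b : ℕ} (hd : σ.mem a < A) :
    Reach E A N (.instr (.store a b)) σ 1 (σ.write (σ.mem a) (σ.mem b)) :=
  Reach.instr h (h.write hd (h.le _)) (one_add_size_add_size_le N (h.le a) (h.le _))

theorem Reach.readX {σ : State} (h : σ.Fits A N) {d a : ℕ} (hd : d < A)
    (hv : E.x (σ.mem a) ≤ N) :
    Reach E A N (.instr (.readX d a)) σ 1 (σ.write d (E.x (σ.mem a))) :=
  Reach.instr h (h.write hd hv) (one_add_size_add_size_le N (h.le a) hv)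

theorem Reach.readY {σ : State} (h : σ.Fits A N) {d a : ℕ} (hd : d < A)
    (hv : E.y (σ.mem a) ≤ N) :
    Reach E A N (.instr (.readY d a)) σ 1 (σ.write d (E.y (σ.mem a))) :=
  Reach.instr h (h.write hd hv) (one_add_size_add_size_le N (h.le a) hv)

theorem Reach.readH {σ : State} (h : σ.Fits A N) {d a : ℕ} (hd : d < A)
    (hv : E.h (σ.mem a) ≤ N) :
    Reach E A N (.instr (.readH d a)) σ 1 (σ.write d (E.h (σ.mem a))) :=
  Reach.instr h (h.write hd hv) (one_add_size_add_size_le N (h.le a) hv)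

theorem Reach.ite_true {a : ℕ} {c₁ c₂ : Prog} {σ σ' : State} {k : ℕ} (hf : σ.Fits A N)
    (ha : σ.mem a ≠ 0) (h : Reach E A N c₁ σ k σ') : Reach E A N (.ite a c₁ c₂) σ (1 + k) σ' := by
  obtain ⟨t, b, h, ht, hb⟩ := h
  refine ⟨_, _, .ite_true ha h, ?_, hb⟩
  have := one_add_size_le N (hf.le a)
  rw [add_mul]
  omega

theorem Reach.ite_false {a : ℕ} {c₁ c₂ : Prog} {σ σ' : State} {k : ℕ}
    (ha : σ.mem a = 0) (h : Reach E A N c₂ σ k σ') : Reach E A N (.ite a c₁ c₂) σ (1 + k) σ' := by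
  obtain ⟨t, b, h, ht, hb⟩ := h
  refine ⟨_, _, .ite_false ha h, ?_, hb⟩
  have := one_add_size_le N (Nat.zero_le N)
  rw [add_mul]
  omega

theorem Reach.loop_false {a : ℕ} {c : Prog} {σ : State} (hf : σ.Fits A N)
    (ha : σ.mem a = 0) : Reach E A N (.loop a c) σ 1 σ :=
  ⟨_, _, .loop_false ha, by have := one_add_size_le N (Nat.zero_le N); omega, hf.bits_le⟩

theorem Reach.loop_true {a : ℕ} {c : Prog} {σ σ₁ σ₂ : State} {k₁ k₂ : ℕ} (hf : σ.Fits A N)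
    (ha : σ.mem a ≠ 0) (h₁ : Reach E A N c σ k₁ σ₁) (h₂ : Reach E A N (.loop a c) σ₁ k₂ σ₂) :
    Reach E A N (.loop a c) σ (1 + k₁ + k₂) σ₂ := by
  obtain ⟨t₁, b₁, h₁, ht₁, hb₁⟩ := h₁
  obtain ⟨t₂, b₂, h₂, ht₂, hb₂⟩ := h₂
  refine ⟨_, _, .loop_true ha h₁ h₂, ?_, max_le hb₁ hb₂⟩
  have := one_add_size_le N (hf.le a)
  rw [add_mul, add_mul]
  omega

end Reach

/-! ### Expressions -/

/-- Expressions over variables, a table, and the input. -/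
inductive Exp where
  | const (c : ℕ)
  | var (v : ℕ)
  | op (o : Op) (a b : Exp)
  | get (a : Exp)
  | readX (a : Exp)
  | readY (a : Exp)
  | readH (a : Exp)

/-- The state of a structured program: variables, a table, and the number of coins used. -/
structure Store where
  var : ℕ → ℕ
  arr : ℕ → ℕ
  used : ℕ

/-- The value of an expression.  The length of the table is the value of the variable `2`. -/
def Exp.eval (E : Env) (s : Store) : Exp → ℕ
  | .const c => c
  | .var v => s.var v
  | .op o a b => o.eval (a.eval E s) (b.eval E s)
  | .get a => s.arr (a.eval E s % s.var 2)
  | .readX a => E.x (a.eval E s)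
  | .readY a => E.y (a.eval E s)
  | .readH a => E.h (a.eval E s)

/-- Code that evaluates an expression into the cell `40 + k`, using only the cells `40 + k`, …,
`59` for intermediate results.  The table starts in cell `80`. -/
def Exp.compile : Exp → ℕ → Prog
  | .const c, k => .instr (.const (40 + k) c)
  | .var v, k => .seq (.instr (.const (40 + k) 0)) (.instr (.op .add (40 + k) v (40 + k)))
  | .op o a b, k =>
      .seq (a.compile k) (.seq (b.compile (k + 1)) (.instr (.op o (40 + k) (40 + k) (40 + (k + 1)))))
  | .get a, k =>
      .seq (a.compile k) (.seq (.instr (.op .mod (40 + k) (40 + k) 2))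
        (.seq (.instr (.const (40 + (k + 1)) 80))
          (.seq (.instr (.op .add (40 + k) (40 + k) (40 + (k + 1))))
            (.instr (.load (40 + k) (40 + k))))))
  | .readX a, k => .seq (a.compile k) (.instr (.readX (40 + k) (40 + k)))
  | .readY a, k => .seq (a.compile k) (.instr (.readY (40 + k) (40 + k)))
  | .readH a, k => .seq (a.compile k) (.instr (.readH (40 + k) (40 + k)))

/-- The number of steps for the evaluation of an expression. -/
def Exp.steps : Exp → ℕ
  | .const _ => 1
  | .var _ => 2
  | .op _ a b => a.steps + (b.steps + 1)
  | .get a => a.steps + 4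
  | .readX a => a.steps + 1
  | .readY a => a.steps + 1
  | .readH a => a.steps + 1

/-- The number of cells that are used in the evaluation of an expression. -/
def Exp.depth : Exp → ℕ
  | .const _ => 1
  | .var _ => 1
  | .op _ a b => max a.depth (b.depth + 1)
  | .get a => max a.depth 2
  | .readX a => a.depth
  | .readY a => a.depth
  | .readH a => a.depth

theorem Exp.depth_pos (e : Exp) : 0 < e.depth := by
  induction e <;> simp_all [Exp.depth]

/-- A syntactic bound for the size of the value of an expression, as the exponent of a power of a
bound on its variables.  The variables in `P` are known to be positive. -/
def Exp.deg (P : ℕ → Bool) : Exp → ℕ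
  | .const _ => 1
  | .var _ => 1
  | .op .add a b => max (a.deg P) (b.deg P) + 1
  | .op .sub a _ => a.deg P
  | .op .mul a b => a.deg P + b.deg P
  | .op .div a _ => a.deg P
  | .op .mod _ (.var v) => if P v then 1 else 8
  | .op .mod a _ => a.deg P
  | .op .lt _ _ => 1
  | .op .eq _ _ => 1
  | .get _ => 1
  | .readX _ => 1
  | .readY _ => 1
  | .readH _ => 1

/-- The side conditions under which expressions are compiled correctly. -/
def Exp.ok (P : ℕ → Bool) : Exp → Bool
  | .const c => c ≤ 100
  | .var v => v < 40
  | .op o a b => a.ok P && b.ok P && decide ((Exp.op o a b).deg P ≤ 8) &&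
      match o, b with
      | .mod, .var v => P v
      | _, _ => true
  | .get a => a.ok P
  | .readX a => a.ok P
  | .readY a => a.ok P
  | .readH a => a.ok P

/-- The values of the store are at most `V`, the length of the table is `W`, and the variables
in `P` are positive. -/
structure Store.Good (P : ℕ → Bool) (V W : ℕ) (s : Store) : Prop where
  var_le : ∀ v, s.var v ≤ V
  arr_le : ∀ i, s.arr i ≤ V
  pos : ∀ v, P v = true → 0 < s.var v
  len : s.var 2 = W
  len_pos : 0 < W

/-- The inputs contain only numbers up to `V`. -/
structure Env.Good (V : ℕ) (E : Env) : Prop where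
  x_le : ∀ i, E.x i ≤ V
  y_le : ∀ i, E.y i ≤ V
  h_le : ∀ i, E.h i ≤ V

/-- A sum needs one more factor `V`, a product adds the exponents. Reduction modulo a variable that
is known to be positive brings the exponent back to one, and this is what keeps assigned values
bounded in loops. -/
theorem Exp.eval_le {P : ℕ → Bool} {V W : ℕ} {s : Store} {E : Env} (hV : 100 ≤ V)
    (hE : E.Good V) (hs : s.Good P V W) (e : Exp) (he : e.ok P) :
    e.eval E s ≤ V ^ e.deg P := by
  induction e with
  | const c =>
    simp only [Exp.ok, decide_eq_true_eq] at he
    simpa [Exp.eval, Exp.deg] using he.trans hV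
  | var v => simpa [Exp.eval, Exp.deg] using hs.var_le v
  | get a => simpa [Exp.eval, Exp.deg] using hs.arr_le _
  | readX a => simpa [Exp.eval, Exp.deg] using hE.x_le _
  | readY a => simpa [Exp.eval, Exp.deg] using hE.y_le _
  | readH a => simpa [Exp.eval, Exp.deg] using hE.h_le _
  | op o a b iha ihb =>
    simp only [Exp.ok, Bool.and_eq_true] at he
    obtain ⟨⟨⟨hoa, hob⟩, -⟩, hm⟩ := he
    have ha := iha hoa
    have hb := ihb hob
    have hV0 : 0 < V := by omega
    cases o with
    | add =>
      have h₁ : V ^ a.deg P ≤ V ^ max (a.deg P) (b.deg P) :=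
        Nat.pow_le_pow_right hV0 (le_max_left _ _)
      have h₂ : V ^ b.deg P ≤ V ^ max (a.deg P) (b.deg P) :=
        Nat.pow_le_pow_right hV0 (le_max_right _ _)
      simp only [Exp.eval, Op.eval, Exp.deg, pow_succ]
      nlinarith
    | sub =>
      simp only [Exp.eval, Op.eval, Exp.deg]
      exact (Nat.sub_le _ _).trans ha
    | mul =>
      simp only [Exp.eval, Op.eval, Exp.deg, pow_add]
      exact Nat.mul_le_mul ha hb
    | div =>
      simp only [Exp.eval, Op.eval, Exp.deg]
      exact (Nat.div_le_self _ _).trans ha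
    | lt =>
      simp only [Exp.eval, Op.eval, Exp.deg, pow_one]
      split_ifs <;> omega
    | eq =>
      simp only [Exp.eval, Op.eval, Exp.deg, pow_one]
      split_ifs <;> omega
    | mod =>
      have hle : (Exp.op .mod a b).eval E s ≤ a.eval E s := Nat.mod_le _ _
      cases b with
      | var v =>
        simp only [Exp.deg, hm, if_true, pow_one, Exp.eval, Op.eval]
        exact ((Nat.mod_lt _ (hs.pos v hm)).le).trans (hs.var_le v)
      | _ => exact hle.trans ha

theorem Exp.deg_le {P : ℕ → Bool} (e : Exp) (he : e.ok P) : e.deg P ≤ 8 := by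
  cases e with
  | op o a b =>
    simp only [Exp.ok, Bool.and_eq_true, decide_eq_true_eq] at he
    exact he.1.2
  | _ => simp [Exp.deg]

/-- The machine state represents the store. -/
structure Rel (W : ℕ) (s : Store) (σ : State) : Prop where
  var : ∀ v, v < 40 → σ.mem v = s.var v
  arr : ∀ i, i < W → σ.mem (80 + i) = s.arr i
  used : σ.used = s.used

/-- Cells 40 to 59 hold intermediate results and cells 60 to 79 loop counters. None of them
represents anything in the store. -/
theorem Rel.congr {W : ℕ} {s : Store} {σ σ' : State} (h : Rel W s σ)
    (hu : σ'.used = σ.used) (hm : ∀ a, (a < 40 ∨ 80 ≤ a) → σ'.mem a = σ.mem a) : Rel W s σ' where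
  var v hv := by rw [hm v (.inl hv), h.var v hv]
  arr i hi := by rw [hm _ (.inr (by omega)), h.arr i hi]
  used := by rw [hu, h.used]

section Compile

variable {P : ℕ → Bool} {V W : ℕ} {s : Store} {E : Env}

/-- Stack discipline: at level `k` only the cells from `40 + k` to 59 are written, so the first
operand survives the evaluation of the second one at level `k + 1`. No intermediate result exceeds
`V ^ 8`, because the degree of an admissible expression is at most 8. -/
theorem Exp.reach (hV : 100 ≤ V) (hE : E.Good V) (hs : s.Good P V W) (e : Exp)
    (he : e.ok P) (k : ℕ) (hk : k + e.depth ≤ 20) (σ : State) (hr : Rel W s σ)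
    (hf : σ.Fits (80 + W) (V ^ 8)) :
    ∃ σ', Reach E (80 + W) (V ^ 8) (e.compile k) σ e.steps σ' ∧ σ'.Fits (80 + W) (V ^ 8) ∧
      σ'.used = σ.used ∧ σ'.mem (40 + k) = e.eval E s ∧
      ∀ a, (a < 40 + k ∨ 60 ≤ a) → σ'.mem a = σ.mem a := by
  have hV1 : V ≤ V ^ 8 := Nat.le_self_pow (by norm_num) V
  have hW := hs.len_pos
  induction e generalizing k σ with
  | const c =>
    simp only [Exp.ok, decide_eq_true_eq] at he
    simp only [Exp.depth] at hk
    have hc : c ≤ V ^ 8 := by omega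
    refine ⟨_, Reach.const hf (d := 40 + k) (by omega) hc, hf.write (by omega) hc, rfl, ?_, ?_⟩
    · simp [State.write_mem, Exp.eval]
    · intro a ha
      rw [State.write_mem, if_neg (by omega)]
  | var v =>
    simp only [Exp.ok, decide_eq_true_eq] at he
    simp only [Exp.depth] at hk
    -- The machine has no instruction for copying; the target is cleared and the variable is added
    -- to it.
    have h₁ : Reach E (80 + W) (V ^ 8) _ σ 1 (σ.write (40 + k) 0) :=
      Reach.const hf (by omega) (Nat.zero_le _)
    have hf₁ : (σ.write (40 + k) 0).Fits (80 + W) (V ^ 8) := hf.write (by omega) (Nat.zero_le _)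
    have hv : Op.add.eval ((σ.write (40 + k) 0).mem v) ((σ.write (40 + k) 0).mem (40 + k)) =
        s.var v := by
      rw [State.write_mem, State.write_mem, if_neg (by omega), if_pos rfl, hr.var v he]
      rfl
    have hle : s.var v ≤ V ^ 8 := (hs.var_le v).trans hV1
    refine ⟨_, h₁.seq (Reach.op hf₁ (by omega) (hv ▸ hle)), hf₁.write (by omega) (hv ▸ hle), rfl,
      ?_, ?_⟩
    · rw [State.write_mem, if_pos rfl, hv]
      rfl
    · intro a ha
      rw [State.write_mem, if_neg (by omega), State.write_mem, if_neg (by omega)]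
  | op o a b iha ihb =>
    have hle : (Exp.op o a b).eval E s ≤ V ^ 8 :=
      ((Exp.op o a b).eval_le hV hE hs he).trans
        (Nat.pow_le_pow_right (by omega) (Exp.deg_le _ he))
    simp only [Exp.ok, Bool.and_eq_true] at he
    simp only [Exp.depth] at hk
    obtain ⟨σ₁, r₁, f₁, u₁, v₁, m₁⟩ := iha he.1.1.1 k (by omega) σ hr hf
    obtain ⟨σ₂, r₂, f₂, u₂, v₂, m₂⟩ := ihb he.1.1.2 (k + 1) (by omega) σ₁
      (hr.congr u₁ fun a ha => m₁ a (by omega)) f₁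
    have hv : o.eval (σ₂.mem (40 + k)) (σ₂.mem (40 + (k + 1))) = (Exp.op o a b).eval E s := by
      rw [v₂, m₂ (40 + k) (by omega), v₁]
      rfl
    refine ⟨_, r₁.seq (r₂.seq (Reach.op f₂ (by omega) (hv ▸ hle))),
      f₂.write (by omega) (hv ▸ hle), by rw [State.write_used, u₂, u₁], ?_, ?_⟩
    · rw [State.write_mem, if_pos rfl, hv]
    · intro a ha
      rw [State.write_mem, if_neg (by omega), m₂ a (by omega), m₁ a (by omega)]
  | get a iha =>
    simp only [Exp.ok] at he
    simp only [Exp.depth] at hk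
    obtain ⟨σ₁, r₁, f₁, u₁, v₁, m₁⟩ := iha he k (by omega) σ hr hf
    have hr₁ : Rel W s σ₁ := hr.congr u₁ fun a ha => m₁ a (by omega)
    have hi : Op.mod.eval (σ₁.mem (40 + k)) (σ₁.mem 2) = a.eval E s % W := by
      rw [v₁, hr₁.var 2 (by omega), hs.len]
      rfl
    have hiW : a.eval E s % W < W := Nat.mod_lt _ hW
    have hWV : W ≤ V := hs.len ▸ hs.var_le 2
    -- The address of a table cell is itself stored in a cell and must respect the bound for
    -- contents.
    have hV2 : 80 + V ≤ V ^ 8 := by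
      calc 80 + V ≤ V ^ 2 := by nlinarith
        _ ≤ V ^ 8 := Nat.pow_le_pow_right (by omega) (by norm_num)
    have r₂ := Reach.op (E := E) (o := .mod) (a := 40 + k) (b := 2) f₁
      (d := 40 + k) (by omega) (by omega)
    have f₂ := f₁.write (d := 40 + k) (v := Op.mod.eval (σ₁.mem (40 + k)) (σ₁.mem 2))
      (by omega) (by omega)
    rw [hi] at r₂ f₂
    set σ₂ := σ₁.write (40 + k) (a.eval E s % W) with hσ₂
    have r₃ := Reach.const (E := E) f₂ (d := 40 + (k + 1)) (c := 80) (by omega) (by omega)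
    have f₃ := f₂.write (d := 40 + (k + 1)) (v := 80) (by omega) (by omega)
    set σ₃ := σ₂.write (40 + (k + 1)) 80 with hσ₃
    have e₃ : Op.add.eval (σ₃.mem (40 + k)) (σ₃.mem (40 + (k + 1))) = 80 + a.eval E s % W := by
      rw [hσ₃, State.write_mem, State.write_mem, if_neg (by omega), if_pos rfl, hσ₂,
        State.write_mem, if_pos rfl]
      exact Nat.add_comm _ _
    have r₄ := Reach.op (E := E) (o := .add) (a := 40 + k) (b := 40 + (k + 1)) f₃
      (d := 40 + k) (by omega) (by omega)
    have f₄ := f₃.write (d := 40 + k) (v := Op.add.eval (σ₃.mem (40 + k)) (σ₃.mem (40 + (k + 1))))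
      (by omega) (by omega)
    rw [e₃] at r₄ f₄
    set σ₄ := σ₃.write (40 + k) (80 + a.eval E s % W) with hσ₄
    have r₅ := Reach.load (E := E) f₄ (d := 40 + k) (a := 40 + k) (by omega)
    have f₅ := f₄.write (d := 40 + k) (v := σ₄.mem (σ₄.mem (40 + k))) (by omega) (f₄.le _)
    refine ⟨_, r₁.seq (r₂.seq (r₃.seq (r₄.seq r₅))), f₅, ?_, ?_, ?_⟩
    · simpa [hσ₄, hσ₃, hσ₂] using u₁
    · rw [State.write_mem, if_pos rfl, hσ₄, State.write_mem (a := 40 + k), if_pos rfl,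
        State.write_mem, if_neg (by omega), hσ₃, State.write_mem, if_neg (by omega), hσ₂,
        State.write_mem, if_neg (by omega), hr₁.arr _ hiW]
      simp only [Exp.eval, hs.len]
    · intro a ha
      rw [State.write_mem, if_neg (by omega), hσ₄, State.write_mem, if_neg (by omega), hσ₃,
        State.write_mem, if_neg (by omega), hσ₂, State.write_mem, if_neg (by omega),
        m₁ a (by omega)]
  | readX a iha =>
    simp only [Exp.ok] at he
    simp only [Exp.depth] at hk
    obtain ⟨σ₁, r₁, f₁, u₁, v₁, m₁⟩ := iha he k hk σ hr hf
    have hle : E.x (σ₁.mem (40 + k)) ≤ V ^ 8 := (hE.x_le _).trans hV1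
    refine ⟨_, r₁.seq (Reach.readX f₁ (by omega) hle), f₁.write (by omega) hle,
      by rw [State.write_used, u₁], ?_, ?_⟩
    · rw [State.write_mem, if_pos rfl, v₁]
      rfl
    · intro i hi
      have := a.depth_pos
      rw [State.write_mem, if_neg (by omega), m₁ i hi]
  | readY a iha =>
    simp only [Exp.ok] at he
    simp only [Exp.depth] at hk
    obtain ⟨σ₁, r₁, f₁, u₁, v₁, m₁⟩ := iha he k hk σ hr hf
    have hle : E.y (σ₁.mem (40 + k)) ≤ V ^ 8 := (hE.y_le _).trans hV1
    refine ⟨_, r₁.seq (Reach.readY f₁ (by omega) hle), f₁.write (by omega) hle,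
      by rw [State.write_used, u₁], ?_, ?_⟩
    · rw [State.write_mem, if_pos rfl, v₁]
      rfl
    · intro i hi
      have := a.depth_pos
      rw [State.write_mem, if_neg (by omega), m₁ i hi]
  | readH a iha =>
    simp only [Exp.ok] at he
    simp only [Exp.depth] at hk
    obtain ⟨σ₁, r₁, f₁, u₁, v₁, m₁⟩ := iha he k hk σ hr hf
    have hle : E.h (σ₁.mem (40 + k)) ≤ V ^ 8 := (hE.h_le _).trans hV1
    refine ⟨_, r₁.seq (Reach.readH f₁ (by omega) hle), f₁.write (by omega) hle,
      by rw [State.write_used, u₁], ?_, ?_⟩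
    · rw [State.write_mem, if_pos rfl, v₁]
      rfl
    · intro i hi
      have := a.depth_pos
      rw [State.write_mem, if_neg (by omega), m₁ i hi]

end Compile

end RAM

/-! ### Commands: compilation and its correctness -/

namespace RAM

/-- Structured programs.  `put a e` writes into the table, `rep v c` repeats `c` as often as the
value of the variable `v` says, and `size v w` writes the bit length of `w` into `v`. -/
inductive Cmd where
  | skip
  | set (v : ℕ) (e : Exp)
  | flip (v : ℕ)
  | put (a e : Exp)
  | seq (c₁ c₂ : Cmd)
  | ite (e : Exp) (c₁ c₂ : Cmd)
  | rep (v : ℕ) (c : Cmd)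
  | size (v w : ℕ)

/-- Write a variable. -/
def Store.set (s : Store) (v x : ℕ) : Store :=
  ⟨Function.update s.var v x, s.arr, s.used⟩

/-- The effect of a structured program. -/
def Cmd.eval (E : Env) : Cmd → Store → Store
  | .skip, s => s
  | .set v e, s => s.set v (e.eval E s)
  | .flip v, s => ⟨Function.update s.var v (if E.coins s.used then 1 else 0), s.arr, s.used + 1⟩
  | .put a e, s => ⟨s.var, Function.update s.arr (a.eval E s % s.var 2) (e.eval E s), s.used⟩
  | .seq c₁ c₂, s => c₂.eval E (c₁.eval E s)
  | .ite e c₁ c₂, s => if e.eval E s ≠ 0 then c₁.eval E s else c₂.eval E s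
  | .rep v c, s => (c.eval E)^[s.var v] s
  | .size v w, s => s.set v (s.var w).size

/-- Compilation; `l` is the number of loops around the command, and the counters of the loops are
in the cells from `60` on. -/
def Cmd.compile : Cmd → ℕ → Prog
  | .skip, _ => .skip
  | .set v e, _ => .seq (e.compile 0) (.seq (.instr (.const 41 0)) (.instr (.op .add v 40 41)))
  | .flip v, _ => .instr (.flip v)
  | .put a e, _ => .seq (a.compile 0) (.seq (e.compile 1) (.seq (.instr (.op .mod 40 40 2))
      (.seq (.instr (.const 42 80)) (.seq (.instr (.op .add 40 40 42)) (.instr (.store 40 41))))))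
  | .seq c₁ c₂, l => .seq (c₁.compile l) (c₂.compile l)
  | .ite e c₁ c₂, l => .seq (e.compile 0) (.ite 40 (c₁.compile l) (c₂.compile l))
  | .rep v c, l => .seq (.instr (.const 40 0)) (.seq (.instr (.op .add (60 + l) v 40))
      (.loop (60 + l) (.seq (c.compile (l + 1)) (.seq (.instr (.const 40 1))
        (.instr (.op .sub (60 + l) (60 + l) 40))))))
  | .size v w, _ => .seq (.instr (.const 40 0)) (.seq (.instr (.op .add 40 w 40))
      (.seq (.instr (.const v 0)) (.loop 40 (.seq (.instr (.const 41 2))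
        (.seq (.instr (.op .div 40 40 41)) (.seq (.instr (.const 41 1))
          (.instr (.op .add v v 41))))))))

/-- A bound for the number of steps, where `Z` bounds the bit length of the values of variables,
and `ρ` are the values of the variables that count loops. -/
def Cmd.steps (Z : ℕ) (ρ : ℕ → ℕ) : Cmd → ℕ
  | .skip => 1
  | .set _ e => e.steps + 2
  | .flip _ => 1
  | .put a e => a.steps + (e.steps + 4)
  | .seq c₁ c₂ => c₁.steps Z ρ + c₂.steps Z ρ
  | .ite e c₁ c₂ => e.steps + (1 + max (c₁.steps Z ρ) (c₂.steps Z ρ))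
  | .rep v c => 3 + ρ v * (c.steps Z ρ + 3)
  | .size _ _ => 4 + 5 * Z

/-- The nesting depth of loops. -/
def Cmd.nest : Cmd → ℕ
  | .seq c₁ c₂ => max c₁.nest c₂.nest
  | .ite _ c₁ c₂ => max c₁.nest c₂.nest
  | .rep _ c => c.nest + 1
  | _ => 0

/-- The side conditions under which programs are compiled correctly.  The variables in `P` are
read-only, and only these variables count loops. -/
def Cmd.ok (P : ℕ → Bool) : Cmd → Bool
  | .skip => true
  | .set v e => decide (v < 40) && !P v && e.ok P && decide (e.deg P ≤ 1) && decide (e.depth ≤ 20)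
  | .flip v => decide (v < 40) && !P v
  | .put a e => a.ok P && e.ok P && decide (e.deg P ≤ 1) && decide (a.depth ≤ 20) &&
      decide (e.depth ≤ 19)
  | .seq c₁ c₂ => c₁.ok P && c₂.ok P
  | .ite e c₁ c₂ => e.ok P && decide (e.depth ≤ 20) && c₁.ok P && c₂.ok P
  | .rep v c => decide (v < 40) && P v && c.ok P
  | .size v w => decide (v < 40) && !P v && decide (w < 40) && decide (v ≠ w)

theorem Store.set_var (s : Store) (v x u : ℕ) :
    (s.set v x).var u = if u = v then x else s.var u := by
  simp only [Store.set, Function.update_apply]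

@[simp] theorem Store.set_arr (s : Store) (v x : ℕ) : (s.set v x).arr = s.arr := rfl

@[simp] theorem Store.set_used (s : Store) (v x : ℕ) : (s.set v x).used = s.used := rfl

section

variable {P : ℕ → Bool} {V W : ℕ} {s : Store} {E : Env} {σ : State}

/-- Variables in `P` are never assigned. Since only they count loops, the iteration counts `ρ` are
the same throughout the execution, and the step bound is a closed expression in them. -/
theorem Cmd.eval_var_of_ok (c : Cmd) (hc : c.ok P) (s : Store) {v : ℕ} (hv : P v = true) :
    (c.eval E s).var v = s.var v := by
  induction c generalizing s with
  | skip => rfl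
  | set u e =>
    simp only [Cmd.ok, Bool.and_eq_true, Bool.not_eq_true'] at hc
    simp only [Cmd.eval, Store.set_var]
    rw [if_neg]
    rintro rfl
    simp [hv] at hc
  | flip u =>
    simp only [Cmd.ok, Bool.and_eq_true, Bool.not_eq_true'] at hc
    simp only [Cmd.eval, Function.update_apply]
    rw [if_neg]
    rintro rfl
    simp [hv] at hc
  | put a e => rfl
  | seq c₁ c₂ ih₁ ih₂ =>
    simp only [Cmd.ok, Bool.and_eq_true] at hc
    simp only [Cmd.eval]
    rw [ih₂ hc.2, ih₁ hc.1]
  | ite e c₁ c₂ ih₁ ih₂ =>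
    simp only [Cmd.ok, Bool.and_eq_true] at hc
    simp only [Cmd.eval]
    split_ifs
    · exact ih₁ hc.1.2 s
    · exact ih₂ hc.2 s
  | rep u c ih =>
    simp only [Cmd.ok, Bool.and_eq_true] at hc
    simp only [Cmd.eval]
    generalize s.var u = j
    induction j generalizing s with
    | zero => rfl
    | succ j ihj => rw [Function.iterate_succ_apply, ihj, ih hc.2]
  | size u w =>
    simp only [Cmd.ok, Bool.and_eq_true, Bool.not_eq_true'] at hc
    simp only [Cmd.eval, Store.set_var]
    rw [if_neg]
    rintro rfl
    simp [hv] at hc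

theorem Store.Good.set (hs : s.Good P V W) {v x : ℕ} (hv : P v = false) (h2 : P 2 = true)
    (hx : x ≤ V) : (s.set v x).Good P V W where
  var_le u := by
    rw [Store.set_var]
    split_ifs
    exacts [hx, hs.var_le u]
  arr_le := hs.arr_le
  pos u hu := by
    rw [Store.set_var, if_neg]
    · exact hs.pos u hu
    · rintro rfl
      simp [hv] at hu
  len := by
    rw [Store.set_var, if_neg, hs.len]
    rintro rfl
    simp [hv] at h2
  len_pos := hs.len_pos

theorem Rel.write (hr : Rel W s σ) {v x : ℕ} (hv : v < 40) : Rel W (s.set v x) (σ.write v x) where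
  var u hu := by
    rw [Store.set_var, State.write_mem]
    split_ifs
    · rfl
    · exact hr.var u hu
  arr i hi := by rw [State.write_mem, if_neg (by omega), hr.arr i hi, Store.set_arr]
  used := hr.used

/-- Assignment is compiled correctly provided that the value is small. -/
theorem Cmd.reach_set (hV : 100 ≤ V) (hE : E.Good V) (hs : s.Good P V W) (hr : Rel W s σ)
    (hf : σ.Fits (80 + W) (V ^ 8)) (h2 : P 2 = true) {v : ℕ} {e : Exp} {l : ℕ} (hv : v < 40)
    (hPv : P v = false) (he : e.ok P) (hd : e.depth ≤ 20) (hle : e.eval E s ≤ V) :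
    ∃ σ', Reach E (80 + W) (V ^ 8) ((Cmd.set v e).compile l) σ (e.steps + 2) σ' ∧
      Rel W ((Cmd.set v e).eval E s) σ' ∧ ((Cmd.set v e).eval E s).Good P V W ∧
      σ'.Fits (80 + W) (V ^ 8) ∧ ∀ a, 60 ≤ a → a < 80 → σ'.mem a = σ.mem a := by
  have hV1 : V ≤ V ^ 8 := Nat.le_self_pow (by norm_num) V
  obtain ⟨σ₁, r₁, f₁, u₁, v₁, m₁⟩ := e.reach hV hE hs he 0 (by omega) σ hr hf
  have hr₁ : Rel W s σ₁ := hr.congr u₁ fun a ha => m₁ a (by omega)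
  have r₂ := Reach.const (E := E) f₁ (d := 41) (c := 0) (by omega) (Nat.zero_le _)
  have f₂ := f₁.write (d := 41) (v := 0) (by omega) (Nat.zero_le _)
  have hr₂ : Rel W s (σ₁.write 41 0) :=
    hr₁.congr rfl fun a ha => by rw [State.write_mem, if_neg (by omega)]
  have hval : Op.add.eval ((σ₁.write 41 0).mem 40) ((σ₁.write 41 0).mem 41) = e.eval E s := by
    rw [State.write_mem, State.write_mem, if_neg (by omega), if_pos rfl]
    exact v₁
  have r₃ := Reach.op (E := E) (o := .add) (a := 40) (b := 41) f₂ (d := v) (by omega)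
    (by omega)
  rw [hval] at r₃
  refine ⟨_, r₁.seq (r₂.seq r₃), hr₂.write hv, hs.set hPv h2 hle,
    f₂.write (by omega) (by omega), fun a ha ha' => ?_⟩
  rw [State.write_mem, if_neg (by omega), State.write_mem, if_neg (by omega), m₁ a (by omega)]

theorem size_eq_succ {t : ℕ} (ht : t ≠ 0) : t.size = (t / 2).size + 1 := by
  conv_lhs => rw [← Nat.bit_bodd_div2 t]
  rw [Nat.size_bit (by rwa [Nat.bit_bodd_div2]), Nat.div2_val]

/-- Cell 40 is halved until it vanishes, and `v` counts the halvings; one test and four instructions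
make five steps for each bit. -/
theorem Cmd.reach_size_loop (hV : 100 ≤ V) {v : ℕ} (hv : v < 40)
    (t k : ℕ) (hk : k + t.size ≤ V)
    (hr : Rel W (s.set v k) σ) (hf : σ.Fits (80 + W) (V ^ 8)) (ht : σ.mem 40 = t) :
    ∃ σ', Reach E (80 + W) (V ^ 8) (.loop 40 (.seq (.instr (.const 41 2))
        (.seq (.instr (.op .div 40 40 41)) (.seq (.instr (.const 41 1))
          (.instr (.op .add v v 41)))))) σ (1 + 5 * t.size) σ' ∧
      Rel W (s.set v (k + t.size)) σ' ∧
      σ'.Fits (80 + W) (V ^ 8) ∧ ∀ a, 60 ≤ a → a < 80 → σ'.mem a = σ.mem a := by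
  have hV1 : V ≤ V ^ 8 := Nat.le_self_pow (by norm_num) V
  induction t using Nat.strong_induction_on generalizing k σ with
  | _ t ih =>
    rcases eq_or_ne t 0 with rfl | h0
    · exact ⟨σ, (Reach.loop_false hf ht).mono (by omega), by simpa using hr, hf, fun _ _ _ => rfl⟩
    · have hsz := size_eq_succ h0
      have r₁ := Reach.const (E := E) hf (d := 41) (c := 2) (by omega) (by omega)
      have f₁ := hf.write (d := 41) (v := 2) (by omega) (by omega)
      set σ₁ := σ.write 41 2 with hσ₁
      have e₁ : Op.div.eval (σ₁.mem 40) (σ₁.mem 41) = t / 2 := by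
        rw [hσ₁, State.write_mem, State.write_mem, if_neg (by omega), if_pos rfl, ht]
        rfl
      have htV : t / 2 ≤ V ^ 8 := (Nat.div_le_self _ _).trans (ht ▸ hf.le 40)
      have r₂ := Reach.op (E := E) (o := .div) (a := 40) (b := 41) f₁ (d := 40) (by omega)
        (by omega)
      rw [e₁] at r₂
      have f₂ := f₁.write (d := 40) (v := t / 2) (by omega) htV
      set σ₂ := σ₁.write 40 (t / 2) with hσ₂
      have r₃ := Reach.const (E := E) f₂ (d := 41) (c := 1) (by omega) (by omega)
      have f₃ := f₂.write (d := 41) (v := 1) (by omega) (by omega)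
      set σ₃ := σ₂.write 41 1 with hσ₃
      have hr₃ : Rel W (s.set v k) σ₃ := hr.congr rfl fun a ha => by
        rw [hσ₃, State.write_mem, if_neg (by omega), hσ₂, State.write_mem, if_neg (by omega),
          hσ₁, State.write_mem, if_neg (by omega)]
      have e₃ : Op.add.eval (σ₃.mem v) (σ₃.mem 41) = k + 1 := by
        rw [hr₃.var v hv, Store.set_var, if_pos rfl, hσ₃, State.write_mem, if_pos rfl]
        rfl
      have r₄ := Reach.op (E := E) (o := .add) (a := v) (b := 41) f₃ (d := v) (by omega)
        (by omega)
      rw [e₃] at r₄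
      have f₄ := f₃.write (d := v) (v := k + 1) (by omega) (by omega)
      have hr₄ : Rel W (s.set v (k + 1)) (σ₃.write v (k + 1)) := by
        have := hr₃.write (v := v) (x := k + 1) hv
        simpa [Store.set] using this
      obtain ⟨σ₅, r₅, hr₅, f₅, m₅⟩ := ih (t / 2) (by omega) (k + 1) (by omega) hr₄ f₄ (by
        rw [State.write_mem, if_neg (by omega), hσ₃, State.write_mem, if_neg (by omega), hσ₂,
          State.write_mem, if_pos rfl])
      refine ⟨σ₅, (Reach.loop_true hf (by omega) (r₁.seq (r₂.seq (r₃.seq r₄))) r₅).mono (by omega),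
        ?_, f₅, fun a ha ha' => ?_⟩
      · rwa [show k + t.size = k + 1 + (t / 2).size by omega]
      · rw [m₅ a ha ha', State.write_mem, if_neg (by omega), hσ₃, State.write_mem,
          if_neg (by omega), hσ₂, State.write_mem, if_neg (by omega), hσ₁, State.write_mem,
          if_neg (by omega)]

/-- Correctness of the compilation. -/
theorem Cmd.reach (hV : 100 ≤ V) (hE : E.Good V) (h2 : P 2 = true) (ρ : ℕ → ℕ) (c : Cmd)
    (hc : c.ok P) (l : ℕ) (hl : l + c.nest ≤ 20) (s : Store) (σ : State)
    (hρ : ∀ v, P v = true → s.var v = ρ v) (hs : s.Good P V W) (hr : Rel W s σ)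
    (hf : σ.Fits (80 + W) (V ^ 8)) :
    ∃ σ', Reach E (80 + W) (V ^ 8) (c.compile l) σ (c.steps V.size ρ) σ' ∧
      Rel W (c.eval E s) σ' ∧ (c.eval E s).Good P V W ∧
      σ'.Fits (80 + W) (V ^ 8) ∧ ∀ a, 60 ≤ a → a < 60 + l → σ'.mem a = σ.mem a := by
  have hV1 : V ≤ V ^ 8 := Nat.le_self_pow (by norm_num) V
  induction c generalizing l s σ with
  | skip => exact ⟨σ, Reach.skip hf, hr, hs, hf, fun _ _ _ => rfl⟩
  | set v e =>
    simp only [Cmd.ok, Bool.and_eq_true, Bool.not_eq_true', decide_eq_true_eq] at hc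
    obtain ⟨⟨⟨⟨hv, hPv⟩, he⟩, hdeg⟩, hd⟩ := hc
    have hle : e.eval E s ≤ V := by
      refine (e.eval_le hV hE hs he).trans ?_
      calc V ^ e.deg P ≤ V ^ 1 := Nat.pow_le_pow_right (by omega) hdeg
        _ = V := pow_one V
    simp only [Cmd.nest] at hl
    obtain ⟨σ', h₁, h₂, h₃, h₄, h₅⟩ := Cmd.reach_set (l := l) hV hE hs hr hf h2 hv hPv he hd hle
    exact ⟨σ', h₁, h₂, h₃, h₄, fun a ha ha' => h₅ a ha (by omega)⟩
  | flip v =>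
    simp only [Cmd.ok, Bool.and_eq_true, Bool.not_eq_true', decide_eq_true_eq] at hc
    simp only [Cmd.nest] at hl
    have hb : (if E.coins σ.used then 1 else 0) ≤ V := by split_ifs <;> omega
    have hmem : ∀ a, (Instr.eval E (.flip v) σ).mem a =
        (σ.write v (if E.coins σ.used then 1 else 0)).mem a := fun a => rfl
    have hf' : (Instr.eval E (.flip v) σ).Fits (80 + W) (V ^ 8) := by
      have h₁ := hf.write (d := v) (v := if E.coins σ.used then 1 else 0) (by omega) (by omega)
      exact ⟨fun a ha => (hmem a).trans (h₁.zero a ha), fun a => (hmem a).le.trans (h₁.le a)⟩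
    refine ⟨Instr.eval E (.flip v) σ, Reach.instr hf hf' ?_, ?_, ?_, hf', ?_⟩
    · have := one_add_size_le (V ^ 8) (Nat.zero_le _)
      simp only [Instr.cost]
      omega
    · have h₁ := hr.write (v := v) (x := if E.coins σ.used then 1 else 0) hc.1
      refine ⟨fun u hu => ?_, fun i hi => ?_, ?_⟩
      · rw [hmem, h₁.var u hu, hr.used]
        rfl
      · exact (hmem _).trans (h₁.arr i hi)
      · simp [Cmd.eval, Instr.eval, hr.used]
    · have h₁ := hs.set (v := v) (x := if E.coins σ.used then 1 else 0) hc.2 h2 hb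
      rw [hr.used] at h₁
      exact ⟨h₁.var_le, h₁.arr_le, h₁.pos, h₁.len, h₁.len_pos⟩
    · intro a ha ha'
      rw [hmem, State.write_mem, if_neg (by omega)]
  | put a e =>
    simp only [Cmd.ok, Bool.and_eq_true, decide_eq_true_eq] at hc
    obtain ⟨⟨⟨⟨hao, heo⟩, hdeg⟩, had⟩, hed⟩ := hc
    simp only [Cmd.nest] at hl
    have hle : e.eval E s ≤ V := by
      refine (e.eval_le hV hE hs heo).trans ?_
      calc V ^ e.deg P ≤ V ^ 1 := Nat.pow_le_pow_right (by omega) hdeg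
        _ = V := pow_one V
    have hW := hs.len_pos
    have hWV : W ≤ V := hs.len ▸ hs.var_le 2
    have hV2 : 80 + V ≤ V ^ 8 := by
      calc 80 + V ≤ V ^ 2 := by nlinarith
        _ ≤ V ^ 8 := Nat.pow_le_pow_right (by omega) (by norm_num)
    obtain ⟨σ₁, r₁, f₁, u₁, v₁, m₁⟩ := a.reach hV hE hs hao 0 (by omega) σ hr hf
    have hr₁ : Rel W s σ₁ := hr.congr u₁ fun a ha => m₁ a (by omega)
    obtain ⟨σ₂, r₂, f₂, u₂, v₂, m₂⟩ := e.reach hV hE hs heo 1 (by omega) σ₁ hr₁ f₁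
    have hr₂ : Rel W s σ₂ := hr₁.congr u₂ fun a ha => m₂ a (by omega)
    have hi : Op.mod.eval (σ₂.mem 40) (σ₂.mem 2) = a.eval E s % W := by
      rw [m₂ 40 (by omega), v₁, hr₂.var 2 (by omega), hs.len]
      rfl
    have hiW : a.eval E s % W < W := Nat.mod_lt _ hW
    have r₃ := Reach.op (E := E) (o := .mod) (a := 40) (b := 2) f₂ (d := 40) (by omega)
      (by omega)
    rw [hi] at r₃
    have f₃ := f₂.write (d := 40) (v := a.eval E s % W) (by omega) (by omega)
    set σ₃ := σ₂.write 40 (a.eval E s % W) with hσ₃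
    have r₄ := Reach.const (E := E) f₃ (d := 42) (c := 80) (by omega) (by omega)
    have f₄ := f₃.write (d := 42) (v := 80) (by omega) (by omega)
    set σ₄ := σ₃.write 42 80 with hσ₄
    have e₄ : Op.add.eval (σ₄.mem 40) (σ₄.mem 42) = 80 + a.eval E s % W := by
      rw [hσ₄, State.write_mem, State.write_mem, if_neg (by omega), if_pos rfl, hσ₃,
        State.write_mem, if_pos rfl]
      exact Nat.add_comm _ _
    have r₅ := Reach.op (E := E) (o := .add) (a := 40) (b := 42) f₄ (d := 40) (by omega)
      (by omega)
    rw [e₄] at r₅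
    have f₅ := f₄.write (d := 40) (v := 80 + a.eval E s % W) (by omega) (by omega)
    set σ₅ := σ₄.write 40 (80 + a.eval E s % W) with hσ₅
    have e₅ : σ₅.mem 40 = 80 + a.eval E s % W := by rw [hσ₅, State.write_mem, if_pos rfl]
    have e₅' : σ₅.mem 41 = e.eval E s := by
      rw [hσ₅, State.write_mem, if_neg (by omega), hσ₄, State.write_mem, if_neg (by omega), hσ₃,
        State.write_mem, if_neg (by omega), v₂]
    have hr₅ : Rel W s σ₅ := hr₂.congr rfl fun a ha => by
      rw [hσ₅, State.write_mem, if_neg (by omega), hσ₄, State.write_mem, if_neg (by omega), hσ₃,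
        State.write_mem, if_neg (by omega)]
    have r₆ := Reach.store (E := E) (a := 40) (b := 41) f₅ (by omega)
    rw [e₅, e₅'] at r₆
    have f₆ := f₅.write (d := 80 + a.eval E s % W) (v := e.eval E s) (by omega) (by omega)
    refine ⟨_, (r₁.seq (r₂.seq (r₃.seq (r₄.seq (r₅.seq r₆))))), ?_, ?_, f₆, ?_⟩
    · refine ⟨fun u hu => ?_, fun i hi => ?_, hr₅.used⟩
      · rw [State.write_mem, if_neg (by omega), hr₅.var u hu]
        rfl
      · simp only [State.write_mem, Cmd.eval, Function.update_apply, hs.len, Nat.add_left_cancel_iff]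
        rw [hr₅.arr i hi]
    · refine ⟨hs.var_le, fun i => ?_, hs.pos, hs.len, hs.len_pos⟩
      simp only [Cmd.eval, Function.update_apply]
      split_ifs
      · exact hle
      · exact hs.arr_le i
    · intro i hi hi'
      rw [State.write_mem, if_neg (by omega), hσ₅, State.write_mem, if_neg (by omega), hσ₄,
        State.write_mem, if_neg (by omega), hσ₃, State.write_mem, if_neg (by omega),
        m₂ i (by omega), m₁ i (by omega)]
  | seq c₁ c₂ ih₁ ih₂ =>
    simp only [Cmd.ok, Bool.and_eq_true] at hc
    simp only [Cmd.nest] at hl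
    obtain ⟨σ₁, r₁, hr₁, hs₁, f₁, m₁⟩ := ih₁ hc.1 l (by omega) s σ hρ hs hr hf
    obtain ⟨σ₂, r₂, hr₂, hs₂, f₂, m₂⟩ := ih₂ hc.2 l (by omega) (c₁.eval E s) σ₁
      (fun v hv => by rw [c₁.eval_var_of_ok hc.1 s hv, hρ v hv]) hs₁ hr₁ f₁
    exact ⟨σ₂, r₁.seq r₂, hr₂, hs₂, f₂, fun a ha ha' => by rw [m₂ a ha ha', m₁ a ha ha']⟩
  | ite e c₁ c₂ ih₁ ih₂ =>
    simp only [Cmd.ok, Bool.and_eq_true, decide_eq_true_eq] at hc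
    simp only [Cmd.nest] at hl
    obtain ⟨⟨⟨he, hd⟩, hc₁⟩, hc₂⟩ := hc
    obtain ⟨σ₁, r₁, f₁, u₁, v₁, m₁⟩ := e.reach hV hE hs he 0 (by omega) σ hr hf
    have hr₁ : Rel W s σ₁ := hr.congr u₁ fun a ha => m₁ a (by omega)
    simp only [Cmd.eval]
    by_cases h0 : e.eval E s = 0
    · rw [if_neg (by simpa using h0)]
      obtain ⟨σ₂, r₂, hr₂, hs₂, f₂, m₂⟩ := ih₂ hc₂ l (by omega) s σ₁ hρ hs hr₁ f₁
      exact ⟨σ₂, r₁.seq (Reach.ite_false (v₁.trans h0) (r₂.mono (le_max_right _ _))), hr₂, hs₂,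
        f₂, fun a ha ha' => by rw [m₂ a ha ha', m₁ a (by omega)]⟩
    · rw [if_pos h0]
      obtain ⟨σ₂, r₂, hr₂, hs₂, f₂, m₂⟩ := ih₁ hc₁ l (by omega) s σ₁ hρ hs hr₁ f₁
      exact ⟨σ₂, r₁.seq (Reach.ite_true f₁ (by rw [v₁]; exact h0) (r₂.mono (le_max_left _ _))),
        hr₂, hs₂, f₂, fun a ha ha' => by rw [m₂ a ha ha', m₁ a (by omega)]⟩
  | rep v c ih =>
    simp only [Cmd.ok, Bool.and_eq_true, decide_eq_true_eq] at hc
    simp only [Cmd.nest] at hl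
    obtain ⟨⟨hv, hPv⟩, hc⟩ := hc
    -- Induction on the content of the counter. The counter is in cell `60 + l`, and the body,
    -- compiled with `l + 1` loops around it, does not touch this cell.
    have loop : ∀ j s σ, (∀ v, P v = true → s.var v = ρ v) → s.Good P V W → Rel W s σ →
        σ.Fits (80 + W) (V ^ 8) → σ.mem (60 + l) = j → ∃ σ',
        Reach E (80 + W) (V ^ 8) (.loop (60 + l) (.seq (c.compile (l + 1))
          (.seq (.instr (.const 40 1)) (.instr (.op .sub (60 + l) (60 + l) 40))))) σ
          (1 + j * (c.steps V.size ρ + 3)) σ' ∧ Rel W ((c.eval E)^[j] s) σ' ∧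
        ((c.eval E)^[j] s).Good P V W ∧ σ'.Fits (80 + W) (V ^ 8) ∧
        ∀ a, 60 ≤ a → a < 60 + l → σ'.mem a = σ.mem a := by
      intro j
      induction j with
      | zero =>
        intro s σ hρ hs hr hf hj
        exact ⟨σ, (Reach.loop_false hf hj).mono (by omega), hr, hs, hf, fun _ _ _ => rfl⟩
      | succ j ihj =>
        intro s σ hρ hs hr hf hj
        obtain ⟨σ₁, r₁, hr₁, hs₁, f₁, m₁⟩ := ih hc (l + 1) (by omega) s σ hρ hs hr hf
        have r₂ := Reach.const (E := E) f₁ (d := 40) (c := 1) (by omega) (by omega)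
        have f₂ := f₁.write (d := 40) (v := 1) (by omega) (by omega)
        set σ₂ := σ₁.write 40 1 with hσ₂
        have e₂ : Op.sub.eval (σ₂.mem (60 + l)) (σ₂.mem 40) = j := by
          rw [hσ₂, State.write_mem, State.write_mem, if_neg (by omega), if_pos rfl,
            m₁ _ (by omega) (by omega), hj]
          rfl
        have hjV : j ≤ V ^ 8 := by
          have := hf.le (60 + l)
          omega
        have r₃ := Reach.op (E := E) (o := .sub) (a := 60 + l) (b := 40) f₂ (d := 60 + l)
          (by omega) (by omega)
        rw [e₂] at r₃
        have f₃ := f₂.write (d := 60 + l) (v := j) (by omega) hjV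
        obtain ⟨σ₄, r₄, hr₄, hs₄, f₄, m₄⟩ := ihj (c.eval E s) (σ₂.write (60 + l) j)
          (fun v hv => by rw [c.eval_var_of_ok hc s hv, hρ v hv]) hs₁
          (hr₁.congr rfl fun a ha => by
            rw [State.write_mem, if_neg (by omega), hσ₂, State.write_mem, if_neg (by omega)])
          f₃ (by rw [State.write_mem, if_pos rfl])
        refine ⟨σ₄, (Reach.loop_true hf (by omega) (r₁.seq (r₂.seq r₃)) r₄).mono ?_, hr₄, hs₄, f₄,
          fun a ha ha' => ?_⟩
        · rw [Nat.succ_mul]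
          omega
        · rw [m₄ a ha ha', State.write_mem, if_neg (by omega), hσ₂, State.write_mem,
            if_neg (by omega), m₁ a ha (by omega)]
    have r₁ := Reach.const (E := E) hf (d := 40) (c := 0) (by omega) (by omega)
    have f₁ := hf.write (d := 40) (v := 0) (by omega) (by omega)
    set σ₁ := σ.write 40 0 with hσ₁
    have hr₁ : Rel W s σ₁ := hr.congr rfl fun a ha => by
      rw [hσ₁, State.write_mem, if_neg (by omega)]
    have e₁ : Op.add.eval (σ₁.mem v) (σ₁.mem 40) = s.var v := by
      rw [hr₁.var v hv, hσ₁, State.write_mem, if_pos rfl]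
      rfl
    have hvV := hs.var_le v
    have r₂ := Reach.op (E := E) (o := .add) (a := v) (b := 40) f₁ (d := 60 + l) (by omega)
      (by omega)
    rw [e₁] at r₂
    have f₂ := f₁.write (d := 60 + l) (v := s.var v) (by omega) (by omega)
    obtain ⟨σ₃, r₃, hr₃, hs₃, f₃, m₃⟩ := loop (s.var v) s (σ₁.write (60 + l) (s.var v)) hρ hs
      (hr₁.congr rfl fun a ha => by rw [State.write_mem, if_neg (by omega)]) f₂
      (by rw [State.write_mem, if_pos rfl])
    refine ⟨σ₃, (r₁.seq (r₂.seq r₃)).mono ?_, hr₃, hs₃, f₃, fun a ha ha' => ?_⟩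
    · simp only [Cmd.steps, hρ v hPv]
      omega
    · rw [m₃ a ha ha', State.write_mem, if_neg (by omega), hσ₁, State.write_mem,
        if_neg (by omega)]
  | size v w =>
    simp only [Cmd.ok, Bool.and_eq_true, Bool.not_eq_true', decide_eq_true_eq] at hc
    simp only [Cmd.nest] at hl
    obtain ⟨⟨⟨hv, hPv⟩, hw⟩, hvw⟩ := hc
    have hwV := hs.var_le w
    -- The bit length is at most the number itself, so the new value of `v` stays within `V`.
    have hsz : (s.var w).size ≤ s.var w := Nat.size_le.2 Nat.lt_two_pow_self
    have r₁ := Reach.const (E := E) hf (d := 40) (c := 0) (by omega) (by omega)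
    have f₁ := hf.write (d := 40) (v := 0) (by omega) (by omega)
    set σ₁ := σ.write 40 0 with hσ₁
    have hr₁ : Rel W s σ₁ := hr.congr rfl fun a ha => by
      rw [hσ₁, State.write_mem, if_neg (by omega)]
    have e₁ : Op.add.eval (σ₁.mem w) (σ₁.mem 40) = s.var w := by
      rw [hr₁.var w hw, hσ₁, State.write_mem, if_pos rfl]
      rfl
    have r₂ := Reach.op (E := E) (o := .add) (a := w) (b := 40) f₁ (d := 40) (by omega)
      (by omega)
    rw [e₁] at r₂
    have f₂ := f₁.write (d := 40) (v := s.var w) (by omega) (by omega)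
    set σ₂ := σ₁.write 40 (s.var w) with hσ₂
    have hr₂ : Rel W s σ₂ := hr₁.congr rfl fun a ha => by
      rw [hσ₂, State.write_mem, if_neg (by omega)]
    have r₃ := Reach.const (E := E) f₂ (d := v) (c := 0) (by omega) (by omega)
    have f₃ := f₂.write (d := v) (v := 0) (by omega) (by omega)
    obtain ⟨σ₄, r₄, hr₄, f₄, m₄⟩ := Cmd.reach_size_loop (E := E) hV hv (s.var w) 0 (by omega)
      (hr₂.write hv) f₃ (by rw [State.write_mem, if_neg (by omega), hσ₂, State.write_mem,
        if_pos rfl])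
    rw [zero_add] at hr₄
    refine ⟨σ₄, (r₁.seq (r₂.seq (r₃.seq r₄))).mono ?_, hr₄, hs.set hPv h2 (by omega), f₄,
      fun a ha ha' => ?_⟩
    · have := Nat.size_le_size hwV
      simp only [Cmd.steps]
      omega
    · rw [m₄ a ha (by omega), State.write_mem, if_neg (by omega), hσ₂, State.write_mem,
        if_neg (by omega), hσ₁, State.write_mem, if_neg (by omega)]

end

end RAM

/-! # The program -/

namespace RAM

instance : Add Exp := ⟨Exp.op .add⟩
instance : Sub Exp := ⟨Exp.op .sub⟩
instance : Mul Exp := ⟨Exp.op .mul⟩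
instance : Div Exp := ⟨Exp.op .div⟩
instance : Mod Exp := ⟨Exp.op .mod⟩
instance (c : ℕ) : OfNat Exp c := ⟨Exp.const c⟩

section eval

variable (E : Env) (s : Store) (a b : Exp) (c v : ℕ)

@[simp] theorem Exp.eval_add : (a + b).eval E s = a.eval E s + b.eval E s := rfl
@[simp] theorem Exp.eval_sub : (a - b).eval E s = a.eval E s - b.eval E s := rfl
@[simp] theorem Exp.eval_mul : (a * b).eval E s = a.eval E s * b.eval E s := rfl
@[simp] theorem Exp.eval_div : (a / b).eval E s = a.eval E s / b.eval E s := rfl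
@[simp] theorem Exp.eval_mod : (a % b).eval E s = a.eval E s % b.eval E s := rfl
@[simp] theorem Exp.eval_ofNat :
    (no_index (OfNat.ofNat c : Exp)).eval E s = (OfNat.ofNat c : ℕ) := rfl
@[simp] theorem Exp.eval_var : (Exp.var v).eval E s = s.var v := rfl
@[simp] theorem Exp.eval_lt :
    (Exp.op .lt a b).eval E s = if a.eval E s < b.eval E s then 1 else 0 := rfl
@[simp] theorem Exp.eval_eq :
    (Exp.op .eq a b).eval E s = if a.eval E s = b.eval E s then 1 else 0 := rfl
@[simp] theorem Exp.eval_get : (Exp.get a).eval E s = s.arr (a.eval E s % s.var 2) := rfl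
@[simp] theorem Exp.eval_readX : (Exp.readX a).eval E s = E.x (a.eval E s) := rfl
@[simp] theorem Exp.eval_readY : (Exp.readY a).eval E s = E.y (a.eval E s) := rfl

end eval

/-- Does the program write the variable `v`? -/
def Cmd.writes (v : ℕ) : Cmd → Bool
  | .set u _ => u = v
  | .flip u => u = v
  | .seq c₁ c₂ => c₁.writes v || c₂.writes v
  | .ite _ c₁ c₂ => c₁.writes v || c₂.writes v
  | .rep _ c => c.writes v
  | .size u _ => u = v
  | _ => false

/-- Does the program leave the coins and the table alone? -/
def Cmd.quiet : Cmd → Bool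
  | .flip _ => false
  | .put _ _ => false
  | .seq c₁ c₂ => c₁.quiet && c₂.quiet
  | .ite _ c₁ c₂ => c₁.quiet && c₂.quiet
  | .rep _ c => c.quiet
  | _ => true

theorem Cmd.eval_var_of_not_writes {E : Env} {v : ℕ} (c : Cmd) (hc : c.writes v = false)
    (s : Store) : (c.eval E s).var v = s.var v := by
  induction c generalizing s with
  | skip => rfl
  | put a e => rfl
  | set u e =>
    simp only [Cmd.writes, decide_eq_false_iff_not] at hc
    simp only [Cmd.eval, Store.set_var]
    rw [if_neg (Ne.symm hc)]
  | flip u =>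
    simp only [Cmd.writes, decide_eq_false_iff_not] at hc
    simp only [Cmd.eval, Function.update_apply]
    rw [if_neg (Ne.symm hc)]
  | size u w =>
    simp only [Cmd.writes, decide_eq_false_iff_not] at hc
    simp only [Cmd.eval, Store.set_var]
    rw [if_neg (Ne.symm hc)]
  | seq c₁ c₂ ih₁ ih₂ =>
    simp only [Cmd.writes, Bool.or_eq_false_iff] at hc
    simp only [Cmd.eval]
    rw [ih₂ hc.2, ih₁ hc.1]
  | ite e c₁ c₂ ih₁ ih₂ =>
    simp only [Cmd.writes, Bool.or_eq_false_iff] at hc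
    simp only [Cmd.eval]
    split_ifs
    exacts [ih₁ hc.1 s, ih₂ hc.2 s]
  | rep u c ih =>
    simp only [Cmd.writes] at hc
    simp only [Cmd.eval]
    generalize s.var u = j
    induction j generalizing s with
    | zero => rfl
    | succ j ihj => rw [Function.iterate_succ_apply, ihj, ih hc]

theorem Cmd.eval_of_quiet {E : Env} (c : Cmd) (hc : c.quiet) (s : Store) :
    (c.eval E s).arr = s.arr ∧ (c.eval E s).used = s.used := by
  induction c generalizing s with
  | skip => exact ⟨rfl, rfl⟩
  | put a e => simp [Cmd.quiet] at hc
  | set u e => exact ⟨rfl, rfl⟩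
  | flip u => simp [Cmd.quiet] at hc
  | size u w => exact ⟨rfl, rfl⟩
  | seq c₁ c₂ ih₁ ih₂ =>
    simp only [Cmd.quiet, Bool.and_eq_true] at hc
    simp only [Cmd.eval]
    rw [(ih₂ hc.2 _).1, (ih₂ hc.2 _).2, (ih₁ hc.1 _).1, (ih₁ hc.1 _).2]
    exact ⟨rfl, rfl⟩
  | ite e c₁ c₂ ih₁ ih₂ =>
    simp only [Cmd.quiet, Bool.and_eq_true] at hc
    simp only [Cmd.eval]
    split_ifs
    exacts [ih₁ hc.1 s, ih₂ hc.2 s]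
  | rep u c ih =>
    simp only [Cmd.quiet] at hc
    simp only [Cmd.eval]
    generalize s.var u = j
    induction j generalizing s with
    | zero => exact ⟨rfl, rfl⟩
    | succ j ihj =>
      rw [Function.iterate_succ_apply, (ihj _).1, (ihj _).2, (ih hc _).1, (ih hc _).2]
      exact ⟨rfl, rfl⟩

/-- The number with the given binary digits. -/
def bitsVal (c : ℕ → Bool) : ℕ → ℕ
  | 0 => 0
  | k + 1 => 2 * bitsVal c k + if c k then 1 else 0

theorem bitsVal_lt (c : ℕ → Bool) (k : ℕ) : bitsVal c k < 2 ^ k := by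
  induction k with
  | zero => simp [bitsVal]
  | succ k ih =>
    simp only [bitsVal, pow_succ]
    split_ifs <;> omega

end RAM

namespace ListDisjointness

open RAM

/-
The variables of the program:
`0` n, `1` m, `2` s (length of the table), `3` p, `4` an upper bound for all numbers,
`5` τ, `6` bound for the length of walks, `7` length of the interval of end points,
`8` number of walks, `9` number of rounds, `10` bit length of n, `11` n * m, `12` its bit length,
`13` divisor, `14` parity, `15` number of the interval, `16`, `17` coefficients of the hash function,
`18` current round, `19` found, `20`, `21` solution, `22` coin, `23` random number,
`24` start of the walk, `25` position, `26` length, `27` finished,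
`28` start of the old walk, `29` position, `30` length, `31` finished, `32` index.
-/

/-- The entry at index `u`, taken from one of the two lists. -/
def entryExp (u : Exp) : Exp :=
  Exp.readX u * (1 - (u / .var 13 + .var 14) % 2) + Exp.readY u * ((u / .var 13 + .var 14) % 2)

/-- The successor of the index `u`. -/
def nextExp (u : Exp) : Exp :=
  (Exp.readH (entryExp u) + ((.var 16 * entryExp u + .var 17) % .var 11) / .var 1) % .var 0

/-- Increment. -/
def incCmd (v : ℕ) : Cmd := .set v ((.var v + 1) % .var 4)

/-- Draw a random number. -/
def sampleCmd (v : ℕ) : Cmd :=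
  .seq (.set 23 0) (.rep v (.seq (.flip 22) (.set 23 ((2 * .var 23 + .var 22) % .var 4))))

/-- One step of a walk. -/
def stepCmd (v len fin : ℕ) : Cmd :=
  .ite (.var fin) .skip (.seq (.set v (nextExp (.var v)))
    (.seq (incCmd len) (.set fin (.op .eq (.var v / .var 7) (.var 15)))))

/-- A walk. -/
def walkCmd (v len fin : ℕ) : Cmd :=
  .seq (.set len 0) (.seq (.set fin 0) (.rep 6 (stepCmd v len fin)))

/-- One step in the search for the point where two walks meet. -/
def mergeStepCmd : Cmd :=
  .ite (.op .lt (.var 30) (.var 26))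
    (.seq (.set 25 (nextExp (.var 25))) (.set 26 (.var 26 - 1)))
    (.ite (.op .lt (.var 26) (.var 30))
      (.seq (.set 29 (nextExp (.var 29))) (.set 30 (.var 30 - 1)))
      (.ite (.op .eq (entryExp (.var 25)) (entryExp (.var 29))) .skip
        (.seq (.set 25 (nextExp (.var 25))) (.set 29 (nextExp (.var 29))))))

/-- Check whether `(M[u], M[v])` is a solution. -/
def checkCmd (u v : ℕ) : Cmd :=
  .ite (.op .lt (.var u) (.var 0)) (.ite (.op .lt (.var v) (.var 0))
    (.ite (.op .eq (.readX (.var u)) (.readY (.var v)))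
      (.seq (.set 20 (.var u)) (.seq (.set 21 (.var v)) (.set 19 1))) .skip) .skip) .skip

/-- Compare a walk with an older one. -/
def compareCmd : Cmd :=
  .seq (.set 28 (.var 28 - 1)) (.seq (.set 29 (.var 28)) (.seq (walkCmd 29 30 31)
    (.seq (.set 25 (.var 24)) (.seq (.set 29 (.var 28)) (.seq (.rep 6 mergeStepCmd)
      (.seq (checkCmd 25 29) (checkCmd 29 25)))))))

/-- Do a walk, enter it into the table, and compare it with the previous entry. -/
def trialCmd : Cmd :=
  .seq (sampleCmd 10) (.seq (.set 24 (.var 23 % .var 0)) (.seq (.set 25 (.var 24))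
    (.seq (walkCmd 25 26 27) (.ite (.var 27)
      (.seq (.set 28 (.get (.var 25))) (.seq (.put (.var 25) ((.var 24 + 1) % .var 4))
        (.ite (.var 28) compareCmd .skip))) .skip))))

/-- Choose the walk function of a round. -/
def setupCmd : Cmd :=
  .seq (.set 15 (.var 18 % 3)) (.seq (.set 14 (.var 18 / 3 % 2))
    (.seq (.set 13 1) (.seq (.set 32 0)
      (.seq (.rep 10 (.seq (.ite (.op .lt (.var 32) (.var 18 / 6 % .var 10))
          (.set 13 ((2 * .var 13) % .var 4)) .skip) (incCmd 32)))
        (.seq (sampleCmd 12) (.seq (.set 16 (.var 23 % .var 11))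
          (.seq (sampleCmd 12) (.set 17 (.var 23 % .var 11)))))))))

/-- One round. -/
def roundCmd : Cmd := .seq setupCmd (.seq (.rep 8 trialCmd) (incCmd 18))

/-- Look for solutions `(i, i)`. -/
def diagCmd : Cmd := .seq (.set 32 0) (.rep 0 (.seq (checkCmd 32 32) (incCmd 32)))

/-- The part of the program after the choice of the parameters. -/
def mainCmd : Cmd := .seq diagCmd (.seq (.set 18 0) (.rep 9 roundCmd))

/-- The choice of the parameters. -/
def initCmd : Cmd :=
  .seq (.set 5 1) (.seq (.rep 0 (.ite
      (.op .lt (.var 0 * .var 0) (64 * 64 * .var 5 * .var 5 * .var 2 * .var 3)) .skip (incCmd 5)))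
    (.seq (.set 6 ((2 * .var 5) % .var 4)) (.seq (.set 7 ((.var 0 / (16 * .var 5) + 1) % .var 4))
      (.seq (.set 8 ((.var 2 / 64 + 2) % .var 4)) (.seq (.size 10 0)
        (.seq (.set 11 ((.var 0 * .var 1) % .var 4)) (.seq (.size 12 11)
          (.set 9 ((6 * .var 10 * ((.var 0 * .var 0) /
            ((.var 2 * .var 5) * (.var 2 * .var 5)) + 1)) % .var 4)))))))))

/-- An upper bound for all numbers that occur. -/
def boundExp : Exp := 100 * .var 0 * .var 0 * .var 0 * .var 0 * .var 1

/-- The set of read-only variables grows during the program: at first the four inputs, then also the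
bound in variable 4, and finally the parameters in `isParam`. -/
theorem initCmd_ok : initCmd.ok (fun v => decide (v < 5)) = true := by decide
theorem boundExp_ok : boundExp.ok (fun v => decide (v < 4)) = true := by decide
theorem boundExp_depth : boundExp.depth ≤ 20 := by decide
theorem initCmd_nest : initCmd.nest ≤ 20 := by decide
theorem mainCmd_nest : mainCmd.nest ≤ 20 := by decide

end ListDisjointness

/-! # What the program does -/

namespace ListDisjointness

open RAM

/-- The entry that `entryExp` computes. -/
def entry (E : Env) (s : Store) (u : ℕ) : ℕ :=
  E.x u * (1 - (u / s.var 13 + s.var 14) % 2) + E.y u * ((u / s.var 13 + s.var 14) % 2)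

/-- The successor that `nextExp` computes. -/
def next (E : Env) (s : Store) (u : ℕ) : ℕ :=
  (E.h (entry E s u) + ((s.var 16 * entry E s u + s.var 17) % s.var 11) / s.var 1) % s.var 0

@[simp] theorem eval_entryExp (E : Env) (s : Store) (u : Exp) :
    (entryExp u).eval E s = entry E s (u.eval E s) := rfl

@[simp] theorem eval_nextExp (E : Env) (s : Store) (u : Exp) :
    (nextExp u).eval E s = next E s (u.eval E s) := rfl

/-- The values that are fixed during a round. -/
structure Ctx (E : Env) (N n W K d S B e : ℕ) (z f : ℕ → ℕ) (s : Store) : Prop where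
  h0 : s.var 0 = n
  h2 : s.var 2 = W
  h4 : s.var 4 = N
  h6 : s.var 6 = K
  h7 : s.var 7 = d
  h8 : s.var 8 = S
  h10 : s.var 10 = B
  h15 : s.var 15 = e
  hz : ∀ u, entry E s u = z u
  hf : ∀ u, next E s u = f u

section

variable {E : Env} {N n W K d S B e : ℕ} {z f : ℕ → ℕ} {s : Store}

theorem Ctx.of_var_eq (h : Ctx E N n W K d S B e z f s) {s' : Store}
    (hv : ∀ v, v < 18 → s'.var v = s.var v) : Ctx E N n W K d S B e z f s' where
  h0 := by rw [hv 0 (by omega), h.h0]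
  h2 := by rw [hv 2 (by omega), h.h2]
  h4 := by rw [hv 4 (by omega), h.h4]
  h6 := by rw [hv 6 (by omega), h.h6]
  h7 := by rw [hv 7 (by omega), h.h7]
  h8 := by rw [hv 8 (by omega), h.h8]
  h10 := by rw [hv 10 (by omega), h.h10]
  h15 := by rw [hv 15 (by omega), h.h15]
  hz u := by
    rw [← h.hz u]
    simp only [entry, hv 13 (by omega), hv 14 (by omega)]
  hf u := by
    rw [← h.hf u]
    simp only [next, entry, hv 13 (by omega), hv 14 (by omega), hv 16 (by omega), hv 17 (by omega),
      hv 11 (by omega), hv 1 (by omega), hv 0 (by omega)]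

theorem Ctx.eval (h : Ctx E N n W K d S B e z f s) (c : Cmd)
    (hc : ∀ v, v < 18 → c.writes v = false) : Ctx E N n W K d S B e z f (c.eval E s) :=
  h.of_var_eq fun v hv => c.eval_var_of_not_writes (hc v hv) s

theorem Ctx.set (h : Ctx E N n W K d S B e z f s) {v : ℕ} (hv : 18 ≤ v) (x : ℕ) :
    Ctx E N n W K d S B e z f (s.set v x) :=
  h.of_var_eq fun u hu => by rw [Store.set_var, if_neg (by omega)]

theorem eval_rep_iterate (v : ℕ) (c : Cmd) (s : Store) :
    (Cmd.rep v c).eval E s = (c.eval E)^[s.var v] s := rfl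

theorem eval_seq (c₁ c₂ : Cmd) (s : Store) :
    (Cmd.seq c₁ c₂).eval E s = c₂.eval E (c₁.eval E s) := rfl

theorem eval_set (v : ℕ) (x : Exp) (s : Store) :
    (Cmd.set v x).eval E s = s.set v (x.eval E s) := rfl

theorem eval_ite_pos {x : Exp} {c₁ c₂ : Cmd} {s : Store} (h : x.eval E s ≠ 0) :
    (Cmd.ite x c₁ c₂).eval E s = c₁.eval E s := if_pos h

theorem eval_ite_neg {x : Exp} {c₁ c₂ : Cmd} {s : Store} (h : x.eval E s = 0) :
    (Cmd.ite x c₁ c₂).eval E s = c₂.eval E s := if_neg (by simpa using h)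

theorem eval_incCmd (v : ℕ) (s : Store) :
    (incCmd v).eval E s = s.set v ((s.var v + 1) % s.var 4) := rfl

/-! ### Sampling -/

/-- The reduction modulo variable 4 only serves the syntactic bound on assigned values. It has no
effect, because a number with `k` binary digits is below `2 ^ k ≤ N`. -/
theorem sample_iterate (s : Store) (h4 : s.var 4 = N) (h23 : s.var 23 = 0) (k : ℕ)
    (hk : 2 ^ k ≤ N) :
    (((Cmd.seq (.flip 22) (.set 23 ((2 * .var 23 + .var 22) % .var 4))).eval E)^[k] s).var 23 =
      bitsVal (fun i => E.coins (s.used + i)) k ∧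
    (((Cmd.seq (.flip 22) (.set 23 ((2 * .var 23 + .var 22) % .var 4))).eval E)^[k] s).used =
      s.used + k ∧
    (((Cmd.seq (.flip 22) (.set 23 ((2 * .var 23 + .var 22) % .var 4))).eval E)^[k] s).arr = s.arr ∧
    ∀ v, v ≠ 22 → v ≠ 23 → (((Cmd.seq (.flip 22) (.set 23
      ((2 * .var 23 + .var 22) % .var 4))).eval E)^[k] s).var v = s.var v := by
  induction k with
  | zero => exact ⟨h23, rfl, rfl, fun _ _ _ => rfl⟩
  | succ k ih =>
    obtain ⟨h₁, h₂, h₃, h₄⟩ := ih ((Nat.pow_le_pow_right (by norm_num) (Nat.le_succ k)).trans hk)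
    rw [Function.iterate_succ_apply']
    set s' := ((Cmd.seq (.flip 22) (.set 23 ((2 * .var 23 + .var 22) % .var 4))).eval E)^[k] s
    have hlt := (bitsVal_lt (fun i => E.coins (s.used + i)) (k + 1)).trans_le hk
    have h4' : s'.var 4 = N := by rw [h₄ 4 (by omega) (by omega), h4]
    refine ⟨?_, ?_, ?_, ?_⟩
    · simp only [bitsVal] at hlt
      simp only [eval_seq, eval_set, Store.set_var, if_true, bitsVal]
      simp [Cmd.eval, h₁, h₂, h4', Nat.mod_eq_of_lt hlt]
    · simp [Cmd.eval, h₂, add_assoc]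
    · simp [Cmd.eval, h₃]
    · intro v hv hv'
      simp only [eval_seq, eval_set, Store.set_var, if_neg hv']
      simp [Cmd.eval, hv, h₄ v hv hv']

theorem eval_sampleCmd (s : Store) (h4 : s.var 4 = N) {v : ℕ} (hv : v ≠ 23)
    (hk : 2 ^ s.var v ≤ N) :
    ((sampleCmd v).eval E s).var 23 = bitsVal (fun i => E.coins (s.used + i)) (s.var v) ∧
    ((sampleCmd v).eval E s).used = s.used + s.var v ∧
    ((sampleCmd v).eval E s).arr = s.arr ∧
    ∀ u, u ≠ 22 → u ≠ 23 → ((sampleCmd v).eval E s).var u = s.var u := by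
  have h := sample_iterate (E := E) (s.set 23 0) (by rw [Store.set_var, if_neg (by omega), h4])
    (by rw [Store.set_var, if_pos rfl]) (s.var v) hk
  have he : (sampleCmd v).eval E s = ((Cmd.seq (.flip 22) (.set 23
      ((2 * .var 23 + .var 22) % .var 4))).eval E)^[s.var v] (s.set 23 0) := by
    rw [sampleCmd, eval_seq, eval_rep_iterate, eval_set, Store.set_var, if_neg hv]
    rfl
  rw [he]
  refine ⟨h.1, h.2.1, h.2.2.1, fun u hu hu' => ?_⟩
  rw [h.2.2.2 u hu hu', Store.set_var, if_neg hu']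

/-! ### Walks -/

/-- The walk along `f` from `v` stops after `L` steps because it arrives in the `e`-th interval of
length `d`. -/
def StopsAt (f : ℕ → ℕ) (d e v L : ℕ) : Prop :=
  1 ≤ L ∧ f^[L] v / d = e ∧ ∀ y, 1 ≤ y → y < L → f^[y] v / d ≠ e

theorem StopsAt.unique {f : ℕ → ℕ} {v L L' : ℕ} (h : StopsAt f d e v L)
    (h' : StopsAt f d e v L') : L = L' := by
  rcases lt_trichotomy L L' with hlt | heq | hgt
  · exact absurd h.2.1 (h'.2.2 L h.1 hlt)
  · exact heq
  · exact absurd h'.2.1 (h.2.2 L' h'.1 hgt)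

/-- Loop invariant. While the flag is zero, the walk has made all `k` steps and met no end point;
once the flag is one, further iterations change nothing. The start is never tested, hence the
conditions `1 ≤ y` and `1 ≤ L`. -/
theorem walk_iterate (hs : Ctx E N n W K d S B e z f s) {v len fin : ℕ} (hv : 18 ≤ v)
    (hl : 18 ≤ len) (hd : 18 ≤ fin) (hvl : v ≠ len) (hvd : v ≠ fin) (hld : len ≠ fin)
    (h0 : s.var len = 0) (h0' : s.var fin = 0) (k : ℕ) (hk : k < N) :
    Ctx E N n W K d S B e z f (((stepCmd v len fin).eval E)^[k] s) ∧
    ∃ L ≤ k, (((stepCmd v len fin).eval E)^[k] s).var v = f^[L] (s.var v) ∧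
      (((stepCmd v len fin).eval E)^[k] s).var len = L ∧
      (∀ y, 1 ≤ y → y < L → f^[y] (s.var v) / d ≠ e) ∧
      (((((stepCmd v len fin).eval E)^[k] s).var fin = 0 ∧ L = k ∧
          (1 ≤ L → f^[L] (s.var v) / d ≠ e)) ∨
        ((((stepCmd v len fin).eval E)^[k] s).var fin = 1 ∧ StopsAt f d e (s.var v) L)) := by
  induction k with
  | zero => exact ⟨hs, 0, le_rfl, rfl, h0, by intros; omega, .inl ⟨h0', rfl, by omega⟩⟩
  | succ k ih =>
    obtain ⟨hc, L, hLk, h₁, h₂, h₃, h₄⟩ := ih (by omega)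
    rw [Function.iterate_succ_apply']
    set s' := ((stepCmd v len fin).eval E)^[k] s
    rcases h₄ with ⟨h₄, h₅, h₆⟩ | ⟨h₄, h₅⟩
    · subst h₅
      have he : (stepCmd v len fin).eval E s' =
          ((s'.set v (f^[L + 1] (s.var v))).set len (L + 1)).set fin
            (if f^[L + 1] (s.var v) / d = e then 1 else 0) := by
        rw [stepCmd, eval_ite_neg (by simpa using h₄), eval_seq, eval_seq, eval_set, eval_incCmd,
          eval_set]
        have : (nextExp (.var v)).eval E s' = f^[L + 1] (s.var v) := by
          rw [eval_nextExp, hc.hf, Exp.eval_var, h₁, Function.iterate_succ_apply']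
        rw [this]
        have hlen : ((s'.set v (f^[L + 1] (s.var v))).var len + 1) %
            (s'.set v (f^[L + 1] (s.var v))).var 4 = L + 1 := by
          rw [Store.set_var, Store.set_var, if_neg hvl.symm, if_neg (by omega), h₂, hc.h4,
            Nat.mod_eq_of_lt hk]
        rw [hlen]
        have hc' := (hc.set hv (f^[L + 1] (s.var v))).set hl (L + 1)
        have hvv : ((s'.set v (f^[L + 1] (s.var v))).set len (L + 1)).var v =
            f^[L + 1] (s.var v) := by simp [Store.set_var, hvl]
        rw [Exp.eval_eq, Exp.eval_div, Exp.eval_var, Exp.eval_var, Exp.eval_var, hc'.h7, hc'.h15,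
          hvv]
      rw [he]
      refine ⟨((hc.set hv _).set hl _).set hd _, L + 1, le_rfl, ?_, ?_, ?_, ?_⟩
      · simp [Store.set_var, hvl, hvd]
      · simp [Store.set_var, hld]
      · intro y hy hyL
        rcases Nat.lt_succ_iff_lt_or_eq.1 hyL with h | rfl
        · exact h₃ y hy h
        · exact h₆ hy
      · simp only [Store.set_var, if_true]
        split_ifs with hcase
        · refine .inr ⟨rfl, by omega, hcase, fun y hy hyL => ?_⟩
          rcases Nat.lt_succ_iff_lt_or_eq.1 hyL with h | rfl
          · exact h₃ y hy h
          · exact h₆ hy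
        · exact .inl ⟨rfl, trivial, fun _ => hcase⟩
    · have he : (stepCmd v len fin).eval E s' = s' := by
        rw [stepCmd, eval_ite_pos (by simp [h₄])]
        rfl
      rw [he]
      exact ⟨hc, L, by omega, h₁, h₂, h₃, .inr ⟨h₄, h₅⟩⟩

/-- The outcome of a walk. -/
theorem eval_walkCmd (hs : Ctx E N n W K d S B e z f s) {v len fin : ℕ} (hv : 18 ≤ v)
    (hl : 18 ≤ len) (hd : 18 ≤ fin) (hvl : v ≠ len) (hvd : v ≠ fin) (hld : len ≠ fin)
    (hK : K < N) :
    Ctx E N n W K d S B e z f ((walkCmd v len fin).eval E s) ∧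
    (∀ L ≤ K, StopsAt f d e (s.var v) L →
      ((walkCmd v len fin).eval E s).var v = f^[L] (s.var v) ∧
      ((walkCmd v len fin).eval E s).var len = L ∧ ((walkCmd v len fin).eval E s).var fin = 1) ∧
    ((∀ L ≤ K, ¬ StopsAt f d e (s.var v) L) → ((walkCmd v len fin).eval E s).var fin = 0) := by
  have he : (walkCmd v len fin).eval E s =
      ((stepCmd v len fin).eval E)^[K] ((s.set len 0).set fin 0) := by
    rw [walkCmd, eval_seq, eval_seq, eval_set, eval_set, eval_rep_iterate, Store.set_var,
      Store.set_var, if_neg (by omega), if_neg (by omega), hs.h6]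
    rfl
  obtain ⟨hc, L, hLK, h₁, h₂, h₃, h₄⟩ := walk_iterate ((hs.set hl 0).set hd 0) hv hl hd hvl hvd hld
    (by simp [Store.set_var]) (by simp [Store.set_var]) K hK
  have hvs : ((s.set len 0).set fin 0).var v = s.var v := by
    simp [Store.set_var, hvl, hvd]
  rw [hvs] at h₁ h₃ h₄
  rw [he]
  refine ⟨hc, fun L' hL' hs_end => ?_, fun hno => ?_⟩
  · rcases h₄ with ⟨-, rfl, h₆⟩ | ⟨h₄, h₅⟩
    · exfalso
      rcases hL'.lt_or_eq with h | rfl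
      · exact h₃ L' hs_end.1 h hs_end.2.1
      · exact h₆ hs_end.1 hs_end.2.1
    · obtain rfl := h₅.unique hs_end
      exact ⟨h₁, h₂, h₄⟩
  · rcases h₄ with ⟨h₄, -, -⟩ | ⟨-, h₅⟩
    · exact h₄
    · exact absurd h₅ (hno L hLK)

/-! ### Merging walks -/

/-- Progress in the search for the point where the walks from `v` and `w` meet. -/
structure MergeInv (f : ℕ → ℕ) (v w r t k : ℕ) (g : ℕ) (s : Store) : Prop where
  ex : ∃ ya yb, ya ≤ r ∧ yb ≤ t ∧ s.var 25 = f^[ya] v ∧ s.var 29 = f^[yb] w ∧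
    max (r - ya) (t - yb) ≤ g ∧
    ((s.var 30 < s.var 26 ∧ yb = 0 ∧ s.var 26 + ya = r + k ∧ s.var 30 = t + k) ∨
      (s.var 26 < s.var 30 ∧ ya = 0 ∧ s.var 30 + yb = t + k ∧ s.var 26 = r + k) ∨
      (s.var 26 = s.var 30 ∧ r - ya = t - yb))

/-- The walk with the greater remaining length advances alone until the lengths agree; from then on
both advance together. Every step reduces the number `g` of steps that are still missing, until both
walks stand at the two sides of the collision, where equal values stop them. -/
theorem mergeStep_inv {v w r t k g : ℕ} (hs : Ctx E N n W K d S B e z f s)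
    (hzf : ∀ u u', z u = z u' → f u = f u') (hne : f^[r] v ≠ f^[t] w)
    (hz : z (f^[r] v) = z (f^[t] w)) (h : MergeInv f v w r t k (g + 1) s) :
    MergeInv f v w r t k g (mergeStepCmd.eval E s) := by
  obtain ⟨ya, yb, hya, hyb, h25, h29, hg, hcase⟩ := h.ex
  have n25 : (nextExp (.var 25)).eval E s = f^[ya + 1] v := by
    rw [eval_nextExp, hs.hf, Exp.eval_var, h25, Function.iterate_succ_apply']
  have n29 : (nextExp (.var 29)).eval E s = f^[yb + 1] w := by
    rw [eval_nextExp, hs.hf, Exp.eval_var, h29, Function.iterate_succ_apply']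
  rcases hcase with ⟨hlt, rfl, ha, hb⟩ | ⟨hlt, rfl, hb, ha⟩ | ⟨heq, hr⟩
  · have he : mergeStepCmd.eval E s = (s.set 25 (f^[ya + 1] v)).set 26 (s.var 26 - 1) := by
      rw [mergeStepCmd, eval_ite_pos (by simp [hlt]), eval_seq, eval_set, eval_set, n25]
      simp [Store.set_var]
    rw [he]
    refine ⟨ya + 1, 0, by omega, by omega, ?_⟩
    simp only [Store.set_var]
    simp only [Nat.reduceEqDiff, if_true, if_false]
    refine ⟨trivial, h29, by omega, ?_⟩
    simp only [true_and, false_and]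
    omega
  · have he : mergeStepCmd.eval E s = (s.set 29 (f^[yb + 1] w)).set 30 (s.var 30 - 1) := by
      rw [mergeStepCmd, eval_ite_neg (by simp [hlt.not_gt]), eval_ite_pos (by simp [hlt]), eval_seq,
        eval_set, eval_set, n29]
      simp [Store.set_var]
    rw [he]
    refine ⟨0, yb + 1, by omega, by omega, ?_⟩
    simp only [Store.set_var]
    simp only [Nat.reduceEqDiff, if_true, if_false]
    refine ⟨h25, trivial, by omega, ?_⟩
    simp only [true_and, false_and]
    omega
  · by_cases hzz : z (s.var 25) = z (s.var 29)
    · have he : mergeStepCmd.eval E s = s := by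
        rw [mergeStepCmd, eval_ite_neg (by simp [heq]), eval_ite_neg (by simp [heq]),
          eval_ite_pos (by simp [hs.hz, hzz])]
        rfl
      rw [he]
      refine ⟨ya, yb, hya, hyb, h25, h29, ?_, .inr (.inr ⟨heq, hr⟩)⟩
      -- Equal values strictly before the collision would make the walks coincide from the next step
      -- on, against `hne`.
      rcases Nat.eq_zero_or_pos (r - ya) with h0 | hpos
      · omega
      · exfalso
        apply hne
        rw [h25, h29] at hzz
        have := hzf _ _ hzz
        rw [← Function.iterate_succ_apply' f, ← Function.iterate_succ_apply' f] at this
        have e₁ : r = (r - ya - 1) + (ya + 1) := by omega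
        have e₂ : t = (r - ya - 1) + (yb + 1) := by omega
        rw [e₁, e₂, Function.iterate_add_apply, Function.iterate_add_apply f _ (yb + 1), this]
    · have hpos : 0 < r - ya := by
        by_contra h0
        apply hzz
        rw [h25, h29, show ya = r by omega, show yb = t by omega, hz]
      have he : mergeStepCmd.eval E s = (s.set 25 (f^[ya + 1] v)).set 29 (f^[yb + 1] w) := by
        have n29' : (nextExp (.var 29)).eval E (s.set 25 (f^[ya + 1] v)) = f^[yb + 1] w := by
          rw [eval_nextExp, (hs.set (by omega) _).hf, Exp.eval_var, Store.set_var,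
            if_neg (by omega), h29, Function.iterate_succ_apply']
        rw [mergeStepCmd, eval_ite_neg (by simp [heq]), eval_ite_neg (by simp [heq]),
          eval_ite_neg (by simp [hs.hz, hzz]), eval_seq, eval_set, eval_set, n25, n29']
      rw [he]
      refine ⟨ya + 1, yb + 1, by omega, by omega, ?_⟩
      simp only [Store.set_var]
      simp only [Nat.reduceEqDiff, if_true, if_false]
      refine ⟨trivial, trivial, by omega, ?_⟩
      omega

theorem mergeStepCmd_writes : ∀ v, v < 18 → mergeStepCmd.writes v = false := by decide

theorem mergeStep_iterate {v w r t k g j : ℕ} (hs : Ctx E N n W K d S B e z f s)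
    (hzf : ∀ u u', z u = z u' → f u = f u') (hne : f^[r] v ≠ f^[t] w)
    (hz : z (f^[r] v) = z (f^[t] w)) (h : MergeInv f v w r t k (g + j) s) :
    Ctx E N n W K d S B e z f ((mergeStepCmd.eval E)^[j] s) ∧
      MergeInv f v w r t k g ((mergeStepCmd.eval E)^[j] s) := by
  induction j generalizing s with
  | zero => exact ⟨hs, h⟩
  | succ j ih =>
    rw [Function.iterate_succ_apply]
    exact ih (hs.eval _ mergeStepCmd_writes) (mergeStep_inv hs hzf hne hz h)

theorem MergeInv.eq {v w r t k : ℕ} (h : MergeInv f v w r t k 0 s) :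
    s.var 25 = f^[r] v ∧ s.var 29 = f^[t] w := by
  obtain ⟨ya, yb, hya, hyb, h25, h29, hg, -⟩ := h.ex
  obtain rfl : ya = r := by omega
  obtain rfl : yb = t := by omega
  exact ⟨h25, h29⟩

/-! ### Soundness -/

/-- If a solution has been recorded then it is correct. -/
def Sound (E : Env) (n : ℕ) (s : Store) : Prop :=
  s.var 19 ≠ 0 → s.var 20 < n ∧ s.var 21 < n ∧ E.x (s.var 20) = E.y (s.var 21)

/-- The program records only correct solutions, and does not forget that it has found one. -/
def Safe (E : Env) (n : ℕ) (c : Cmd) : Prop :=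
  ∀ s, s.var 0 = n → Sound E n s → (c.eval E s).var 0 = n ∧ Sound E n (c.eval E s) ∧
    (s.var 19 ≠ 0 → (c.eval E s).var 19 ≠ 0)

theorem Safe.of_not_writes {c : Cmd} (h0 : c.writes 0 = false) (h19 : c.writes 19 = false)
    (h20 : c.writes 20 = false) (h21 : c.writes 21 = false) : Safe E n c := by
  intro s hn hs
  have e0 := c.eval_var_of_not_writes (E := E) h0 s
  have e19 := c.eval_var_of_not_writes (E := E) h19 s
  have e20 := c.eval_var_of_not_writes (E := E) h20 s
  have e21 := c.eval_var_of_not_writes (E := E) h21 s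
  refine ⟨e0.trans hn, ?_, ?_⟩
  · simpa only [Sound, e19, e20, e21] using hs
  · rw [e19]
    exact id

theorem Safe.seq {c₁ c₂ : Cmd} (h₁ : Safe E n c₁) (h₂ : Safe E n c₂) :
    Safe E n (.seq c₁ c₂) := by
  intro s hn hs
  obtain ⟨a, b, c⟩ := h₁ s hn hs
  obtain ⟨a', b', c'⟩ := h₂ _ a b
  exact ⟨a', b', fun h => c' (c h)⟩

theorem Safe.ite {x : Exp} {c₁ c₂ : Cmd} (h₁ : Safe E n c₁) (h₂ : Safe E n c₂) :
    Safe E n (.ite x c₁ c₂) := by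
  intro s hn hs
  by_cases h : x.eval E s = 0
  · rw [eval_ite_neg h]
    exact h₂ s hn hs
  · rw [eval_ite_pos h]
    exact h₁ s hn hs

theorem Safe.iterate {c : Cmd} (h : Safe E n c) (j : ℕ) (s : Store) (hn : s.var 0 = n)
    (hs : Sound E n s) : ((c.eval E)^[j] s).var 0 = n ∧ Sound E n ((c.eval E)^[j] s) ∧
      (s.var 19 ≠ 0 → ((c.eval E)^[j] s).var 19 ≠ 0) := by
  induction j generalizing s with
  | zero => exact ⟨hn, hs, id⟩
  | succ j ih =>
    rw [Function.iterate_succ_apply]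
    obtain ⟨a, b, c⟩ := h s hn hs
    obtain ⟨a', b', c'⟩ := ih _ a b
    exact ⟨a', b', fun h => c' (c h)⟩

theorem Safe.rep {v : ℕ} {c : Cmd} (h : Safe E n c) : Safe E n (.rep v c) :=
  fun s hn hs => h.iterate (s.var v) s hn hs

theorem eval_checkCmd {u v : ℕ} (hn : s.var 0 = n) :
    (s.var u < n ∧ s.var v < n ∧ E.x (s.var u) = E.y (s.var v) ∧
      (checkCmd u v).eval E s = ((s.set 20 (s.var u)).set 21
        ((s.set 20 (s.var u)).var v)).set 19 1) ∨
    (¬ (s.var u < n ∧ s.var v < n ∧ E.x (s.var u) = E.y (s.var v)) ∧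
      (checkCmd u v).eval E s = s) := by
  by_cases h₁ : s.var u < n
  · by_cases h₂ : s.var v < n
    · by_cases h₃ : E.x (s.var u) = E.y (s.var v)
      · refine .inl ⟨h₁, h₂, h₃, ?_⟩
        rw [checkCmd, eval_ite_pos (by simp [hn, h₁]), eval_ite_pos (by simp [hn, h₂]),
          eval_ite_pos (by simp [h₃])]
        rfl
      · refine .inr ⟨by tauto, ?_⟩
        rw [checkCmd, eval_ite_pos (by simp [hn, h₁]), eval_ite_pos (by simp [hn, h₂]),
          eval_ite_neg (by simp [h₃])]
        rfl
    · refine .inr ⟨by tauto, ?_⟩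
      rw [checkCmd, eval_ite_pos (by simp [hn, h₁]), eval_ite_neg (by simpa [hn] using h₂)]
      rfl
  · refine .inr ⟨by tauto, ?_⟩
    rw [checkCmd, eval_ite_neg (by simpa [hn] using h₁)]
    rfl

/-- Variable 20 is overwritten before `v` is copied, hence the condition on `v`. -/
theorem safe_checkCmd {u v : ℕ} (hv : v ≠ 20) : Safe E n (checkCmd u v) := by
  intro s hn hs
  rcases eval_checkCmd (E := E) (u := u) (v := v) hn with ⟨h₁, h₂, h₃, he⟩ | ⟨-, he⟩
  · rw [he]
    refine ⟨by simpa [Store.set_var] using hn, fun _ => ?_, fun _ => by simp [Store.set_var]⟩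
    simp [Store.set_var, hv, h₁, h₂, h₃]
  · rw [he]
    exact ⟨hn, hs, id⟩

theorem checkCmd_found {u v : ℕ} (hn : s.var 0 = n) (hu : s.var u < n) (hv : s.var v < n)
    (h : E.x (s.var u) = E.y (s.var v)) : ((checkCmd u v).eval E s).var 19 ≠ 0 := by
  rcases eval_checkCmd (E := E) (u := u) (v := v) hn with ⟨-, -, -, he⟩ | ⟨h', -⟩
  · rw [he]
    simp [Store.set_var]
  · exact absurd ⟨hu, hv, h⟩ h'

theorem safe_compareCmd : Safe E n compareCmd := by
  refine .seq (.of_not_writes rfl rfl rfl rfl) (.seq (.of_not_writes rfl rfl rfl rfl)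
    (.seq (.of_not_writes rfl rfl rfl rfl) (.seq (.of_not_writes rfl rfl rfl rfl)
      (.seq (.of_not_writes rfl rfl rfl rfl) (.seq (.of_not_writes rfl rfl rfl rfl)
        (.seq ?_ ?_))))))
  · exact safe_checkCmd (by norm_num)
  · exact safe_checkCmd (by norm_num)

theorem safe_trialCmd : Safe E n trialCmd :=
  .seq (.of_not_writes rfl rfl rfl rfl) (.seq (.of_not_writes rfl rfl rfl rfl)
    (.seq (.of_not_writes rfl rfl rfl rfl) (.seq (.of_not_writes rfl rfl rfl rfl)
      (.ite (.seq (.of_not_writes rfl rfl rfl rfl) (.seq (.of_not_writes rfl rfl rfl rfl)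
        (.ite safe_compareCmd (.of_not_writes rfl rfl rfl rfl))))
        (.of_not_writes rfl rfl rfl rfl)))))

theorem safe_roundCmd : Safe E n roundCmd :=
  .seq (.of_not_writes rfl rfl rfl rfl)
    (.seq (.rep safe_trialCmd) (.of_not_writes rfl rfl rfl rfl))

end

end ListDisjointness

/-! ### Trials: a walk, its table entry, and the comparison -/

namespace ListDisjointness

open RAM

section

variable {E : Env} {N n W K d S B e : ℕ} {z f : ℕ → ℕ} {s : Store}

/-- Two walks that meet at a solution lead to its discovery. -/
theorem compareCmd_found (hs : Ctx E N n W K d S B e z f s) (hK : K < N)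
    (hzf : ∀ u u', z u = z u' → f u = f u') {v u r t k : ℕ} (h28 : s.var 28 = u + 1)
    (h24 : s.var 24 = v) (h26 : s.var 26 = r + k) (hr : r + k ≤ K) (ht : t + k ≤ K)
    (hs_end : StopsAt f d e u (t + k)) (hne : f^[r] v ≠ f^[t] u)
    (hz : z (f^[r] v) = z (f^[t] u)) (hv : f^[r] v < n) (hu : f^[t] u < n)
    (hxy : E.x (f^[r] v) = E.y (f^[t] u) ∨ E.x (f^[t] u) = E.y (f^[r] v)) :
    (compareCmd.eval E s).var 19 ≠ 0 := by
  set s₁ := s.set 28 u with hs₁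
  have hc₁ : Ctx E N n W K d S B e z f s₁ := hs.set (by norm_num) _
  set s₂ := s₁.set 29 u with hs₂
  have hc₂ : Ctx E N n W K d S B e z f s₂ := hc₁.set (by norm_num) _
  obtain ⟨hc₃, hw, -⟩ := eval_walkCmd hc₂ (v := 29) (len := 30) (fin := 31) (by norm_num)
    (by norm_num) (by norm_num) (by norm_num) (by norm_num) (by norm_num) hK
  have hu₂ : s₂.var 29 = u := by simp [hs₂, Store.set_var]
  rw [hu₂] at hw
  have h30 := (hw _ ht hs_end).2.1
  set s₃ := (walkCmd 29 30 31).eval E s₂ with hs₃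
  have h24₃ : s₃.var 24 = v := by
    rw [hs₃, Cmd.eval_var_of_not_writes _ rfl]
    simp [hs₂, hs₁, Store.set_var, h24]
  have h26₃ : s₃.var 26 = r + k := by
    rw [hs₃, Cmd.eval_var_of_not_writes _ rfl]
    simp [hs₂, hs₁, Store.set_var, h26]
  have h28₃ : s₃.var 28 = u := by
    rw [hs₃, Cmd.eval_var_of_not_writes _ rfl]
    simp [hs₂, hs₁, Store.set_var]
  set s₅ := (s₃.set 25 v).set 29 u with hs₅
  have hc₅ : Ctx E N n W K d S B e z f s₅ := (hc₃.set (by norm_num) _).set (by norm_num) _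
  -- Both sides of the collision are at most `K` steps away from the starts, so `K` merge steps are
  -- enough.
  have hinv : MergeInv f v u r t k (0 + K) s₅ := by
    refine ⟨0, 0, by omega, by omega, by simp [hs₅, Store.set_var], by simp [hs₅, Store.set_var],
      by omega, ?_⟩
    have e26 : s₅.var 26 = r + k := by simp [hs₅, Store.set_var, h26₃]
    have e30 : s₅.var 30 = t + k := by simp [hs₅, Store.set_var, h30]
    rw [e26, e30]
    rcases lt_trichotomy r t with h | h | h
    · exact .inr (.inl ⟨by omega, rfl, by omega, rfl⟩)
    · exact .inr (.inr ⟨by omega, by omega⟩)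
    · exact .inl ⟨by omega, rfl, by omega, rfl⟩
  obtain ⟨hc₆, hm⟩ := mergeStep_iterate hc₅ hzf hne hz hinv
  have he : compareCmd.eval E s = (checkCmd 29 25).eval E ((checkCmd 25 29).eval E
      ((mergeStepCmd.eval E)^[K] s₅)) := by
    have e₁ : (Cmd.set 28 (.var 28 - 1)).eval E s = s₁ := by
      simp [eval_set, h28, hs₁]
    have e₂ : (Cmd.set 29 (.var 28)).eval E s₁ = s₂ := by
      simp [eval_set, hs₂, hs₁, Store.set_var]
    have e₄ : (Cmd.set 25 (.var 24)).eval E s₃ = s₃.set 25 v := by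
      simp [eval_set, h24₃]
    have e₅ : (Cmd.set 29 (.var 28)).eval E (s₃.set 25 v) = s₅ := by
      simp [eval_set, Store.set_var, h28₃, hs₅]
    rw [compareCmd, eval_seq, e₁, eval_seq, e₂, eval_seq, ← hs₃, eval_seq, e₄, eval_seq, e₅,
      eval_seq, eval_rep_iterate, hc₅.h6, eval_seq]
  rw [he]
  obtain ⟨h25, h29⟩ := hm.eq
  set s₆ := (mergeStepCmd.eval E)^[K] s₅
  -- It is not known which of the two indices belongs to `x`, so both orders are checked. A success
  -- of the first check is not undone by the second.
  rcases eval_checkCmd (E := E) (u := 25) (v := 29) hc₆.h0 with ⟨h₁, h₂, h₃, he⟩ | ⟨h', he⟩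
  · have hfound : ((checkCmd 25 29).eval E s₆).var 19 ≠ 0 :=
      checkCmd_found hc₆.h0 h₁ h₂ h₃
    rcases eval_checkCmd (E := E) (u := 29) (v := 25) (s := (checkCmd 25 29).eval E s₆) (n := n)
      (by rw [he]; simpa [Store.set_var] using hc₆.h0) with ⟨h₁', h₂', h₃', he'⟩ | ⟨h', he'⟩
    · rw [he']
      simp [Store.set_var]
    · rw [he']
      exact hfound
  · rw [he]
    refine checkCmd_found hc₆.h0 (by rwa [h29]) (by rwa [h25]) ?_
    rw [h25, h29] at h' ⊢
    rcases hxy with h | h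
    · exact absurd ⟨hv, hu, h⟩ h'
    · exact h

/-- The starting point of a walk, as a function of the coins. -/
def startOf (E : Env) (n B u : ℕ) : ℕ := bitsVal (fun i => E.coins (u + i)) B % n

/-- The table stores the start plus one, so that zero means an empty cell. The last clause is the
point: if the cell of the end point still holds the start of a walk that merges with the present one
at a solution, then the solution is found. -/
theorem eval_trialCmd (hs : Ctx E N n W K d S B e z f s) (hK : K < N) (hn : 0 < n) (hnN : n < N)
    (hB : 2 ^ B ≤ N) (hzf : ∀ u u', z u = z u' → f u = f u') :
    Ctx E N n W K d S B e z f (trialCmd.eval E s) ∧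
    (trialCmd.eval E s).used = s.used + B ∧
    (∀ L ≤ K, StopsAt f d e (startOf E n B s.used) L → (trialCmd.eval E s).arr =
      Function.update s.arr (f^[L] (startOf E n B s.used) % W) (startOf E n B s.used + 1)) ∧
    ((∀ L ≤ K, ¬ StopsAt f d e (startOf E n B s.used) L) → (trialCmd.eval E s).arr = s.arr) ∧
    (∀ u r t k, r + k ≤ K → t + k ≤ K → StopsAt f d e (startOf E n B s.used) (r + k) →
      StopsAt f d e u (t + k) → f^[r] (startOf E n B s.used) ≠ f^[t] u →
      z (f^[r] (startOf E n B s.used)) = z (f^[t] u) →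
      f^[r] (startOf E n B s.used) < n → f^[t] u < n →
      (E.x (f^[r] (startOf E n B s.used)) = E.y (f^[t] u) ∨
        E.x (f^[t] u) = E.y (f^[r] (startOf E n B s.used))) →
      s.arr (f^[r + k] (startOf E n B s.used) % W) = u + 1 →
      (trialCmd.eval E s).var 19 ≠ 0) := by
  obtain ⟨a₁, a₂, a₃, a₄⟩ := eval_sampleCmd (E := E) s hs.h4 (v := 10) (by norm_num)
    (by rw [hs.h10]; exact hB)
  rw [hs.h10] at a₁ a₂
  set s₁ := (sampleCmd 10).eval E s with hs₁
  have hc₁ : Ctx E N n W K d S B e z f s₁ :=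
    hs.of_var_eq fun v hv => a₄ v (by omega) (by omega)
  set v₀ := startOf E n B s.used with hv₀
  have e₂ : (Cmd.set 24 (.var 23 % .var 0)).eval E s₁ = s₁.set 24 v₀ := by
    simp [eval_set, a₁, hc₁.h0, hv₀, startOf]
  set s₂ := s₁.set 24 v₀ with hs₂
  have e₃ : (Cmd.set 25 (.var 24)).eval E s₂ = s₂.set 25 v₀ := by
    simp [eval_set, hs₂, Store.set_var]
  set s₃ := s₂.set 25 v₀ with hs₃
  have hc₃ : Ctx E N n W K d S B e z f s₃ := (hc₁.set (by norm_num) _).set (by norm_num) _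
  obtain ⟨hc₄, hw, hw'⟩ := eval_walkCmd hc₃ (v := 25) (len := 26) (fin := 27) (by norm_num)
    (by norm_num) (by norm_num) (by norm_num) (by norm_num) (by norm_num) hK
  have h25₃ : s₃.var 25 = v₀ := by simp [hs₃, Store.set_var]
  rw [h25₃] at hw hw'
  obtain ⟨q₁, q₂⟩ := (walkCmd 25 26 27).eval_of_quiet (E := E) rfl s₃
  have h24 : ((walkCmd 25 26 27).eval E s₃).var 24 = v₀ := by
    rw [Cmd.eval_var_of_not_writes _ rfl]
    simp [hs₃, hs₂, Store.set_var]
  set s₄ := (walkCmd 25 26 27).eval E s₃ with hs₄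
  have harr₄ : s₄.arr = s.arr := by rw [q₁, ← a₃]; rfl
  have hused₄ : s₄.used = s.used + B := by rw [q₂, ← a₂]; rfl
  have hv₀n : v₀ < n := Nat.mod_lt _ hn
  have he : trialCmd.eval E s = (Cmd.ite (.var 27)
      (.seq (.set 28 (.get (.var 25))) (.seq (.put (.var 25) ((.var 24 + 1) % .var 4))
        (.ite (.var 28) compareCmd .skip))) .skip).eval E s₄ := by
    rw [trialCmd, eval_seq, eval_seq, ← hs₁, e₂, eval_seq, e₃, eval_seq]
  by_cases hex : ∃ L ≤ K, StopsAt f d e v₀ L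
  · obtain ⟨L, hL, hs_end⟩ := hex
    obtain ⟨b₁, b₂, b₃⟩ := hw L hL hs_end
    set a := s.arr (f^[L] v₀ % W) with ha
    set s₅ := s₄.set 28 a with hs₅
    have hc₅ : Ctx E N n W K d S B e z f s₅ := hc₄.set (by norm_num) _
    -- The old entry was saved in variable 28, so the comparison may run after the cell has been
    -- overwritten.
    set s₆ : Store := ⟨s₅.var, Function.update s.arr (f^[L] v₀ % W) (v₀ + 1), s₅.used⟩ with hs₆
    have hc₆ : Ctx E N n W K d S B e z f s₆ := hc₅.of_var_eq fun v _ => rfl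
    have he' : trialCmd.eval E s = (Cmd.ite (.var 28) compareCmd .skip).eval E s₆ := by
      have e₅ : (Cmd.set 28 (.get (.var 25))).eval E s₄ = s₅ := by
        simp [eval_set, b₁, harr₄, hc₄.h2, hs₅, ha]
      have e₆ : (Cmd.put (.var 25) ((.var 24 + 1) % .var 4)).eval E s₅ = s₆ := by
        have : s₅.arr = s.arr := harr₄
        have h25 : s₅.var 25 = f^[L] v₀ := by simp [hs₅, Store.set_var, b₁]
        have h24' : s₅.var 24 = v₀ := by simp [hs₅, Store.set_var, h24]
        simp only [Cmd.eval, Exp.eval_var, Exp.eval_mod, Exp.eval_add, h25, h24', hc₅.h2, hc₅.h4,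
          this, hs₆, Exp.eval_ofNat]
        rw [Nat.mod_eq_of_lt (show v₀ + 1 < N by omega)]
      rw [he, eval_ite_pos (by simp [b₃]), eval_seq, e₅, eval_seq, e₆]
    have h28 : s₆.var 28 = a := by simp [hs₆, hs₅, Store.set_var]
    have hquiet : (Cmd.ite (.var 28) compareCmd .skip).quiet = true := rfl
    obtain ⟨c₁, c₂⟩ := (Cmd.ite (.var 28) compareCmd .skip).eval_of_quiet (E := E) hquiet s₆
    rw [he', c₁, c₂]
    refine ⟨?_, hused₄, ?_, ?_, ?_⟩
    · exact hc₆.eval _ (by decide)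
    · intro L' _ hL'
      rw [← hs_end.unique hL']
    · intro hno
      exact absurd hs_end (hno L hL)
    · intro u r t k hr ht hs_end' hu hne hz hvn hun hxy harr
      obtain rfl := hs_end.unique hs_end'
      rw [eval_ite_pos (by simp [h28, ha, harr])]
      refine compareCmd_found hc₆ hK hzf (by rw [h28, ha, harr]) ?_ ?_ hr ht hu hne hz hvn hun hxy
      · simp [hs₆, hs₅, Store.set_var, h24]
      · simp [hs₆, hs₅, Store.set_var, b₂]
  · have hno : ∀ L ≤ K, ¬ StopsAt f d e v₀ L := fun L hL h => hex ⟨L, hL, h⟩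
    have he' : trialCmd.eval E s = s₄ := by
      rw [he, eval_ite_neg (by simp [hw' hno])]
      rfl
    rw [he']
    refine ⟨hc₄, hused₄, fun L hL h => absurd h (hno L hL), fun _ => harr₄, ?_⟩
    intro u r t k hr _ h
    exact absurd h (hno _ hr)

/-- The round with the starting points `st` succeeds: two walks meet at a solution, and no walk
between them overwrites the entry of the first one. -/
def Success (E : Env) (n W K d S e : ℕ) (z f : ℕ → ℕ) (st : ℕ → ℕ) : Prop :=
  ∃ a b r t k, a < b ∧ b < S ∧ r + k ≤ K ∧ t + k ≤ K ∧ StopsAt f d e (st b) (r + k) ∧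
    StopsAt f d e (st a) (t + k) ∧ f^[r] (st b) ≠ f^[t] (st a) ∧
    z (f^[r] (st b)) = z (f^[t] (st a)) ∧ f^[r] (st b) < n ∧ f^[t] (st a) < n ∧
    (E.x (f^[r] (st b)) = E.y (f^[t] (st a)) ∨ E.x (f^[t] (st a)) = E.y (f^[r] (st b))) ∧
    f^[r + k] (st b) = f^[t + k] (st a) ∧
    ∀ q, a < q → q < b → ∀ L ≤ K, StopsAt f d e (st q) L →
      f^[L] (st q) % W ≠ f^[t + k] (st a) % W

theorem trial_iterate (hs : Ctx E N n W K d S B e z f s) (hK : K < N) (hn : 0 < n) (hnN : n < N)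
    (hB : 2 ^ B ≤ N) (hzf : ∀ u u', z u = z u' → f u = f u') (q : ℕ) :
    Ctx E N n W K d S B e z f ((trialCmd.eval E)^[q] s) ∧
      ((trialCmd.eval E)^[q] s).used = s.used + q * B := by
  induction q with
  | zero => exact ⟨hs, by simp⟩
  | succ q ih =>
    rw [Function.iterate_succ_apply']
    obtain ⟨h₁, h₂, -⟩ := eval_trialCmd ih.1 hK hn hnN hB hzf
    exact ⟨h₁, by rw [h₂, ih.2]; ring⟩

/-- What trial `a` writes is still there when trial `b` reads it, since no walk between them ends in
the same cell. The remaining trials cannot forget what trial `b` records. -/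
theorem trials_found (hs : Ctx E N n W K d S B e z f s) (hK : K < N) (hn : 0 < n) (hnN : n < N)
    (hB : 2 ^ B ≤ N) (hzf : ∀ u u', z u = z u' → f u = f u') (hsound : Sound E n s)
    (hsucc : Success E n W K d S e z f fun q => startOf E n B (s.used + q * B)) :
    ((trialCmd.eval E)^[S] s).var 19 ≠ 0 := by
  obtain ⟨a, b, r, t, k, hab, hbS, hr, ht, hsb, hsa, hne, hz, hvn, hun, hxy, hend, hno⟩ := hsucc
  have key : ∀ q, a < q → q ≤ b → ((trialCmd.eval E)^[q] s).arr
      (f^[t + k] (startOf E n B (s.used + a * B)) % W) = startOf E n B (s.used + a * B) + 1 := by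
    intro q haq
    induction q, haq using Nat.le_induction with
    | base =>
      intro _
      rw [Function.iterate_succ_apply']
      obtain ⟨hc, hu⟩ := trial_iterate hs hK hn hnN hB hzf a
      obtain ⟨-, -, h₃, -⟩ := eval_trialCmd hc hK hn hnN hB hzf
      rw [hu] at h₃
      rw [h₃ _ ht hsa, Function.update_self]
    | succ q haq ih =>
      intro hqb
      rw [Function.iterate_succ_apply']
      obtain ⟨hc, hu⟩ := trial_iterate hs hK hn hnN hB hzf q
      obtain ⟨-, -, h₃, h₄, -⟩ := eval_trialCmd hc hK hn hnN hB hzf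
      rw [hu] at h₃ h₄
      by_cases hex : ∃ L ≤ K, StopsAt f d e (startOf E n B (s.used + q * B)) L
      · obtain ⟨L, hL, hst⟩ := hex
        rw [h₃ L hL hst, Function.update_of_ne, ih (by omega)]
        exact (hno q haq (by omega) L hL hst).symm
      · rw [h₄ fun L hL h => hex ⟨L, hL, h⟩, ih (by omega)]
  obtain ⟨hc, hu⟩ := trial_iterate hs hK hn hnN hB hzf b
  obtain ⟨-, -, -, -, h₅⟩ := eval_trialCmd hc hK hn hnN hB hzf
  rw [hu] at h₅
  have hfound := h₅ _ r t k hr ht hsb hsa hne hz hvn hun hxy (by rw [hend]; exact key b hab le_rfl)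
  rw [← Function.iterate_succ_apply' (trialCmd.eval E)] at hfound
  obtain ⟨j, rfl⟩ := Nat.exists_eq_add_of_le (show b + 1 ≤ S by omega)
  rw [Nat.add_comm (b + 1) j, Function.iterate_add_apply]
  obtain ⟨g₁, g₂, -⟩ := (safe_trialCmd (E := E) (n := n)).iterate (b + 1) s hs.h0 hsound
  exact (safe_trialCmd.iterate j _ g₁ g₂).2.2 hfound

end

end ListDisjointness

/-! ### Rounds, the main loop and the parameters -/

namespace ListDisjointness

open RAM

/-- The entries that a round uses. -/
def roundEntry (E : Env) (pw c u : ℕ) : ℕ :=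
  E.x u * (1 - (u / pw + c) % 2) + E.y u * ((u / pw + c) % 2)

/-- The walk function of a round. -/
def roundNext (E : Env) (n m M pw c a b u : ℕ) : ℕ :=
  (E.h (roundEntry E pw c u) + ((a * roundEntry E pw c u + b) % M) / m) % n

/-- A random number from the coins at position `u`. -/
def coinsVal (E : Env) (u B : ℕ) : ℕ := bitsVal (fun i => E.coins (u + i)) B

/-- The values of the parameters. -/
structure Par (N n m W K d S R B M B₂ : ℕ) (s : Store) : Prop where
  h0 : s.var 0 = n
  h1 : s.var 1 = m
  h2 : s.var 2 = W
  h4 : s.var 4 = N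
  h6 : s.var 6 = K
  h7 : s.var 7 = d
  h8 : s.var 8 = S
  h9 : s.var 9 = R
  h10 : s.var 10 = B
  h11 : s.var 11 = M
  h12 : s.var 12 = B₂

section

variable {E : Env} {N n m W K d S R B M B₂ : ℕ} {s : Store}

theorem Par.of_var_eq (h : Par N n m W K d S R B M B₂ s) {s' : Store}
    (hv : ∀ v, v < 13 → s'.var v = s.var v) : Par N n m W K d S R B M B₂ s' where
  h0 := by rw [hv 0 (by omega), h.h0]
  h1 := by rw [hv 1 (by omega), h.h1]
  h2 := by rw [hv 2 (by omega), h.h2]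
  h4 := by rw [hv 4 (by omega), h.h4]
  h6 := by rw [hv 6 (by omega), h.h6]
  h7 := by rw [hv 7 (by omega), h.h7]
  h8 := by rw [hv 8 (by omega), h.h8]
  h9 := by rw [hv 9 (by omega), h.h9]
  h10 := by rw [hv 10 (by omega), h.h10]
  h11 := by rw [hv 11 (by omega), h.h11]
  h12 := by rw [hv 12 (by omega), h.h12]

theorem Par.set (h : Par N n m W K d S R B M B₂ s) {v : ℕ} (hv : 13 ≤ v) (x : ℕ) :
    Par N n m W K d S R B M B₂ (s.set v x) :=
  h.of_var_eq fun u hu => by rw [Store.set_var, if_neg (by omega)]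

theorem Par.eval (h : Par N n m W K d S R B M B₂ s) (c : Cmd)
    (hc : ∀ v, v < 13 → c.writes v = false) : Par N n m W K d S R B M B₂ (c.eval E s) :=
  h.of_var_eq fun v hv => c.eval_var_of_not_writes (hc v hv) s

/-- The body of the loop that computes a power of two. -/
def powCmd : Cmd :=
  .seq (.ite (.op .lt (.var 32) (.var 18 / 6 % .var 10))
    (.set 13 ((2 * .var 13) % .var 4)) .skip) (incCmd 32)

/-- Loops may only be counted by read-only variables. Hence the loop runs over all `B` bit
positions, and only the iterations below the wanted exponent double the result. -/
theorem powCmd_iterate (hs : Par N n m W K d S R B M B₂ s) (hB : 2 ^ B ≤ N) (hB0 : 0 < B)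
    (h13 : s.var 13 = 1) (h32 : s.var 32 = 0) (j : ℕ) (hj : j ≤ B) :
    Par N n m W K d S R B M B₂ ((powCmd.eval E)^[j] s) ∧
    ((powCmd.eval E)^[j] s).var 32 = j ∧ ((powCmd.eval E)^[j] s).var 18 = s.var 18 ∧
    ((powCmd.eval E)^[j] s).var 13 = 2 ^ min j (s.var 18 / 6 % B) := by
  induction j with
  | zero => exact ⟨hs, h32, rfl, by simpa using h13⟩
  | succ j ih =>
    obtain ⟨hp, g₁, g₂, g₃⟩ := ih (by omega)
    rw [Function.iterate_succ_apply']
    set s' := (powCmd.eval E)^[j] s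
    have hBN : B < N := lt_of_lt_of_le Nat.lt_two_pow_self hB
    have hβ : s.var 18 / 6 % B < B := Nat.mod_lt _ hB0
    by_cases hlt : j < s.var 18 / 6 % B
    · have hpow : 2 * 2 ^ j < N := by
        rw [← pow_succ']
        exact lt_of_lt_of_le (Nat.pow_lt_pow_right (by norm_num) (by omega)) hB
      have he : powCmd.eval E s' = (s'.set 13 (2 ^ (j + 1))).set 32 (j + 1) := by
        have e₁ : (Cmd.ite (.op .lt (.var 32) (.var 18 / 6 % .var 10))
            (.set 13 ((2 * .var 13) % .var 4)) .skip).eval E s' = s'.set 13 (2 ^ (j + 1)) := by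
          rw [eval_ite_pos (by simp [g₁, g₂, hp.h10, hlt]), eval_set]
          simp only [Exp.eval_mod, Exp.eval_mul, Exp.eval_ofNat, Exp.eval_var, g₃, hp.h4,
            min_eq_left hlt.le]
          rw [Nat.mod_eq_of_lt hpow, pow_succ']
        rw [powCmd, eval_seq, e₁, eval_incCmd]
        simp only [Store.set_var, Nat.reduceEqDiff, if_false, g₁, hp.h4]
        rw [Nat.mod_eq_of_lt (by omega)]
      rw [he]
      refine ⟨(hp.set (by norm_num) _).set (by norm_num) _, by simp [Store.set_var],
        by simp [Store.set_var, g₂], ?_⟩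
      simp only [Store.set_var, Nat.reduceEqDiff, if_false, if_true]
      rw [min_eq_left (by omega)]
    · have he : powCmd.eval E s' = s'.set 32 (j + 1) := by
        have e₁ : (Cmd.ite (.op .lt (.var 32) (.var 18 / 6 % .var 10))
            (.set 13 ((2 * .var 13) % .var 4)) .skip).eval E s' = s' := by
          rw [eval_ite_neg (by simpa [g₁, g₂, hp.h10] using hlt)]
          rfl
        rw [powCmd, eval_seq, e₁, eval_incCmd, g₁, hp.h4, Nat.mod_eq_of_lt (by omega)]
      rw [he]
      refine ⟨hp.set (by norm_num) _, by simp [Store.set_var], by simp [Store.set_var, g₂], ?_⟩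
      simp only [Store.set_var, Nat.reduceEqDiff, if_false]
      rw [g₃, min_eq_right (by omega), min_eq_right (by omega)]

/-- The round number is read in mixed radix 3, 2, `B`: the digits are the stopping interval, the
orientation and the bit position, so that `6 * B` consecutive rounds run through all combinations.
-/
theorem eval_setupCmd (hs : Par N n m W K d S R B M B₂ s) (hB : 2 ^ B ≤ N) (hB0 : 0 < B)
    (hB₂ : 2 ^ B₂ ≤ N) :
    Par N n m W K d S R B M B₂ (setupCmd.eval E s) ∧
    Ctx E N n W K d S B (s.var 18 % 3)
      (roundEntry E (2 ^ (s.var 18 / 6 % B)) (s.var 18 / 3 % 2))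
      (roundNext E n m M (2 ^ (s.var 18 / 6 % B)) (s.var 18 / 3 % 2)
        (coinsVal E s.used B₂ % M) (coinsVal E (s.used + B₂) B₂ % M)) (setupCmd.eval E s) ∧
    (setupCmd.eval E s).used = s.used + 2 * B₂ ∧
    (setupCmd.eval E s).var 18 = s.var 18 := by
  set s₁ := (((s.set 15 (s.var 18 % 3)).set 14 (s.var 18 / 3 % 2)).set 13 1).set 32 0 with hs₁
  have hp₁ : Par N n m W K d S R B M B₂ s₁ :=
    (((hs.set (by norm_num) _).set (by norm_num) _).set (by norm_num) _).set (by norm_num) _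
  obtain ⟨hp₂, g₁, g₂, g₃⟩ := powCmd_iterate (E := E) hp₁ hB hB0 (by simp [hs₁, Store.set_var])
    (by simp [hs₁, Store.set_var]) B le_rfl
  have e18 : s₁.var 18 = s.var 18 := by simp [hs₁, Store.set_var]
  have q₁ := (Cmd.rep 10 powCmd).eval_of_quiet (E := E) rfl s₁
  have w₁ := fun v (hv : (Cmd.rep 10 powCmd).writes v = false) =>
    (Cmd.rep 10 powCmd).eval_var_of_not_writes (E := E) hv s₁
  rw [eval_rep_iterate, hp₁.h10] at q₁ w₁
  have hβ : s.var 18 / 6 % B < B := Nat.mod_lt _ hB0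
  rw [e18, min_eq_right hβ.le] at g₃
  rw [e18] at g₂
  set s₂ := (powCmd.eval E)^[B] s₁ with hs₂
  obtain ⟨a₁, a₂, a₃, a₄⟩ := eval_sampleCmd (E := E) s₂ hp₂.h4 (v := 12) (by norm_num)
    (by rw [hp₂.h12]; exact hB₂)
  rw [hp₂.h12] at a₁ a₂
  set s₃ := (sampleCmd 12).eval E s₂ with hs₃
  have hp₃ : Par N n m W K d S R B M B₂ s₃ :=
    hp₂.of_var_eq fun v hv => a₄ v (by omega) (by omega)
  set s₄ := s₃.set 16 (coinsVal E s.used B₂ % M) with hs₄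
  have hp₄ : Par N n m W K d S R B M B₂ s₄ := hp₃.set (by norm_num) _
  obtain ⟨b₁, b₂, b₃, b₄⟩ := eval_sampleCmd (E := E) s₄ hp₄.h4 (v := 12) (by norm_num)
    (by rw [hp₄.h12]; exact hB₂)
  rw [hp₄.h12] at b₁ b₂
  set s₅ := (sampleCmd 12).eval E s₄ with hs₅
  have hp₅ : Par N n m W K d S R B M B₂ s₅ :=
    hp₄.of_var_eq fun v hv => b₄ v (by omega) (by omega)
  have hu₂ : s₂.used = s.used := q₁.2
  have hu₄ : s₄.used = s.used + B₂ := by rw [hs₄, Store.set_used, a₂, hu₂]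
  have he : setupCmd.eval E s = s₅.set 17 (coinsVal E (s.used + B₂) B₂ % M) := by
    have e₁ : (Cmd.set 32 0).eval E ((Cmd.set 13 1).eval E ((Cmd.set 14 (.var 18 / 3 % 2)).eval E
        ((Cmd.set 15 (.var 18 % 3)).eval E s))) = s₁ := by
      simp [eval_set, hs₁, Store.set_var]
    have e₄ : (Cmd.set 16 (.var 23 % .var 11)).eval E s₃ = s₄ := by
      simp only [eval_set, Exp.eval_mod, Exp.eval_var, a₁, hp₃.h11, hs₄, hu₂, coinsVal]
    have e₆ : (Cmd.set 17 (.var 23 % .var 11)).eval E s₅ =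
        s₅.set 17 (coinsVal E (s.used + B₂) B₂ % M) := by
      simp only [eval_set, Exp.eval_mod, Exp.eval_var, b₁, hp₅.h11, hu₄, coinsVal]
    change (Cmd.set 17 (.var 23 % .var 11)).eval E ((sampleCmd 12).eval E
      ((Cmd.set 16 (.var 23 % .var 11)).eval E ((sampleCmd 12).eval E
        ((Cmd.rep 10 powCmd).eval E ((Cmd.set 32 0).eval E ((Cmd.set 13 1).eval E
          ((Cmd.set 14 (.var 18 / 3 % 2)).eval E ((Cmd.set 15 (.var 18 % 3)).eval E s)))))))) = _
    rw [e₁, eval_rep_iterate, hp₁.h10, ← hs₂, ← hs₃, e₄, ← hs₅, e₆]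
  rw [he]
  have hp₆ : Par N n m W K d S R B M B₂ (s₅.set 17 (coinsVal E (s.used + B₂) B₂ % M)) :=
    hp₅.set (by norm_num) _
  have k13 : s₅.var 13 = 2 ^ (s.var 18 / 6 % B) := by
    rw [b₄ 13 (by norm_num) (by norm_num), hs₄, Store.set_var, if_neg (by norm_num),
      a₄ 13 (by norm_num) (by norm_num), g₃]
  have k14 : s₅.var 14 = s.var 18 / 3 % 2 := by
    rw [b₄ 14 (by norm_num) (by norm_num), hs₄, Store.set_var, if_neg (by norm_num),
      a₄ 14 (by norm_num) (by norm_num), w₁ 14 rfl]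
    simp [hs₁, Store.set_var]
  have k15 : s₅.var 15 = s.var 18 % 3 := by
    rw [b₄ 15 (by norm_num) (by norm_num), hs₄, Store.set_var, if_neg (by norm_num),
      a₄ 15 (by norm_num) (by norm_num), w₁ 15 rfl]
    simp [hs₁, Store.set_var]
  have k16 : s₅.var 16 = coinsVal E s.used B₂ % M := by
    rw [b₄ 16 (by norm_num) (by norm_num), hs₄, Store.set_var, if_pos rfl]
  have k18 : s₅.var 18 = s.var 18 := by
    rw [b₄ 18 (by norm_num) (by norm_num), hs₄, Store.set_var, if_neg (by norm_num),
      a₄ 18 (by norm_num) (by norm_num), g₂]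
  have hentry : ∀ u, entry E (s₅.set 17 (coinsVal E (s.used + B₂) B₂ % M)) u =
      roundEntry E (2 ^ (s.var 18 / 6 % B)) (s.var 18 / 3 % 2) u := by
    intro u
    simp [entry, roundEntry, Store.set_var, k13, k14]
  refine ⟨hp₆, ⟨hp₆.h0, hp₆.h2, hp₆.h4, hp₆.h6, hp₆.h7, hp₆.h8, hp₆.h10, ?_, hentry, ?_⟩, ?_, ?_⟩
  · simp [Store.set_var, k15]
  · intro u
    rw [next, hentry, hp₆.h11, hp₆.h0, hp₆.h1]
    simp [roundNext, Store.set_var, k16]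
  · rw [Store.set_used, b₂, hu₄]
    ring
  · simp [Store.set_var, k18]

/-- Round number `it`, with the coins from position `u` on, succeeds. -/
def RoundSuccess (E : Env) (n m W K d S B M B₂ it u : ℕ) : Prop :=
  Success E n W K d S (it % 3) (roundEntry E (2 ^ (it / 6 % B)) (it / 3 % 2))
    (roundNext E n m M (2 ^ (it / 6 % B)) (it / 3 % 2) (coinsVal E u B₂ % M)
      (coinsVal E (u + B₂) B₂ % M)) fun q => startOf E n B (u + 2 * B₂ + q * B)

theorem eval_roundCmd (hs : Par N n m W K d S R B M B₂ s) (hB : 2 ^ B ≤ N) (hB0 : 0 < B)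
    (hB₂ : 2 ^ B₂ ≤ N) (hK : K < N) (hn : 0 < n) (hnN : n < N) (hsound : Sound E n s)
    (hit : s.var 18 + 1 < N) :
    Par N n m W K d S R B M B₂ (roundCmd.eval E s) ∧ Sound E n (roundCmd.eval E s) ∧
    (roundCmd.eval E s).used = s.used + (2 * B₂ + S * B) ∧
    (roundCmd.eval E s).var 18 = s.var 18 + 1 ∧
    (s.var 19 ≠ 0 → (roundCmd.eval E s).var 19 ≠ 0) ∧
    (RoundSuccess E n m W K d S B M B₂ (s.var 18) s.used → (roundCmd.eval E s).var 19 ≠ 0) := by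
  obtain ⟨hp₁, hc₁, hu₁, h18⟩ := eval_setupCmd (E := E) hs hB hB0 hB₂
  obtain ⟨-, hsound₁, -⟩ := (Safe.of_not_writes rfl rfl rfl rfl : Safe E n setupCmd) s hs.h0 hsound
  set s₁ := setupCmd.eval E s with hs₁
  set z := roundEntry E (2 ^ (s.var 18 / 6 % B)) (s.var 18 / 3 % 2)
  set f := roundNext E n m M (2 ^ (s.var 18 / 6 % B)) (s.var 18 / 3 % 2)
        (coinsVal E s.used B₂ % M) (coinsVal E (s.used + B₂) B₂ % M) with hf
  -- The walk function depends on the index only through its entry.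
  have hzf : ∀ u u', z u = z u' → f u = f u' := by
    intro u u' h
    change (E.h (z u) + _) % n = (E.h (z u') + _) % n
    change (E.h (z u) + ((_ * z u + _) % M) / m) % n = (E.h (z u') + ((_ * z u' + _) % M) / m) % n
    rw [h]
  obtain ⟨hc₂, hu₂⟩ := trial_iterate hc₁ hK hn hnN hB hzf S
  have hp₂ : Par N n m W K d S R B M B₂ ((trialCmd.eval E)^[S] s₁) := by
    have := hp₁.eval (E := E) (.rep 8 trialCmd) (by decide)
    rwa [eval_rep_iterate, hp₁.h8] at this
  have h18₂ : ((trialCmd.eval E)^[S] s₁).var 18 = s₁.var 18 := by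
    have := (Cmd.rep 8 trialCmd).eval_var_of_not_writes (E := E) (v := 18) rfl s₁
    rwa [eval_rep_iterate, hp₁.h8] at this
  have he : roundCmd.eval E s = ((trialCmd.eval E)^[S] s₁).set 18 (s.var 18 + 1) := by
    rw [roundCmd, eval_seq, ← hs₁, eval_seq, eval_rep_iterate, hp₁.h8, eval_incCmd, hp₂.h4, h18₂,
      h18, Nat.mod_eq_of_lt hit]
  obtain ⟨-, g₂, g₃⟩ := (safe_roundCmd (E := E)) s hs.h0 hsound
  refine ⟨?_, g₂, ?_, ?_, g₃, ?_⟩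
  · rw [he]
    exact hp₂.set (by norm_num) _
  · rw [he, Store.set_used, hu₂, hu₁]
    ring
  · rw [he, Store.set_var, if_pos rfl]
  · intro hsucc
    rw [he, Store.set_var, if_neg (by norm_num)]
    refine trials_found hc₁ hK hn hnN hB hzf hsound₁ ?_
    rw [hu₁]
    exact hsucc

/-- Every round uses the same number of coins, whatever happens in it. So round `i` reads its coins
from a fixed position, and different rounds use disjoint sets of coins. -/
theorem roundCmd_iterate (hs : Par N n m W K d S R B M B₂ s) (hB : 2 ^ B ≤ N) (hB0 : 0 < B)
    (hB₂ : 2 ^ B₂ ≤ N) (hK : K < N) (hn : 0 < n) (hnN : n < N) (hsound : Sound E n s)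
    (h18 : s.var 18 = 0) (j : ℕ) (hj : j < N) :
    Par N n m W K d S R B M B₂ ((roundCmd.eval E)^[j] s) ∧
    Sound E n ((roundCmd.eval E)^[j] s) ∧
    ((roundCmd.eval E)^[j] s).used = s.used + j * (2 * B₂ + S * B) ∧
    ((roundCmd.eval E)^[j] s).var 18 = j ∧
    (s.var 19 ≠ 0 → ((roundCmd.eval E)^[j] s).var 19 ≠ 0) ∧
    (∀ i < j, RoundSuccess E n m W K d S B M B₂ i (s.used + i * (2 * B₂ + S * B)) →
      ((roundCmd.eval E)^[j] s).var 19 ≠ 0) := by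
  induction j with
  | zero => exact ⟨hs, hsound, by simp, h18, id, by intros; omega⟩
  | succ j ih =>
    obtain ⟨g₁, g₂, g₃, g₄, g₅, g₆⟩ := ih (by omega)
    rw [Function.iterate_succ_apply']
    obtain ⟨k₁, k₂, k₃, k₄, k₅, k₆⟩ := eval_roundCmd g₁ hB hB0 hB₂ hK hn hnN g₂ (by omega)
    refine ⟨k₁, k₂, by rw [k₃, g₃]; ring, by rw [k₄, g₄], fun h => k₅ (g₅ h), fun i hi hsucc => ?_⟩
    rcases Nat.lt_succ_iff_lt_or_eq.1 hi with h | rfl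
    · exact k₅ (g₆ i h hsucc)
    · exact k₆ (by rw [g₄, g₃]; exact hsucc)

/-- A solution with two equal indices is invisible to the walks, because no bit separates an index
from itself. It is found by exhaustive search. -/
theorem diag_iterate (hs : Par N n m W K d S R B M B₂ s) (hsound : Sound E n s)
    (h32 : s.var 32 = 0) (j : ℕ) (hj : j < N) :
    Par N n m W K d S R B M B₂ (((Cmd.seq (checkCmd 32 32) (incCmd 32)).eval E)^[j] s) ∧
    Sound E n (((Cmd.seq (checkCmd 32 32) (incCmd 32)).eval E)^[j] s) ∧
    (((Cmd.seq (checkCmd 32 32) (incCmd 32)).eval E)^[j] s).var 32 = j ∧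
    ((∃ i < j, i < n ∧ E.x i = E.y i) →
      (((Cmd.seq (checkCmd 32 32) (incCmd 32)).eval E)^[j] s).var 19 ≠ 0) := by
  induction j with
  | zero => exact ⟨hs, hsound, h32, by rintro ⟨i, hi, -⟩; omega⟩
  | succ j ih =>
    obtain ⟨g₁, g₂, g₃, g₄⟩ := ih (by omega)
    rw [Function.iterate_succ_apply']
    set s' := ((Cmd.seq (checkCmd 32 32) (incCmd 32)).eval E)^[j] s
    have h32' : ((checkCmd 32 32).eval E s').var 32 = j := by
      rw [Cmd.eval_var_of_not_writes _ rfl, g₃]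
    have h4' : ((checkCmd 32 32).eval E s').var 4 = N := by
      rw [Cmd.eval_var_of_not_writes _ rfl, g₁.h4]
    obtain ⟨-, k₁, k₂⟩ := safe_checkCmd (E := E) (n := n) (u := 32) (v := 32) (by norm_num) s' g₁.h0
      g₂
    obtain ⟨-, k₃, -⟩ := ((safe_checkCmd (by norm_num)).seq (.of_not_writes rfl rfl rfl rfl) :
      Safe E n (.seq (checkCmd 32 32) (incCmd 32))) s' g₁.h0 g₂
    refine ⟨g₁.eval _ (by decide), k₃, ?_, ?_⟩
    · rw [eval_seq, eval_incCmd, Store.set_var, if_pos rfl, h32', h4', Nat.mod_eq_of_lt hj]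
    · rintro ⟨i, hi, hin, hxy⟩
      rw [eval_seq, eval_incCmd, Store.set_var, if_neg (by norm_num)]
      rcases Nat.lt_succ_iff_lt_or_eq.1 hi with h | rfl
      · exact k₂ (g₄ ⟨i, h, hin, hxy⟩)
      · exact checkCmd_found g₁.h0 (by rwa [g₃]) (by rwa [g₃]) (by rwa [g₃])

/-- What the main part of the program finds. -/
theorem eval_mainCmd (hs : Par N n m W K d S R B M B₂ s) (hB : 2 ^ B ≤ N) (hB0 : 0 < B)
    (hB₂ : 2 ^ B₂ ≤ N) (hK : K < N) (hn : 0 < n) (hnN : n < N) (hRN : R < N)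
    (h19 : s.var 19 = 0) :
    Sound E n (mainCmd.eval E s) ∧
    ((∃ i < n, E.x i = E.y i) → (mainCmd.eval E s).var 19 ≠ 0) ∧
    (∀ i < R, RoundSuccess E n m W K d S B M B₂ i (s.used + i * (2 * B₂ + S * B)) →
      (mainCmd.eval E s).var 19 ≠ 0) := by
  have hsound : Sound E n s := fun h => absurd h19 h
  have hp₁ : Par N n m W K d S R B M B₂ (s.set 32 0) := hs.set (by norm_num) _
  obtain ⟨g₁, g₂, g₃, g₄⟩ := diag_iterate (E := E) hp₁
    (by simpa [Sound, Store.set_var] using hsound) (by simp [Store.set_var]) n hnN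
  have hq : (((Cmd.seq (checkCmd 32 32) (incCmd 32)).eval E)^[n] (s.set 32 0)).used = s.used := by
    have := (Cmd.rep 0 (.seq (checkCmd 32 32) (incCmd 32))).eval_of_quiet (E := E) rfl (s.set 32 0)
    rw [eval_rep_iterate, hp₁.h0] at this
    exact this.2
  set s₂ := ((Cmd.seq (checkCmd 32 32) (incCmd 32)).eval E)^[n] (s.set 32 0) with hs₂
  obtain ⟨k₁, k₂, k₃, k₄, k₅, k₆⟩ := roundCmd_iterate (E := E) (s := s₂.set 18 0)
    (g₁.set (by norm_num) _) hB hB0 hB₂ hK hn hnN (by simpa [Sound, Store.set_var] using g₂)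
    (by simp [Store.set_var]) R hRN
  have he : mainCmd.eval E s = (roundCmd.eval E)^[R] (s₂.set 18 0) := by
    have e₁ : diagCmd.eval E s = s₂ := by
      rw [diagCmd, eval_seq, eval_rep_iterate]
      change (_)^[(s.set 32 0).var 0] (s.set 32 0) = s₂
      rw [hp₁.h0]
    have e₂ : (Cmd.set 18 0).eval E s₂ = s₂.set 18 0 := rfl
    rw [mainCmd, eval_seq, e₁, eval_seq, e₂, eval_rep_iterate, (g₁.set (by norm_num) _).h9]
  rw [he]
  refine ⟨k₂, ?_, ?_⟩
  · rintro ⟨i, hi, hxy⟩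
    exact k₅ (by rw [Store.set_var, if_neg (by norm_num)]; exact g₄ ⟨i, hi, hi, hxy⟩)
  · intro i hi hsucc
    refine k₆ i hi ?_
    rw [Store.set_used, hq]
    exact hsucc

/-- The choice of `τ`. -/
structure IsTau (n s p τ : ℕ) : Prop where
  pos : 1 ≤ τ
  upper : n * n < 64 * 64 * τ * τ * s * p
  lower : τ = 1 ∨ 64 * 64 * (τ - 1) * (τ - 1) * s * p ≤ n * n

theorem IsTau.le {n s p τ : ℕ} (h : IsTau n s p τ) (hs : 0 < s) (hp : 0 < p) (hn : 0 < n) :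
    τ ≤ n := by
  rcases h.lower with h1 | h1
  · omega
  · by_contra hlt
    have h2 : n ≤ τ - 1 := by omega
    have h3 : n * n ≤ (τ - 1) * (τ - 1) := Nat.mul_le_mul h2 h2
    have h4 : 1 ≤ s * p := Nat.mul_pos hs hp
    have h5 : 0 < n * n := Nat.mul_pos hn hn
    have h6 : 64 * 64 * (τ - 1) * (τ - 1) * s * p = 64 * 64 * ((τ - 1) * (τ - 1)) * (s * p) := by
      ring
    have h7 : (τ - 1) * (τ - 1) ≤ (τ - 1) * (τ - 1) * (s * p) := Nat.le_mul_of_pos_right _ h4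
    nlinarith

/-- Linear search in a loop of fixed length: the candidate grows only while the inequality fails,
and the later iterations are idle. The last clause says that the candidate has either succeeded or
grown in every iteration. -/
theorem tau_iterate {p : ℕ} (h0 : s.var 0 = n) (h2 : s.var 2 = W) (h3 : s.var 3 = p)
    (h4 : s.var 4 = N) (h5 : s.var 5 = 1) (j : ℕ) (hj : j + 1 < N) :
    ∃ τ, (((Cmd.ite (.op .lt (.var 0 * .var 0) (64 * 64 * .var 5 * .var 5 * .var 2 * .var 3)) .skip
      (incCmd 5)).eval E)^[j] s) = s.set 5 τ ∧ 1 ≤ τ ∧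
      (τ = 1 ∨ 64 * 64 * (τ - 1) * (τ - 1) * W * p ≤ n * n) ∧
      (n * n < 64 * 64 * τ * τ * W * p ∨ τ = 1 + j) := by
  induction j with
  | zero =>
    refine ⟨1, ?_, le_rfl, .inl rfl, .inr rfl⟩
    simp [Store.set, ← h5]
  | succ j ih =>
    obtain ⟨τ, he, g₁, g₂, g₃⟩ := ih (by omega)
    rw [Function.iterate_succ_apply', he]
    by_cases hlt : n * n < 64 * 64 * τ * τ * W * p
    · refine ⟨τ, ?_, g₁, g₂, .inl hlt⟩
      rw [eval_ite_pos (by simp [Store.set_var, h0, h2, h3, hlt])]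
      rfl
    · obtain rfl : τ = 1 + j := g₃.resolve_left hlt
      refine ⟨1 + j + 1, ?_, by omega, .inr ?_, .inr (by omega)⟩
      · rw [eval_ite_neg (by simpa [Store.set_var, h0, h2, h3] using hlt), eval_incCmd]
        simp only [Store.set_var, Nat.reduceEqDiff, if_true, if_false, h4]
        rw [Nat.mod_eq_of_lt (by omega)]
        simp [Store.set]
      · rw [Nat.add_sub_cancel]
        exact not_lt.1 hlt

/-- The parameters. -/
theorem eval_initCmd {p : ℕ} (h0 : s.var 0 = n) (h1 : s.var 1 = m) (h2 : s.var 2 = W)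
    (h3 : s.var 3 = p) (h4 : s.var 4 = N) (h19 : s.var 19 = 0) (hN : N = 100 * n * n * n * n * m)
    (hn : 2 ≤ n) (hm : 0 < m) (hW : 0 < W) (hp : 0 < p) (hWn : W ≤ n) :
    (initCmd.eval E s).used = s.used ∧ (initCmd.eval E s).var 19 = 0 ∧
    ∃ τ, IsTau n W p τ ∧ Par N n m W (2 * τ) (n / (16 * τ) + 1) (W / 64 + 2)
      (6 * n.size * (n * n / ((W * τ) * (W * τ)) + 1)) n.size (n * m) (n * m).size
      (initCmd.eval E s) := by
  have hn4 : 100 * n * n * n * n * m = 100 * (n * n * n) * (n * m) := by ring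
  have hnm : n ≤ n * m := Nat.le_mul_of_pos_right n hm
  have hn3 : 8 ≤ n * n * n := by nlinarith [Nat.mul_le_mul hn hn]
  have hbig : 800 * (n * m) ≤ N := by rw [hN, hn4]; nlinarith
  have hbig' : 100 * (n * n * n) * n ≤ N := by rw [hN, hn4]; exact Nat.mul_le_mul_left _ hnm
  refine ⟨(initCmd.eval_of_quiet rfl s).2, by rw [Cmd.eval_var_of_not_writes _ rfl, h19], ?_⟩
  obtain ⟨τ, he, g₁, g₂, g₃⟩ := tau_iterate (E := E) (s := s.set 5 1) (n := n) (W := W) (p := p)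
    (N := N) (by simpa [Store.set_var] using h0) (by simpa [Store.set_var] using h2)
    (by simpa [Store.set_var] using h3) (by simpa [Store.set_var] using h4)
    (by simp [Store.set_var]) n (by omega)
  have hτ : IsTau n W p τ := by
    refine ⟨g₁, g₃.resolve_right ?_, g₂⟩
    -- If the search had failed in all `n` iterations, then the last rejected candidate `n` would
    -- give `64 * 64 * (n * n) * (W * p) ≤ n * n`.
    rintro rfl
    have h6 : 64 * 64 * (1 + n - 1) * (1 + n - 1) * W * p = 64 * 64 * (n * n) * (W * p) := by
      rw [Nat.add_sub_cancel_left]; ring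
    rcases g₂ with h | h
    · omega
    · rw [h6] at h
      have h4 : 1 ≤ W * p := Nat.mul_pos hW hp
      have h5 : 0 < n * n := by positivity
      nlinarith
  have hτn := hτ.le hW hp (by omega)
  refine ⟨τ, hτ, ?_⟩
  have hd : n / (16 * τ) ≤ n := Nat.div_le_self _ _
  have hB : n.size ≤ n := Nat.size_le.2 Nat.lt_two_pow_self
  have hq : n * n / ((W * τ) * (W * τ)) ≤ n * n := Nat.div_le_self _ _
  have hR : 6 * n.size * (n * n / ((W * τ) * (W * τ)) + 1) < N := by
    calc 6 * n.size * (n * n / ((W * τ) * (W * τ)) + 1) ≤ 6 * n * (n * n + 1) :=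
          Nat.mul_le_mul (by omega) (by omega)
      _ < 100 * (n * n * n) * n := by nlinarith
      _ ≤ N := hbig'
  set R := 6 * n.size * (n * n / ((W * τ) * (W * τ)) + 1) with hRdef
  have hfin : initCmd.eval E s =
      ((((((((s.set 5 τ).set 6 (2 * τ)).set 7 (n / (16 * τ) + 1)).set 8 (W / 64 + 2)).set 10
        n.size).set 11 (n * m)).set 12 (n * m).size).set 9 R) := by
    have e₁ : (Cmd.rep 0 (.ite (.op .lt (.var 0 * .var 0)
        (64 * 64 * .var 5 * .var 5 * .var 2 * .var 3)) .skip (incCmd 5))).eval E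
          ((Cmd.set 5 1).eval E s) = s.set 5 τ := by
      have hv : ((Cmd.set 5 1).eval E s) = s.set 5 1 := rfl
      rw [hv, eval_rep_iterate, Store.set_var, if_neg (by norm_num), h0, he]
      simp [Store.set]
    have m₁ : (2 * τ) % N = 2 * τ := Nat.mod_eq_of_lt (by omega)
    have m₂ : (n / (16 * τ) + 1) % N = n / (16 * τ) + 1 := Nat.mod_eq_of_lt (by omega)
    have m₃ : (W / 64 + 2) % N = W / 64 + 2 := Nat.mod_eq_of_lt (by omega)
    have m₄ : (n * m) % N = n * m := Nat.mod_eq_of_lt (by omega)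
    have m₅ : R % N = R := Nat.mod_eq_of_lt hR
    rw [initCmd, eval_seq, eval_seq, e₁]
    simp only [Cmd.eval, Store.set_var, Exp.eval_add, Exp.eval_mul,
      Exp.eval_div, Exp.eval_mod, Exp.eval_var, Exp.eval_ofNat, Nat.reduceEqDiff, if_true, if_false,
      h0, h1, h2, h4, m₁, m₂, m₃, m₄, m₅, ← hRdef]
  rw [hfin]
  constructor <;> simp [Store.set_var, h0, h1, h2, h4]

end

end ListDisjointness

/-! # Walks in random functional graphs -/

namespace ListDisjointness

open Finset Function
open scoped BigOperators

/-- The indicator of a proposition. -/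
noncomputable def ind (p : Prop) : ℝ := open Classical in if p then 1 else 0

section ind

variable {p q : Prop}

theorem ind_of (h : p) : ind p = 1 := if_pos h

theorem ind_of_not (h : ¬ p) : ind p = 0 := if_neg h

theorem ind_nonneg (p : Prop) : 0 ≤ ind p := by
  unfold ind
  split_ifs <;> norm_num

theorem ind_le_one (p : Prop) : ind p ≤ 1 := by
  unfold ind
  split_ifs <;> norm_num

theorem ind_mono (h : p → q) : ind p ≤ ind q := by
  by_cases hp : p
  · rw [ind_of hp, ind_of (h hp)]
  · rw [ind_of_not hp]
    exact ind_nonneg q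

theorem ind_congr (h : p ↔ q) : ind p = ind q := by rw [propext h]

theorem ind_and (p q : Prop) : ind (p ∧ q) = ind p * ind q := by
  by_cases hp : p <;> by_cases hq : q <;> simp [ind, hp, hq]

theorem of_ind_ne_zero (h : ind p ≠ 0) : p := by
  by_contra hp
  exact h (ind_of_not hp)

theorem ind_or_le (p q : Prop) : ind (p ∨ q) ≤ ind p + ind q := by
  by_cases hp : p <;> by_cases hq : q <;> simp [ind, hp, hq]

theorem ind_exists_le {ι : Type*} (s : Finset ι) (p : ι → Prop) :
    ind (∃ i ∈ s, p i) ≤ ∑ i ∈ s, ind (p i) := by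
  by_cases h : ∃ i ∈ s, p i
  · obtain ⟨i, hi, hp⟩ := h
    calc ind _ ≤ 1 := ind_le_one _
      _ = ind (p i) := (ind_of hp).symm
      _ ≤ _ := Finset.single_le_sum (f := fun i => ind (p i)) (fun i _ => ind_nonneg _) hi
  · rw [ind_of_not h]
    exact Finset.sum_nonneg fun i _ => ind_nonneg _

/-- At most one summand is nonzero. In this way the probabilities of mutually exclusive patterns are
added up to a lower bound. -/
theorem sum_ind_le {ι : Type*} (s : Finset ι) (p : ι → Prop) (q : Prop)
    (h : ∀ i ∈ s, p i → q) (huniq : ∀ i ∈ s, ∀ j ∈ s, p i → p j → i = j) :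
    ∑ i ∈ s, ind (p i) ≤ ind q := by
  by_cases hex : ∃ i ∈ s, p i
  · obtain ⟨i, hi, hp⟩ := hex
    rw [Finset.sum_eq_single_of_mem i hi fun j hj hne => ind_of_not fun hpj =>
      hne (huniq j hj i hi hpj hp)]
    exact ind_mono (h i hi)
  · rw [Finset.sum_eq_zero fun i hi => ind_of_not fun hp => hex ⟨i, hi, hp⟩]
    exact ind_nonneg q

theorem sum_ind_eq_card {ι : Type*} (s : Finset ι) (p : ι → Prop) [DecidablePred p] :
    ∑ i ∈ s, ind (p i) = (s.filter p).card := by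
  rw [Finset.card_filter, Nat.cast_sum]
  refine Finset.sum_congr rfl fun i _ => ?_
  by_cases h : p i <;> simp [ind, h]

end ind

section expect

theorem expect_nonneg' {ι : Type*} [Fintype ι] {f : ι → ℝ} (h : ∀ i, 0 ≤ f i) : 0 ≤ 𝔼 i, f i :=
  Finset.expect_nonneg fun i _ => h i

theorem expect_mono' {ι : Type*} [Fintype ι] {f g : ι → ℝ} (h : ∀ i, f i ≤ g i) :
    𝔼 i, f i ≤ 𝔼 i, g i := Finset.expect_le_expect fun i _ => h i

theorem expect_ind_mem {V : Type*} [Fintype V] (T : Finset V) :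
    𝔼 u : V, ind (u ∈ T) = T.card / Fintype.card V := by
  classical
  rw [Fintype.expect_eq_sum_div_card, sum_ind_eq_card, Finset.filter_mem_eq_inter,
    Finset.univ_inter]

theorem expect_ind_eq {V : Type*} [Fintype V] (v : V) :
    𝔼 u : V, ind (u = v) = 1 / Fintype.card V := by
  have := expect_ind_mem ({v} : Finset V)
  simpa using this

end expect

section resample

variable {A V : Type*} [Fintype A] [DecidableEq A] [Fintype V] [Nonempty V]

/-- The value of a random function at a point that may depend on the function, but not on its value
at this point, is uniformly random. -/
theorem expect_resample (Φ : (A → V) → ℝ) (Q : (A → V) → A)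
    (h : ∀ g u, Φ g ≠ 0 → Q (update g (Q g) u) = Q g ∧ Φ (update g (Q g) u) = Φ g)
    (ψ : A → V → ℝ) :
    𝔼 g, Φ g * ψ (Q g) (g (Q g)) = 𝔼 g, Φ g * 𝔼 u, ψ (Q g) u := by
  classical
  have key : ∑ x : (A → V) × V, Φ x.1 * ψ (Q x.1) (x.1 (Q x.1)) =
      ∑ x : (A → V) × V, Φ x.1 * ψ (Q x.1) x.2 := by
    -- The value of `g` at `Q g` and the independent value `u` are exchanged. Where `Φ` does not
    -- vanish, neither `Q` nor `Φ` notices the exchange, so it is an involution that turns one sum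
    -- into the other.
    refine Finset.sum_bij_ne_zero (fun x _ _ => (update x.1 (Q x.1) x.2, x.1 (Q x.1)))
      (fun _ _ _ => Finset.mem_univ _) ?_ ?_ ?_
    · rintro ⟨g, u⟩ - hg ⟨g', u'⟩ - hg' heq
      have hΦ := left_ne_zero_of_mul hg
      have hΦ' := left_ne_zero_of_mul hg'
      simp only [Prod.mk.injEq] at heq ⊢
      obtain ⟨e₁, e₂⟩ := heq
      have q₁ := (h g u hΦ).1
      have q₂ := (h g' u' hΦ').1
      have hQ : Q g = Q g' := by rw [← q₁, ← q₂, e₁]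
      have hu : u = u' := by
        have := congrFun e₁ (Q g)
        rwa [update_self, hQ, update_self] at this
      refine ⟨?_, hu⟩
      have e₃ := congrArg (fun k => update k (Q g) (g (Q g))) e₁
      simp only [update_idem, update_eq_self] at e₃
      rw [e₂, hQ, update_idem, update_eq_self] at e₃
      exact e₃
    · rintro ⟨g, u⟩ - hg
      have hΦ := left_ne_zero_of_mul hg
      obtain ⟨q₁, q₂⟩ := h g (u) hΦ
      have hne : Φ (update g (Q g) u) * ψ (Q (update g (Q g) u))
          ((update g (Q g) u) (Q (update g (Q g) u))) ≠ 0 := by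
        rw [q₁, q₂, update_self]
        exact hg
      refine ⟨(update g (Q g) u, g (Q g)), Finset.mem_univ _, hne, ?_⟩
      simp only [q₁, update_idem, update_eq_self, update_self]
    · rintro ⟨g, u⟩ - hg
      have hΦ := left_ne_zero_of_mul hg
      obtain ⟨q₁, q₂⟩ := h g u hΦ
      simp only [q₁, q₂]
  have h₁ : 𝔼 x : (A → V) × V, Φ x.1 * ψ (Q x.1) (x.1 (Q x.1)) =
      𝔼 x : (A → V) × V, Φ x.1 * ψ (Q x.1) x.2 := by
    rw [Fintype.expect_eq_sum_div_card, Fintype.expect_eq_sum_div_card, key]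
  have h₂ := Finset.expect_product' (s := (Finset.univ : Finset (A → V)))
    (t := (Finset.univ : Finset V)) (f := fun g _ => Φ g * ψ (Q g) (g (Q g)))
  have h₃ := Finset.expect_product' (s := (Finset.univ : Finset (A → V)))
    (t := (Finset.univ : Finset V)) (f := fun g u => Φ g * ψ (Q g) u)
  rw [Finset.univ_product_univ] at h₂ h₃
  rw [h₂, h₃] at h₁
  simpa only [Fintype.expect_const, ← Finset.mul_expect] using h₁

theorem expect_resample_le (Φ : (A → V) → ℝ) (hΦ : ∀ g, 0 ≤ Φ g) (Q : (A → V) → A)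
    (h : ∀ g u, Φ g ≠ 0 → Q (update g (Q g) u) = Q g ∧ Φ (update g (Q g) u) = Φ g)
    (ψ : A → V → ℝ) {c : ℝ} (hψ : ∀ a, 𝔼 u, ψ a u ≤ c) :
    𝔼 g, Φ g * ψ (Q g) (g (Q g)) ≤ c * 𝔼 g, Φ g := by
  rw [expect_resample Φ Q h ψ, Finset.mul_expect]
  refine expect_mono' fun g => ?_
  rw [mul_comm]
  exact mul_le_mul_of_nonneg_right (hψ _) (hΦ g)

/-- The coordinate `a` is independent of everything that does not depend on it. -/
theorem expect_coord (Φ : (A → V) → ℝ) (a : A) (h : ∀ g u, Φ (update g a u) = Φ g)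
    (ψ : V → ℝ) : 𝔼 g, Φ g * ψ (g a) = (𝔼 g, Φ g) * 𝔼 u, ψ u := by
  rw [expect_resample Φ (fun _ => a) (fun g u _ => ⟨rfl, h g u⟩) fun _ => ψ, Finset.expect_mul]

theorem expect_apply (a : A) (ψ : V → ℝ) : 𝔼 g : A → V, ψ (g a) = 𝔼 u, ψ u := by
  have := expect_coord (fun _ => 1) a (fun _ _ => rfl) ψ
  simpa using this

theorem expect_apply₂ {a b : A} (hab : a ≠ b) (ψ φ : V → ℝ) :
    𝔼 g : A → V, ψ (g a) * φ (g b) = (𝔼 u, ψ u) * 𝔼 u, φ u := by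
  rw [expect_coord (fun g => ψ (g a)) b (fun g u => by rw [update_of_ne hab]) φ, expect_apply]

theorem expect_apply₃ {a b c : A} (hab : a ≠ b) (hac : a ≠ c) (hbc : b ≠ c) (ψ φ χ : V → ℝ) :
    𝔼 g : A → V, ψ (g a) * φ (g b) * χ (g c) = (𝔼 u, ψ u) * (𝔼 u, φ u) * 𝔼 u, χ u := by
  rw [expect_coord (fun g => ψ (g a) * φ (g b)) c
    (fun g u => by rw [update_of_ne hac, update_of_ne hbc]) χ, expect_apply₂ hab]

/-- The probability that a random function has prescribed values at distinct points. -/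
theorem expect_ind_forall {O : Type*} [Fintype O] (κ : O → A) (hκ : Injective κ) (val : O → V) :
    𝔼 g : A → V, ind (∀ o, g (κ o) = val o) = (1 / Fintype.card V : ℝ) ^ Fintype.card O := by
  classical
  have key : ∀ s : Finset O, 𝔼 g : A → V, ind (∀ o ∈ s, g (κ o) = val o) =
      (1 / Fintype.card V : ℝ) ^ s.card := by
    intro s
    induction s using Finset.induction_on with
    | empty => simp [ind]
    | insert o s ho ih =>
      have e : ∀ g : A → V, ind (∀ o' ∈ insert o s, g (κ o') = val o') =
          ind (∀ o' ∈ s, g (κ o') = val o') * ind (g (κ o) = val o) := by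
        intro g
        rw [← ind_and]
        exact ind_congr (by rw [Finset.forall_mem_insert, and_comm])
      simp only [e]
      rw [expect_coord (fun g : A → V => ind (∀ o' ∈ s, g (κ o') = val o')) (κ o) _
        fun u => ind (u = val o), ih, expect_ind_eq, Finset.card_insert_of_notMem ho, pow_succ]
      intro g u
      refine ind_congr (forall₂_congr fun o' ho' => ?_)
      rw [update_of_ne]
      intro h
      exact ho (hκ h ▸ ho')
  have := key Finset.univ
  simpa using this

end resample

section walk

variable {A V : Type*} {z : V → A}

/-- Changing the values of `g` at a point that the walk has not used does not change the walk. -/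
theorem iterate_update [DecidableEq A] (g : A → V) (q : A) (u : V) (v : V) (l : ℕ)
    (h : ∀ x < l, z ((g ∘ z)^[x] v) ≠ q) : ∀ x ≤ l, (update g q u ∘ z)^[x] v = (g ∘ z)^[x] v := by
  intro x
  induction x with
  | zero => intro _; rfl
  | succ x ih =>
    intro hx
    rw [iterate_succ_apply', iterate_succ_apply', ih (by omega), comp_apply, comp_apply,
      update_of_ne (h x (by omega))]

/-- The walk reaches its `l`-th position without seeing a value in `Z` or a value twice. -/
def FreshUntil (z : V → A) (g : A → V) (Z : Set A) (v : V) (l : ℕ) : Prop :=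
  (∀ x < l, z ((g ∘ z)^[x] v) ∉ Z) ∧ ∀ x < l, ∀ y < l, z ((g ∘ z)^[x] v) = z ((g ∘ z)^[y] v) → x = y

/-- The first visit of a set that contains everything with values in `Z`. -/
theorem exists_freshUntil (g : A → V) (Z : Set A) (C : Set V) (hC : ∀ v, z v ∈ Z → v ∈ C) (v : V)
    {l₀ : ℕ} (h : (g ∘ z)^[l₀] v ∈ C) : ∃ l ≤ l₀, FreshUntil z g Z v l ∧ (g ∘ z)^[l] v ∈ C := by
  classical
  have hex : ∃ l, (g ∘ z)^[l] v ∈ C := ⟨l₀, h⟩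
  refine ⟨Nat.find hex, Nat.find_min' hex h, ⟨fun x hx hZ => ?_, ?_⟩, Nat.find_spec hex⟩
  · exact Nat.find_min hex hx (hC _ hZ)
  · have aux : ∀ x y, x < y → y < Nat.find hex →
        z ((g ∘ z)^[x] v) ≠ z ((g ∘ z)^[y] v) := by
      intro x y hxy hy heq
      have h₁ : (g ∘ z)^[x + 1] v = (g ∘ z)^[y + 1] v := by
        rw [iterate_succ_apply', iterate_succ_apply', comp_apply, comp_apply, heq]
      have h₂ : (g ∘ z)^[(Nat.find hex - (y + 1)) + (x + 1)] v ∈ C := by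
        rw [iterate_add_apply, h₁, ← iterate_add_apply]
        rw [Nat.sub_add_cancel (by omega)]
        exact Nat.find_spec hex
      exact Nat.find_min hex (by omega) h₂
    intro x hx y hy heq
    rcases lt_trichotomy x y with hlt | h | hlt
    · exact absurd heq (aux x y hlt hy)
    · exact h
    · exact absurd heq.symm (aux y x hlt hx)

/-- The probability that a walk enters `T` fresh. -/
theorem expect_freshUntil_le [Fintype A] [DecidableEq A] [Fintype V] [Nonempty V]
    (Φ : (A → V) → ℝ) (hΦ : ∀ g, 0 ≤ Φ g) (Z : Set A)
    (hZ : ∀ g q u, q ∉ Z → Φ (update g q u) = Φ g) (T : Finset V) (v : V) (l : ℕ) :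
    𝔼 g, Φ g * ind (FreshUntil z g Z v (l + 1) ∧ (g ∘ z)^[l + 1] v ∈ T) ≤
      T.card / Fintype.card V * 𝔼 g, Φ g := by
  set Φ' : (A → V) → ℝ := fun g => Φ g * ind (FreshUntil z g Z v (l + 1)) with hΦ'
  have h₁ : ∀ g, Φ g * ind (FreshUntil z g Z v (l + 1) ∧ (g ∘ z)^[l + 1] v ∈ T) =
      Φ' g * (fun _ u => ind (u ∈ T)) (z ((g ∘ z)^[l] v)) (g (z ((g ∘ z)^[l] v))) := by
    intro g
    rw [ind_and, iterate_succ_apply', ← mul_assoc]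
    rfl
  simp only [h₁]
  calc 𝔼 g, Φ' g * (fun _ u => ind (u ∈ T)) (z ((g ∘ z)^[l] v)) (g (z ((g ∘ z)^[l] v)))
      ≤ T.card / Fintype.card V * 𝔼 g, Φ' g := by
        -- The last query is outside `Z` and different from all earlier ones. Hence its answer may
        -- be resampled without changing `Φ` or the walk up to this query.
        refine expect_resample_le Φ' (fun g => mul_nonneg (hΦ g) (ind_nonneg _))
          (fun g => z ((g ∘ z)^[l] v)) ?_ (fun _ u => ind (u ∈ T)) fun a => (expect_ind_mem T).le
        intro g u hne
        have hf := of_ind_ne_zero (right_ne_zero_of_mul hne)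
        have hit := iterate_update (z := z) g (z ((g ∘ z)^[l] v)) u v l fun x hx heq =>
          absurd (hf.2 x (by omega) l (by omega) heq) (by omega)
        refine ⟨by rw [hit l le_rfl], ?_⟩
        have hf' : FreshUntil z (update g (z ((g ∘ z)^[l] v)) u) Z v (l + 1) := by
          refine ⟨fun x hx => ?_, fun x hx y hy => ?_⟩
          · rw [hit x (by omega)]
            exact hf.1 x hx
          · rw [hit x (by omega), hit y (by omega)]
            exact hf.2 x hx y hy
        simp only [hΦ']
        rw [ind_of hf, ind_of hf', hZ g _ u (hf.1 l (by omega))]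
    _ ≤ T.card / Fintype.card V * 𝔼 g, Φ g := by
        refine mul_le_mul_of_nonneg_left (expect_mono' fun g => ?_) (by positivity)
        exact mul_le_of_le_one_right (hΦ g) (ind_le_one _)

end walk

end ListDisjointness

/-! # The success probability of a single run -/

namespace ListDisjointness

open Finset Function
open scoped BigOperators

section hitting

theorem expect_start_mem_le {V C : Type*} [Fintype V] [Fintype C] {st : C → V} (hup : ∀ v, 𝔼 σ, ind (st σ = v) ≤ 2 / Fintype.card V)
    (T : Finset V) : 𝔼 σ, ind (st σ ∈ T) ≤ 2 * T.card / Fintype.card V := by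
  calc 𝔼 σ, ind (st σ ∈ T) ≤ 𝔼 σ, ∑ v ∈ T, ind (st σ = v) := by
        refine expect_mono' fun σ => ?_
        refine le_trans (ind_mono fun h => ?_) (ind_exists_le T fun v => st σ = v)
        exact ⟨st σ, h, rfl⟩
    _ = ∑ v ∈ T, 𝔼 σ, ind (st σ = v) := Finset.expect_sum_comm _ _ _
    _ ≤ ∑ _v ∈ T, (2 / Fintype.card V : ℝ) := Finset.sum_le_sum fun v _ => hup v
    _ = 2 * T.card / Fintype.card V := by
        rw [Finset.sum_const, nsmul_eq_mul]
        ring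

variable {A V C : Type*} [Fintype A] [DecidableEq A] [Fintype V] [Nonempty V]
  [Fintype C] {z : V → A} {st : C → V}

/-- The probability that a walk from a random start enters `T` fresh within `K` steps. -/
theorem expect_hit_le (hup : ∀ v, 𝔼 σ, ind (st σ = v) ≤ 2 / Fintype.card V)
    (Φ : (A → V) → ℝ) (hΦ : ∀ g, 0 ≤ Φ g) (Z : Set A)
    (hZ : ∀ g q u, q ∉ Z → Φ (update g q u) = Φ g) (T : Finset V) (K : ℕ)
    (Bad : (A → V) → V → Prop)
    (hBad : ∀ g v, Φ g ≠ 0 → Bad g v → ∃ l ≤ K, FreshUntil z g Z v l ∧ (g ∘ z)^[l] v ∈ T) :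
    𝔼 g, Φ g * 𝔼 σ, ind (Bad g (st σ)) ≤ (K + 2) * T.card / Fintype.card V * 𝔼 g, Φ g := by
  have h₁ : ∀ g, Φ g * 𝔼 σ, ind (Bad g (st σ)) ≤ Φ g * 𝔼 σ, ind (st σ ∈ T) +
      𝔼 σ, ∑ l ∈ range K, Φ g * ind (FreshUntil z g Z (st σ) (l + 1) ∧
        (g ∘ z)^[l + 1] (st σ) ∈ T) := by
    intro g
    rw [Finset.mul_expect, Finset.mul_expect, ← Finset.expect_add_distrib]
    refine expect_mono' fun σ => ?_
    rw [← Finset.mul_sum, ← mul_add]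
    by_cases h0 : Φ g = 0
    · simp [h0]
    refine mul_le_mul_of_nonneg_left ?_ (hΦ g)
    refine le_trans (ind_mono (q := st σ ∈ T ∨ ∃ l ∈ range K,
      (FreshUntil z g Z (st σ) (l + 1) ∧ (g ∘ z)^[l + 1] (st σ) ∈ T)) fun hb => ?_)
      ((ind_or_le _ _).trans (add_le_add le_rfl (ind_exists_le _ _)))
    obtain ⟨l, hl, hf, hT⟩ := hBad g _ h0 hb
    cases l with
    | zero => exact Or.inl hT
    | succ l => exact Or.inr ⟨l, Finset.mem_range.2 (by omega), hf, hT⟩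
  have hP : 0 ≤ 𝔼 g, Φ g := expect_nonneg' hΦ
  calc 𝔼 g, Φ g * 𝔼 σ, ind (Bad g (st σ))
      ≤ 𝔼 g, (Φ g * 𝔼 σ, ind (st σ ∈ T) +
      𝔼 σ, ∑ l ∈ range K, Φ g * ind (FreshUntil z g Z (st σ) (l + 1) ∧
        (g ∘ z)^[l + 1] (st σ) ∈ T)) := expect_mono' h₁
    _ = (𝔼 g, Φ g) * (𝔼 σ, ind (st σ ∈ T)) + 𝔼 σ, ∑ l ∈ range K, 𝔼 g, Φ g *
        ind (FreshUntil z g Z (st σ) (l + 1) ∧ (g ∘ z)^[l + 1] (st σ) ∈ T) := by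
        rw [Finset.expect_add_distrib, Finset.expect_mul, Finset.expect_comm]
        simp only [Finset.expect_sum_comm]
    -- The start is at most twice as likely as uniform to lie in `T`, and each of the `K` fresh
    -- answers is uniform; together this is the factor `K + 2`.
    _ ≤ (𝔼 g, Φ g) * (2 * T.card / Fintype.card V) +
        K * (T.card / Fintype.card V * 𝔼 g, Φ g) := by
        refine add_le_add (mul_le_mul_of_nonneg_left (expect_start_mem_le hup T) hP) ?_
        calc _ ≤ 𝔼 _σ : C, ∑ _l ∈ range K, (T.card / Fintype.card V * 𝔼 g, Φ g : ℝ) :=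
              expect_mono' fun σ => Finset.sum_le_sum fun l _ =>
                expect_freshUntil_le Φ hΦ Z hZ T (st σ) l
          _ ≤ K * (T.card / Fintype.card V * 𝔼 g, Φ g) := by
              simp only [Finset.sum_const, Finset.card_range, nsmul_eq_mul]
              rcases isEmpty_or_nonempty C with hC | hC
              · simp only [Finset.univ_eq_empty, Finset.expect_empty]
                positivity
              · rw [Fintype.expect_const]
    _ = _ := by ring

/-- A lower bound for the probability that two given runs have prescribed starts and that no other
run does something bad. -/
theorem le_expect_starts {S : ℕ} (hlow : ∀ v, 1 / (2 * Fintype.card V) ≤ 𝔼 σ, ind (st σ = v))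
    (hup : ∀ v, 𝔼 σ, ind (st σ = v) ≤ 2 / Fintype.card V)
    (Φ : (A → V) → ℝ) (hΦ : ∀ g, 0 ≤ Φ g) (Z : Set A)
    (hZ : ∀ g q u, q ∉ Z → Φ (update g q u) = Φ g) (a b : Fin S) (hab : a ≠ b) (u u' : V) (K : ℕ)
    (T : Fin S → Finset V) (Bad : Fin S → (A → V) → V → Prop)
    (hBad : ∀ q g v, q ≠ a → q ≠ b → Φ g ≠ 0 → Bad q g v →
      ∃ l ≤ K, FreshUntil z g Z v l ∧ (g ∘ z)^[l] v ∈ T q)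
    (x : ℝ) (hx : x ≤ 1 - ∑ q ∈ univ.filter (fun q => q ≠ a ∧ q ≠ b),
      (K + 2) * ((T q).card : ℝ) / Fintype.card V) (hx0 : 0 ≤ x) :
    (1 / (2 * Fintype.card V)) ^ 2 * x * 𝔼 g, Φ g ≤
      𝔼 g, 𝔼 ω : Fin S → C, Φ g * ind (st (ω a) = u ∧ st (ω b) = u' ∧
        ∀ q, q ≠ a → q ≠ b → ¬ Bad q g (st (ω q))) := by
  have hne : Nonempty C := by
    by_contra hC
    rw [not_nonempty_iff] at hC
    have := hlow u
    rw [Finset.univ_eq_empty, Finset.expect_empty] at this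
    have h2 : (0 : ℝ) < 1 / (2 * Fintype.card V) := by
      have := Fintype.card_pos (α := V)
      positivity
    linarith
  classical
  set Q := univ.filter (fun q : Fin S => q ≠ a ∧ q ≠ b) with hQ
  set pa := 𝔼 σ, ind (st σ = u) with hpa
  set pb := 𝔼 σ, ind (st σ = u') with hpb
  have hP : 0 ≤ 𝔼 g, Φ g := expect_nonneg' hΦ
  have hpa0 : 0 ≤ pa := expect_nonneg' fun _ => ind_nonneg _
  have hpb0 : 0 ≤ pb := expect_nonneg' fun _ => ind_nonneg _
  -- Union bound over the other runs. For fixed `g`, every summand involves three different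
  -- coordinates of `ω`, which are independent.
  have h₁ : ∀ (g : A → V) (ω : Fin S → C), Φ g * (ind (st (ω a) = u) * ind (st (ω b) = u')) -
      ∑ q ∈ Q, Φ g * (ind (st (ω a) = u) * ind (st (ω b) = u') * ind (Bad q g (st (ω q)))) ≤
      Φ g * ind (st (ω a) = u ∧ st (ω b) = u' ∧
        ∀ q, q ≠ a → q ≠ b → ¬ Bad q g (st (ω q))) := by
    intro g ω
    rw [← Finset.mul_sum, ← mul_sub]
    refine mul_le_mul_of_nonneg_left ?_ (hΦ g)
    rw [← Finset.mul_sum, ind_and, ind_and, ← mul_assoc]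
    rw [show ∀ y s : ℝ, y - y * s = y * (1 - s) from fun y s => by ring]
    refine mul_le_mul_of_nonneg_left ?_ (mul_nonneg (ind_nonneg _) (ind_nonneg _))
    by_cases h : ∀ q, q ≠ a → q ≠ b → ¬ Bad q g (st (ω q))
    · rw [ind_of h]
      linarith [Finset.sum_nonneg fun q (_ : q ∈ Q) => ind_nonneg (Bad q g (st (ω q)))]
    · push Not at h
      obtain ⟨q, h1, h2, h3⟩ := h
      have h4 := Finset.single_le_sum (f := fun q => ind (Bad q g (st (ω q))))
        (fun q _ => ind_nonneg _) (Finset.mem_filter.2 ⟨Finset.mem_univ q, h1, h2⟩ : q ∈ Q)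
      simp only [ind_of h3] at h4
      linarith [ind_nonneg (∀ q, q ≠ a → q ≠ b → ¬ Bad q g (st (ω q)))]
  have h₂ : ∀ g, 𝔼 ω : Fin S → C, Φ g * (ind (st (ω a) = u) * ind (st (ω b) = u')) =
      pa * pb * Φ g := by
    intro g
    rw [← Finset.mul_expect, expect_apply₂ hab (fun σ => ind (st σ = u)) fun σ => ind (st σ = u')]
    ring
  have h₃ : ∀ g, ∀ q ∈ Q, 𝔼 ω : Fin S → C, Φ g * (ind (st (ω a) = u) * ind (st (ω b) = u') *
      ind (Bad q g (st (ω q)))) = pa * pb * (Φ g * 𝔼 σ, ind (Bad q g (st σ))) := by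
    intro g q hq
    have hq' := (Finset.mem_filter.1 hq).2
    rw [← Finset.mul_expect, expect_apply₃ hab hq'.1.symm hq'.2.symm (fun σ => ind (st σ = u))
      (fun σ => ind (st σ = u')) fun σ => ind (Bad q g (st σ))]
    ring
  calc (1 / (2 * Fintype.card V)) ^ 2 * x * 𝔼 g, Φ g ≤ pa * pb * x * 𝔼 g, Φ g := by
        refine mul_le_mul_of_nonneg_right (mul_le_mul_of_nonneg_right ?_ hx0) hP
        rw [sq]
        exact mul_le_mul (hlow u) (hlow u') (by positivity) hpa0
    _ ≤ pa * pb * (1 - ∑ q ∈ Q, (K + 2) * ((T q).card : ℝ) / Fintype.card V) * 𝔼 g, Φ g := by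
        refine mul_le_mul_of_nonneg_right (mul_le_mul_of_nonneg_left hx ?_) hP
        exact mul_nonneg hpa0 hpb0
    _ = pa * pb * 𝔼 g, Φ g - ∑ q ∈ Q, pa * pb *
          ((K + 2) * (T q).card / Fintype.card V * 𝔼 g, Φ g) := by
        rw [← Finset.mul_sum, ← Finset.sum_mul]
        ring
    _ ≤ pa * pb * 𝔼 g, Φ g - ∑ q ∈ Q, pa * pb * 𝔼 g, Φ g * 𝔼 σ, ind (Bad q g (st σ)) := by
        refine sub_le_sub le_rfl (Finset.sum_le_sum fun q hq => ?_)
        refine mul_le_mul_of_nonneg_left ?_ (mul_nonneg hpa0 hpb0)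
        have hq' := (Finset.mem_filter.1 hq).2
        exact expect_hit_le hup Φ hΦ Z hZ (T q) K (Bad q) fun g v =>
          hBad q g v hq'.1 hq'.2
    _ = 𝔼 g, 𝔼 ω : Fin S → C, (Φ g * (ind (st (ω a) = u) * ind (st (ω b) = u')) -
      ∑ q ∈ Q, Φ g * (ind (st (ω a) = u) * ind (st (ω b) = u') *
        ind (Bad q g (st (ω q))))) := by
        simp only [Finset.expect_sub_distrib, h₂, Finset.expect_sum_comm]
        rw [← Finset.mul_expect]
        congr 1
        refine Finset.sum_congr rfl fun q hq => ?_
        simp only [h₃ _ q hq]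
        rw [← Finset.mul_expect]
    _ ≤ _ := expect_mono' fun g => expect_mono' fun ω => h₁ g ω

end hitting

end ListDisjointness

/-! # The pattern of a collision -/

namespace ListDisjointness

open Finset Function
open scoped BigOperators

section pattern

variable {A V : Type*}

/-- The walk from `v` reaches `D` (after its start) for the first time after `L` steps. -/
def Stops (f : V → V) (D : Finset V) (v : V) (L : ℕ) : Prop :=
  1 ≤ L ∧ f^[L] v ∈ D ∧ ∀ y, 1 ≤ y → y < L → f^[y] v ∉ D

/-- The walk from `v` visits `j` within `K` steps and before it stops. -/
def Visits (f : V → V) (D : Finset V) (j : V) (K : ℕ) (v : V) : Prop :=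
  ∃ x ≤ K, f^[x] v = j ∧ ∀ y, 1 ≤ y → y ≤ x → f^[y] v ∉ D

/-- The walk from `v` stops within `K` steps, in slot `c`. -/
def StopsWith (f : V → V) (D : Finset V) (slot : V → ℕ) (K c : ℕ) (v : V) : Prop :=
  ∃ L ≤ K, Stops f D v L ∧ slot (f^[L] v) = c

theorem Stops.unique {f : V → V} {D : Finset V} {v : V} {L L' : ℕ} (h : Stops f D v L)
    (h' : Stops f D v L') : L = L' := by
  rcases lt_trichotomy L L' with hlt | heq | hgt
  · exact absurd h.2.1 (h'.2.2 L h.1 hlt)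
  · exact heq
  · exact absurd h'.2.1 (h.2.2 L' h'.1 hgt)

/-- The runs `a` and `b` meet after `i` and `j`, which they reach after `t` and `r` steps, and stop
`k` steps later; no other run visits `j`, and no run between them ends in the same slot. -/
structure Pattern (f : V → V) (D : Finset V) (slot : V → ℕ) (K : ℕ) (j : V) {S : ℕ} (w : Fin S → V)
    (a b : Fin S) (i : V) (t r k : ℕ) : Prop where
  lt : a < b
  left : f^[t] (w a) = i
  right : f^[r] (w b) = j
  left_stops : Stops f D (w a) (t + k)
  right_stops : Stops f D (w b) (r + k)
  meet : f^[t + k] (w a) = f^[r + k] (w b)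
  not_visits : ∀ q, q ≠ b → ¬ Visits f D j K (w q)
  between : ∀ q, a < q → q < b → ¬ StopsWith f D slot K (slot (f^[t + k] (w a))) (w q)

/-- The run `b` is the only one that visits `j`, and it visits `j` only once, which determines `r`
and then `k`. The run `a` is the last run before `b` that ends in the same slot, and its length
determines `t` and `i`. So patterns with different data exclude each other. -/
theorem Pattern.unique {f : V → V} {D : Finset V} {slot : V → ℕ} {K : ℕ} {j : V} {S : ℕ}
    {w : Fin S → V} {a b a' b' : Fin S} {i i' : V} {t r k t' r' k' : ℕ}
    (h : Pattern f D slot K j w a b i t r k) (h' : Pattern f D slot K j w a' b' i' t' r' k')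
    (hk : 1 ≤ k) (hk' : 1 ≤ k') (hK : r + k ≤ K) (hK' : r' + k' ≤ K) (hL : t + k ≤ K)
    (hL' : t' + k' ≤ K) : a = a' ∧ b = b' ∧ i = i' ∧ t = t' ∧ r = r' ∧ k = k' := by
  have hb : b = b' := by
    by_contra hne
    refine h'.not_visits b hne ⟨r, by omega, h.right, fun y hy hyr => ?_⟩
    exact h.right_stops.2.2 y hy (by omega)
  subst hb
  have hrk := h.right_stops.unique h'.right_stops
  -- After an earlier visit of `j` the walk would already take the course that follows the later
  -- visit, and so it would have stopped before its actual end.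
  have aux : ∀ {r₁ r₂ k₁ k₂ : ℕ}, f^[r₁] (w b) = j → f^[r₂] (w b) = j →
      Stops f D (w b) (r₁ + k₁) → r₁ + k₁ = r₂ + k₂ → 1 ≤ k₂ → ¬ r₁ < r₂ := by
    intro r₁ r₂ k₁ k₂ h₁ h₂ hs he hk₂ hlt
    refine hs.2.2 (k₂ + r₁) (by omega) (by omega) ?_
    rw [iterate_add_apply, h₁, ← h₂, ← iterate_add_apply, show k₂ + r₂ = r₁ + k₁ by omega]
    exact hs.2.1
  have hr : r = r' := by
    have h₁ := aux h.right h'.right h.right_stops hrk hk'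
    have h₂ := aux h'.right h.right h'.right_stops hrk.symm hk
    omega
  subst hr
  have hk : k = k' := by omega
  subst hk
  have ha : a = a' := by
    rcases lt_trichotomy a a' with hlt | heq | hgt
    · exact absurd ⟨t' + k, hL', h'.left_stops, by rw [h'.meet, h.meet]⟩
        (h.between a' hlt h'.lt)
    · exact heq
    · exact absurd ⟨t + k, hL, h.left_stops, by rw [h'.meet, h.meet]⟩
        (h'.between a hgt h.lt)
  subst ha
  have htk := h.left_stops.unique h'.left_stops
  have ht : t = t' := by omega
  subst ht
  exact ⟨rfl, rfl, by rw [← h.left, ← h'.left], rfl, rfl, rfl⟩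

/-- The places of a pattern, except for `i`, `j` and the final one: before `i`, before `j`, and
after these two. -/
abbrev Places (t r k : ℕ) : Type := Fin t ⊕ Fin r ⊕ Fin k

variable {t r k : ℕ}

/-- The path to `i`. -/
def leftPath (i : V) (δ : Places t r k → V) (x : ℕ) : V :=
  if h : x < t then δ (.inl ⟨x, h⟩) else i

/-- The path to `j`. -/
def rightPath (j : V) (δ : Places t r k → V) (x : ℕ) : V :=
  if h : x < r then δ (.inr (.inl ⟨x, h⟩)) else j

/-- The common path to `e`. -/
def tailPath (e : V) (δ : Places t r k → V) (y : ℕ) : V :=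
  if h : y < k then δ (.inr (.inr ⟨y, h⟩)) else e

/-- The arguments of the random function in a pattern. -/
def keys (z : V → A) (j : V) (δ : Places t r k → V) : Option (Places t r k) → A
  | none => z j
  | some x => z (δ x)

/-- The values of the random function in a pattern. -/
def vals (i j e : V) (δ : Places t r k → V) : Option (Places t r k) → V
  | none => tailPath e δ 0
  | some (.inl x) => leftPath i δ (x + 1)
  | some (.inr (.inl x)) => rightPath j δ (x + 1)
  | some (.inr (.inr y)) => tailPath e δ (y + 1)

/-- The random function follows the pattern. -/
def Follows (z : V → A) (i j e : V) (δ : Places t r k → V) (g : A → V) : Prop :=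
  ∀ o, g (keys z j δ o) = vals i j e δ o

section follows

variable {z : V → A} {i j e : V} {δ : Places t r k → V} {g : A → V}

theorem Follows.left (h : Follows z i j e δ g) {x : ℕ} (hx : x ≤ t) :
    (g ∘ z)^[x] (leftPath i δ 0) = leftPath i δ x := by
  induction x with
  | zero => rfl
  | succ x ih =>
    rw [iterate_succ_apply', ih (by omega), comp_apply]
    have := h (some (.inl ⟨x, hx⟩))
    simp only [keys, vals] at this
    rw [← this, leftPath, dif_pos (by omega : x < t)]

theorem Follows.right (h : Follows z i j e δ g) {x : ℕ} (hx : x ≤ r) :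
    (g ∘ z)^[x] (rightPath j δ 0) = rightPath j δ x := by
  induction x with
  | zero => rfl
  | succ x ih =>
    rw [iterate_succ_apply', ih (by omega), comp_apply]
    have := h (some (.inr (.inl ⟨x, hx⟩)))
    simp only [keys, vals] at this
    rw [← this, rightPath, dif_pos (by omega : x < r)]

theorem Follows.tail (h : Follows z i j e δ g) {v : V} (hv : z v = z j) {y : ℕ} (hy : y ≤ k) :
    (g ∘ z)^[y + 1] v = tailPath e δ y := by
  induction y with
  | zero =>
    have := h none
    simp only [keys, vals] at this
    rw [iterate_one, comp_apply, hv, this]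
  | succ y ih =>
    rw [iterate_succ_apply', ih (by omega), comp_apply]
    have := h (some (.inr (.inr ⟨y, hy⟩)))
    simp only [keys, vals] at this
    rw [← this, tailPath, dif_pos (by omega : y < k)]

theorem leftPath_last : leftPath i δ t = i := dif_neg (lt_irrefl t)

theorem rightPath_last : rightPath j δ r = j := dif_neg (lt_irrefl r)

theorem tailPath_last : tailPath e δ k = e := dif_neg (lt_irrefl k)

theorem Follows.left_tail (h : Follows z i j e δ g) (hij : z i = z j) {y : ℕ} (hy : y ≤ k) :
    (g ∘ z)^[t + (y + 1)] (leftPath i δ 0) = tailPath e δ y := by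
  rw [add_comm, iterate_add_apply, h.left le_rfl, leftPath_last, h.tail hij hy]

theorem Follows.right_tail (h : Follows z i j e δ g) {y : ℕ} (hy : y ≤ k) :
    (g ∘ z)^[r + (y + 1)] (rightPath j δ 0) = tailPath e δ y := by
  rw [add_comm, iterate_add_apply, h.right le_rfl, rightPath_last, h.tail rfl hy]

/-- The places and the end point are positions on the walks from the two starts, hence determined by
`g` and the starts. Different choices of places are therefore disjoint events. -/
theorem Follows.unique {e' : V} {δ' : Places t r k → V} (h : Follows z i j e δ g)
    (h' : Follows z i j e' δ' g) (hl : leftPath i δ 0 = leftPath i δ' 0)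
    (hr : rightPath j δ 0 = rightPath j δ' 0) : δ = δ' ∧ e = e' := by
  constructor
  · funext x
    rcases x with ⟨x, hx⟩ | ⟨x, hx⟩ | ⟨y, hy⟩
    · have h₁ := h.left hx.le
      have h₂ := h'.left hx.le
      rw [hl, h₂, leftPath, leftPath, dif_pos hx, dif_pos hx] at h₁
      exact h₁.symm
    · have h₁ := h.right hx.le
      have h₂ := h'.right hx.le
      rw [hr, h₂, rightPath, rightPath, dif_pos hx, dif_pos hx] at h₁
      exact h₁.symm
    · have h₁ := h.right_tail hy.le
      have h₂ := h'.right_tail hy.le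
      rw [hr, h₂, tailPath, tailPath, dif_pos hy, dif_pos hy] at h₁
      exact h₁.symm
  · have h₁ := h.right_tail le_rfl
    have h₂ := h'.right_tail le_rfl
    rw [hr, h₂, tailPath_last, tailPath_last] at h₁
    exact h₁.symm

/-- A choice of the places that leads to a pattern. -/
structure GoodPlaces (z : V → A) (D : Finset V) (j : V) (δ : Places t r k → V) : Prop where
  injective : Injective (keys z j δ)
  notMem : ∀ x, δ x ∉ D

theorem GoodPlaces.ne {D : Finset V} (hδ : GoodPlaces z D j δ) (x : Places t r k) :
    z (δ x) ≠ z j := fun h =>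
  Option.some_ne_none x (hδ.injective h)

theorem GoodPlaces.tailPath_ne {D : Finset V} (hδ : GoodPlaces z D j δ) {y : ℕ} (hy : y < k) :
    tailPath e δ y ≠ j := by
  rw [tailPath, dif_pos hy]
  exact fun h => hδ.ne _ (congrArg z h)

theorem stops_of_path {f : V → V} {D : Finset V} {v : V} {l : ℕ}
    (h₁ : ∀ x, 1 ≤ x → x ≤ l → f^[x] v ∉ D) (h₂ : ∀ y < k, f^[l + (y + 1)] v ∉ D)
    (h₃ : f^[l + (k + 1)] v ∈ D) : Stops f D v (l + (k + 1)) := by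
  refine ⟨by omega, h₃, fun y hy hy' => ?_⟩
  rcases le_or_gt y l with h | h
  · exact h₁ y hy h
  · have := h₂ (y - l - 1) (by omega)
    rwa [show l + (y - l - 1 + 1) = y by omega] at this

/-- The `k` common places come after `i` and `j` and before `e`, so that the walks stop `k + 1`
steps after `i` and `j`. If `t = 0` then `i` is the start of its walk and may lie in `D`, since
starts are not tested; likewise for `j`. The run `a` misses `j`, because its places have other
values and `i ≠ j`. -/
theorem Follows.pattern {D : Finset V} {slot : V → ℕ} {K S : ℕ} {w : Fin S → V} {a b : Fin S}
    (h : Follows z i j e δ g) (hδ : GoodPlaces z D j δ) (hab : a < b) (hij : i ≠ j)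
    (hz : z i = z j) (hi : 0 < t → i ∉ D) (hj : 0 < r → j ∉ D) (he : e ∈ D)
    (ha : w a = leftPath i δ 0) (hb : w b = rightPath j δ 0)
    (hq : ∀ q, q ≠ a → q ≠ b → ¬ (Visits (g ∘ z) D j K (w q) ∨
      ((a < q ∧ q < b) ∧ StopsWith (g ∘ z) D slot K (slot e) (w q)))) :
    Pattern (g ∘ z) D slot K j w a b i t r (k + 1) := by
  have htail : ∀ y < k, tailPath e δ y ∉ D := by
    intro y hy
    rw [tailPath, dif_pos hy]
    exact hδ.notMem _
  have hs_end : Stops (g ∘ z) D (w a) (t + (k + 1)) := by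
    rw [ha]
    refine stops_of_path (fun x hx hxt => ?_) (fun y hy => ?_) ?_
    · rw [h.left hxt, leftPath]
      split_ifs with hlt
      · exact hδ.notMem _
      · exact hi (by omega)
    · rw [h.left_tail hz hy.le]
      exact htail y hy
    · rwa [h.left_tail hz le_rfl, tailPath_last]
  have hmeet : (g ∘ z)^[t + (k + 1)] (w a) = e := by
    rw [ha, h.left_tail hz le_rfl, tailPath_last]
  refine ⟨hab, ?_, ?_, hs_end, ?_, ?_, fun q hqb => ?_, fun q h₁ h₂ => ?_⟩
  · rw [ha, h.left le_rfl, leftPath_last]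
  · rw [hb, h.right le_rfl, rightPath_last]
  · rw [hb]
    refine stops_of_path (fun x hx hxt => ?_) (fun y hy => ?_) ?_
    · rw [h.right hxt, rightPath]
      split_ifs with hlt
      · exact hδ.notMem _
      · exact hj (by omega)
    · rw [h.right_tail hy.le]
      exact htail y hy
    · rwa [h.right_tail le_rfl, tailPath_last]
  · rw [hmeet, hb, h.right_tail le_rfl, tailPath_last]
  · by_cases hqa : q = a
    · subst hqa
      rintro ⟨x, -, hx, hxD⟩
      have hlt : x < t + (k + 1) := by
        by_contra hlt
        exact hxD _ hs_end.1 (by omega) hs_end.2.1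
      rcases lt_trichotomy x t with hxt | hxt | hxt
      · rw [ha, h.left hxt.le, leftPath, dif_pos hxt] at hx
        exact hδ.ne _ (congrArg z hx)
      · subst hxt
        rw [ha, h.left le_rfl, leftPath_last] at hx
        exact hij hx
      · obtain ⟨y, rfl⟩ : ∃ y, x = t + (y + 1) := ⟨x - t - 1, by omega⟩
        rw [ha, h.left_tail hz (by omega)] at hx
        exact hδ.tailPath_ne (by omega) hx
    · exact fun hv => hq q hqa hqb (Or.inl hv)
  · rw [hmeet]
    exact fun hs => hq q h₁.ne' h₂.ne (Or.inr ⟨⟨h₁, h₂⟩, hs⟩)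

/-- A run that visits `j` enters `j` or the other places of the pattern fresh. -/
theorem Follows.freshUntil_of_visits {D : Finset V} {K : ℕ} {v : V} (h : Follows z i j e δ g)
    (hδ : GoodPlaces z D j δ) (he : e ∈ D) (hv : Visits (g ∘ z) D j K v) :
    ∃ l ≤ K, FreshUntil z g (Set.range (keys z j δ)) v l ∧
      ((g ∘ z)^[l] v = j ∨ ∃ x, z ((g ∘ z)^[l] v) = z (δ x)) := by
  obtain ⟨x, hx, hxj, hxD⟩ := hv
  obtain ⟨l, hl, hf, o, ho⟩ := exists_freshUntil g (Set.range (keys z j δ))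
    {u | z u ∈ Set.range (keys z j δ)} (fun u hu => hu) v (l₀ := x)
    (by rw [hxj]; exact ⟨none, rfl⟩)
  refine ⟨l, by omega, hf, ?_⟩
  cases o with
  | some y => exact Or.inr ⟨y, ho.symm⟩
  -- A run that enters at another vertex with the value of `j` follows the tail to `e` and stops
  -- without having visited `j`. Hence only `j` itself is dangerous, not all vertices with its
  -- value; this matters when that value is frequent.
  | none =>
    left
    by_contra hne
    have hlx : l ≠ x := fun he => hne (by rw [he, hxj])
    have htail : ∀ y ≤ k, (g ∘ z)^[y + 1 + l] v = tailPath e δ y := fun y hy => by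
      rw [iterate_add_apply, h.tail ho.symm hy]
    rcases le_or_gt (k + 1 + l) x with hle | hgt
    · refine hxD _ (by omega) hle ?_
      rw [htail k le_rfl, tailPath_last]
      exact he
    · have h₁ := htail (x - l - 1) (by omega)
      rw [show x - l - 1 + 1 + l = x by omega, hxj] at h₁
      exact hδ.tailPath_ne (by omega) h₁.symm

/-- A run between `a` and `b` must also not end in the common slot, so entering at any vertex with
the value of `j` does harm. The target is larger here, but only for these few runs. -/
theorem freshUntil_of_visits_or {D D' : Finset V} {slot : V → ℕ} {c K : ℕ} {v : V}
    (hD' : ∀ u ∈ D, slot u = c → u ∈ D')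
    (hv : Visits (g ∘ z) D j K v ∨ StopsWith (g ∘ z) D slot K c v) :
    ∃ l ≤ K, FreshUntil z g (Set.range (keys z j δ)) v l ∧
      (z ((g ∘ z)^[l] v) ∈ Set.range (keys z j δ) ∨ (g ∘ z)^[l] v ∈ D') := by
  obtain ⟨x, hx, hxC⟩ : ∃ x ≤ K, (g ∘ z)^[x] v ∈
      {u | z u ∈ Set.range (keys z j δ) ∨ u ∈ D'} := by
    rcases hv with ⟨x, hx, hxj, -⟩ | ⟨L, hL, hs, hc⟩
    · exact ⟨x, hx, Or.inl ⟨none, by rw [hxj]; rfl⟩⟩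
    · exact ⟨L, hL, Or.inr (hD' _ hs.2.1 hc)⟩
  obtain ⟨l, hl, hf, h⟩ := exists_freshUntil g (Set.range (keys z j δ))
    {u | z u ∈ Set.range (keys z j δ) ∨ u ∈ D'} (fun u hu => Or.inl hu) v hxC
  exact ⟨l, by omega, hf, h⟩

end follows

end pattern

end ListDisjointness

/-! ### The probability of a pattern with given data -/

namespace ListDisjointness

open Finset Function
open scoped BigOperators

section places

variable {A V : Type*} [DecidableEq A] [Fintype V]

/-- The number of vertices with value `a`. -/
def freq (z : V → A) (a : A) : ℕ := (univ.filter fun v => z v = a).card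

/-- The number of pairs of vertices with equal values. -/
def freqSum (z : V → A) : ℕ := ∑ v, freq z (z v)

theorem expect_ind_value (z : V → A) (a : A) :
    𝔼 u, ind (z u = a) = freq z a / Fintype.card V := by
  rw [Fintype.expect_eq_sum_div_card, sum_ind_eq_card, freq]

variable [Nonempty V] {J : Type*} [Fintype J] [DecidableEq J]

theorem expect_freq (z : V → A) (x : J) :
    𝔼 δ : J → V, (freq z (z (δ x)) : ℝ) = freqSum z / Fintype.card V := by
  classical
  rw [expect_apply x fun u => (freq z (z u) : ℝ), Fintype.expect_eq_sum_div_card, freqSum,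
    Nat.cast_sum]

theorem expect_ind_eq_value (z : V → A) {x y : J} (hxy : x ≠ y) :
    𝔼 δ : J → V, ind (z (δ x) = z (δ y)) = freqSum z / (Fintype.card V : ℝ) ^ 2 := by
  classical
  have h : ∀ δ : J → V, ind (z (δ x) = z (δ y)) =
      ∑ v, ind (δ y = v) * ind (z (δ x) = z v) := by
    intro δ
    rw [Finset.sum_eq_single (δ y)]
    · rw [ind_of rfl, one_mul]
    · intro v _ hv
      rw [ind_of_not hv.symm, zero_mul]
    · intro h
      exact absurd (Finset.mem_univ _) h
  simp only [h, Finset.expect_sum_comm]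
  have h' : ∀ v, 𝔼 δ : J → V, ind (δ y = v) * ind (z (δ x) = z v) =
      1 / Fintype.card V * (freq z (z v) / Fintype.card V) := by
    intro v
    rw [expect_apply₂ hxy.symm (fun u => ind (u = v)) fun u => ind (z u = z v), expect_ind_eq,
      expect_ind_value]
  simp only [h']
  rw [← Finset.mul_sum, ← Finset.sum_div, freqSum, Nat.cast_sum]
  have : (Fintype.card V : ℝ) ≠ 0 := Nat.cast_ne_zero.2 Fintype.card_ne_zero
  field_simp

/-- A lower bound for the expectation over the places of a pattern. -/
theorem le_expect_places (z : V → A) (D : Finset V) (j : V) (Good : (J → V) → Prop)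
    (hGood : ∀ δ, (∀ x y, x ≠ y → z (δ x) ≠ z (δ y)) → (∀ x, z (δ x) ≠ z j) → (∀ x, δ x ∉ D) →
      Good δ) (N α β : ℝ) (hN : Fintype.card J ≤ N) (hα : 0 ≤ α) (hβ : 0 ≤ β)
    (h : N ^ 2 * freqSum z / (Fintype.card V : ℝ) ^ 2 + N * freq z (z j) / Fintype.card V +
      N * D.card / Fintype.card V + α * (1 + N * freqSum z / Fintype.card V) + β ≤ 1 / 2) :
    1 / 2 ≤ 𝔼 δ : J → V, ind (Good δ) * (1 - α * (1 + ∑ x, (freq z (z (δ x)) : ℝ)) - β) := by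
  classical
  -- Where `Good` fails, one of the subtracted indicators equals one, so the left side is at most
  -- zero. The expectation of the left side involves at most two places at a time.
  have h₁ : ∀ δ : J → V, 1 - α * (1 + ∑ x, (freq z (z (δ x)) : ℝ)) - β -
      (∑ x, ∑ y ∈ univ.erase x, ind (z (δ x) = z (δ y)) + ∑ x, ind (z (δ x) = z j) +
        ∑ x, ind (δ x ∈ D)) ≤
      ind (Good δ) * (1 - α * (1 + ∑ x, (freq z (z (δ x)) : ℝ)) - β) := by
    intro δ
    have hF : 0 ≤ α * (1 + ∑ x, (freq z (z (δ x)) : ℝ)) :=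
      mul_nonneg hα (add_nonneg zero_le_one (Finset.sum_nonneg fun _ _ => Nat.cast_nonneg _))
    have n₁ : 0 ≤ ∑ x, ∑ y ∈ univ.erase x, ind (z (δ x) = z (δ y)) :=
      Finset.sum_nonneg fun _ _ => Finset.sum_nonneg fun _ _ => ind_nonneg _
    have n₂ : 0 ≤ ∑ x, ind (z (δ x) = z j) := Finset.sum_nonneg fun _ _ => ind_nonneg _
    have n₃ : 0 ≤ ∑ x, ind (δ x ∈ D) := Finset.sum_nonneg fun _ _ => ind_nonneg _
    by_cases hδ : Good δ
    · rw [ind_of hδ]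
      linarith
    · rw [ind_of_not hδ, zero_mul]
      have key : 1 ≤ ∑ x, ∑ y ∈ univ.erase x, ind (z (δ x) = z (δ y)) +
          ∑ x, ind (z (δ x) = z j) + ∑ x, ind (δ x ∈ D) := by
        by_contra hlt
        apply hδ
        refine hGood δ (fun x y hxy he => ?_) (fun x he => ?_) fun x he => ?_
        · have e₁ := Finset.single_le_sum (f := fun y => ind (z (δ x) = z (δ y)))
            (fun _ _ => ind_nonneg _) (Finset.mem_erase.2 ⟨hxy.symm, Finset.mem_univ y⟩)
          have e₂ := Finset.single_le_sum
            (f := fun x => ∑ y ∈ univ.erase x, ind (z (δ x) = z (δ y)))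
            (fun _ _ => Finset.sum_nonneg fun _ _ => ind_nonneg _) (Finset.mem_univ x)
          simp only [ind_of he] at e₁
          linarith
        · have e₁ := Finset.single_le_sum (f := fun x => ind (z (δ x) = z j))
            (fun _ _ => ind_nonneg _) (Finset.mem_univ x)
          simp only [ind_of he] at e₁
          linarith
        · have e₁ := Finset.single_le_sum (f := fun x => ind (δ x ∈ D))
            (fun _ _ => ind_nonneg _) (Finset.mem_univ x)
          simp only [ind_of he] at e₁
          linarith
      linarith
  refine le_trans ?_ (expect_mono' h₁)
  have hne : (univ : Finset (J → V)).Nonempty := Finset.univ_nonempty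
  simp only [Finset.expect_sub_distrib, Finset.expect_add_distrib, Finset.expect_sum_comm,
    ← Finset.mul_expect, Finset.expect_const hne, expect_freq]
  have e₁ : ∀ x : J, ∑ y ∈ univ.erase x, 𝔼 δ : J → V, ind (z (δ x) = z (δ y)) =
      (Fintype.card J - 1 : ℕ) * (freqSum z / (Fintype.card V : ℝ) ^ 2) := by
    intro x
    rw [Finset.sum_congr rfl fun y hy => expect_ind_eq_value z (Finset.ne_of_mem_erase hy).symm,
      Finset.sum_const, nsmul_eq_mul, Finset.card_erase_of_mem (Finset.mem_univ x),
      Finset.card_univ]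
  have e₂ : ∀ x : J, 𝔼 δ : J → V, ind (z (δ x) = z j) = freq z (z j) / Fintype.card V := by
    intro x
    rw [expect_apply x fun u => ind (z u = z j), expect_ind_value]
  have e₃ : ∀ x : J, 𝔼 δ : J → V, ind (δ x ∈ D) = D.card / Fintype.card V := by
    intro x
    rw [expect_apply x fun u => ind (u ∈ D), expect_ind_mem]
  simp only [e₁, e₂, e₃, Finset.sum_const, nsmul_eq_mul, Finset.card_univ]
  set c : ℝ := (Fintype.card J : ℝ) with hc
  have hc0 : 0 ≤ c := Nat.cast_nonneg _
  have hc1 : ((Fintype.card J - 1 : ℕ) : ℝ) ≤ c := Nat.cast_le.2 (Nat.sub_le _ _)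
  set Q : ℝ := freqSum z / (Fintype.card V : ℝ) ^ 2 with hQ
  have hQ0 : 0 ≤ Q := by positivity
  set P₁ : ℝ := freq z (z j) / Fintype.card V with hP₁
  have hP₁0 : 0 ≤ P₁ := by positivity
  set P₂ : ℝ := (D.card : ℝ) / Fintype.card V with hP₂
  have hP₂0 : 0 ≤ P₂ := by positivity
  set P₃ : ℝ := (freqSum z : ℝ) / Fintype.card V with hP₃
  have hP₃0 : 0 ≤ P₃ := by positivity
  have h' : N ^ 2 * Q + N * P₁ + N * P₂ + α * (1 + N * P₃) + β ≤ 1 / 2 := by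
    rw [hQ, hP₁, hP₂, hP₃]
    simpa only [mul_div_assoc] using h
  have i₁ : c * (((Fintype.card J - 1 : ℕ) : ℝ) * Q) ≤ N ^ 2 * Q := by
    rw [← mul_assoc]
    refine mul_le_mul_of_nonneg_right ?_ hQ0
    rw [sq]
    exact mul_le_mul hN (hc1.trans hN) (Nat.cast_nonneg _) (hc0.trans hN)
  have i₂ := mul_le_mul_of_nonneg_right hN hP₁0
  have i₃ := mul_le_mul_of_nonneg_right hN hP₂0
  have i₄ : α * (1 + c * P₃) ≤ α * (1 + N * P₃) :=
    mul_le_mul_of_nonneg_left (by linarith [mul_le_mul_of_nonneg_right hN hP₃0]) hα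
  linarith

end places

section pattern

theorem card_filter_or_le {ι : Type*} (s : Finset ι) (p q : ι → Prop) [DecidablePred p]
    [DecidablePred q] [DecidablePred fun i => p i ∨ q i] :
    (s.filter fun i => p i ∨ q i).card ≤ (s.filter p).card + (s.filter q).card := by
  classical
  refine le_trans (Finset.card_le_card fun i hi => ?_) (Finset.card_union_le _ _)
  rw [Finset.mem_union, Finset.mem_filter, Finset.mem_filter, ← and_or_left]
  exact Finset.mem_filter.1 hi

theorem card_value_exists_le {A V : Type*} [DecidableEq A] [Fintype V] {z : V → A} {J : Type*} [Fintype J] (δ : J → V) (p : V → Prop) [DecidablePred p]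
    [DecidablePred fun v => p v ∨ ∃ x, z v = z (δ x)] :
    (univ.filter fun v => p v ∨ ∃ x, z v = z (δ x)).card ≤
      (univ.filter p).card + ∑ x, freq z (z (δ x)) := by
  classical
  refine (card_filter_or_le univ p fun v => ∃ x, z v = z (δ x)).trans (Nat.add_le_add_left ?_ _)
  calc (univ.filter fun v => ∃ x, z v = z (δ x)).card
      ≤ (univ.biUnion fun x => univ.filter fun v => z v = z (δ x)).card := by
        refine Finset.card_le_card fun v hv => ?_
        obtain ⟨x, hx⟩ := (Finset.mem_filter.1 hv).2
        exact Finset.mem_biUnion.2 ⟨x, Finset.mem_univ x, Finset.mem_filter.2 ⟨Finset.mem_univ v, hx⟩⟩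
    _ ≤ ∑ x, freq z (z (δ x)) := Finset.card_biUnion_le

variable {A V C : Type*} [Fintype A] [DecidableEq A] [Fintype V] [Nonempty V]
  [Fintype C] {z : V → A} {st : C → V}

/-- The probability of a pattern with given places. -/
theorem le_expect_follows {S t r k : ℕ}
    (hlow : ∀ v, 1 / (2 * Fintype.card V) ≤ 𝔼 σ, ind (st σ = v))
    (hup : ∀ v, 𝔼 σ, ind (st σ = v) ≤ 2 / Fintype.card V)
    (D : Finset V) (slot : V → ℕ) (j i e : V) (he : e ∈ D) (δ : Places t r k → V)
    (hδ : GoodPlaces z D j δ) (a b : Fin S) (hab : a < b) (w : ℕ) (hw : (b : ℕ) ≤ a + w) (K σm : ℕ)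
    (hσ : ∀ c, (D.filter fun v => slot v = c).card ≤ σm) :
    (1 / (2 * Fintype.card V)) ^ 2 * (1 / Fintype.card V : ℝ) ^ (t + r + k + 1) *
      (1 - (K + 2) * (S - 2 : ℕ) / Fintype.card V * (1 + ∑ x, (freq z (z (δ x)) : ℝ)) -
        (K + 2) * ((w - 1 : ℕ) * (freq z (z j) + σm)) / Fintype.card V) ≤
    𝔼 g, 𝔼 ω : Fin S → C, ind (Follows z i j e δ g ∧ st (ω a) = leftPath i δ 0 ∧
      st (ω b) = rightPath j δ 0 ∧ ∀ q, q ≠ a → q ≠ b → ¬ (Visits (g ∘ z) D j K (st (ω q)) ∨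
        ((a < q ∧ q < b) ∧ StopsWith (g ∘ z) D slot K (slot e) (st (ω q))))) := by
  classical
  set X := 1 - (K + 2) * (S - 2 : ℕ) / Fintype.card V * (1 + ∑ x, (freq z (z (δ x)) : ℝ)) -
        (K + 2) * ((w - 1 : ℕ) * (freq z (z j) + σm)) / Fintype.card V with hX
  rcases le_or_gt X 0 with hX0 | hX0
  · refine le_trans (mul_nonpos_of_nonneg_of_nonpos (by positivity) hX0) ?_
    exact expect_nonneg' fun g => expect_nonneg' fun ω => ind_nonneg _
  set F := ∑ x, freq z (z (δ x)) with hF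
  set T₁ : Finset V := univ.filter fun v => v = j ∨ ∃ x, z v = z (δ x) with hT₁
  set T₂ : Finset V := univ.filter fun v => (z v = z j ∨ v ∈ D.filter fun v => slot v = slot e) ∨
    ∃ x, z v = z (δ x) with hT₂
  have c₁ : T₁.card ≤ 1 + F := by
    refine (card_value_exists_le δ fun v => v = j).trans (Nat.add_le_add_right ?_ _)
    refine Finset.card_le_one.2 fun u hu v hv => ?_
    rw [(Finset.mem_filter.1 hu).2, (Finset.mem_filter.1 hv).2]
  have c₂ : T₂.card ≤ 1 + F + (freq z (z j) + σm) := by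
    refine (card_value_exists_le δ fun v => z v = z j ∨ v ∈ D.filter fun v => slot v = slot e).trans ?_
    have := card_filter_or_le (univ : Finset V) (fun v => z v = z j)
      fun v => v ∈ D.filter fun v => slot v = slot e
    rw [Finset.filter_mem_eq_inter, Finset.univ_inter] at this
    have h' := hσ (slot e)
    rw [freq, hF]
    omega
  -- Only the at most `w - 1` runs between `a` and `b` have to pay for the frequency of the value of
  -- `j` and for the size of the slot.
  set T : Fin S → Finset V := fun q => if a < q ∧ q < b then T₂ else T₁ with hT
  have hcard : ∑ q ∈ univ.filter (fun q : Fin S => q ≠ a ∧ q ≠ b), (T q).card ≤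
      (S - 2) * (1 + F) + (w - 1) * (freq z (z j) + σm) := by
    calc _ ≤ ∑ q ∈ univ.filter (fun q : Fin S => q ≠ a ∧ q ≠ b),
          ((1 + F) + if a < q ∧ q < b then freq z (z j) + σm else 0) := by
          refine Finset.sum_le_sum fun q _ => ?_
          simp only [hT]
          split_ifs
          · exact c₂
          · exact c₁
      _ = (univ.filter (fun q : Fin S => q ≠ a ∧ q ≠ b)).card * (1 + F) +
          ((univ.filter (fun q : Fin S => q ≠ a ∧ q ≠ b)).filter fun q => a < q ∧ q < b).card *
            (freq z (z j) + σm) := by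
          rw [Finset.sum_add_distrib, Finset.sum_const, smul_eq_mul, ← Finset.sum_filter,
            Finset.sum_const, smul_eq_mul]
      _ ≤ _ := by
          refine Nat.add_le_add (Nat.mul_le_mul_right _ ?_) (Nat.mul_le_mul_right _ ?_)
          · have : univ.filter (fun q : Fin S => q ≠ a ∧ q ≠ b) = (univ.erase a).erase b := by
              ext q
              simp [and_comm]
            rw [this, Finset.card_erase_of_mem (by simp [hab.ne']),
              Finset.card_erase_of_mem (Finset.mem_univ a), Finset.card_univ, Fintype.card_fin]
            omega
          · calc _ ≤ (Finset.Ioo a b).card := by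
                  refine Finset.card_le_card fun q hq => ?_
                  exact Finset.mem_Ioo.2 (Finset.mem_filter.1 hq).2
              _ ≤ w - 1 := by
                  rw [Fin.card_Ioo]
                  omega
  have hκ := hδ.injective
  -- The arguments are distinct, so each of the `t + r + k + 1` prescribed values contributes a
  -- factor `1 / |V|`.
  have hΦ := expect_ind_forall (V := V) (keys z j δ) hκ (vals i j e δ)
  have hc : Fintype.card (Option (Places t r k)) = t + r + k + 1 := by
    simp only [Fintype.card_option, Fintype.card_sum, Fintype.card_fin, add_assoc]
  rw [hc] at hΦ
  have key := le_expect_starts (z := z) hlow hup (fun g => ind (Follows z i j e δ g))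
    (fun g => ind_nonneg _) (Set.range (keys z j δ)) (fun g q u hq => ind_congr
      (forall_congr' fun o => by rw [update_of_ne fun h => hq ⟨o, h⟩])) a b hab.ne
    (leftPath i δ 0) (rightPath j δ 0) K T
    (fun q g v => Visits (g ∘ z) D j K v ∨
        ((a < q ∧ q < b) ∧ StopsWith (g ∘ z) D slot K (slot e) v)) ?_ X ?_ hX0.le
  · have e₁ : 𝔼 g, ind (Follows z i j e δ g) = (1 / Fintype.card V : ℝ) ^ (t + r + k + 1) := hΦ
    rw [e₁] at key
    rw [mul_assoc, mul_comm (_ ^ (t + r + k + 1)), ← mul_assoc]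
    simpa only [← ind_and] using key
  · intro q g v _ _ hg hbad
    have hfol := of_ind_ne_zero hg
    by_cases hq : a < q ∧ q < b
    · obtain ⟨l, hl, hf, h⟩ := freshUntil_of_visits_or (D' := D.filter fun v => slot v = slot e)
        (δ := δ) (fun u hu hs => Finset.mem_filter.2 ⟨hu, hs⟩) (hbad.imp_right And.right)
      refine ⟨l, hl, hf, ?_⟩
      simp only [hT]
      rw [if_pos hq]
      refine Finset.mem_filter.2 ⟨Finset.mem_univ _, ?_⟩
      rcases h with ⟨o, ho⟩ | h
      · cases o with
        | none => exact Or.inl (Or.inl ho.symm)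
        | some x => exact Or.inr ⟨x, ho.symm⟩
      · exact Or.inl (Or.inr h)
    · have hv : Visits (g ∘ z) D j K v := hbad.resolve_right fun h => hq h.1
      obtain ⟨l, hl, hf, h⟩ := hfol.freshUntil_of_visits hδ he hv
      refine ⟨l, hl, hf, ?_⟩
      simp only [hT]
      rw [if_neg hq]
      exact Finset.mem_filter.2 ⟨Finset.mem_univ _, h⟩
  · have h₁ : ∑ q ∈ univ.filter (fun q : Fin S => q ≠ a ∧ q ≠ b),
        (K + 2) * ((T q).card : ℝ) / Fintype.card V = (K + 2) / Fintype.card V *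
        ((∑ q ∈ univ.filter (fun q : Fin S => q ≠ a ∧ q ≠ b), (T q).card : ℕ) : ℝ) := by
      rw [Nat.cast_sum, Finset.mul_sum]
      refine Finset.sum_congr rfl fun q _ => by ring
    rw [h₁, hX]
    have h₂ : ((∑ q ∈ univ.filter (fun q : Fin S => q ≠ a ∧ q ≠ b), (T q).card : ℕ) : ℝ) ≤
        (S - 2 : ℕ) * (1 + ∑ x, (freq z (z (δ x)) : ℝ)) + (w - 1 : ℕ) * (freq z (z j) + σm) := by
      have := (Nat.cast_le (α := ℝ)).2 hcard
      rw [hF] at this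
      push_cast at this ⊢
      exact this
    have h₃ := mul_le_mul_of_nonneg_left h₂
      (by positivity : (0 : ℝ) ≤ (K + 2) / Fintype.card V)
    refine le_trans (le_of_eq ?_) (sub_le_sub_left h₃ 1)
    ring

/-- The probability that two given runs form a pattern with given data. -/
theorem le_expect_pattern {S t r k : ℕ}
    (hlow : ∀ v, 1 / (2 * Fintype.card V) ≤ 𝔼 σ, ind (st σ = v))
    (hup : ∀ v, 𝔼 σ, ind (st σ = v) ≤ 2 / Fintype.card V)
    (D : Finset V) (slot : V → ℕ) (j i : V) (hij : i ≠ j) (hz : z i = z j) (hi : 0 < t → i ∉ D)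
    (hj : 0 < r → j ∉ D) (a b : Fin S) (hab : a < b) (w : ℕ) (hw : (b : ℕ) ≤ a + w) (K σm : ℕ)
    (hσ : ∀ c, (D.filter fun v => slot v = c).card ≤ σm) (N : ℝ) (hN : ((t + r + k : ℕ) : ℝ) ≤ N)
    (h : N ^ 2 * freqSum z / (Fintype.card V : ℝ) ^ 2 + N * freq z (z j) / Fintype.card V +
      N * D.card / Fintype.card V +
      (K + 2) * (S - 2 : ℕ) / Fintype.card V * (1 + N * freqSum z / Fintype.card V) +
      (K + 2) * ((w - 1 : ℕ) * (freq z (z j) + σm)) / Fintype.card V ≤ 1 / 2) :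
    D.card / (8 * (Fintype.card V : ℝ) ^ 3) ≤ 𝔼 g, 𝔼 ω : Fin S → C,
      ind (Pattern (g ∘ z) D slot K j (st ∘ ω) a b i t r (k + 1)) := by
  classical
  set n : ℝ := (Fintype.card V : ℝ) with hn
  have hn0 : 0 < n := Nat.cast_pos.2 Fintype.card_pos
  set X : (Places t r k → V) → ℝ := fun δ =>
    1 - (K + 2) * (S - 2 : ℕ) / n * (1 + ∑ x, (freq z (z (δ x)) : ℝ)) -
        (K + 2) * ((w - 1 : ℕ) * (freq z (z j) + σm)) / n with hX
  set Ev : (Places t r k → V) × V → (A → V) → (Fin S → C) → Prop := fun p g ω =>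
    GoodPlaces z D j p.1 ∧ Follows z i j p.2 p.1 g ∧ st (ω a) = leftPath i p.1 0 ∧
      st (ω b) = rightPath j p.1 0 ∧ ∀ q, q ≠ a → q ≠ b → ¬ (Visits (g ∘ z) D j K (st (ω q)) ∨
        ((a < q ∧ q < b) ∧ StopsWith (g ∘ z) D slot K (slot p.2) (st (ω q)))) with hEv
  have hc : Fintype.card (Places t r k) = t + r + k := by
    simp only [Fintype.card_sum, Fintype.card_fin, add_assoc]
  have h₁ : 1 / 2 ≤ 𝔼 δ, ind (GoodPlaces z D j δ) * X δ := by
    refine le_expect_places z D j (GoodPlaces z D j) (fun δ h₁ h₂ h₃ => ⟨?_, h₃⟩) N _ _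
      (by rwa [hc]) (by positivity) (by positivity) h
    rintro (_ | x) (_ | y) hxy
    · rfl
    · exact absurd hxy.symm (h₂ y)
    · exact absurd hxy (h₂ x)
    · by_contra hne
      exact h₁ x y (fun he => hne (by rw [he])) hxy
  have h₂ : ∀ p ∈ (univ : Finset (Places t r k → V)) ×ˢ D,
      (1 / (2 * n)) ^ 2 * (1 / n) ^ (t + r + k + 1) * (ind (GoodPlaces z D j p.1) * X p.1) ≤
        𝔼 g, 𝔼 ω : Fin S → C, ind (Ev p g ω) := by
    rintro ⟨δ, e⟩ hp
    by_cases hδ : GoodPlaces z D j δ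
    · rw [ind_of hδ, one_mul]
      refine (le_expect_follows hlow hup D slot j i e (Finset.mem_product.1 hp).2 δ hδ a b hab w hw
        K σm hσ).trans (expect_mono' fun g => expect_mono' fun ω => ind_mono fun h => ⟨hδ, h⟩)
    · rw [ind_of_not hδ, zero_mul, mul_zero]
      exact expect_nonneg' fun g => expect_nonneg' fun ω => ind_nonneg _
  have h₃ : ∀ (g : A → V) (ω : Fin S → C), ∑ p ∈ (univ : Finset (Places t r k → V)) ×ˢ D,
      ind (Ev p g ω) ≤ ind (Pattern (g ∘ z) D slot K j (st ∘ ω) a b i t r (k + 1)) := by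
    intro g ω
    refine sum_ind_le _ _ _ (fun p hp h => ?_) fun p hp p' hp' h h' => ?_
    · exact h.2.1.pattern h.1 hab hij hz hi hj (Finset.mem_product.1 hp).2 h.2.2.1 h.2.2.2.1
        h.2.2.2.2
    · obtain ⟨e₁, e₂⟩ := h.2.1.unique h'.2.1 (h.2.2.1.symm.trans h'.2.2.1)
        (h.2.2.2.1.symm.trans h'.2.2.2.1)
      exact Prod.ext e₁ e₂
  calc D.card / (8 * n ^ 3) = D.card * ((1 / (2 * n)) ^ 2 * (1 / n)) * (1 / 2) := by
        field_simp
        norm_num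
    _ ≤ D.card * ((1 / (2 * n)) ^ 2 * (1 / n)) *
        𝔼 δ, ind (GoodPlaces z D j δ) * X δ := by
        exact mul_le_mul_of_nonneg_left h₁ (by positivity)
    -- The number `n ^ (t + r + k)` of choices of the places cancels all but one of the factors `1 /
    -- n` from the prescribed values, so the bound does not depend on the lengths.
    _ = ∑ p ∈ (univ : Finset (Places t r k → V)) ×ˢ D,
      (1 / (2 * n)) ^ 2 * (1 / n) ^ (t + r + k + 1) * (ind (GoodPlaces z D j p.1) * X p.1) := by
        rw [Finset.sum_product, Fintype.expect_eq_sum_div_card, Fintype.card_fun, hc]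
        simp only [Finset.sum_const, nsmul_eq_mul, ← Finset.mul_sum]
        rw [Nat.cast_pow, ← hn, pow_succ (1 / n), one_div_pow n]
        field_simp
    _ ≤ ∑ p ∈ (univ : Finset (Places t r k → V)) ×ˢ D, 𝔼 g, 𝔼 ω : Fin S → C, ind (Ev p g ω) :=
        Finset.sum_le_sum h₂
    _ = 𝔼 g, 𝔼 ω : Fin S → C, ∑ p ∈ (univ : Finset (Places t r k → V)) ×ˢ D, ind (Ev p g ω) := by
        simp only [Finset.expect_sum_comm]
    _ ≤ _ := expect_mono' fun g => expect_mono' fun ω => h₃ g ω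

end pattern

end ListDisjointness

/-! ### The probability of some pattern -/

namespace ListDisjointness

open Finset Function
open scoped BigOperators

section pattern

variable {A V C : Type*}

/-- Two runs form a pattern with an `i ∈ I`. -/
def HasPattern (f : V → V) (D : Finset V) (slot : V → ℕ) (K : ℕ) (j : V) (I : Finset V) {S : ℕ}
    (w : Fin S → V) : Prop :=
  ∃ a b i t r k, i ∈ I ∧ 1 ≤ k ∧ r + k ≤ K ∧ t + k ≤ K ∧ Pattern f D slot K j w a b i t r k

theorem HasPattern.visit_right {f : V → V} {D : Finset V} {slot : V → ℕ} {K : ℕ} {j : V}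
    {I : Finset V} {S : ℕ} {w : Fin S → V} (h : HasPattern f D slot K j I w) :
    ∃ q, ∃ l ≤ K, f^[l] (w q) = j := by
  obtain ⟨a, b, i, t, r, k, -, -, h₁, -, h⟩ := h
  exact ⟨b, r, by omega, h.right⟩

theorem HasPattern.visit_left {f : V → V} {D : Finset V} {slot : V → ℕ} {K : ℕ} {j : V}
    {I : Finset V} {S : ℕ} {w : Fin S → V} (h : HasPattern f D slot K j I w) :
    ∃ i ∈ I, ∃ q, ∃ l ≤ K, f^[l] (w q) = i := by
  obtain ⟨a, b, i, t, r, k, hi, -, -, h₁, h⟩ := h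
  exact ⟨i, hi, a, t, by omega, h.left⟩

/-- Success is decided by the first `K` steps of the walks. Later this shows that it does not depend
on values of the random function which the runs never use. -/
theorem HasPattern.congr {f f' : V → V} {D : Finset V} {slot : V → ℕ} {K : ℕ} {j : V}
    {I : Finset V} {S : ℕ} {w : Fin S → V} (hf : ∀ q, ∀ l ≤ K, f^[l] (w q) = f'^[l] (w q))
    (h : HasPattern f D slot K j I w) : HasPattern f' D slot K j I w := by
  obtain ⟨a, b, i, t, r, k, hi, hk, hr, ht, h⟩ := h
  have hst : ∀ q, ∀ L ≤ K, Stops f D (w q) L ↔ Stops f' D (w q) L := by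
    intro q L hL
    refine and_congr_right fun _ => and_congr (by rw [hf q L hL]) ?_
    exact forall_congr' fun y => imp_congr_right fun _ => forall_congr' fun hy => by
      rw [hf q y (by omega)]
  refine ⟨a, b, i, t, r, k, hi, hk, hr, ht, h.lt, ?_, ?_, ?_, ?_, ?_, ?_, ?_⟩
  · rw [← hf a t (by omega), h.left]
  · rw [← hf b r (by omega), h.right]
  · exact (hst a _ ht).1 h.left_stops
  · exact (hst b _ hr).1 h.right_stops
  · rw [← hf a _ ht, ← hf b _ hr, h.meet]
  · rintro q hq ⟨x, hx, hxj, hxD⟩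
    refine h.not_visits q hq ⟨x, hx, by rw [hf q x hx, hxj], fun y hy hyx => ?_⟩
    rw [hf q y (by omega)]
    exact hxD y hy hyx
  · rintro q h₁ h₂ ⟨L, hL, hs, hc⟩
    refine h.between q h₁ h₂ ⟨L, hL, (hst q L hL).2 hs, ?_⟩
    rw [hf q L hL, hf a _ ht, hc]

variable [Fintype A] [DecidableEq A] [Fintype V] [Nonempty V] [Fintype C] {z : V → A} {st : C → V}

/-- The success probability of a block of runs. -/
theorem le_expect_hasPattern {S : ℕ}
    (hlow : ∀ v, 1 / (2 * Fintype.card V) ≤ 𝔼 σ, ind (st σ = v))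
    (hup : ∀ v, 𝔼 σ, ind (st σ = v) ≤ 2 / Fintype.card V)
    (D : Finset V) (slot : V → ℕ) (j : V) (I : Finset V) (τ : ℕ) (hIj : j ∉ I)
    (hz : ∀ i ∈ I, z i = z j) (hI : 1 < τ → ∀ i ∈ I, i ∉ D) (hj : 1 < τ → j ∉ D)
    (w K σm : ℕ) (hK : 2 * τ ≤ K + 1) (hσ : ∀ c, (D.filter fun v => slot v = c).card ≤ σm)
    (P : Finset (Fin S × Fin S)) (hP : ∀ p ∈ P, p.1 < p.2 ∧ (p.2 : ℕ) ≤ p.1 + w)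
    (N : ℝ) (hN : ((3 * (τ - 1) : ℕ) : ℝ) ≤ N)
    (h : N ^ 2 * freqSum z / (Fintype.card V : ℝ) ^ 2 + N * freq z (z j) / Fintype.card V +
      N * D.card / Fintype.card V +
      (K + 2) * (S - 2 : ℕ) / Fintype.card V * (1 + N * freqSum z / Fintype.card V) +
      (K + 2) * ((w - 1 : ℕ) * (freq z (z j) + σm)) / Fintype.card V ≤ 1 / 2) :
    P.card * I.card * τ ^ 3 * D.card / (8 * (Fintype.card V : ℝ) ^ 3) ≤ 𝔼 g, 𝔼 ω : Fin S → C,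
      ind (HasPattern (g ∘ z) D slot K j I (st ∘ ω)) := by
  classical
  -- The lengths before `i`, before `j` and after both range below `τ`. So a walk has at most `2 * τ
  -- - 1 ≤ K` steps, and a pattern has at most `3 * (τ - 1)` free places.
  set T := P ×ˢ I ×ˢ (range τ ×ˢ range τ ×ˢ range τ) with hT
  have hmem : ∀ x ∈ T, x.1 ∈ P ∧ x.2.1 ∈ I ∧ x.2.2.1 < τ ∧ x.2.2.2.1 < τ ∧ x.2.2.2.2 < τ := by
    intro x hx
    simpa only [hT, Finset.mem_product, Finset.mem_range] using hx
  calc _ = ∑ _x ∈ T, (D.card / (8 * (Fintype.card V : ℝ) ^ 3) : ℝ) := by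
        rw [Finset.sum_const, nsmul_eq_mul, hT]
        simp only [Finset.card_product, Finset.card_range]
        push_cast
        ring
    _ ≤ ∑ x ∈ T, 𝔼 g, 𝔼 ω : Fin S → C, ind (Pattern (g ∘ z) D slot K j (st ∘ ω) x.1.1 x.1.2 x.2.1
          x.2.2.1 x.2.2.2.1 (x.2.2.2.2 + 1)) := by
        refine Finset.sum_le_sum fun x hx => ?_
        obtain ⟨h₁, h₂, h₃, h₄, h₅⟩ := hmem x hx
        refine le_expect_pattern hlow hup D slot j x.2.1 (fun he => hIj (he ▸ h₂)) (hz _ h₂)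
          (fun _ => hI (by omega) _ h₂) (fun _ => hj (by omega)) _ _ (hP _ h₁).1 w (hP _ h₁).2 K σm
          hσ N (le_trans (Nat.cast_le.2 (by omega)) hN) h
    _ = 𝔼 g, 𝔼 ω : Fin S → C, ∑ x ∈ T, ind (Pattern (g ∘ z) D slot K j (st ∘ ω) x.1.1 x.1.2 x.2.1
          x.2.2.1 x.2.2.2.1 (x.2.2.2.2 + 1)) := by
        simp only [Finset.expect_sum_comm]
    _ ≤ _ := by
        refine expect_mono' fun g => expect_mono' fun ω => sum_ind_le _ _ _ (fun x hx hp => ?_)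
          fun x hx x' hx' hp hp' => ?_
        · obtain ⟨h₁, h₂, h₃, h₄, h₅⟩ := hmem x hx
          exact ⟨_, _, _, _, _, _, h₂, by omega, by omega, by omega, hp⟩
        · obtain ⟨h₁, h₂, h₃, h₄, h₅⟩ := hmem x hx
          obtain ⟨h₁', h₂', h₃', h₄', h₅'⟩ := hmem x' hx'
          obtain ⟨e₁, e₂, e₃, e₄, e₅, e₆⟩ := hp.unique hp' (by omega) (by omega) (by omega)
            (by omega) (by omega) (by omega)
          obtain ⟨⟨a, b⟩, i, t, r, k⟩ := x
          obtain ⟨⟨a', b'⟩, i', t', r', k'⟩ := x'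
          simp only at e₁ e₂ e₃ e₄ e₅ e₆
          simp only [Prod.mk.injEq]
          exact ⟨⟨e₁, e₂⟩, e₃, e₄, e₅, by omega⟩

end pattern

/-! ### Answers to new queries -/

section queries

variable {A V : Type*}

/-- The `p`-th query is new and its answer is `v`. -/
def NewAnswer (Q : ℕ → (A → V) → A) (Z : (A → V) → Finset A) (tw : A → V → V) (v : V)
    (p : ℕ) (h : A → V) : Prop :=
  Q p h ∉ Z h ∧ (∀ p' < p, Q p' h ≠ Q p h) ∧ tw (Q p h) (h (Q p h)) = v

theorem exists_newAnswer {Q : ℕ → (A → V) → A} {Z : (A → V) → Finset A} {tw : A → V → V} {v : V}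
    {h : A → V} {p : ℕ} (hp : tw (Q p h) (h (Q p h)) = v) :
    (∃ a ∈ Z h, tw a (h a) = v) ∨ ∃ p' ≤ p, NewAnswer Q Z tw v p' h := by
  classical
  have hex : ∃ p, tw (Q p h) (h (Q p h)) = v := ⟨p, hp⟩
  by_cases hZ : Q (Nat.find hex) h ∈ Z h
  · exact Or.inl ⟨_, hZ, Nat.find_spec hex⟩
  · refine Or.inr ⟨Nat.find hex, Nat.find_min' hex hp, hZ, fun p' hp' he => ?_, Nat.find_spec hex⟩
    refine Nat.find_min hex hp' ?_
    rw [he]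
    exact Nat.find_spec hex

theorem expect_ind_bijective [Fintype V] {t : V → V} (ht : Bijective t) (v : V) :
    𝔼 u, ind (t u = v) = 1 / Fintype.card V := by
  rw [← expect_ind_eq v]
  exact Fintype.expect_bijective t ht _ _ fun u => rfl

variable [Fintype A] [DecidableEq A] [Fintype V] [Nonempty V]
  {Q : ℕ → (A → V) → A} {Z : (A → V) → Finset A} {tw : A → V → V}

/-- The probability that a given query is new and has the answer `v`. -/
theorem expect_newAnswer_le
    (hQ : ∀ h a u p, (∀ p' < p, Q p' h ≠ a) → Q p (update h a u) = Q p h)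
    (htw : ∀ a, Bijective (tw a)) (Φ : (A → V) → ℝ) (hΦ : ∀ h, 0 ≤ Φ h) (v : V) (p : ℕ)
    (hΦZ : ∀ h u, Φ h ≠ 0 → Q p h ∉ Z h → (∀ p' < p, Q p' h ≠ Q p h) →
      Φ (update h (Q p h) u) = Φ h ∧ Z (update h (Q p h) u) = Z h) :
    𝔼 h, Φ h * ind (NewAnswer Q Z tw v p h) ≤ 1 / Fintype.card V * 𝔼 h, Φ h := by
  set Φ' : (A → V) → ℝ := fun h => Φ h * ind (Q p h ∉ Z h ∧ ∀ p' < p, Q p' h ≠ Q p h) with hΦ'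
  have e : ∀ h, Φ h * ind (NewAnswer Q Z tw v p h) =
      Φ' h * (fun a u => ind (tw a u = v)) (Q p h) (h (Q p h)) := by
    intro h
    simp only [hΦ']
    rw [mul_assoc, ← ind_and, and_assoc]
    rfl
  simp only [e]
  refine (expect_resample_le Φ' (fun h => mul_nonneg (hΦ h) (ind_nonneg _)) (Q p) ?_
    (fun a u => ind (tw a u = v)) fun a => (expect_ind_bijective (htw a) v).le).trans
    (mul_le_mul_of_nonneg_left (expect_mono' fun h => ?_) (by positivity))
  · intro h u hne
    have h₁ := left_ne_zero_of_mul hne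
    have h₂ := of_ind_ne_zero (right_ne_zero_of_mul hne)
    obtain ⟨e₁, e₂⟩ := hΦZ h u h₁ h₂.1 h₂.2
    have e₃ : ∀ p' ≤ p, Q p' (update h (Q p h) u) = Q p' h := fun p' hp' =>
      hQ h _ u p' fun p'' hp'' => h₂.2 p'' (by omega)
    refine ⟨e₃ p le_rfl, ?_⟩
    simp only [hΦ']
    rw [e₁, e₂, e₃ p le_rfl]
    congr 1
    refine ind_congr (and_congr_right fun _ => forall₂_congr fun p' hp' => ?_)
    rw [e₃ p' (by omega)]
  · exact mul_le_of_le_one_right (hΦ h) (ind_le_one _)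

theorem expect_exists_newAnswer_le
    (hQ : ∀ h a u p, (∀ p' < p, Q p' h ≠ a) → Q p (update h a u) = Q p h)
    (htw : ∀ a, Bijective (tw a)) (Φ : (A → V) → ℝ) (hΦ : ∀ h, 0 ≤ Φ h) (v : V)
    (hΦZ : ∀ h a u, a ∉ Z h → Φ (update h a u) = Φ h ∧ Z (update h a u) = Z h) (L : ℕ) :
    𝔼 h, Φ h * ind (∃ p ∈ range L, NewAnswer Q Z tw v p h) ≤ L / Fintype.card V * 𝔼 h, Φ h := by
  calc _ ≤ 𝔼 h, ∑ p ∈ range L, Φ h * ind (NewAnswer Q Z tw v p h) := by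
        refine expect_mono' fun h => ?_
        rw [← Finset.mul_sum]
        exact mul_le_mul_of_nonneg_left (ind_exists_le _ _) (hΦ h)
    _ = ∑ p ∈ range L, 𝔼 h, Φ h * ind (NewAnswer Q Z tw v p h) := Finset.expect_sum_comm _ _ _
    _ ≤ ∑ _p ∈ range L, 1 / Fintype.card V * 𝔼 h, Φ h := Finset.sum_le_sum fun p _ =>
        expect_newAnswer_le hQ htw Φ hΦ v p fun h u _ hZ _ => hΦZ h _ u hZ
    _ = _ := by
        rw [Finset.sum_const, nsmul_eq_mul, Finset.card_range]
        ring

/-- One query cannot have both answers, as `v ≠ v'`. For two different queries, the bound for one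
answer is applied first to the later query, with the event about the earlier query put into the
weight, and then to the earlier one. -/
theorem expect_exists_newAnswer₂_le
    (hQ : ∀ h a u p, (∀ p' < p, Q p' h ≠ a) → Q p (update h a u) = Q p h)
    (htw : ∀ a, Bijective (tw a)) (Φ : (A → V) → ℝ) (hΦ : ∀ h, 0 ≤ Φ h) {v v' : V} (hv : v ≠ v')
    (hΦZ : ∀ h a u, a ∉ Z h → Φ (update h a u) = Φ h ∧ Z (update h a u) = Z h) (L : ℕ) :
    𝔼 h, Φ h * (ind (∃ p ∈ range L, NewAnswer Q Z tw v p h) *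
      ind (∃ p ∈ range L, NewAnswer Q Z tw v' p h)) ≤
      (L / Fintype.card V) ^ 2 * 𝔼 h, Φ h := by
  have hP : 0 ≤ 𝔼 h, Φ h := expect_nonneg' hΦ
  have pair : ∀ (v v' : V) (p p' : ℕ), p < p' → 𝔼 h, Φ h * (ind (NewAnswer Q Z tw v p h) *
      ind (NewAnswer Q Z tw v' p' h)) ≤ (1 / Fintype.card V) ^ 2 * 𝔼 h, Φ h := by
    intro v v' p p' hlt
    calc 𝔼 h, Φ h * (ind (NewAnswer Q Z tw v p h) * ind (NewAnswer Q Z tw v' p' h))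
        = 𝔼 h, (Φ h * ind (NewAnswer Q Z tw v p h)) * ind (NewAnswer Q Z tw v' p' h) := by
          simp only [mul_assoc]
      _ ≤ 1 / Fintype.card V * 𝔼 h, Φ h * ind (NewAnswer Q Z tw v p h) := by
          refine expect_newAnswer_le hQ htw _ (fun h => mul_nonneg (hΦ h) (ind_nonneg _)) v' p'
            fun h u _ hZ hne => ?_
          obtain ⟨e₁, e₂⟩ := hΦZ h _ u hZ
          refine ⟨?_, e₂⟩
          have e₃ : ∀ x ≤ p, Q x (update h (Q p' h) u) = Q x h := fun x hx =>
            hQ h _ u x fun x' hx' => hne x' (by omega)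
          rw [e₁]
          congr 1
          refine ind_congr ?_
          unfold NewAnswer
          rw [e₂, e₃ p le_rfl, update_of_ne (hne p hlt)]
          refine and_congr_right fun _ => and_congr_left fun _ => forall₂_congr fun x hx => ?_
          rw [e₃ x (by omega)]
      _ ≤ 1 / Fintype.card V * (1 / Fintype.card V * 𝔼 h, Φ h) := by
          refine mul_le_mul_of_nonneg_left ?_ (by positivity)
          exact expect_newAnswer_le hQ htw Φ hΦ v p fun h u _ hZ _ => hΦZ h _ u hZ
      _ = _ := by ring
  have same : ∀ p h, Φ h * (ind (NewAnswer Q Z tw v p h) * ind (NewAnswer Q Z tw v' p h)) = 0 := by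
    intro p h
    rw [← ind_and, ind_of_not, mul_zero]
    rintro ⟨h₁, h₂⟩
    exact hv (h₁.2.2.symm.trans h₂.2.2)
  calc _ ≤ 𝔼 h, ∑ p ∈ range L, ∑ p' ∈ range L,
        Φ h * (ind (NewAnswer Q Z tw v p h) * ind (NewAnswer Q Z tw v' p' h)) := by
        refine expect_mono' fun h => ?_
        simp only [← Finset.mul_sum]
        rw [← Finset.sum_mul]
        refine mul_le_mul_of_nonneg_left ?_ (hΦ h)
        exact mul_le_mul (ind_exists_le _ _) (ind_exists_le _ _) (ind_nonneg _)
          (Finset.sum_nonneg fun _ _ => ind_nonneg _)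
    _ = ∑ p ∈ range L, ∑ p' ∈ range L, 𝔼 h,
        Φ h * (ind (NewAnswer Q Z tw v p h) * ind (NewAnswer Q Z tw v' p' h)) := by
        simp only [Finset.expect_sum_comm]
    _ ≤ ∑ _p ∈ range L, ∑ _p' ∈ range L, (1 / Fintype.card V) ^ 2 * 𝔼 h, Φ h := by
        refine Finset.sum_le_sum fun p _ => Finset.sum_le_sum fun p' _ => ?_
        rcases lt_trichotomy p p' with hlt | rfl | hlt
        · exact pair v v' p p' hlt
        · simp only [same, Finset.expect_const_zero]
          positivity
        · have := pair v' v p' p hlt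
          simpa only [mul_comm (ind (NewAnswer Q Z tw v' p' _))] using this
    _ = _ := by
        simp only [Finset.sum_const, nsmul_eq_mul, Finset.card_range]
        ring

end queries

end ListDisjointness

/-! # Two runs with the same random function -/

namespace ListDisjointness

open Finset Function
open scoped BigOperators

section expect

theorem expect_prod {X Y : Type*} [Fintype X] [Fintype Y] (f : X → Y → ℝ) :
    𝔼 β : X × Y, f β.1 β.2 = 𝔼 x, 𝔼 y, f x y := by
  rw [← Finset.univ_product_univ]
  exact Finset.expect_product' univ univ f

theorem expect_prod_mul {X Y : Type*} [Fintype X] [Fintype Y] (f : X → ℝ) (g : Y → ℝ) :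
    𝔼 β : X × Y, f β.1 * g β.2 = (𝔼 x, f x) * 𝔼 y, g y := by
  rw [expect_prod fun x y => f x * g y]
  simp only [← Finset.mul_expect, ← Finset.expect_mul]

theorem expect_fst {X Y : Type*} [Fintype X] [Fintype Y] [Nonempty Y] (f : X → ℝ) :
    𝔼 β : X × Y, f β.1 = 𝔼 x, f x := by
  have := expect_prod_mul (Y := Y) f fun _ => 1
  simpa using this

theorem expect_snd {X Y : Type*} [Fintype X] [Fintype Y] [Nonempty X] (f : Y → ℝ) :
    𝔼 β : X × Y, f β.2 = 𝔼 y, f y := by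
  have := expect_prod_mul (X := X) (fun _ => 1) f
  simpa using this

end expect

section base

variable {A V C Θ : Type*} {S : ℕ}

/-- A value that does not need a new query: a start, or an answer to an old query. -/
def Known (tw : Θ → A → V → V) (st : C → V) (Z : Finset A) (h : A → V) (v : V)
    (β : Θ × (Fin S → C)) : Prop :=
  (∃ q, st (β.2 q) = v) ∨ ∃ a ∈ Z, tw β.1 a (h a) = v

variable [Fintype V] [Fintype C] [Fintype Θ] {tw : Θ → A → V → V} {st : C → V}

theorem expect_exists_start_le [Nonempty C] (hup : ∀ v, 𝔼 σ, ind (st σ = v) ≤ 2 / Fintype.card V) (v : V) :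
    𝔼 ω : Fin S → C, ind (∃ q, st (ω q) = v) ≤ 2 * S / Fintype.card V := by
  calc _ ≤ 𝔼 ω : Fin S → C, ∑ q, ind (st (ω q) = v) := by
        refine expect_mono' fun ω => ?_
        refine le_trans (ind_mono fun h => ?_) (ind_exists_le univ fun q => st (ω q) = v)
        obtain ⟨q, hq⟩ := h
        exact ⟨q, Finset.mem_univ q, hq⟩
    _ = ∑ q, 𝔼 ω : Fin S → C, ind (st (ω q) = v) := Finset.expect_sum_comm _ _ _
    _ ≤ ∑ _q : Fin S, (2 / Fintype.card V : ℝ) := by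
        refine Finset.sum_le_sum fun q _ => ?_
        rw [expect_apply q fun σ => ind (st σ = v)]
        exact hup v
    _ = _ := by
        rw [Finset.sum_const, nsmul_eq_mul, Finset.card_univ, Fintype.card_fin]
        ring

theorem expect_exists_start₂_le [Nonempty C] (hup : ∀ v, 𝔼 σ, ind (st σ = v) ≤ 2 / Fintype.card V) {v v' : V}
    (hv : v ≠ v') : 𝔼 ω : Fin S → C, ind (∃ q, st (ω q) = v) * ind (∃ q, st (ω q) = v') ≤
      (2 * S / Fintype.card V) ^ 2 := by
  have hex : ∀ (ω : Fin S → C) v, ind (∃ q, st (ω q) = v) ≤ ∑ q, ind (st (ω q) = v) := by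
    intro ω v
    refine le_trans (ind_mono fun h => ?_) (ind_exists_le univ fun q => st (ω q) = v)
    obtain ⟨q, hq⟩ := h
    exact ⟨q, Finset.mem_univ q, hq⟩
  calc _ ≤ 𝔼 ω : Fin S → C, ∑ q, ∑ q', ind (st (ω q) = v) * ind (st (ω q') = v') := by
        refine expect_mono' fun ω => ?_
        rw [← Finset.sum_mul_sum]
        exact mul_le_mul (hex ω v) (hex ω v') (ind_nonneg _)
          (Finset.sum_nonneg fun _ _ => ind_nonneg _)
    _ = ∑ q, ∑ q', 𝔼 ω : Fin S → C, ind (st (ω q) = v) * ind (st (ω q') = v') := by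
        simp only [Finset.expect_sum_comm]
    _ ≤ ∑ _q : Fin S, ∑ _q' : Fin S, (2 / Fintype.card V : ℝ) ^ 2 := by
        refine Finset.sum_le_sum fun q _ => Finset.sum_le_sum fun q' _ => ?_
        by_cases hq : q = q'
        · subst hq
          have : ∀ ω : Fin S → C, ind (st (ω q) = v) * ind (st (ω q) = v') = 0 := by
            intro ω
            rw [← ind_and, ind_of_not]
            rintro ⟨h₁, h₂⟩
            exact hv (h₁.symm.trans h₂)
          simp only [this, Finset.expect_const_zero]
          positivity
        · rw [expect_apply₂ hq (fun σ => ind (st σ = v)) fun σ => ind (st σ = v'), sq]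
          exact mul_le_mul (hup v) (hup v') (expect_nonneg' fun _ => ind_nonneg _) (by positivity)
    _ = _ := by
        simp only [Finset.sum_const, nsmul_eq_mul, Finset.card_univ, Fintype.card_fin]
        ring

theorem expect_exists_old_le {c : ℝ} (h₁ : ∀ a u v, 𝔼 θ, ind (tw θ a u = v) ≤ c / Fintype.card V)
    (Z : Finset A) (h : A → V) (v : V) :
    𝔼 θ, ind (∃ a ∈ Z, tw θ a (h a) = v) ≤ c * Z.card / Fintype.card V := by
  calc _ ≤ 𝔼 θ, ∑ a ∈ Z, ind (tw θ a (h a) = v) := expect_mono' fun θ => ind_exists_le _ _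
    _ = ∑ a ∈ Z, 𝔼 θ, ind (tw θ a (h a) = v) := Finset.expect_sum_comm _ _ _
    _ ≤ ∑ _a ∈ Z, (c / Fintype.card V : ℝ) := Finset.sum_le_sum fun a _ => h₁ _ _ _
    _ = _ := by
        rw [Finset.sum_const, nsmul_eq_mul]
        ring

theorem expect_exists_old₂_le {c : ℝ} (h₂ : ∀ a a' u u' v v', a ≠ a' →
      𝔼 θ, ind (tw θ a u = v ∧ tw θ a' u' = v') ≤ (c / Fintype.card V) ^ 2)
    (Z : Finset A) (h : A → V) {v v' : V} (hv : v ≠ v') :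
    𝔼 θ, ind (∃ a ∈ Z, tw θ a (h a) = v) * ind (∃ a ∈ Z, tw θ a (h a) = v') ≤
      (c * Z.card / Fintype.card V) ^ 2 := by
  calc _ ≤ 𝔼 θ, ∑ a ∈ Z, ∑ a' ∈ Z, ind (tw θ a (h a) = v) * ind (tw θ a' (h a') = v') := by
        refine expect_mono' fun θ => ?_
        rw [← Finset.sum_mul_sum]
        exact mul_le_mul (ind_exists_le _ _) (ind_exists_le _ _) (ind_nonneg _)
          (Finset.sum_nonneg fun _ _ => ind_nonneg _)
    _ = ∑ a ∈ Z, ∑ a' ∈ Z, 𝔼 θ, ind (tw θ a (h a) = v) * ind (tw θ a' (h a') = v') := by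
        simp only [Finset.expect_sum_comm]
    _ ≤ ∑ _a ∈ Z, ∑ _a' ∈ Z, (c / Fintype.card V : ℝ) ^ 2 := by
        refine Finset.sum_le_sum fun a _ => Finset.sum_le_sum fun a' _ => ?_
        simp only [← ind_and]
        by_cases ha : a = a'
        · subst ha
          have : ∀ θ, ind (tw θ a (h a) = v ∧ tw θ a (h a) = v') = 0 := fun θ =>
            ind_of_not fun h => hv (h.1.symm.trans h.2)
          simp only [this, Finset.expect_const_zero]
          positivity
        · exact h₂ _ _ _ _ _ _ ha
    _ = _ := by
        simp only [Finset.sum_const, nsmul_eq_mul]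
        ring

variable [Nonempty C] [Nonempty Θ]

theorem expect_known_le (hup : ∀ v, 𝔼 σ, ind (st σ = v) ≤ 2 / Fintype.card V) {c : ℝ}
    (h₁ : ∀ a u v, 𝔼 θ, ind (tw θ a u = v) ≤ c / Fintype.card V)
    (Z : Finset A) (h : A → V) (v : V) :
    𝔼 β, ind (Known (S := S) tw st Z h v β) ≤ (2 * S + c * Z.card) / Fintype.card V := by
  calc _ ≤ 𝔼 β : Θ × (Fin S → C), (ind (∃ q, st (β.2 q) = v) +
        ind (∃ a ∈ Z, tw β.1 a (h a) = v)) := expect_mono' fun β => ind_or_le _ _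
    _ ≤ 2 * S / Fintype.card V + c * Z.card / Fintype.card V := by
        rw [Finset.expect_add_distrib, expect_snd fun ω : Fin S → C => ind (∃ q, st (ω q) = v),
          expect_fst fun θ => ind (∃ a ∈ Z, tw θ a (h a) = v)]
        exact add_le_add (expect_exists_start_le hup v) (expect_exists_old_le h₁ Z h v)
    _ = _ := by ring

/-- Starts are independent of the twist, so the mixed terms factor. The term with two old arguments
is where the near pairwise independence of the twist enters; a single old argument cannot give both
`v` and `v'`. -/
theorem expect_known₂_le (hup : ∀ v, 𝔼 σ, ind (st σ = v) ≤ 2 / Fintype.card V) {c : ℝ}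
    (hc : 0 ≤ c) (h₁ : ∀ a u v, 𝔼 θ, ind (tw θ a u = v) ≤ c / Fintype.card V)
    (h₂ : ∀ a a' u u' v v', a ≠ a' →
      𝔼 θ, ind (tw θ a u = v ∧ tw θ a' u' = v') ≤ (c / Fintype.card V) ^ 2)
    (Z : Finset A) (h : A → V) {v v' : V} (hv : v ≠ v') :
    𝔼 β, ind (Known (S := S) tw st Z h v β) * ind (Known tw st Z h v' β) ≤
      ((2 * S + c * Z.card) / Fintype.card V) ^ 2 := by
  set s : V → (Fin S → C) → ℝ := fun v ω => ind (∃ q, st (ω q) = v) with hs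
  set o : V → Θ → ℝ := fun v θ => ind (∃ a ∈ Z, tw θ a (h a) = v) with ho
  have hs0 : ∀ v, 0 ≤ 𝔼 ω, s v ω := fun v => expect_nonneg' fun ω => ind_nonneg _
  have ho0 : ∀ v, 0 ≤ 𝔼 θ, o v θ := fun v => expect_nonneg' fun ω => ind_nonneg _
  calc _ ≤ 𝔼 β : Θ × (Fin S → C), (s v β.2 * s v' β.2 + o v' β.1 * s v β.2 +
        o v β.1 * s v' β.2 + o v β.1 * o v' β.1) := by
        refine expect_mono' fun β => ?_
        refine (mul_le_mul (ind_or_le _ _) (ind_or_le _ _) (ind_nonneg _)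
          (add_nonneg (ind_nonneg _) (ind_nonneg _))).trans (le_of_eq ?_)
        simp only [hs, ho]
        ring
    _ = 𝔼 ω, s v ω * s v' ω + (𝔼 θ, o v' θ) * 𝔼 ω, s v ω + (𝔼 θ, o v θ) * 𝔼 ω, s v' ω +
        𝔼 θ, o v θ * o v' θ := by
        rw [Finset.expect_add_distrib, Finset.expect_add_distrib, Finset.expect_add_distrib,
          expect_snd fun ω => s v ω * s v' ω, expect_fst fun θ => o v θ * o v' θ, expect_prod_mul,
          expect_prod_mul]
    _ ≤ (2 * S / Fintype.card V) ^ 2 + c * Z.card / Fintype.card V * (2 * S / Fintype.card V) +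
        c * Z.card / Fintype.card V * (2 * S / Fintype.card V) +
        (c * Z.card / Fintype.card V) ^ 2 := by
        have hS : (0 : ℝ) ≤ c * Z.card / Fintype.card V := by positivity
        refine add_le_add (add_le_add (add_le_add ?_ ?_) ?_) ?_
        · exact expect_exists_start₂_le hup hv
        · exact mul_le_mul (expect_exists_old_le h₁ Z h v') (expect_exists_start_le hup v)
            (hs0 v) hS
        · exact mul_le_mul (expect_exists_old_le h₁ Z h v) (expect_exists_start_le hup v')
            (hs0 v') hS
        · exact expect_exists_old₂_le h₂ Z h hv
    _ = _ := by ring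

end base

theorem expect_mul_le_of_forall {X Y : Type*} [Fintype X] [Fintype Y] (Φ : X → ℝ) (hΦ : ∀ h, 0 ≤ Φ h)
    (f : X → Y → ℝ) {B : ℝ} (hf : ∀ h, 𝔼 β, f h β ≤ B) :
    𝔼 β, 𝔼 h, Φ h * f h β ≤ B * 𝔼 h, Φ h := by
  rw [Finset.expect_comm, Finset.mul_expect]
  refine expect_mono' fun h => ?_
  rw [← Finset.mul_expect, mul_comm]
  exact mul_le_mul_of_nonneg_right (hf h) (hΦ h)

section visit

variable {A V C Θ : Type*} {S : ℕ}

/-- The random function of a block of runs. -/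
def twist (tw : Θ → A → V → V) (θ : Θ) (h : A → V) (a : A) : V := tw θ a (h a)

/-- A block of runs visits `v`. -/
def BlockVisits (tw : Θ → A → V → V) (st : C → V) (z : V → A) (K : ℕ) (h : A → V) (v : V)
    (β : Θ × (Fin S → C)) : Prop :=
  ∃ q, ∃ l ≤ K, (twist tw β.1 h ∘ z)^[l] (st (β.2 q)) = v

theorem twist_update [DecidableEq A] (tw : Θ → A → V → V) (θ : Θ) (h : A → V) (a : A) (u : V) :
    twist tw θ (update h a u) = update (twist tw θ h) a (tw θ a u) := by
  funext x
  by_cases hx : x = a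
  · subst hx
    simp [twist]
  · simp [twist, hx]

variable [Nonempty V]

/-- The queries of a block of runs, in their order. -/
noncomputable def blockQuery (tw : Θ → A → V → V) (st : C → V) (z : V → A) (K : ℕ)
    (β : Θ × (Fin S → C)) (p : ℕ) (h : A → V) : A :=
  if hp : p / K < S then z ((twist tw β.1 h ∘ z)^[p % K] (st (β.2 ⟨p / K, hp⟩)))
  else z (Classical.arbitrary V)

variable {tw : Θ → A → V → V} {st : C → V} {z : V → A} {K : ℕ}

theorem blockQuery_mul_add (β : Θ × (Fin S → C)) (h : A → V) (q : Fin S) {l : ℕ} (hl : l < K) :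
    blockQuery tw st z K β (K * q + l) h = z ((twist tw β.1 h ∘ z)^[l] (st (β.2 q))) := by
  have e₁ : (K * q + l) / K = q := by
    rw [Nat.mul_add_div (by omega), Nat.div_eq_of_lt hl, add_zero]
  have e₂ : (K * q + l) % K = l := by
    rw [Nat.mul_add_mod, Nat.mod_eq_of_lt hl]
  have hq : (K * q + l) / K < S := by omega
  have e₃ : (⟨(K * q + l) / K, hq⟩ : Fin S) = q := Fin.ext e₁
  rw [blockQuery, dif_pos hq, e₂, e₃]

/-- The queries are adaptive: each one depends on `h` only through the answers to the earlier ones.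
Here it is enough to look at the earlier queries of the same run. -/
theorem blockQuery_update [DecidableEq A] (hK : 0 < K) (β : Θ × (Fin S → C)) (h : A → V) (a : A)
    (u : V) (p : ℕ) (hp : ∀ p' < p, blockQuery tw st z K β p' h ≠ a) :
    blockQuery tw st z K β p (update h a u) = blockQuery tw st z K β p h := by
  by_cases hq : p / K < S
  · have hmod := Nat.mod_lt p hK
    have e : p = K * (⟨p / K, hq⟩ : Fin S) + p % K := (Nat.div_add_mod p K).symm
    rw [e, blockQuery_mul_add _ _ _ hmod, blockQuery_mul_add _ _ _ hmod, twist_update,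
      iterate_update _ _ _ _ (p % K) (fun x hx => ?_) _ le_rfl]
    rw [← blockQuery_mul_add (tw := tw) (st := st) (z := z) β h _ (hx.trans hmod)]
    exact hp _ (by omega)
  · rw [blockQuery, blockQuery, dif_neg hq, dif_neg hq]

theorem BlockVisits.known_or_new {β : Θ × (Fin S → C)} {h : A → V} {v : V}
    (hv : BlockVisits tw st z K h v β) (Z : (A → V) → Finset A) : Known tw st (Z h) h v β ∨
      ∃ p ∈ range (K * S), NewAnswer (blockQuery tw st z K β) Z (tw β.1) v p h := by
  obtain ⟨q, l, hl, hv⟩ := hv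
  cases l with
  | zero => exact Or.inl (Or.inl ⟨q, hv⟩)
  | succ l =>
    rw [iterate_succ_apply', comp_apply, ← blockQuery_mul_add (tw := tw) (st := st) (z := z) β h q hl] at hv
    rcases exists_newAnswer (Z := Z) (tw := tw β.1) hv with h' | ⟨p, hp, h'⟩
    · exact Or.inl (Or.inr h')
    · refine Or.inr ⟨p, Finset.mem_range.2 ?_, h'⟩
      have h₁ : K * (q + 1) ≤ K * S := Nat.mul_le_mul_left K q.2
      rw [Nat.mul_succ] at h₁
      omega

variable [Fintype A] [DecidableEq A] [Fintype V] [Fintype C] [Nonempty C] [Fintype Θ] [Nonempty Θ]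

/-- A second block of runs rarely visits `v`, whatever the first one does. -/
theorem expect_blockVisits_le (hK : 0 < K)
    (hup : ∀ v, 𝔼 σ, ind (st σ = v) ≤ 2 / Fintype.card V) {c : ℝ} (hc : 0 ≤ c)
    (htw : ∀ θ a, Bijective (tw θ a))
    (h₁ : ∀ a u v, 𝔼 θ, ind (tw θ a u = v) ≤ c / Fintype.card V)
    (Φ : (A → V) → ℝ) (hΦ : ∀ h, 0 ≤ Φ h) (Z : (A → V) → Finset A) {L : ℕ}
    (hL : ∀ h, (Z h).card ≤ L)
    (hΦZ : ∀ h a u, a ∉ Z h → Φ (update h a u) = Φ h ∧ Z (update h a u) = Z h)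
    (v : V) :
    𝔼 β : Θ × (Fin S → C), 𝔼 h, Φ h * ind (BlockVisits tw st z K h v β) ≤
      ((2 * S + c * L) / Fintype.card V + (K * S : ℕ) / Fintype.card V) * 𝔼 h, Φ h := by
  have hP : 0 ≤ 𝔼 h, Φ h := expect_nonneg' hΦ
  calc _ ≤ 𝔼 β : Θ × (Fin S → C), (𝔼 h, Φ h * ind (Known tw st (Z h) h v β) +
        𝔼 h, Φ h * ind (∃ p ∈ range (K * S),
          NewAnswer (blockQuery tw st z K β) Z (tw β.1) v p h)) := by
        refine expect_mono' fun β => ?_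
        rw [← Finset.expect_add_distrib]
        refine expect_mono' fun h => ?_
        rw [← mul_add]
        exact mul_le_mul_of_nonneg_left
          ((ind_mono fun hv => hv.known_or_new Z).trans (ind_or_le _ _)) (hΦ h)
    _ ≤ (2 * S + c * L) / Fintype.card V * 𝔼 h, Φ h +
        𝔼 _β : Θ × (Fin S → C), (K * S : ℕ) / Fintype.card V * 𝔼 h, Φ h := by
        rw [Finset.expect_add_distrib]
        refine add_le_add (expect_mul_le_of_forall Φ hΦ _ fun h => ?_) (expect_mono' fun β => ?_)
        · refine (expect_known_le hup h₁ _ h v).trans ?_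
          have : ((Z h).card : ℝ) ≤ L := Nat.cast_le.2 (hL h)
          gcongr
        · exact expect_exists_newAnswer_le (blockQuery_update hK β) (htw β.1) Φ hΦ v hΦZ _
    _ = _ := by
        rw [Fintype.expect_const]
        ring

/-- Each of the two visits is either a known value or the answer to a new query, so there are four
terms, which add up to a square. In the mixed terms the event about the known value depends only on
`h` within `Z` and can be absorbed into the weight `Φ`. -/
theorem expect_blockVisits₂_le (hK : 0 < K)
    (hup : ∀ v, 𝔼 σ, ind (st σ = v) ≤ 2 / Fintype.card V) {c : ℝ} (hc : 0 ≤ c)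
    (htw : ∀ θ a, Bijective (tw θ a))
    (h₁ : ∀ a u v, 𝔼 θ, ind (tw θ a u = v) ≤ c / Fintype.card V)
    (h₂ : ∀ a a' u u' v v', a ≠ a' →
      𝔼 θ, ind (tw θ a u = v ∧ tw θ a' u' = v') ≤ (c / Fintype.card V) ^ 2)
    (Φ : (A → V) → ℝ) (hΦ : ∀ h, 0 ≤ Φ h) (Z : (A → V) → Finset A) {L : ℕ}
    (hL : ∀ h, (Z h).card ≤ L)
    (hΦZ : ∀ h a u, a ∉ Z h → Φ (update h a u) = Φ h ∧ Z (update h a u) = Z h)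
    {v v' : V} (hv : v ≠ v') :
    𝔼 β : Θ × (Fin S → C), 𝔼 h, Φ h * (ind (BlockVisits tw st z K h v β) *
        ind (BlockVisits tw st z K h v' β)) ≤
      ((2 * S + c * L) / Fintype.card V + (K * S : ℕ) / Fintype.card V) ^ 2 * 𝔼 h, Φ h := by
  have hP : 0 ≤ 𝔼 h, Φ h := expect_nonneg' hΦ
  set kn : V → (A → V) → Θ × (Fin S → C) → ℝ := fun v h β => ind (Known tw st (Z h) h v β)
    with hkn
  set nw : V → (A → V) → Θ × (Fin S → C) → ℝ := fun v h β => ind (∃ p ∈ range (K * S),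
          NewAnswer (blockQuery tw st z K β) Z (tw β.1) v p h) with hnw
  set B : ℝ := (2 * S + c * L) / Fintype.card V with hB
  set F : ℝ := (K * S : ℕ) / Fintype.card V with hF
  have hF0 : 0 ≤ F := by positivity
  have hknΦ : ∀ v v' β, 𝔼 h, Φ h * (kn v h β * nw v' h β) ≤ F * 𝔼 h, Φ h * kn v h β := by
    intro v v' β
    simp only [← mul_assoc]
    refine expect_exists_newAnswer_le (blockQuery_update hK β) (htw β.1) _
      (fun h => mul_nonneg (hΦ h) (ind_nonneg _)) _ (fun h a u ha => ?_) _
    obtain ⟨e₁, e₂⟩ := hΦZ h a u ha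
    refine ⟨?_, e₂⟩
    rw [e₁, e₂]
    congr 1
    refine ind_congr (or_congr_right (exists_congr fun x => and_congr_right fun hx => ?_))
    rw [update_of_ne fun hxa : x = a => ha (hxa ▸ hx)]
  have hle : ∀ h : A → V, (2 * S + c * (Z h).card) / Fintype.card V ≤ B := by
    intro h
    have : ((Z h).card : ℝ) ≤ L := Nat.cast_le.2 (hL h)
    rw [hB]
    gcongr
  have hkn₁ : ∀ v, 𝔼 β, 𝔼 h, Φ h * kn v h β ≤ B * 𝔼 h, Φ h := fun v =>
    expect_mul_le_of_forall Φ hΦ _ fun h => (expect_known_le hup h₁ _ h v).trans (hle h)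
  have hkn₂ : 𝔼 β, 𝔼 h, Φ h * (kn v h β * kn v' h β) ≤ B ^ 2 * 𝔼 h, Φ h :=
    expect_mul_le_of_forall Φ hΦ _ fun h => (expect_known₂_le hup hc h₁ h₂ _ h hv).trans
      (pow_le_pow_left₀ (by positivity) (hle h) 2)
  have hmix : ∀ v v', 𝔼 β, 𝔼 h, Φ h * (kn v h β * nw v' h β) ≤ F * (B * 𝔼 h, Φ h) := by
    intro v v'
    refine (expect_mono' fun β => hknΦ v v' β).trans ?_
    rw [← Finset.mul_expect]
    exact mul_le_mul_of_nonneg_left (hkn₁ v) hF0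
  calc _ ≤ 𝔼 β : Θ × (Fin S → C), 𝔼 h, (Φ h * (kn v h β * kn v' h β) +
        Φ h * (kn v h β * nw v' h β) + Φ h * (kn v' h β * nw v h β) +
        Φ h * (nw v h β * nw v' h β)) := by
        refine expect_mono' fun β => expect_mono' fun h => ?_
        have hle : ∀ v, ind (BlockVisits tw st z K h v β) ≤ kn v h β + nw v h β := fun v =>
          (ind_mono fun hv => hv.known_or_new Z).trans (ind_or_le _ _)
        have := mul_le_mul_of_nonneg_left (mul_le_mul (hle v) (hle v') (ind_nonneg _)
          (add_nonneg (ind_nonneg _) (ind_nonneg _))) (hΦ h)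
        refine this.trans (le_of_eq ?_)
        ring
    _ = 𝔼 β, 𝔼 h, Φ h * (kn v h β * kn v' h β) + 𝔼 β, 𝔼 h, Φ h * (kn v h β * nw v' h β) +
        𝔼 β, 𝔼 h, Φ h * (kn v' h β * nw v h β) +
        𝔼 β, 𝔼 h, Φ h * (nw v h β * nw v' h β) := by
        simp only [Finset.expect_add_distrib]
    _ ≤ B ^ 2 * 𝔼 h, Φ h + F * (B * 𝔼 h, Φ h) + F * (B * 𝔼 h, Φ h) +
        𝔼 _β : Θ × (Fin S → C), F ^ 2 * 𝔼 h, Φ h := by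
        refine add_le_add (add_le_add (add_le_add hkn₂ (hmix v v')) (hmix v' v))
          (expect_mono' fun β => ?_)
        exact expect_exists_newAnswer₂_le (blockQuery_update hK β) (htw β.1) Φ hΦ hv hΦZ _
    _ = _ := by
        rw [Fintype.expect_const]
        ring

end visit

end ListDisjointness

/-! # Independent blocks of runs with the same random function -/

namespace ListDisjointness

open Finset Function
open scoped BigOperators

section rounds

variable {H B : Type*} [Fintype H] [Fintype B]

/-- The second moment method: a lower bound for the probability that one of `R` independent blocks
succeeds. -/
theorem le_expect_exists_of_sq_le [Nonempty B] (P : B → H → Prop) {c : ℝ} (hc : 0 ≤ c)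
    (h : 𝔼 h, (𝔼 β, ind (P β h)) ^ 2 ≤ c * 𝔼 h, 𝔼 β, ind (P β h)) (R : ℕ) :
    R * (𝔼 h, 𝔼 β, ind (P β h)) / (1 + R * c) ≤
      𝔼 h, 𝔼 β : Fin R → B, ind (∃ i, P (β i) h) := by
  classical
  set Y : H → ℝ := fun h => 𝔼 β, ind (P β h) with hY
  have hY0 : ∀ h, 0 ≤ Y h := fun h => expect_nonneg' fun β => ind_nonneg _
  set E := 𝔼 h, Y h with hE
  have hE0 : 0 ≤ E := expect_nonneg' hY0
  -- If `X` counts the successful blocks, then the indicator of `X > 0` is at least `2lX - l²X²`,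
  -- because `(1 - lX)² ≥ 0`. This `l` maximises the resulting lower bound.
  set l : ℝ := 1 / (1 + R * c) with hl
  have hRc : 0 < 1 + R * c := by positivity
  have hl0 : 0 ≤ l := by positivity
  have h₁ : ∀ h, 2 * l * (R * Y h) - l ^ 2 * (R * Y h + (R * Y h) ^ 2) ≤
      𝔼 β : Fin R → B, ind (∃ i, P (β i) h) := by
    intro h
    have e₁ : ∀ β : Fin R → B, 2 * l * (∑ i, ind (P (β i) h)) -
        l ^ 2 * (∑ i, ∑ i', ind (P (β i) h) * ind (P (β i') h)) ≤ ind (∃ i, P (β i) h) := by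
      intro β
      rw [← Finset.sum_mul_sum]
      by_cases hex : ∃ i, P (β i) h
      · rw [ind_of hex]
        nlinarith [sq_nonneg (1 - l * ∑ i, ind (P (β i) h))]
      · rw [ind_of_not hex, Finset.sum_eq_zero fun i _ => ind_of_not fun hp => hex ⟨i, hp⟩]
        simp
    have e₂ : 𝔼 β : Fin R → B, ∑ i, ind (P (β i) h) = R * Y h := by
      rw [Finset.expect_sum_comm, Finset.sum_congr rfl fun i _ =>
        expect_apply i fun b => ind (P b h), Finset.sum_const, nsmul_eq_mul, Finset.card_univ,
        Fintype.card_fin]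
    have e₃ : 𝔼 β : Fin R → B, ∑ i, ∑ i', ind (P (β i) h) * ind (P (β i') h) ≤
        R * Y h + (R * Y h) ^ 2 := by
      calc _ = ∑ i, ∑ i', 𝔼 β : Fin R → B, ind (P (β i) h) * ind (P (β i') h) := by
            simp only [Finset.expect_sum_comm]
        _ ≤ ∑ i : Fin R, ∑ i' : Fin R, ((if i = i' then Y h else 0) + Y h * Y h) := by
            refine Finset.sum_le_sum fun i _ => Finset.sum_le_sum fun i' _ => ?_
            split_ifs with hi
            · subst hi
              simp only [← ind_and, and_self]
              rw [expect_apply i fun b => ind (P b h)]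
              linarith [mul_nonneg (hY0 h) (hY0 h)]
            · rw [expect_apply₂ hi (fun b => ind (P b h)) fun b => ind (P b h), zero_add]
        _ = _ := by
            simp only [Finset.sum_add_distrib, Finset.sum_ite_eq, Finset.mem_univ, if_true,
              Finset.sum_const, nsmul_eq_mul, Finset.card_univ, Fintype.card_fin]
            ring
    calc _ ≤ 2 * l * (𝔼 β : Fin R → B, ∑ i, ind (P (β i) h)) -
        l ^ 2 * (𝔼 β : Fin R → B, ∑ i, ∑ i', ind (P (β i) h) * ind (P (β i') h)) := by
          rw [e₂]
          exact sub_le_sub_left (mul_le_mul_of_nonneg_left e₃ (sq_nonneg l)) _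
      _ = 𝔼 β : Fin R → B, (2 * l * (∑ i, ind (P (β i) h)) -
        l ^ 2 * (∑ i, ∑ i', ind (P (β i) h) * ind (P (β i') h))) := by
          rw [Finset.expect_sub_distrib, Finset.mul_expect, Finset.mul_expect]
      _ ≤ _ := expect_mono' e₁
  calc R * E / (1 + R * c) = l * (R * E) := by
        rw [hl]
        ring
    _ = 2 * l * (R * E) - l ^ 2 * (R * E + R ^ 2 * (c * E)) := by
        have : l * (1 + R * c) = 1 := one_div_mul_cancel hRc.ne'
        linear_combination (l * R * E) * this
    _ ≤ 2 * l * (R * E) - l ^ 2 * (R * E + R ^ 2 * 𝔼 h, Y h ^ 2) := by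
        gcongr
    _ = 𝔼 h, (2 * l * (R * Y h) - l ^ 2 * (R * Y h + (R * Y h) ^ 2)) := by
        simp only [mul_pow, Finset.expect_sub_distrib, Finset.expect_add_distrib,
          ← Finset.mul_expect, hE]
    _ ≤ _ := expect_mono' h₁

/-- A bound for the second moment, if every block that succeeds has a property that is rare
whatever another block does. -/
theorem expect_sq_le (P V : B → H → Prop) (hPV : ∀ β h, P β h → V β h) {c : ℝ}
    (h : ∀ β, 𝔼 β', 𝔼 h, ind (P β h) * ind (V β' h) ≤ c * 𝔼 h, ind (P β h)) :
    𝔼 h, (𝔼 β, ind (P β h)) ^ 2 ≤ c * 𝔼 h, 𝔼 β, ind (P β h) := by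
  calc 𝔼 h, (𝔼 β, ind (P β h)) ^ 2 = 𝔼 h, 𝔼 β, 𝔼 β', ind (P β h) * ind (P β' h) := by
        refine Finset.expect_congr rfl fun h _ => ?_
        rw [sq, Finset.expect_mul]
        simp only [Finset.mul_expect]
    _ ≤ 𝔼 h, 𝔼 β, 𝔼 β', ind (P β h) * ind (V β' h) :=
        expect_mono' fun h => expect_mono' fun β => expect_mono' fun β' =>
          mul_le_mul_of_nonneg_left (ind_mono (hPV β' h)) (ind_nonneg _)
    _ = 𝔼 β, 𝔼 β', 𝔼 h, ind (P β h) * ind (V β' h) := by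
        rw [Finset.expect_comm]
        exact Finset.expect_congr rfl fun β _ => Finset.expect_comm _ _ _
    _ ≤ 𝔼 β, c * 𝔼 h, ind (P β h) := expect_mono' h
    _ = _ := by rw [← Finset.mul_expect, Finset.expect_comm]

end rounds

section blocks

/-- At most `2 * S` comes from starts, `4 * S * K` from old arguments and `K * S` from new queries;
as `1 ≤ K`, the constant 7 suffices. -/
theorem visit_bound_le {S K : ℕ} (hK : 0 < K) (n : ℕ) :
    ((2 * S + 4 * (S * K : ℕ)) / n + (K * S : ℕ) / n : ℝ) ≤ 7 * S * K / n := by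
  have : (1 : ℝ) ≤ K := by exact_mod_cast hK
  rw [← add_div]
  refine div_le_div_of_nonneg_right ?_ (Nat.cast_nonneg n)
  push_cast
  nlinarith [mul_le_mul_of_nonneg_left this (Nat.cast_nonneg (α := ℝ) S)]

variable {A V C Θ : Type*} {S : ℕ} {tw : Θ → A → V → V} {st : C → V} {z : V → A}

/-- A block of runs succeeds. -/
def BlockSucceeds (tw : Θ → A → V → V) (st : C → V) (z : V → A) (D : Finset V) (slot : V → ℕ)
    (K : ℕ) (j : V) (I : Finset V) (β : Θ × (Fin S → C)) (h : A → V) : Prop :=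
  HasPattern (twist tw β.1 h ∘ z) D slot K j I (st ∘ β.2)

/-- The arguments of the random function that a block of runs uses. -/
def blockArgs [DecidableEq A] (tw : Θ → A → V → V) (st : C → V) (z : V → A) (K : ℕ)
    (β : Θ × (Fin S → C)) (h : A → V) : Finset A :=
  (univ ×ˢ range K).image fun x : Fin S × ℕ => z ((twist tw β.1 h ∘ z)^[x.2] (st (β.2 x.1)))

theorem card_blockArgs_le [DecidableEq A] (K : ℕ) (β : Θ × (Fin S → C)) (h : A → V) :
    (blockArgs tw st z K β h).card ≤ S * K := by
  refine Finset.card_image_le.trans ?_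
  rw [Finset.card_product, Finset.card_univ, Fintype.card_fin, Finset.card_range]

theorem iterate_update_of_notMem [DecidableEq A] {K : ℕ} {β : Θ × (Fin S → C)} {h : A → V} {a : A}
    (ha : a ∉ blockArgs tw st z K β h) (u : V) (q : Fin S) : ∀ l ≤ K,
      (twist tw β.1 (update h a u) ∘ z)^[l] (st (β.2 q)) =
        (twist tw β.1 h ∘ z)^[l] (st (β.2 q)) := by
  rw [twist_update]
  refine iterate_update _ _ _ _ K fun x hx he => ha ?_
  exact Finset.mem_image.2 ⟨(q, x), Finset.mem_product.2 ⟨Finset.mem_univ q,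
    Finset.mem_range.2 hx⟩, he⟩

theorem blockArgs_update [DecidableEq A] {K : ℕ} {β : Θ × (Fin S → C)} {h : A → V} {a : A}
    (ha : a ∉ blockArgs tw st z K β h) (u : V) :
    blockArgs tw st z K β (update h a u) = blockArgs tw st z K β h := by
  refine Finset.image_congr fun x hx => ?_
  have hx' := Finset.mem_range.1 (Finset.mem_product.1 (Finset.mem_coe.1 hx)).2
  rw [iterate_update_of_notMem ha u x.1 x.2 hx'.le]

theorem blockSucceeds_update [DecidableEq A] {D : Finset V} {slot : V → ℕ} {K : ℕ} {j : V}
    {I : Finset V} {β : Θ × (Fin S → C)} {h : A → V} {a : A}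
    (ha : a ∉ blockArgs tw st z K β h) (u : V) :
    BlockSucceeds tw st z D slot K j I β (update h a u) ↔
      BlockSucceeds tw st z D slot K j I β h :=
  ⟨HasPattern.congr fun q l hl => iterate_update_of_notMem ha u q l hl,
    HasPattern.congr fun q l hl => (iterate_update_of_notMem ha u q l hl).symm⟩

variable [Fintype A] [DecidableEq A] [Fintype V]

/-- For a fixed `θ` the twist permutes the values at every argument. So each single round works with
a uniformly random function. -/
theorem expect_twist (htw : ∀ θ a, Bijective (tw θ a)) (f : (A → V) → ℝ) (θ : Θ) :
    𝔼 h, f (twist tw θ h) = 𝔼 g, f g := by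
  refine Fintype.expect_bijective (twist tw θ) ⟨fun h h' he => ?_, fun g => ?_⟩ _ _ fun _ => rfl
  · exact funext fun a => (htw θ a).1 (congrFun he a)
  · choose f hf using fun a => (htw θ a).2 (g a)
    exact ⟨f, funext hf⟩

variable [Fintype C] [Fintype Θ] [Nonempty Θ]

theorem expect_blockSucceeds (htw : ∀ θ a, Bijective (tw θ a)) (D : Finset V) (slot : V → ℕ)
    (K : ℕ) (j : V) (I : Finset V) :
    𝔼 h, 𝔼 β : Θ × (Fin S → C), ind (BlockSucceeds tw st z D slot K j I β h) =
      𝔼 g, 𝔼 ω : Fin S → C, ind (HasPattern (g ∘ z) D slot K j I (st ∘ ω)) := by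
  rw [Finset.expect_comm, expect_prod fun θ (ω : Fin S → C) =>
    𝔼 h, ind (BlockSucceeds tw st z D slot K j I (θ, ω) h)]
  have e : ∀ θ (ω : Fin S → C), 𝔼 h, ind (BlockSucceeds tw st z D slot K j I (θ, ω) h) =
      𝔼 g, ind (HasPattern (g ∘ z) D slot K j I (st ∘ ω)) := fun θ ω =>
    expect_twist htw (fun g => ind (HasPattern (g ∘ z) D slot K j I (st ∘ ω))) θ
  simp only [e]
  rw [Fintype.expect_const, Finset.expect_comm]

variable [Nonempty C] [Nonempty V]

/-- The success probability of `R` independent blocks, if there are many `i`. -/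
theorem le_expect_exists_blockSucceeds {K : ℕ} (hK : 0 < K)
    (hup : ∀ v, 𝔼 σ, ind (st σ = v) ≤ 2 / Fintype.card V) (htw : ∀ θ a, Bijective (tw θ a))
    (h₁ : ∀ a u v, 𝔼 θ, ind (tw θ a u = v) ≤ 4 / Fintype.card V)
    (D : Finset V) (slot : V → ℕ) (j : V) (I : Finset V) (R : ℕ) :
    R * (𝔼 g, 𝔼 ω : Fin S → C, ind (HasPattern (g ∘ z) D slot K j I (st ∘ ω))) /
        (1 + R * (7 * S * K / Fintype.card V)) ≤
      𝔼 h, 𝔼 β : Fin R → Θ × (Fin S → C),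
        ind (∃ i, BlockSucceeds tw st z D slot K j I (β i) h) := by
  rw [← expect_blockSucceeds htw]
  refine le_expect_exists_of_sq_le _ (by positivity) (expect_sq_le _
    (fun β h => BlockVisits tw st z K h j β) (fun β h hs => hs.visit_right) fun β => ?_) R
  refine (expect_blockVisits_le hK hup (by norm_num) htw h₁
    (fun h => ind (BlockSucceeds tw st z D slot K j I β h)) (fun h => ind_nonneg _)
    (blockArgs tw st z K β) (card_blockArgs_le K β) (fun h a u ha => ⟨?_, blockArgs_update ha u⟩)
    j).trans ?_
  · exact ind_congr (blockSucceeds_update ha u)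
  · exact mul_le_mul_of_nonneg_right (visit_bound_le hK _) (expect_nonneg' fun _ => ind_nonneg _)

/-- The success probability of `R` independent blocks, if there is only one `i`. -/
theorem le_expect_exists_blockSucceeds_singleton {K : ℕ} (hK : 0 < K)
    (hup : ∀ v, 𝔼 σ, ind (st σ = v) ≤ 2 / Fintype.card V) (htw : ∀ θ a, Bijective (tw θ a))
    (h₁ : ∀ a u v, 𝔼 θ, ind (tw θ a u = v) ≤ 4 / Fintype.card V)
    (h₂ : ∀ a a' u u' v v', a ≠ a' →
      𝔼 θ, ind (tw θ a u = v ∧ tw θ a' u' = v') ≤ (4 / Fintype.card V) ^ 2)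
    (D : Finset V) (slot : V → ℕ) {i j : V} (hij : i ≠ j) (R : ℕ) :
    R * (𝔼 g, 𝔼 ω : Fin S → C, ind (HasPattern (g ∘ z) D slot K j {i} (st ∘ ω))) /
        (1 + R * (7 * S * K / Fintype.card V) ^ 2) ≤
      𝔼 h, 𝔼 β : Fin R → Θ × (Fin S → C),
        ind (∃ r, BlockSucceeds tw st z D slot K j {i} (β r) h) := by
  rw [← expect_blockSucceeds htw]
  -- With a single `i`, a successful block visits both `i` and `j`, which is why the bound for the
  -- second block is squared.
  refine le_expect_exists_of_sq_le _ (by positivity) (expect_sq_le _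
    (fun β h => BlockVisits tw st z K h i β ∧ BlockVisits tw st z K h j β)
    (fun β h hs => ⟨?_, hs.visit_right⟩) fun β => ?_) R
  · obtain ⟨i', hi', h⟩ := hs.visit_left
    rwa [Finset.mem_singleton.1 hi'] at h
  simp only [ind_and]
  refine (expect_blockVisits₂_le hK hup (by norm_num) htw h₁ h₂
    (fun h => ind (BlockSucceeds tw st z D slot K j {i} β h)) (fun h => ind_nonneg _)
    (blockArgs tw st z K β) (card_blockArgs_le K β) (fun h a u ha => ⟨?_, blockArgs_update ha u⟩)
    hij).trans ?_
  · exact ind_congr (blockSucceeds_update ha u)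
  · exact mul_le_mul_of_nonneg_right (pow_le_pow_left₀ (by positivity) (visit_bound_le hK _) 2)
      (expect_nonneg' fun _ => ind_nonneg _)

end blocks

end ListDisjointness

/-! # The choice of the parameters -/

namespace ListDisjointness

open Finset Function
open scoped BigOperators

section numeric

theorem IsTau.le_real {n W p τ : ℕ} (hτ : IsTau n W p τ) :
    4096 * ((τ : ℝ) - 1) ^ 2 * W * p ≤ (n : ℝ) ^ 2 := by
  obtain ⟨T, rfl⟩ : ∃ T, τ = T + 1 := ⟨τ - 1, by have := hτ.pos; omega⟩
  rcases hτ.lower with h | h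
  · have : T = 0 := by omega
    subst this
    simp only [Nat.cast_add, Nat.cast_zero, Nat.cast_one]
    nlinarith [sq_nonneg (n : ℝ)]
  · have := (Nat.cast_le (α := ℝ)).2 h
    rw [Nat.add_sub_cancel] at this
    push_cast at this ⊢
    nlinarith

/-- The parameters are small enough for the success probability of a pattern. -/
theorem pattern_condition {n W p T d F N : ℝ} {σm S₂ u : ℝ} (hn : 2 ≤ n) (hW : 1 ≤ W)
    (hp : 2 * n ≤ p) (hWp : W * p ≤ n ^ 2) (hT : 0 ≤ T) (hTp : 4096 * T ^ 2 * W * p ≤ n ^ 2)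
    (hN0 : 0 ≤ N) (hN : N ^ 2 ≤ 2 * p) (hF : F ≤ 2 * p)
    (hd0 : 0 ≤ d) (hd : d ≤ n / (16 * (T + 1)) + 1) (hσ : σm ≤ d / W + 1) (hσ0 : 0 ≤ σm)
    (hS₂0 : 0 ≤ S₂) (hS : 64 * S₂ ≤ W) (hu0 : 0 ≤ u) (huS : u ≤ S₂)
    (huN : 64 * u * N * (T + 1) ≤ n) :
    (3 * T) ^ 2 * F / n ^ 2 + 3 * T * N / n + 3 * T * d / n +
      (2 * (T + 1) + 2) * S₂ / n * (1 + 3 * T * F / n) +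
      (2 * (T + 1) + 2) * (u * (N + σm)) / n ≤ 1 / 2 := by
  have hn0 : 0 < n := by linarith
  have hp0 : 0 < p := by linarith
  have hW0 : 0 < W := by linarith
  have hT2 : 0 ≤ T ^ 2 := sq_nonneg T
  have hn2 : 0 ≤ n ^ 2 := sq_nonneg n
  have hT2p : 4096 * (T ^ 2 * p) ≤ n ^ 2 := by
    have : T ^ 2 * p ≤ T ^ 2 * W * p := by
      have := mul_le_mul_of_nonneg_left hW (mul_nonneg hT2 hp0.le)
      linarith
    linarith
  -- Squaring reduces the claim to `N ^ 2 ≤ 2 * p` and `4096 * (T ^ 2 * p) ≤ n ^ 2`.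
  have f₁ : T * N ≤ n / 45 := by
    refine abs_le_of_sq_le_sq' ?_ (by positivity) |>.2
    have : T ^ 2 * N ^ 2 ≤ T ^ 2 * (2 * p) := mul_le_mul_of_nonneg_left hN hT2
    rw [mul_pow, div_pow]
    linarith
  have f₂ : T ≤ n / 128 := by
    refine abs_le_of_sq_le_sq' ?_ (by positivity) |>.2
    have : T ^ 2 * 4 ≤ T ^ 2 * p := mul_le_mul_of_nonneg_left (by linarith) hT2
    rw [div_pow]
    linarith
  have hWp4 : 4 * W ≤ p := by
    have h₁ : 4 * (W * p) ≤ p * p := by nlinarith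
    nlinarith
  have f₃ : T * W ≤ n / 128 := by
    refine abs_le_of_sq_le_sq' ?_ (by positivity) |>.2
    have h₁ : (T ^ 2 * W) * (4 * W) ≤ (T ^ 2 * W) * p :=
      mul_le_mul_of_nonneg_left hWp4 (by positivity)
    rw [mul_pow, div_pow]
    linarith
  have f₄ : W ≤ n / 2 := by
    have h₁ : W * (2 * n) ≤ W * p := mul_le_mul_of_nonneg_left hp hW0.le
    have h₂ : W * 2 ≤ n := by
      by_contra hlt
      push Not at hlt
      nlinarith
    linarith
  have f₅ : T * (W * p) ≤ n ^ 2 / 64 := by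
    refine abs_le_of_sq_le_sq' ?_ (by positivity) |>.2
    have h₁ : (4096 * T ^ 2 * W * p) * (W * p) ≤ n ^ 2 * n ^ 2 :=
      mul_le_mul hTp hWp (by positivity) (by positivity)
    rw [mul_pow, div_pow]
    linarith
  have f₆ : T ^ 2 * (W * p) ≤ n ^ 2 / 4096 := by linarith
  -- This is the dominant error. The interval has density about `1 / (16 * (T + 1))`, and up to `3 *
  -- T` places have to avoid it, which costs about `3 / 16`.
  have hTd : T * d ≤ n / 16 + T := by
    have h₁ := mul_le_mul_of_nonneg_left hd hT
    have h₂ : T * (n / (16 * (T + 1))) ≤ n / 16 := by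
      rw [mul_div_assoc', div_le_div_iff₀ (by positivity) (by norm_num)]
      linarith
    linarith
  have hTF : T ^ 2 * F ≤ n ^ 2 / 2048 := by
    have := mul_le_mul_of_nonneg_left hF hT2
    linarith
  have hkS : (2 * (T + 1) + 2) * S₂ ≤ n * (1 / 31) := by
    have := mul_le_mul_of_nonneg_left hS hT
    linarith
  have hTFS : (2 * (T + 1) + 2) * S₂ * (3 * T * F) ≤ n ^ 2 * (1 / 150) := by
    have h₁ : (2 * (T + 1) + 2) * S₂ * (3 * T) * F ≤
        (2 * (T + 1) + 2) * S₂ * (3 * T) * (2 * p) :=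
      mul_le_mul_of_nonneg_left hF (by positivity)
    have h₂ : (2 * (T + 1) + 2) * (3 * T) * (2 * p) * (64 * S₂) ≤
        (2 * (T + 1) + 2) * (3 * T) * (2 * p) * W :=
      mul_le_mul_of_nonneg_left hS (by positivity)
    linarith
  have huN' : (2 * (T + 1) + 2) * (u * N) ≤ n * (1 / 16) := by
    have : T * (u * N) + u * N ≤ n / 64 := by linarith
    have h₂ : 0 ≤ T * (u * N) := by positivity
    linarith
  have huσ : (2 * (T + 1) + 2) * (u * σm) ≤ n * (1 / 14) := by
    have h₁ : u * σm ≤ S₂ * σm := mul_le_mul_of_nonneg_right huS hσ0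
    have h₂ : S₂ * σm ≤ S₂ * (d / W + 1) := mul_le_mul_of_nonneg_left hσ hS₂0
    have h₃ : S₂ * (d / W) ≤ d / 64 := by
      calc S₂ * (d / W) ≤ W / 64 * (d / W) :=
            mul_le_mul_of_nonneg_right (by linarith) (by positivity)
        _ = d / 64 := by field_simp
    have h₄ : (2 * (T + 1) + 2) * d ≤ n / 4 + 2 * T + 4 := by
      have h₅ := mul_le_mul_of_nonneg_left hd (by linarith : (0 : ℝ) ≤ 2 * (T + 1) + 2)
      have h₆ : (2 * (T + 1) + 2) * (n / (16 * (T + 1))) ≤ n / 4 := by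
        rw [mul_div_assoc', div_le_div_iff₀ (by positivity) (by norm_num)]
        have : 0 ≤ n * T := mul_nonneg hn0.le hT
        linarith
      linarith
    have h₇ : (2 * (T + 1) + 2) * (u * σm) ≤ (2 * (T + 1) + 2) * (d / 64 + S₂) :=
      mul_le_mul_of_nonneg_left (by linarith) (by linarith)
    linarith
  have e : (3 * T) ^ 2 * F / n ^ 2 + 3 * T * N / n + 3 * T * d / n +
      (2 * (T + 1) + 2) * S₂ / n * (1 + 3 * T * F / n) +
      (2 * (T + 1) + 2) * (u * (N + σm)) / n = 9 * (T ^ 2 * F) / n ^ 2 + (3 * (T * N) +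
      3 * (T * d) + (2 * (T + 1) + 2) * S₂ + (2 * (T + 1) + 2) * (u * N) +
      (2 * (T + 1) + 2) * (u * σm)) / n + (2 * (T + 1) + 2) * S₂ * (3 * T * F) / n ^ 2 := by
    field_simp
    ring
  rw [e]
  have g₁ : 9 * (T ^ 2 * F) / n ^ 2 ≤ 9 / 2048 := by
    rw [div_le_div_iff₀ (by positivity) (by norm_num)]
    linarith
  have g₂ : (3 * (T * N) +
      3 * (T * d) + (2 * (T + 1) + 2) * S₂ + (2 * (T + 1) + 2) * (u * N) +
      (2 * (T + 1) + 2) * (u * σm)) / n ≤ 3 / 45 + 3 / 16 + 3 / 128 + 1 / 31 + 1 / 16 + 1 / 14 := by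
    rw [div_le_iff₀ hn0]
    linarith
  have g₃ : (2 * (T + 1) + 2) * S₂ * (3 * T * F) / n ^ 2 ≤ 1 / 150 := by
    rw [div_le_iff₀ (by positivity)]
    linarith
  refine (add_le_add (add_le_add g₁ g₂) g₃).trans ?_
  norm_num

end numeric

/-! ### Stopping intervals and pairs of nearby runs -/

section choice

/-- The stopping set of a round. -/
def stopSet (n d e : ℕ) : Finset (Fin n) := univ.filter fun v => (v : ℕ) / d = e

variable {n d e : ℕ}

theorem mem_stopSet {v : Fin n} : v ∈ stopSet n d e ↔ (v : ℕ) / d = e := by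
  simp [stopSet]

/-- Within an interval of length `d` the members of a residue class modulo `W` are `W` apart, so the
quotient of the offset by `W` distinguishes them. -/
theorem card_stopSet_slot_le (hd : 0 < d) (W c : ℕ) :
    ((stopSet n d e).filter fun v : Fin n => (v : ℕ) % W = c).card ≤ d / W + 1 := by
  rw [← Finset.card_range (d / W + 1)]
  refine Finset.card_le_card_of_injOn (fun v => (v : ℕ) % d / W) (fun v _ => ?_) ?_
  · simp only [Finset.coe_range, Set.mem_Iio]
    have := Nat.div_le_div_right (c := W) (Nat.mod_lt (v : ℕ) hd).le
    omega
  · intro v hv v' hv' h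
    simp only [Finset.coe_filter, Set.mem_ofPred_eq, mem_stopSet] at hv hv' h
    have e₁ := Nat.div_add_mod (v : ℕ) d
    have e₂ := Nat.div_add_mod (v' : ℕ) d
    rw [hv.1] at e₁
    rw [hv'.1] at e₂
    have hmod : (v : ℕ) % d ≡ (v' : ℕ) % d [MOD W] := by
      have : d * e + (v : ℕ) % d ≡ d * e + (v' : ℕ) % d [MOD W] := by
        rw [e₁, e₂]
        exact hv.2.trans hv'.2.symm
      exact Nat.ModEq.add_left_cancel' _ this
    have : (v : ℕ) % d = (v' : ℕ) % d := by
      rw [← Nat.div_add_mod ((v : ℕ) % d) W, ← Nat.div_add_mod ((v' : ℕ) % d) W, h, hmod]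
    exact Fin.ext (by omega)

theorem card_stopSet_le (hd : 0 < d) : (stopSet n d e).card ≤ d := by
  refine le_trans (Finset.card_le_card_of_injOn (t := range d) (fun v => (v : ℕ) % d)
    (fun v _ => ?_) ?_) (Finset.card_range d).le
  · simpa using Nat.mod_lt (v : ℕ) hd
  · intro v hv v' hv' h
    have h₁ := mem_stopSet.1 (Finset.mem_coe.1 hv)
    have h₂ := mem_stopSet.1 (Finset.mem_coe.1 hv')
    simp only at h
    exact Fin.ext (by rw [← Nat.div_add_mod (v : ℕ) d, ← Nat.div_add_mod (v' : ℕ) d, h₁, h₂, h])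

theorem le_card_stopSet (hn : (e + 1) * d ≤ n) : d ≤ (stopSet n d e).card := by
  have hlt : ∀ x ∈ range d, e * d + x < n := by
    intro x hx
    have := Finset.mem_range.1 hx
    have h : (e + 1) * d = e * d + d := by ring
    omega
  rcases Nat.eq_zero_or_pos d with rfl | hd
  · exact Nat.zero_le _
  refine le_trans (Finset.card_attach.trans (Finset.card_range d)).ge
    (Finset.card_le_card_of_injOn (s := (range d).attach)
      (fun x => ⟨e * d + x.1, hlt x.1 x.2⟩) (fun x _ => ?_) ?_)
  · refine Finset.mem_coe.2 (mem_stopSet.2 ?_)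
    simp only
    rw [Nat.mul_comm, Nat.mul_add_div hd, Nat.div_eq_of_lt (Finset.mem_range.1 x.2), add_zero]
  · intro x _ x' _ h
    simp only [Fin.mk.injEq, Nat.add_left_cancel_iff] at h
    exact Subtype.ext h

/-- At most one of three disjoint intervals contains `j`. Of two others, at least one leaves half of
`I` outside. -/
theorem exists_stopSet (I : Finset (Fin n)) (j : Fin n) :
    ∃ e < 3, j ∉ stopSet n d e ∧ I.card ≤ 2 * (I \ stopSet n d e).card := by
  have key : ∀ e₁ e₂, e₁ ≠ e₂ →
      I.card ≤ (I \ stopSet n d e₁).card + (I \ stopSet n d e₂).card := by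
    intro e₁ e₂ hne
    refine le_trans (Finset.card_le_card fun v hv => ?_) (Finset.card_union_le _ _)
    rw [Finset.mem_union, Finset.mem_sdiff, Finset.mem_sdiff, mem_stopSet, mem_stopSet]
    by_cases h : (v : ℕ) / d = e₁
    · exact Or.inr ⟨hv, fun h' => hne (h.symm.trans h')⟩
    · exact Or.inl ⟨hv, h⟩
  have pick : ∀ e₁ e₂, e₁ < 3 → e₂ < 3 → e₁ ≠ e₂ → (j : ℕ) / d ≠ e₁ → (j : ℕ) / d ≠ e₂ →
      ∃ e < 3, j ∉ stopSet n d e ∧ I.card ≤ 2 * (I \ stopSet n d e).card := by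
    intro e₁ e₂ h₁ h₂ hne hj₁ hj₂
    have := key e₁ e₂ hne
    rcases le_total (I \ stopSet n d e₁).card (I \ stopSet n d e₂).card with h | h
    · exact ⟨e₂, h₂, fun h' => hj₂ (mem_stopSet.1 h'), by omega⟩
    · exact ⟨e₁, h₁, fun h' => hj₁ (mem_stopSet.1 h'), by omega⟩
  by_cases h0 : (j : ℕ) / d = 0
  · exact pick 1 2 (by norm_num) (by norm_num) (by norm_num) (by omega) (by omega)
  · by_cases h1 : (j : ℕ) / d = 1
    · exact pick 0 2 (by norm_num) (by norm_num) (by norm_num) (by omega) (by omega)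
    · exact pick 0 1 (by norm_num) (by norm_num) (by norm_num) h0 h1

/-- The pairs of runs at distance at most `w`. -/
def nearPairs (S w : ℕ) : Finset (Fin S × Fin S) :=
  univ.filter fun p => p.1 < p.2 ∧ (p.2 : ℕ) ≤ p.1 + w

/-- Take the first run from the lower half and a distance of at most `(w + 1) / 2`; then the second
run is still in range. -/
theorem le_card_nearPairs {S w : ℕ} (hw : w + 1 ≤ S) : S * w ≤ 4 * (nearPairs S w).card := by
  have h : ((S + 1) / 2) * ((w + 1) / 2) ≤ (nearPairs S w).card := by
    rw [← Finset.card_range ((S + 1) / 2), ← Finset.card_range ((w + 1) / 2),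
      ← Finset.card_product, ← Finset.card_attach]
    have hx : ∀ x ∈ range ((S + 1) / 2) ×ˢ range ((w + 1) / 2), x.1 < (S + 1) / 2 ∧
        x.2 < (w + 1) / 2 := by
      intro x hx
      simpa only [Finset.mem_product, Finset.mem_range] using hx
    refine Finset.card_le_card_of_injOn (fun x => (⟨x.1.1, by have := hx x.1 x.2; omega⟩,
      ⟨x.1.1 + x.1.2 + 1, by have := hx x.1 x.2; omega⟩)) (fun x _ => ?_) ?_
    · have := hx x.1 x.2
      simp only [nearPairs, Finset.coe_filter, Finset.mem_univ, true_and, Set.mem_ofPred_eq,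
        Fin.mk_lt_mk]
      omega
    · rintro ⟨⟨a, b⟩, hx⟩ _ ⟨⟨a', b'⟩, hx'⟩ _ h
      simp only [Prod.mk.injEq, Fin.mk.injEq] at h
      exact Subtype.ext (Prod.ext h.1 (by dsimp only; omega))
  have h₁ : S ≤ 2 * ((S + 1) / 2) := by omega
  have h₂ : w ≤ 2 * ((w + 1) / 2) := by omega
  calc S * w ≤ 2 * ((S + 1) / 2) * (2 * ((w + 1) / 2)) := Nat.mul_le_mul h₁ h₂
    _ = 4 * (((S + 1) / 2) * ((w + 1) / 2)) := by ring
    _ ≤ _ := Nat.mul_le_mul_left 4 h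

end choice

/-! ### The success probability of a round -/

section main

variable {A C : Type*} [Fintype A] [DecidableEq A] [Fintype C] {n : ℕ}

theorem sq_freq_le_freqSum {A V : Type*} [DecidableEq A] [Fintype V] (z : V → A) (j : V) :
    freq z (z j) ^ 2 ≤ freqSum z := by
  calc freq z (z j) ^ 2 = ∑ _v ∈ univ.filter fun v => z v = z j, freq z (z j) := by
        rw [Finset.sum_const, smul_eq_mul, sq, freq]
    _ = ∑ v ∈ univ.filter fun v => z v = z j, freq z (z v) :=
        Finset.sum_congr rfl fun v hv => by rw [(Finset.mem_filter.1 hv).2]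
    _ ≤ freqSum z := Finset.sum_le_sum_of_subset (Finset.filter_subset _ _)

/-- The success probability of a block of runs, for suitable parameters. -/
theorem le_expect_hasPattern_stopSet {st : C → Fin n} {z : Fin n → A} {W p τ : ℕ} (hn : 2 ≤ n)
    (hW : 0 < W) (hp : 2 * n ≤ p) (hWp : W * p ≤ n ^ 2) (hτ : IsTau n W p τ)
    (hlow : ∀ v, 1 / (2 * n) ≤ 𝔼 σ, ind (st σ = v)) (hup : ∀ v, 𝔼 σ, ind (st σ = v) ≤ 2 / n)
    (hF : freqSum z ≤ 2 * p) (e : ℕ) (he : (e + 1) * (n / (16 * τ) + 1) ≤ n) (j : Fin n)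
    (I : Finset (Fin n)) (hIj : j ∉ I) (hz : ∀ i ∈ I, z i = z j)
    (hI : 1 < τ → ∀ i ∈ I, i ∉ stopSet n (n / (16 * τ) + 1) e)
    (hj : 1 < τ → j ∉ stopSet n (n / (16 * τ) + 1) e) (u : ℕ) (huS : u ≤ W / 64)
    (hu : 64 * u * freq z (z j) * τ ≤ n) :
    ((W / 64 + 2 : ℕ) : ℝ) * (u + 1) * I.card * τ ^ 2 / (512 * (n : ℝ) ^ 2) ≤
      𝔼 g, 𝔼 ω : Fin (W / 64 + 2) → C, ind (HasPattern (g ∘ z) (stopSet n (n / (16 * τ) + 1) e)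
        (fun v => (v : ℕ) % W) (2 * τ) j I (st ∘ ω)) := by
  have hn0 : (0 : ℝ) < n := by exact_mod_cast (by omega : 0 < n)
  have hτ1 := hτ.pos
  have hτ0 : (0 : ℝ) < τ := by exact_mod_cast hτ1
  have : Nonempty (Fin n) := ⟨⟨0, by omega⟩⟩
  set d := n / (16 * τ) + 1 with hd
  have hd0 : 0 < d := Nat.succ_pos _
  have hdlow : (n : ℝ) / (16 * τ) ≤ d := by
    have := Nat.lt_div_mul_add (a := n) (b := 16 * τ) (by omega)
    rw [div_le_iff₀ (by positivity)]
    have h₂ : n ≤ d * (16 * τ) := by rw [hd, Nat.add_mul, one_mul]; omega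
    exact_mod_cast h₂
  have hdup : (d : ℝ) ≤ n / (16 * ((τ - 1) + 1)) + 1 := by
    rw [hd, sub_add_cancel]
    push_cast
    have := Nat.cast_div_le (α := ℝ) (m := n) (n := 16 * τ)
    push_cast at this
    linarith
  have hD := le_card_stopSet he
  have hP := le_card_nearPairs (S := W / 64 + 2) (w := u + 1) (by omega)
  have key := le_expect_hasPattern (z := z) (st := st) (S := W / 64 + 2)
    (by simpa only [Fintype.card_fin] using hlow) (by simpa only [Fintype.card_fin] using hup)
    (stopSet n d e) (fun v => (v : ℕ) % W) j I τ hIj hz hI hj (u + 1) (2 * τ) (d / W + 1)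
    (by omega) (card_stopSet_slot_le hd0 W) (nearPairs (W / 64 + 2) (u + 1))
    (fun p hp => (Finset.mem_filter.1 hp).2) (3 * ((τ : ℝ) - 1))
    (by rw [Nat.cast_mul, Nat.cast_sub hτ1]; norm_num) ?_
  -- The interval has at least `n / (16 * τ)` elements, which trades one factor `τ` for `n / 16`.
  -- With the factor 4 for pairs and the 8 in `key` this gives `512 = 8 * 4 * 16`.
  · refine le_trans ?_ key
    rw [Fintype.card_fin]
    have h₁ : ((W / 64 + 2 : ℕ) : ℝ) * (u + 1) ≤ 4 * (nearPairs (W / 64 + 2) (u + 1)).card := by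
      exact_mod_cast hP
    have h₂ : (n : ℝ) ≤ 16 * τ * (stopSet n d e).card := by
      rw [div_le_iff₀ (by positivity)] at hdlow
      have : (d : ℝ) ≤ (stopSet n d e).card := by exact_mod_cast hD
      nlinarith
    rw [div_le_div_iff₀ (by positivity) (by positivity)]
    calc ((W / 64 + 2 : ℕ) : ℝ) * (u + 1) * I.card * τ ^ 2 * (8 * (n : ℝ) ^ 3)
        = ((W / 64 + 2 : ℕ) : ℝ) * (u + 1) * (I.card * τ ^ 2 * (8 * (n : ℝ) ^ 2)) * n := by ring
      _ ≤ 4 * (nearPairs (W / 64 + 2) (u + 1)).card * (I.card * τ ^ 2 * (8 * (n : ℝ) ^ 2)) *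
          (16 * τ * (stopSet n d e).card) := by gcongr
      _ = _ := by ring
  · rw [Fintype.card_fin]
    have hc := pattern_condition (n := n) (W := W) (p := p) (T := τ - 1) (d := d) (F := freqSum z)
      (N := freq z (z j)) (σm := (d / W + 1 : ℕ)) (S₂ := (W / 64 : ℕ)) (u := u)
      (by exact_mod_cast hn) (by exact_mod_cast hW) (by exact_mod_cast hp) (by exact_mod_cast hWp)
      (by rw [sub_nonneg]; exact_mod_cast hτ1) hτ.le_real (Nat.cast_nonneg _)
      (by exact_mod_cast (sq_freq_le_freqSum z j).trans hF) (by exact_mod_cast hF)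
      (Nat.cast_nonneg _) hdup
      (by push_cast; linarith [Nat.cast_div_le (α := ℝ) (m := d) (n := W)]) (Nat.cast_nonneg _)
      (Nat.cast_nonneg _) (by exact_mod_cast Nat.mul_div_le W 64) (Nat.cast_nonneg _)
      (by exact_mod_cast huS) (by rw [sub_add_cancel]; exact_mod_cast hu)
    rw [sub_add_cancel] at hc
    have hcard : ((stopSet n d e).card : ℝ) ≤ d := by exact_mod_cast card_stopSet_le hd0
    refine le_trans ?_ hc
    rw [Nat.add_sub_cancel, Nat.add_sub_cancel]
    have hT : (0 : ℝ) ≤ τ - 1 := by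
      rw [sub_nonneg]
      exact_mod_cast hτ1
    push_cast
    gcongr

end main

end ListDisjointness

/-! ### Constant success probability of all rounds -/

namespace ListDisjointness

open Finset Function
open scoped BigOperators

section main

/-- Here `x` is the expected number of successful rounds up to constants, and `y` the denominator
from the second moment method. The number 196 is `(7 * 2) ^ 2`, from the factor 7 in
`visit_bound_le` and walks of length `2 * τ`. -/
theorem one_div_le_of_block {E x y k l : ℝ} (hx : 1 ≤ k * x) (hl : 0 < l)
    (hE : x / l ≤ E) (hy : y ≤ 1 + 196 * x) (hy0 : 0 < y) (hk : 0 < k) :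
    1 / (l * (k + 196)) ≤ E / y := by
  rw [div_le_div_iff₀ (by positivity) hy0]
  have h₁ : y ≤ (k + 196) * x := by linarith
  have h₂ : x ≤ E * l := (div_le_iff₀ hl).1 hE
  calc 1 * y ≤ (k + 196) * x := by linarith
    _ ≤ (k + 196) * (E * l) := mul_le_mul_of_nonneg_left h₂ (by linarith)
    _ = _ := by ring

variable {A C Θ : Type*} [Fintype A] [DecidableEq A] [Fintype C] [Nonempty C] [Fintype Θ]
  [Nonempty Θ] {n : ℕ}

/-- The success probability of sufficiently many blocks of runs. -/
theorem exists_le_expect_exists_blockSucceeds {tw : Θ → A → Fin n → Fin n} {st : C → Fin n}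
    {z : Fin n → A} {W p τ : ℕ} (hn : 2 ≤ n)
    (hW : 0 < W) (hp : 2 * n ≤ p) (hWp : W * p ≤ n ^ 2) (hτ : IsTau n W p τ)
    (hlow : ∀ v, 1 / (2 * n) ≤ 𝔼 σ, ind (st σ = v)) (hup : ∀ v, 𝔼 σ, ind (st σ = v) ≤ 2 / n)
    (htw : ∀ θ a, Bijective (tw θ a)) (h₁ : ∀ a u v, 𝔼 θ, ind (tw θ a u = v) ≤ 4 / n)
    (h₂ : ∀ a a' u u' v v', a ≠ a' →
      𝔼 θ, ind (tw θ a u = v ∧ tw θ a' u' = v') ≤ (4 / (n : ℝ)) ^ 2)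
    (hF : freqSum z ≤ 2 * p) (j : Fin n) (I : Finset (Fin n)) (hIj : j ∉ I)
    (hz : ∀ i ∈ I, z i = z j) (hI : freq z (z j) ≤ 2 * I.card) (R : ℕ) (hR0 : 1 ≤ R)
    (hR : n ^ 2 ≤ R * (W * τ) ^ 2) :
    ∃ e < 3, ∃ I' ⊆ I, 1 / 2 ^ 28 ≤ 𝔼 h, 𝔼 β : Fin R → Θ × (Fin (W / 64 + 2) → C),
      ind (∃ r, BlockSucceeds tw st z (stopSet n (n / (16 * τ) + 1) e) (fun v => (v : ℕ) % W)
        (2 * τ) j I' (β r) h) := by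
  have : Nonempty (Fin n) := ⟨⟨0, by omega⟩⟩
  have hn0 : (0 : ℝ) < n := by exact_mod_cast (by omega : 0 < n)
  have hτ1 := hτ.pos
  have hτ0 : (0 : ℝ) < τ := by exact_mod_cast hτ1
  have hW0 : (0 : ℝ) < W := by exact_mod_cast hW
  have hK : 0 < 2 * τ := by omega
  have hN : 1 ≤ freq z (z j) := Finset.card_pos.2 ⟨j, by simp⟩
  -- For `1 < τ` the lower bound in `IsTau` makes `n` so large that three intervals fit. For `τ = 1`
  -- the indices `i` and `j` are starts in all patterns, so they may be end points and the first
  -- interval will do.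
  obtain ⟨e, he, hed, I', hI', hIc, hIe, hje⟩ : ∃ e < 3, (e + 1) * (n / (16 * τ) + 1) ≤ n ∧
      ∃ I' ⊆ I, I.card ≤ 2 * I'.card ∧ (1 < τ → ∀ i ∈ I', i ∉ stopSet n (n / (16 * τ) + 1) e) ∧
        (1 < τ → j ∉ stopSet n (n / (16 * τ) + 1) e) := by
    by_cases h : 1 < τ
    · obtain ⟨e, he, hj, hc⟩ := exists_stopSet (d := n / (16 * τ) + 1) I j
      refine ⟨e, he, ?_, _, Finset.sdiff_subset, hc, fun _ i hi => (Finset.mem_sdiff.1 hi).2,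
        fun _ => hj⟩
      have h8 : 8 ≤ n := by
        rcases hτ.lower with h' | h'
        · omega
        · have e₁ : 64 * 64 * 1 * 1 * 1 * p ≤ 64 * 64 * (τ - 1) * (τ - 1) * W * p := by
            gcongr <;> omega
          by_contra hlt
          have : n * n ≤ 8 * n := Nat.mul_le_mul_right n (by omega)
          omega
      have h32 : n / (16 * τ) ≤ n / 32 := Nat.div_le_div_left (by omega) (by norm_num)
      calc (e + 1) * (n / (16 * τ) + 1) ≤ 3 * (n / 32 + 1) := Nat.mul_le_mul (by omega) (by omega)
        _ ≤ n := by omega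
    · refine ⟨0, by norm_num, ?_, I, Finset.Subset.refl I, by omega, fun h' => absurd h' h,
        fun h' => absurd h' h⟩
      have : τ = 1 := by omega
      subst this
      omega
  refine ⟨e, he, ?_⟩
  have hIj' : j ∉ I' := fun h => hIj (hI' h)
  have hN4 : freq z (z j) ≤ 4 * I'.card := by omega
  set S := W / 64 + 2 with hS
  have hSW : (W : ℝ) ≤ 64 * S := by
    have : W ≤ 64 * S := by omega
    exact_mod_cast this
  have hS0 : (0 : ℝ) < S := by
    have : 0 < S := by omega
    exact_mod_cast this
  have hR0' : (1 : ℝ) ≤ R := by exact_mod_cast hR0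
  have hR' : (n : ℝ) ^ 2 ≤ R * (W * τ) ^ 2 := by exact_mod_cast hR
  have h₁' : ∀ a u v, 𝔼 θ, ind (tw θ a u = v) ≤ 4 / (Fintype.card (Fin n) : ℝ) := by
    simpa only [Fintype.card_fin] using h₁
  have h₂' : ∀ a a' u u' v v', a ≠ a' →
      𝔼 θ, ind (tw θ a u = v ∧ tw θ a' u' = v') ≤ (4 / (Fintype.card (Fin n) : ℝ)) ^ 2 := by
    simpa only [Fintype.card_fin] using h₂
  have hup' : ∀ v, 𝔼 σ, ind (st σ = v) ≤ 2 / (Fintype.card (Fin n) : ℝ) := by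
    simpa only [Fintype.card_fin] using hup
  -- The walks between the two of a pattern must not meet the value of `j`. If this value is rare,
  -- all pairs of walks are admissible. One `i` then suffices, and success is of order `(S * τ / n)
  -- ^ 2`, matching the probability that another round visits `i` and `j`.
  by_cases hlight : 64 * (W / 64) * freq z (z j) * τ ≤ n
  · obtain ⟨i, hi⟩ : I'.Nonempty := Finset.card_pos.1 (by omega)
    have hij : i ≠ j := fun h => hIj' (h ▸ hi)
    refine ⟨{i}, Finset.singleton_subset_iff.2 (hI' hi), ?_⟩
    have hE := le_expect_hasPattern_stopSet hn hW hp hWp hτ hlow hup hF e hed j {i}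
      (by simpa using hij.symm) (by simpa using hz i (hI' hi))
      (fun h => by simpa using hIe h i hi) hje (W / 64) le_rfl hlight
    have key := le_expect_exists_blockSucceeds_singleton (S := S) (K := 2 * τ) (z := z) hK hup' htw
      h₁' h₂' (stopSet n (n / (16 * τ) + 1) e) (fun v => (v : ℕ) % W) hij R
    refine le_trans ?_ key
    rw [Fintype.card_fin]
    set x : ℝ := R * (S * τ / n) ^ 2 with hx
    have hx1 : 1 ≤ 4096 * x := by
      rw [hx, div_pow, mul_div_assoc', mul_div_assoc', le_div_iff₀ (by positivity), one_mul]
      refine hR'.trans ?_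
      calc (R : ℝ) * (W * τ) ^ 2 ≤ R * (64 * S * τ) ^ 2 := by gcongr
        _ = _ := by ring
    -- The constant 1024 is the 512 from the probability of a round times 2 from `S ≤ 2 * (W / 64 +
    -- 1)`.
    refine le_trans ?_ (one_div_le_of_block (l := 1024) hx1 (by norm_num) ?_ ?_
      (by positivity) (by norm_num))
    · norm_num
    · refine le_trans ?_ (mul_le_mul_of_nonneg_left hE (Nat.cast_nonneg R))
      have h2 : (S : ℝ) ≤ 2 * ((W / 64 : ℕ) + 1) := by
        rw [hS]
        push_cast
        linarith [(Nat.cast_nonneg (W / 64) : (0 : ℝ) ≤ (W / 64 : ℕ))]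
      rw [Finset.card_singleton, Nat.cast_one, mul_one, hx, div_pow, mul_div_assoc',
        div_div, mul_div_assoc', div_le_div_iff₀ (by positivity) (by positivity)]
      calc (R : ℝ) * (S * τ) ^ 2 * (512 * (n : ℝ) ^ 2) = R * (S * τ ^ 2) * (512 * (n : ℝ) ^ 2) * S := by ring
        _ ≤ R * (S * τ ^ 2) * (512 * (n : ℝ) ^ 2) * (2 * ((W / 64 : ℕ) + 1)) := by gcongr
        _ = _ := by ring
    · rw [hx]
      push_cast
      refine le_of_eq ?_
      ring
  · refine ⟨I', hI', ?_⟩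
    push Not at hlight
    set N := freq z (z j) with hNdef
    -- Frequent value: this is the largest distance for which the walks in between do no harm. The
    -- loss by a factor `N` in the number of pairs is made up for by the at least `N / 4` choices of
    -- `i`, so success is of order `S * τ / n`, the order of the probability of a visit of `j`.
    set u := n / (64 * N * τ) with hu
    have hNτ : 0 < 64 * N * τ := Nat.mul_pos (by omega) hτ1
    have huW : u ≤ W / 64 := by
      refine Nat.le_of_lt ((Nat.div_lt_iff_lt_mul hNτ).2 ?_)
      calc n < 64 * (W / 64) * N * τ := hlight
        _ = W / 64 * (64 * N * τ) := by ring
    have hE := le_expect_hasPattern_stopSet hn hW hp hWp hτ hlow hup hF e hed j I' hIj'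
      (fun i hi => hz i (hI' hi)) hIe hje u huW (by
        calc 64 * u * N * τ = 64 * N * τ * u := by ring
          _ ≤ n := Nat.mul_div_le _ _)
    have key := le_expect_exists_blockSucceeds (S := S) (K := 2 * τ) (z := z) hK hup' htw
      h₁' (stopSet n (n / (16 * τ) + 1) e) (fun v => (v : ℕ) % W) j I' R
    refine le_trans ?_ key
    rw [Fintype.card_fin]
    set x : ℝ := R * (S * τ / n) with hx
    have hx1 : 1 ≤ 64 * x := by
      have h1 : (n : ℝ) ≤ R * (W * τ) := by
        refine abs_le_of_sq_le_sq' ?_ (by positivity) |>.2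
        calc (n : ℝ) ^ 2 ≤ R * (W * τ) ^ 2 := hR'
          _ ≤ R * (R * (W * τ) ^ 2) := le_mul_of_one_le_left (by positivity) hR0'
          _ = _ := by ring
      rw [hx, mul_div_assoc', mul_div_assoc', le_div_iff₀ hn0, one_mul]
      refine h1.trans ?_
      calc (R : ℝ) * (W * τ) ≤ R * (64 * S * τ) := by gcongr
        _ = _ := by ring
    refine le_trans ?_ (one_div_le_of_block (l := 131072) hx1 (by norm_num) ?_ ?_
      (by positivity) (by norm_num))
    · norm_num
    · refine le_trans ?_ (mul_le_mul_of_nonneg_left hE (Nat.cast_nonneg R))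
      have hu1 : (n : ℝ) ≤ (u + 1) * (64 * N * τ) := by
        have : n < 64 * N * τ * (n / (64 * N * τ)) + 64 * N * τ := Nat.lt_mul_div_succ n hNτ
        have h' : n ≤ (u + 1) * (64 * N * τ) := by
          rw [hu]
          calc n ≤ 64 * N * τ * (n / (64 * N * τ)) + 64 * N * τ := this.le
            _ = _ := by ring
        exact_mod_cast h'
      have hN4' : (N : ℝ) ≤ 4 * I'.card := by exact_mod_cast hN4
      have hN0 : (0 : ℝ) < N := by exact_mod_cast hN
      have hcomb : (n : ℝ) ≤ (u + 1) * (256 * I'.card * τ) := by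
        refine hu1.trans ?_
        calc ((u : ℝ) + 1) * (64 * N * τ) ≤ (u + 1) * (64 * (4 * I'.card) * τ) := by gcongr
          _ = _ := by ring
      rw [hx, mul_div_assoc', div_div, mul_div_assoc',
        div_le_div_iff₀ (by positivity) (by positivity)]
      calc (R : ℝ) * (S * τ) * (512 * (n : ℝ) ^ 2) = 512 * (R * S * τ * n) * n := by ring
        _ ≤ 512 * (R * S * τ * n) * ((u + 1) * (256 * I'.card * τ)) := by gcongr
        _ = _ := by ring
    · rw [hx]
      push_cast
      have : (0 : ℝ) ≤ R * (S * τ / n) := by positivity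
      have e : (1 : ℝ) + R * (7 * S * (2 * τ) / n) = 1 + 14 * (R * (S * τ / n)) := by ring
      linarith

end main

end ListDisjointness

/-! # Random numbers and the random shifts -/

namespace ListDisjointness

open Finset Function RAM
open scoped BigOperators

section bits

theorem bitsVal_injOn {c c' : ℕ → Bool} {k : ℕ} (h : bitsVal c k = bitsVal c' k) :
    ∀ i < k, c i = c' i := by
  induction k with
  | zero => intro i hi; omega
  | succ k ih =>
    simp only [bitsVal] at h
    have h₁ : bitsVal c k = bitsVal c' k ∧ c k = c' k := by
      rcases hc : c k <;> rcases hc' : c' k <;> simp only [hc, hc'] at h ⊢ <;> simp at h ⊢ <;> omega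
    intro i hi
    rcases Nat.lt_succ_iff_lt_or_eq.1 hi with hlt | rfl
    · exact ih h₁.1 i hlt
    · exact h₁.2

theorem bitsVal_congr {c c' : ℕ → Bool} {k : ℕ} (h : ∀ i < k, c i = c' i) :
    bitsVal c k = bitsVal c' k := by
  induction k with
  | zero => rfl
  | succ k ih => rw [bitsVal, bitsVal, ih fun i hi => h i (by omega), h k (by omega)]

/-- The number with the given bits. -/
def num {B : ℕ} (c : Fin B → Bool) : ℕ := bitsVal (fun i => if h : i < B then c ⟨i, h⟩ else false) B

theorem num_injective {B : ℕ} : Injective (num (B := B)) := by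
  intro c c' h
  funext ⟨i, hi⟩
  have := bitsVal_injOn h i hi
  simpa only [dif_pos hi] using this

theorem expect_num {B : ℕ} (φ : ℕ → ℝ) :
    𝔼 c : Fin B → Bool, φ (num c) = (∑ x ∈ range (2 ^ B), φ x) / 2 ^ B := by
  have hmap : Set.MapsTo (num (B := B)) (univ : Finset (Fin B → Bool)) (range (2 ^ B)) :=
    fun c _ => Finset.mem_coe.2 (Finset.mem_range.2 (bitsVal_lt _ _))
  rw [Fintype.expect_eq_sum_div_card]
  congr 1
  · refine Finset.sum_nbij num (fun c hc => hmap hc) num_injective.injOn ?_ fun _ _ => rfl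
    refine Finset.surjOn_of_injOn_of_card_le _ hmap num_injective.injOn ?_
    simp
  · simp

theorem sum_range_mod_two (M : ℕ) (φ : ℕ → ℝ) :
    ∑ x ∈ range (2 * M), φ (x % M) = 2 * ∑ x ∈ range M, φ x := by
  have h : ∀ x ∈ range M, φ (x % M) = φ x := fun x hx => by
    rw [Nat.mod_eq_of_lt (Finset.mem_range.1 hx)]
  rw [two_mul, Finset.sum_range_add, two_mul, Finset.sum_congr rfl h]
  congr 1
  refine Finset.sum_congr rfl fun x hx => ?_
  rw [Nat.add_mod_left, h x hx]

/-- Reducing `B` random bits modulo `M` is not uniform. But every residue comes from one or two of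
the `2 ^ B` numbers, so it is uniform up to a factor 2 in either direction. -/
theorem expect_num_mod_le {B M : ℕ} (hM : M < 2 ^ B) (hM2 : 2 ^ B ≤ 2 * M) {φ : ℕ → ℝ}
    (hφ : ∀ x, 0 ≤ φ x) :
    𝔼 c : Fin B → Bool, φ (num c % M) ≤ 2 / M * ∑ x ∈ range M, φ x := by
  have hM0 : 0 < M := by have := Nat.one_le_two_pow (n := B); omega
  have hs : 0 ≤ ∑ x ∈ range M, φ x := Finset.sum_nonneg fun x _ => hφ x
  rw [expect_num fun x => φ (x % M)]
  calc (∑ x ∈ range (2 ^ B), φ (x % M)) / 2 ^ B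
      ≤ (∑ x ∈ range (2 * M), φ (x % M)) / 2 ^ B := by
        refine div_le_div_of_nonneg_right ?_ (by positivity)
        exact Finset.sum_le_sum_of_subset_of_nonneg (Finset.range_subset_range.2 hM2)
          fun x _ _ => hφ _
    _ = 2 * (∑ x ∈ range M, φ x) / 2 ^ B := by rw [sum_range_mod_two]
    _ ≤ 2 * (∑ x ∈ range M, φ x) / M := by
        refine div_le_div_of_nonneg_left (by positivity) (by exact_mod_cast hM0) ?_
        exact_mod_cast hM.le
    _ = _ := by ring

theorem le_expect_num_mod {B M : ℕ} (hM : M < 2 ^ B) (hM2 : 2 ^ B ≤ 2 * M) {φ : ℕ → ℝ}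
    (hφ : ∀ x, 0 ≤ φ x) :
    1 / (2 * M) * ∑ x ∈ range M, φ x ≤ 𝔼 c : Fin B → Bool, φ (num c % M) := by
  have hs : 0 ≤ ∑ x ∈ range M, φ x := Finset.sum_nonneg fun x _ => hφ x
  rw [expect_num fun x => φ (x % M)]
  calc 1 / (2 * M) * ∑ x ∈ range M, φ x = (∑ x ∈ range M, φ x) / (2 * M) := by ring
    _ ≤ (∑ x ∈ range M, φ x) / 2 ^ B := by
        refine div_le_div_of_nonneg_left hs (by positivity) ?_
        exact_mod_cast hM2
    _ = (∑ x ∈ range M, φ (x % M)) / 2 ^ B := by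
        congr 1
        exact Finset.sum_congr rfl fun x hx => by rw [Nat.mod_eq_of_lt (Finset.mem_range.1 hx)]
    _ ≤ _ := by
        refine div_le_div_of_nonneg_right ?_ (by positivity)
        exact Finset.sum_le_sum_of_subset_of_nonneg (Finset.range_subset_range.2 hM.le)
          fun x _ _ => hφ _

theorem two_pow_size_le {n : ℕ} (hn : 0 < n) : 2 ^ n.size ≤ 2 * n := by
  obtain ⟨k, hk⟩ : ∃ k, n.size = k + 1 := ⟨n.size - 1, by have := Nat.size_pos.2 hn; omega⟩
  have : 2 ^ k ≤ n := Nat.lt_size.1 (by omega)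
  rw [hk, pow_succ]
  omega

variable {n : ℕ} (hn : 0 < n)

/-- A random vertex. -/
def startVertex (c : Fin n.size → Bool) : Fin n := ⟨num c % n, Nat.mod_lt _ hn⟩

theorem sum_ind_startVertex (v : Fin n) : ∑ x ∈ range n, ind (x = (v : ℕ)) = 1 := by
  rw [Finset.sum_eq_single_of_mem (v : ℕ) (Finset.mem_range.2 v.2) fun x _ hx => ind_of_not hx,
    ind_of rfl]

theorem expect_startVertex_le (v : Fin n) : 𝔼 c, ind (startVertex hn c = v) ≤ 2 / n := by
  have := expect_num_mod_le (Nat.lt_size_self n) (two_pow_size_le hn)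
    (φ := fun x => ind (x = (v : ℕ))) fun x => ind_nonneg _
  rw [sum_ind_startVertex, mul_one] at this
  refine le_of_eq_of_le (Finset.expect_congr rfl fun c _ => ind_congr ?_) this
  exact Fin.ext_iff

theorem le_expect_startVertex (v : Fin n) : 1 / (2 * n) ≤ 𝔼 c, ind (startVertex hn c = v) := by
  have := le_expect_num_mod (Nat.lt_size_self n) (two_pow_size_le hn)
    (φ := fun x => ind (x = (v : ℕ))) fun x => ind_nonneg _
  rw [sum_ind_startVertex, mul_one] at this
  refine this.trans_eq (Finset.expect_congr rfl fun c _ => ind_congr ?_)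
  exact (Fin.ext_iff (a := startVertex hn c) (b := v)).symm

end bits

/-! ### The shifts: an almost pairwise independent hash -/

section shift

variable {n m : ℕ}

theorem sum_range_add_mod (M c : ℕ) (φ : ℕ → ℝ) :
    ∑ b ∈ range M, φ ((c + b) % M) = ∑ w ∈ range M, φ w := by
  rcases Nat.eq_zero_or_pos M with rfl | hM
  · simp
  have hmap : Set.MapsTo (fun b => (c + b) % M) (range M) (range M) := fun b _ =>
    Finset.mem_coe.2 (Finset.mem_range.2 (Nat.mod_lt _ hM))
  have hinj : Set.InjOn (fun b => (c + b) % M) (range M) := by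
    intro b hb b' hb' h
    have h₁ : b ≡ b' [MOD M] := Nat.ModEq.add_left_cancel' c h
    exact Nat.ModEq.eq_of_lt_of_lt h₁ (Finset.mem_range.1 hb) (Finset.mem_range.1 hb')
  exact Finset.sum_nbij _ (fun b hb => hmap hb) hinj
    (Finset.surjOn_of_injOn_of_card_le _ hmap hinj le_rfl) fun _ _ => rfl

theorem sum_ind_div_le (hm : 0 < m) (M k : ℕ) : ∑ w ∈ range M, ind (w / m = k) ≤ m := by
  classical
  rw [sum_ind_eq_card]
  refine Nat.cast_le.2 (le_trans (Finset.card_le_card_of_injOn (t := range m) (fun w => w % m)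
    (fun w _ => ?_) ?_) (Finset.card_range m).le)
  · exact Finset.mem_coe.2 (Finset.mem_range.2 (Nat.mod_lt w hm))
  · intro w hw w' hw' h
    have h₁ := (Finset.mem_filter.1 (Finset.mem_coe.1 hw)).2
    have h₂ := (Finset.mem_filter.1 (Finset.mem_coe.1 hw')).2
    simp only at h
    rw [← Nat.div_add_mod w m, ← Nat.div_add_mod w' m, h₁, h₂, h]

/-- A linear function modulo `M` rarely hits an interval. -/
theorem sum_ind_linear_le {M w δ : ℕ} (hw : w < M) (hδ : 0 < δ) (hδm : δ < m) (k : ℕ) :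
    ∑ a ∈ range M, ind ((w + a * δ) % M / m = k) ≤ 3 * m := by
  classical
  have hM : 0 < M := by omega
  rw [sum_ind_eq_card]
  -- As `a` grows, `w + a * δ` winds around at most `δ + 1` times, and on each turn it hits the
  -- interval of length `m` at most `m / δ + 1` times. The turn and the block of length `δ` in the
  -- interval determine `a`.
  have hcard : ((range M).filter fun a => (w + a * δ) % M / m = k).card ≤
      (range (δ + 1) ×ˢ range (m / δ + 1)).card := by
    refine Finset.card_le_card_of_injOn
      (fun a => ((w + a * δ) / M, (w + a * δ) % M % m / δ)) (fun a ha => ?_) ?_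
    · have ha' := Finset.mem_range.1 (Finset.mem_filter.1 (Finset.mem_coe.1 ha)).1
      refine Finset.mem_coe.2 (Finset.mem_product.2 ⟨Finset.mem_range.2 ?_, Finset.mem_range.2 ?_⟩)
      · refine (Nat.div_lt_iff_lt_mul hM).2 ?_
        have : a * δ ≤ M * δ := Nat.mul_le_mul_right δ ha'.le
        calc w + a * δ < M + M * δ := by omega
          _ = (δ + 1) * M := by ring
      · exact Nat.lt_succ_of_le (Nat.div_le_div_right (Nat.mod_lt _ (by omega)).le)
    · intro a ha a' ha' h
      have h₁ := (Finset.mem_filter.1 (Finset.mem_coe.1 ha)).2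
      have h₂ := (Finset.mem_filter.1 (Finset.mem_coe.1 ha')).2
      simp only [Prod.mk.injEq] at h
      have aux : ∀ a a' : ℕ, (w + a * δ) % M / m = k → (w + a' * δ) % M / m = k →
          (w + a * δ) / M = (w + a' * δ) / M →
          (w + a * δ) % M % m / δ = (w + a' * δ) % M % m / δ → ¬ a < a' := by
        intro a a' h₁ h₂ h₃ h₄ hlt
        have e₁ := Nat.div_add_mod (w + a * δ) M
        have e₂ := Nat.div_add_mod (w + a' * δ) M
        have e₃ := Nat.div_add_mod ((w + a * δ) % M) m
        have e₄ := Nat.div_add_mod ((w + a' * δ) % M) m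
        have e₅ := Nat.div_add_mod ((w + a * δ) % M % m) δ
        have e₆ := Nat.div_add_mod ((w + a' * δ) % M % m) δ
        have e₇ := Nat.mod_lt ((w + a' * δ) % M % m) hδ
        have e₈ : (a + 1) * δ ≤ a' * δ := Nat.mul_le_mul_right δ hlt
        rw [Nat.add_mul, one_mul] at e₈
        rw [h₁] at e₃
        rw [h₂] at e₄
        rw [h₃] at e₁
        rw [h₄] at e₅
        omega
      rcases lt_trichotomy a a' with hlt | heq | hgt
      · exact absurd hlt (aux a a' h₁ h₂ h.1 h.2)
      · exact heq
      · exact absurd hgt (aux a' a h₂ h₁ h.1.symm h.2.symm)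
  rw [Finset.card_product, Finset.card_range, Finset.card_range] at hcard
  have h₁ : δ * (m / δ) ≤ m := Nat.mul_div_le m δ
  have h₂ : m / δ ≤ m := Nat.div_le_self m δ
  have h₃ : (δ + 1) * (m / δ + 1) = δ * (m / δ) + m / δ + δ + 1 := by ring
  have h₄ : ((range M).filter fun a => (w + a * δ) % M / m = k).card ≤ 3 * m := by omega
  exact_mod_cast h₄

/-- The shift of `ζ`. -/
def hashShift (M m a b ζ : ℕ) : ℕ := (a * ζ + b) % M / m

theorem sum_ind_hashShift_le (hm : 0 < m) (M a ζ k : ℕ) :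
    ∑ b ∈ range M, ind (hashShift M m a b ζ = k) ≤ m := by
  have := sum_range_add_mod M (a * ζ) fun w => ind (w / m = k)
  simp only [hashShift]
  rw [this]
  exact sum_ind_div_le hm M k

/-- For fixed `a`, the residue `w` of `a * ζ + b` runs through all residues as `b` does, and the
second argument gives `w + a * δ` with `δ = ζ' - ζ`. The first condition leaves at most `m` values
of `w`, and the second at most `3 * m` values of `a` for each. No primality of the modulus is
needed. -/
theorem sum_ind_hashShift₂_le {M ζ ζ' : ℕ} (hζ' : ζ' < m) (hlt : ζ < ζ') (k k' : ℕ) :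
    ∑ a ∈ range M, ∑ b ∈ range M, ind (hashShift M m a b ζ = k ∧ hashShift M m a b ζ' = k') ≤
      3 * m * m := by
  obtain ⟨δ, rfl⟩ : ∃ δ, ζ' = ζ + δ := ⟨ζ' - ζ, by omega⟩
  have h₁ : ∀ a b, ind (hashShift M m a b ζ = k ∧ hashShift M m a b (ζ + δ) = k') =
      (fun w => ind (w / m = k ∧ (w + a * δ) % M / m = k')) ((a * ζ + b) % M) := by
    intro a b
    refine ind_congr (and_congr_right fun _ => ?_)
    rw [hashShift, Nat.mod_add_mod, show a * (ζ + δ) + b = a * ζ + b + a * δ by ring]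
  rw [Finset.sum_congr rfl fun a _ => (Finset.sum_congr rfl fun b _ => h₁ a b).trans
    (sum_range_add_mod M (a * ζ) fun w => ind (w / m = k ∧ (w + a * δ) % M / m = k')),
    Finset.sum_comm]
  simp only [ind_and]
  calc ∑ w ∈ range M, ∑ a ∈ range M, ind (w / m = k) * ind ((w + a * δ) % M / m = k')
      ≤ ∑ w ∈ range M, ind (w / m = k) * (3 * m) := by
        refine Finset.sum_le_sum fun w hw => ?_
        rw [← Finset.mul_sum]
        exact mul_le_mul_of_nonneg_left
          (sum_ind_linear_le (Finset.mem_range.1 hw) (by omega) (by omega) k') (ind_nonneg _)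
    _ ≤ m * (3 * m) := by
        rw [← Finset.sum_mul]
        exact mul_le_mul_of_nonneg_right (sum_ind_div_le (by omega) M k) (by positivity)
    _ = _ := by ring

variable (hn : 0 < n)

/-- The random permutations by which the rounds change the random function. -/
def shift (B : ℕ) (θ : (Fin B → Bool) × (Fin B → Bool)) (ζ : Fin m) (u : Fin n) : Fin n :=
  ⟨(u + hashShift (n * m) m (num θ.1 % (n * m)) (num θ.2 % (n * m)) ζ) % n, Nat.mod_lt _ hn⟩

theorem shift_bijective {B : ℕ} (θ : (Fin B → Bool) × (Fin B → Bool)) (ζ : Fin m) :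
    Bijective (shift hn B θ ζ) := by
  refine Finite.injective_iff_bijective.1 fun u u' h => ?_
  have h₁ : (u : ℕ) ≡ u' [MOD n] := Nat.ModEq.add_right_cancel' _ (Fin.ext_iff.1 h)
  exact Fin.ext (Nat.ModEq.eq_of_lt_of_lt h₁ u.2 u'.2)

theorem hashShift_of_shift {B : ℕ} {θ : (Fin B → Bool) × (Fin B → Bool)} {ζ : Fin m} {u v : Fin n}
    (h : shift hn B θ ζ u = v) :
    hashShift (n * m) m (num θ.1 % (n * m)) (num θ.2 % (n * m)) ζ = (v + (n - u)) % n := by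
  have hm : 0 < m := ζ.pos
  have hlt : hashShift (n * m) m (num θ.1 % (n * m)) (num θ.2 % (n * m)) ζ < n :=
    (Nat.div_lt_iff_lt_mul hm).2 (Nat.mod_lt _ (Nat.mul_pos hn hm))
  have hu := u.2
  rw [← h, shift]
  simp only
  rw [Nat.mod_add_mod]
  generalize hashShift (n * m) m (num θ.1 % (n * m)) (num θ.2 % (n * m)) ζ = g at hlt
  rw [show (u : ℕ) + g + (n - u) = g + n by omega, Nat.add_mod_right, Nat.mod_eq_of_lt hlt]

theorem expect_pair_num_mod_le {B M : ℕ} (hM : M < 2 ^ B) (hM2 : 2 ^ B ≤ 2 * M) {φ : ℕ → ℕ → ℝ}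
    (hφ : ∀ x y, 0 ≤ φ x y) :
    𝔼 θ : (Fin B → Bool) × (Fin B → Bool), φ (num θ.1 % M) (num θ.2 % M) ≤
      (2 / M) ^ 2 * ∑ a ∈ range M, ∑ b ∈ range M, φ a b := by
  rw [expect_prod fun a b : Fin B → Bool => φ (num a % M) (num b % M)]
  calc _ ≤ 𝔼 a : Fin B → Bool, (fun x => 2 / M * ∑ b ∈ range M, φ x b) (num a % M) :=
        expect_mono' fun a =>
          expect_num_mod_le hM hM2 (φ := fun y => φ (num a % M) y) fun x => hφ _ x
    _ ≤ 2 / M * ∑ a ∈ range M, 2 / M * ∑ b ∈ range M, φ a b :=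
        expect_num_mod_le hM hM2 (φ := fun x => 2 / M * ∑ b ∈ range M, φ x b) fun x =>
          mul_nonneg (by positivity) (Finset.sum_nonneg fun _ _ => hφ _ _)
    _ = _ := by
        rw [← Finset.mul_sum]
        ring

theorem expect_shift_le (ζ : Fin m) (u v : Fin n) :
    𝔼 θ, ind (shift hn (n * m).size θ ζ u = v) ≤ 4 / n := by
  have hm : 0 < m := ζ.pos
  have hM := Nat.mul_pos hn hm
  have hn0 : (0 : ℝ) < n := by exact_mod_cast hn
  have hm0 : (0 : ℝ) < m := by exact_mod_cast hm
  calc _ ≤ 𝔼 θ : (Fin (n * m).size → Bool) × (Fin (n * m).size → Bool),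
        ind (hashShift (n * m) m (num θ.1 % (n * m)) (num θ.2 % (n * m)) ζ = (v + (n - u)) % n) :=
        expect_mono' fun θ => ind_mono fun h => hashShift_of_shift hn h
    _ ≤ (2 / (n * m : ℕ)) ^ 2 * ∑ a ∈ range (n * m), ∑ b ∈ range (n * m),
        ind (hashShift (n * m) m a b ζ = (v + (n - u)) % n) :=
        expect_pair_num_mod_le (Nat.lt_size_self _) (two_pow_size_le hM)
          (φ := fun a b => ind (hashShift (n * m) m a b ζ = (v + (n - u)) % n))
          fun _ _ => ind_nonneg _
    _ ≤ (2 / (n * m : ℕ)) ^ 2 * ∑ _a ∈ range (n * m), (m : ℝ) := by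
        refine mul_le_mul_of_nonneg_left (Finset.sum_le_sum fun a _ => ?_) (by positivity)
        exact sum_ind_hashShift_le hm _ _ _ _
    _ = _ := by
        rw [Finset.sum_const, nsmul_eq_mul, Finset.card_range]
        push_cast
        field_simp
        norm_num

/-- The two biased coefficients cost a factor 2 each, so the bound is `(2 / (n * m)) ^ 2 * (3 * m *
m) = 12 / n ^ 2`, which is below the required `16 / n ^ 2`. -/
theorem expect_shift₂_le (ζ ζ' : Fin m) (u u' v v' : Fin n) (hne : ζ ≠ ζ') :
    𝔼 θ, ind (shift hn (n * m).size θ ζ u = v ∧ shift hn (n * m).size θ ζ' u' = v') ≤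
      (4 / (n : ℝ)) ^ 2 := by
  have hm : 0 < m := ζ.pos
  have hM := Nat.mul_pos hn hm
  have hn0 : (0 : ℝ) < n := by exact_mod_cast hn
  have hm0 : (0 : ℝ) < m := by exact_mod_cast hm
  calc _ ≤ 𝔼 θ : (Fin (n * m).size → Bool) × (Fin (n * m).size → Bool),
        ind (hashShift (n * m) m (num θ.1 % (n * m)) (num θ.2 % (n * m)) ζ = (v + (n - u)) % n ∧
          hashShift (n * m) m (num θ.1 % (n * m)) (num θ.2 % (n * m)) ζ' =
            (v' + (n - u')) % n) :=
        expect_mono' fun θ => ind_mono fun h =>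
          ⟨hashShift_of_shift hn h.1, hashShift_of_shift hn h.2⟩
    _ ≤ (2 / (n * m : ℕ)) ^ 2 * ∑ a ∈ range (n * m), ∑ b ∈ range (n * m),
        ind (hashShift (n * m) m a b ζ = (v + (n - u)) % n ∧
          hashShift (n * m) m a b ζ' = (v' + (n - u')) % n) :=
        expect_pair_num_mod_le (Nat.lt_size_self _) (two_pow_size_le hM)
          (φ := fun a b => ind (hashShift (n * m) m a b ζ = (v + (n - u)) % n ∧
          hashShift (n * m) m a b ζ' = (v' + (n - u')) % n))
          fun _ _ => ind_nonneg _
    _ ≤ (2 / (n * m : ℕ)) ^ 2 * (3 * m * m) := by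
        refine mul_le_mul_of_nonneg_left ?_ (by positivity)
        rcases lt_or_gt_of_ne (fun h => hne (Fin.ext h) : (ζ : ℕ) ≠ ζ') with hlt | hlt
        · exact sum_ind_hashShift₂_le ζ'.2 hlt _ _
        · simp only [and_comm (a := hashShift (n * m) m _ _ ζ = (v + (n - u)) % n)]
          exact sum_ind_hashShift₂_le ζ.2 hlt _ _
    _ ≤ _ := by
        push_cast
        field_simp
        norm_num

end shift

end ListDisjointness

/-! # The law of the coins -/

namespace ListDisjointness

open Finset Function RAM MeasureTheory ProbabilityTheory
open scoped BigOperators ENNReal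

section law

theorem isProbabilityMeasure_uniformOn_univ (Ω : Type*) [Finite Ω] [Nonempty Ω]
    [MeasurableSpace Ω] [MeasurableSingletonClass Ω] :
    IsProbabilityMeasure (uniformOn (Set.univ : Set Ω)) :=
  isProbabilityMeasure_uniformOn Set.finite_univ Set.univ_nonempty

theorem uniformOn_univ_singleton {Ω : Type*} [Fintype Ω] [MeasurableSpace Ω]
    [MeasurableSingletonClass Ω] (x : Ω) :
    uniformOn (Set.univ : Set Ω) {x} = (Fintype.card Ω : ℝ≥0∞)⁻¹ := by
  rw [uniformOn_univ, Measure.count_singleton, one_div]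

theorem isProbabilityMeasure_coinLaw : IsProbabilityMeasure coinLaw := by
  have := isProbabilityMeasure_uniformOn_univ Bool
  unfold coinLaw
  infer_instance

theorem isProbabilityMeasure_law {n m : ℕ} (hn : 0 < n) : IsProbabilityMeasure (law n m) := by
  have : Nonempty (Fin n) := ⟨⟨0, hn⟩⟩
  have := isProbabilityMeasure_uniformOn_univ (Fin m → Fin n)
  have := isProbabilityMeasure_coinLaw
  unfold law
  infer_instance

theorem coinLaw_cylinder {I : Type*} [Fintype I] [DecidableEq I] {ι : I → ℕ} (hι : Injective ι) (c : I → Bool) :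
    coinLaw {ω | ∀ i, ω (ι i) = c i} = (Fintype.card (I → Bool) : ℝ≥0∞)⁻¹ := by
  classical
  have := isProbabilityMeasure_uniformOn_univ Bool
  rcases isEmpty_or_nonempty I with hI | hI
  · have := isProbabilityMeasure_coinLaw
    simp
  have e : {ω : ℕ → Bool | ∀ i, ω (ι i) = c i} =
      Set.pi (univ.image ι : Finset ℕ) fun x => {c (invFun ι x)} := by
    ext ω
    simp [Set.mem_pi, leftInverse_invFun hι _]
  rw [e, coinLaw, Measure.infinitePi_pi _ fun _ _ => measurableSet_singleton _,
    Finset.prod_congr rfl fun x _ => uniformOn_univ_singleton (c (invFun ι x)),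
    Finset.prod_const, Finset.card_image_of_injective _ hι, Finset.card_univ, Fintype.card_fun,
    Nat.cast_pow, ENNReal.inv_pow]

/-- An event has at least the probability that finitely many coins say so. -/
theorem expect_le_law {n m : ℕ} (hn : 0 < n) {I : Type*} [Fintype I] [DecidableEq I] {ι : I → ℕ}
    (hι : Injective ι) (Q : (Fin m → Fin n) → (I → Bool) → Prop)
    (A : Set ((Fin m → Fin n) × (ℕ → Bool)))
    (hA : ∀ h ω, Q h (fun i => ω (ι i)) → (h, ω) ∈ A) :
    𝔼 h, 𝔼 c, ind (Q h c) ≤ (law n m).real A := by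
  classical
  have := isProbabilityMeasure_law (m := m) hn
  have : Nonempty (Fin n) := ⟨⟨0, hn⟩⟩
  have := isProbabilityMeasure_uniformOn_univ (Fin m → Fin n)
  have := isProbabilityMeasure_coinLaw
  set T := (univ : Finset ((Fin m → Fin n) × (I → Bool))).filter fun x => Q x.1 x.2 with hT
  set U : (Fin m → Fin n) × (I → Bool) → Set ((Fin m → Fin n) × (ℕ → Bool)) :=
    fun x => {x.1} ×ˢ {ω | ∀ i, ω (ι i) = x.2 i} with hU
  have hmeas : ∀ x, MeasurableSet (U x) := by
    intro x
    refine (measurableSet_singleton _).prod ?_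
    have : {ω : ℕ → Bool | ∀ i, ω (ι i) = x.2 i} =
        ⋂ i, (fun ω : ℕ → Bool => ω (ι i)) ⁻¹' {x.2 i} := by
      ext ω
      simp
    rw [this]
    exact MeasurableSet.iInter fun i => measurable_pi_apply (ι i) (measurableSet_singleton _)
  have hdisj : Set.PairwiseDisjoint (T : Set ((Fin m → Fin n) × (I → Bool))) U := by
    intro x _ y _ hxy
    refine Set.disjoint_left.2 fun a hax hay => hxy ?_
    obtain ⟨h₁, h₂⟩ := hax
    obtain ⟨h₃, h₄⟩ := hay
    refine Prod.ext ((Set.mem_singleton_iff.1 h₁).symm.trans (Set.mem_singleton_iff.1 h₃)) ?_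
    funext i
    exact (h₂ i).symm.trans (h₄ i)
  have hval : ∀ x, (law n m).real (U x) =
      (1 / Fintype.card (Fin m → Fin n)) * (1 / Fintype.card (I → Bool)) := by
    intro x
    rw [measureReal_def, law, hU, Measure.prod_prod, uniformOn_univ_singleton, coinLaw_cylinder hι,
      ENNReal.toReal_mul, ENNReal.toReal_inv, ENNReal.toReal_inv, ENNReal.toReal_natCast,
      ENNReal.toReal_natCast, one_div, one_div]
  calc 𝔼 h, 𝔼 c, ind (Q h c) = 𝔼 x : (Fin m → Fin n) × (I → Bool), ind (Q x.1 x.2) :=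
        (expect_prod fun h c => ind (Q h c)).symm
    _ = ∑ x ∈ T, (law n m).real (U x) := by
        rw [Fintype.expect_eq_sum_div_card, sum_ind_eq_card, Fintype.card_prod]
        simp only [hval, Finset.sum_const, nsmul_eq_mul]
        push_cast
        ring
    _ = (law n m).real (⋃ x ∈ T, U x) :=
        (measureReal_biUnion_finset hdisj fun x _ => hmeas x).symm
    -- The disjoint cylinders are measurable, and monotonicity does not need measurability of `A`.
    _ ≤ (law n m).real A := by
        refine measureReal_mono ?_
        intro a ha
        simp only [Set.mem_iUnion] at ha
        obtain ⟨x, hx, h₁, h₂⟩ := ha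
        have hQ := (Finset.mem_filter.1 hx).2
        have := hA a.1 a.2 (by
          rw [Set.mem_singleton_iff.1 h₁, funext h₂]
          exact hQ)
        exact this

/-- The coins of the rounds, sorted. -/
def sortCoins {R B₂ S B : ℕ} (c : Fin R × (Fin B₂ ⊕ Fin B₂ ⊕ Fin S × Fin B) → Bool) (r : Fin R) :
    ((Fin B₂ → Bool) × (Fin B₂ → Bool)) × (Fin S → Fin B → Bool) :=
  ((fun i => c (r, .inl i), fun i => c (r, .inr (.inl i))), fun q i => c (r, .inr (.inr (q, i))))

theorem sortCoins_bijective {R B₂ S B : ℕ} :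
    Bijective (sortCoins (R := R) (B₂ := B₂) (S := S) (B := B)) := by
  constructor
  · intro c c' h
    funext ⟨r, x⟩
    have hr := congrFun h r
    simp only [sortCoins, Prod.mk.injEq] at hr
    rcases x with i | i | ⟨q, i⟩
    · exact congrFun hr.1.1 i
    · exact congrFun hr.1.2 i
    · exact congrFun (congrFun hr.2 q) i
  · intro β
    refine ⟨fun x => match x with
      | (r, .inl i) => (β r).1.1 i
      | (r, .inr (.inl i)) => (β r).1.2 i
      | (r, .inr (.inr (q, i))) => (β r).2 q i, rfl⟩

/-- The position of a coin in the sequence of coins; round `r` starts at position `pos r`. -/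
def coinPos {R B₂ S B : ℕ} (pos : ℕ → ℕ) : Fin R × (Fin B₂ ⊕ Fin B₂ ⊕ Fin S × Fin B) → ℕ
  | (r, .inl i) => pos r + i
  | (r, .inr (.inl i)) => pos r + (B₂ + i)
  | (r, .inr (.inr (q, i))) => pos r + (2 * B₂ + q * B + i)

theorem coinPos_injective {R B₂ S B : ℕ} {pos : ℕ → ℕ}
    (hpos : ∀ r r', r < r' → pos r + (2 * B₂ + S * B) ≤ pos r') :
    Injective (coinPos (R := R) (B₂ := B₂) (S := S) (B := B) pos) := by
  have hq : ∀ (q : Fin S) (i : Fin B), (q : ℕ) * B + i < S * B := by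
    intro q i
    have : ((q : ℕ) + 1) * B ≤ S * B := Nat.mul_le_mul_right B q.2
    rw [Nat.add_mul, one_mul] at this
    omega
  have hb : ∀ x : Fin R × (Fin B₂ ⊕ Fin B₂ ⊕ Fin S × Fin B),
      pos x.1 ≤ coinPos pos x ∧ coinPos pos x < pos x.1 + (2 * B₂ + S * B) := by
    rintro ⟨r, i | i | ⟨q, i⟩⟩ <;> simp only [coinPos]
    · omega
    · omega
    · have := hq q i
      omega
  rintro ⟨r, x⟩ ⟨r', x'⟩ h
  have h₁ := hb (r, x)
  have h₂ := hb (r', x')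
  simp only at h₁ h₂
  have hr : r = r' := by
    rcases lt_trichotomy (r : ℕ) r' with hlt | heq | hgt
    · have := hpos _ _ hlt
      omega
    · exact Fin.ext heq
    · have := hpos _ _ hgt
      omega
  subst hr
  congr 1
  rcases x with i | i | ⟨q, i⟩ <;> rcases x' with i' | i' | ⟨q', i'⟩ <;>
    simp only [coinPos, Nat.add_left_cancel_iff] at h
  · rw [Fin.ext h]
  · omega
  · omega
  · omega
  · rw [Fin.ext (by omega : (i : ℕ) = i')]
  · omega
  · omega
  · omega
  · have e₁ : (q : ℕ) * B + i = q' * B + i' := by omega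
    have hB : 0 < B := i.pos
    have e₂ : (q : ℕ) = q' := by
      have := congrArg (· / B) e₁
      simpa [Nat.mul_comm _ B, Nat.mul_add_div hB, Nat.div_eq_of_lt] using this
    have e₃ : (i : ℕ) = i' := by
      rw [e₂] at e₁
      omega
    rw [Fin.ext e₂, Fin.ext e₃]

/-- An event has at least the probability that some of the rounds succeed. -/
theorem expect_exists_le_law {n m R B₂ S B : ℕ} (hn : 0 < n) {pos : ℕ → ℕ}
    (hpos : ∀ r r', r < r' → pos r + (2 * B₂ + S * B) ≤ pos r')
    (Q : ((Fin B₂ → Bool) × (Fin B₂ → Bool)) × (Fin S → Fin B → Bool) → (Fin m → Fin n) → Prop)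
    (A : Set ((Fin m → Fin n) × (ℕ → Bool)))
    (hA : ∀ h ω, ∀ r < R, Q ((fun i => ω (pos r + i), fun i => ω (pos r + (B₂ + i))),
      fun q i => ω (pos r + (2 * B₂ + q * B + i))) h → (h, ω) ∈ A) :
    𝔼 h, 𝔼 β : Fin R → ((Fin B₂ → Bool) × (Fin B₂ → Bool)) × (Fin S → Fin B → Bool),
      ind (∃ r, Q (β r) h) ≤ (law n m).real A := by
  have e : ∀ h, 𝔼 c : Fin R × (Fin B₂ ⊕ Fin B₂ ⊕ Fin S × Fin B) → Bool,
      ind (∃ r, Q (sortCoins c r) h) = 𝔼 β : Fin R → ((Fin B₂ → Bool) × (Fin B₂ → Bool)) ×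
        (Fin S → Fin B → Bool), ind (∃ r, Q (β r) h) := fun h =>
    Fintype.expect_bijective sortCoins sortCoins_bijective _ _ fun _ => rfl
  simp only [← e]
  refine expect_le_law hn (coinPos_injective hpos) (fun h c => ∃ r, Q (sortCoins c r) h) A ?_
  rintro h ω ⟨r, hr⟩
  exact hA h ω r r.2 hr

end law

end ListDisjointness

/-! # The success probability of the rounds -/

namespace ListDisjointness

open Finset Function RAM MeasureTheory ProbabilityTheory
open scoped BigOperators

section transfer

variable {n : ℕ}

theorem iterate_coe {f : Fin n → Fin n} {fN : ℕ → ℕ} (hf : ∀ u : Fin n, fN u = f u) (u : Fin n)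
    (l : ℕ) : fN^[l] u = (f^[l] u : Fin n) := by
  induction l with
  | zero => rfl
  | succ l ih => rw [iterate_succ_apply', iterate_succ_apply', ih, hf]

theorem stopsAt_iff {f : Fin n → Fin n} {fN : ℕ → ℕ} (hf : ∀ u : Fin n, fN u = f u) {d e L : ℕ}
    {u : Fin n} : StopsAt fN d e u L ↔ Stops f (stopSet n d e) u L := by
  simp only [StopsAt, Stops, mem_stopSet, iterate_coe hf]

/-- The run `b` of the pattern is the trial that reads the table, and the run `a` is the one whose
entry it finds. The condition on the runs in between says that this entry has not been overwritten.
-/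
theorem HasPattern.success {E : Env} {z : Fin n → ℕ} {f : Fin n → Fin n} {zN fN st : ℕ → ℕ}
    {W K d S e : ℕ} {w : Fin S → Fin n} {j : Fin n} {I : Finset (Fin n)}
    (hzN : ∀ u : Fin n, zN u = z u) (hf : ∀ u : Fin n, fN u = f u) (hst : ∀ q : Fin S, st q = w q)
    (hz : ∀ i ∈ I, z i = z j) (hj : j ∉ I) (hxy : ∀ i ∈ I, E.x j = E.y i ∨ E.x i = E.y j)
    (h : HasPattern f (stopSet n d e) (fun v => (v : ℕ) % W) K j I w) :
    Success E n W K d S e zN fN st := by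
  obtain ⟨a, b, i, t, r, k, hi, hk, hr, ht, h⟩ := h
  have ea : ∀ l, fN^[l] (st a) = (f^[l] (w a) : Fin n) := fun l => by rw [hst, iterate_coe hf]
  have eb : ∀ l, fN^[l] (st b) = (f^[l] (w b) : Fin n) := fun l => by rw [hst, iterate_coe hf]
  have hij : i ≠ j := fun h => hj (h ▸ hi)
  refine ⟨a, b, r, t, k, h.lt, b.2, hr, ht, ?_, ?_, ?_, ?_, ?_, ?_, ?_, ?_, ?_⟩
  · rw [hst, stopsAt_iff hf]
    exact h.right_stops
  · rw [hst, stopsAt_iff hf]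
    exact h.left_stops
  · rw [ea, eb, h.left, h.right]
    exact fun he => hij (Fin.ext he.symm)
  · rw [ea, eb, h.left, h.right, hzN, hzN, hz i hi]
  · rw [eb]
    exact Fin.is_lt _
  · rw [ea]
    exact Fin.is_lt _
  · rw [ea, eb, h.left, h.right]
    exact hxy i hi
  · rw [ea, eb, h.meet]
  · intro q h₁ h₂ L hL hs he
    have hq : q < S := h₂.trans b.2
    have hst' := hst ⟨q, hq⟩
    simp only at hst'
    rw [hst', stopsAt_iff hf] at hs
    rw [hst', iterate_coe hf, ea] at he
    exact h.between ⟨q, hq⟩ h₁ h₂ ⟨L, hL, hs, he⟩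

end transfer

/-! ### The mixed list of entries and the separating bit -/

section entries

variable {n m : ℕ} (x y : Fin n → Fin m)

theorem oracle_apply {a b : ℕ} (f : Fin a → Fin b) (i : Fin a) : oracle f i = f i := by
  rw [oracle, dif_pos i.2]

/-- The entry at an index, from the list that a bit of the index selects. -/
def entryAt (pw c : ℕ) (u : Fin n) : Fin m := if ((u : ℕ) / pw + c) % 2 = 0 then x u else y u

theorem roundEntry_eq {h : ℕ → ℕ} {ω : ℕ → Bool} (pw c : ℕ) (u : Fin n) :
    roundEntry ⟨oracle x, oracle y, h, ω⟩ pw c u = entryAt x y pw c u := by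
  unfold roundEntry entryAt
  simp only [oracle_apply]
  rcases Nat.mod_two_eq_zero_or_one ((u : ℕ) / pw + c) with h | h <;> simp [h]

theorem roundNext_eq (hn : 0 < n) (h : Fin m → Fin n) {ω : ℕ → Bool} {B : ℕ}
    (θ : (Fin B → Bool) × (Fin B → Bool)) (pw c : ℕ) (u : Fin n) :
    roundNext ⟨oracle x, oracle y, oracle h, ω⟩ n m (n * m) pw c (num θ.1 % (n * m))
      (num θ.2 % (n * m)) u = (twist (shift hn B) θ h ∘ entryAt x y pw c) u := by
  rw [roundNext, roundEntry_eq]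
  simp only [oracle_apply]
  rfl

theorem coinsVal_eq_num (E : Env) (u B : ℕ) :
    coinsVal E u B = num fun i : Fin B => E.coins (u + i) := by
  refine bitsVal_congr fun i hi => ?_
  rw [dif_pos hi]

theorem startOf_eq (E : Env) (hn : 0 < n) (u : ℕ) :
    startOf E n n.size u = startVertex hn fun i => E.coins (u + i) :=
  congrArg (· % n) (coinsVal_eq_num E u n.size)

theorem freqSum_eq (z : Fin n → Fin m) : freqSum z = ∑ a, freq z a ^ 2 := by
  calc freqSum z = ∑ a, ∑ v ∈ univ.filter fun v => z v = a, freq z (z v) :=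
        (Finset.sum_fiberwise univ z fun v => freq z (z v)).symm
    _ = ∑ a, freq z a ^ 2 := by
        refine Finset.sum_congr rfl fun a _ => ?_
        rw [Finset.sum_congr rfl fun v hv => by rw [(Finset.mem_filter.1 hv).2], Finset.sum_const,
          smul_eq_mul, sq, freq]

theorem freqSum_entryAt_le (pw c : ℕ) : freqSum (entryAt x y pw c) ≤ 2 * sqFreq x y := by
  rw [freqSum_eq, sqFreq, Finset.mul_sum]
  refine Finset.sum_le_sum fun a _ => ?_
  have h : freq (entryAt x y pw c) a ≤ (univ.filter fun i => x i = a).card +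
      (univ.filter fun i => y i = a).card := by
    refine le_trans (Finset.card_le_card fun u hu => ?_) (Finset.card_union_le _ _)
    have hu' := (Finset.mem_filter.1 hu).2
    rw [entryAt] at hu'
    rw [Finset.mem_union, Finset.mem_filter, Finset.mem_filter]
    split_ifs at hu' with hbit
    · exact Or.inl ⟨Finset.mem_univ u, hu'⟩
    · exact Or.inr ⟨Finset.mem_univ u, hu'⟩
  calc freq (entryAt x y pw c) a ^ 2 ≤ ((univ.filter fun i => x i = a).card +
        (univ.filter fun i => y i = a).card) ^ 2 := Nat.pow_le_pow_left h 2
    _ ≤ _ := add_sq_le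

/-- Different indices differ in some bit. -/
theorem exists_bit_ne {k a b : ℕ} (ha : a < 2 ^ k) (hb : b < 2 ^ k) (hne : a ≠ b) :
    ∃ β < k, a / 2 ^ β % 2 ≠ b / 2 ^ β % 2 := by
  induction k generalizing a b with
  | zero =>
    rw [pow_zero] at ha hb
    omega
  | succ k ih =>
    by_cases h0 : a % 2 = b % 2
    · obtain ⟨β, hβ, h⟩ := ih (a := a / 2) (b := b / 2) (by rw [pow_succ] at ha; omega)
        (by rw [pow_succ] at hb; omega) (by omega)
      refine ⟨β + 1, by omega, ?_⟩
      rwa [pow_succ', ← Nat.div_div_eq_div_mul, ← Nat.div_div_eq_div_mul]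
    · exact ⟨0, by omega, by simpa using h0⟩

/-- A bit and an orientation for which the walk sees `x i = y j` at `i` and `j`, and the larger one
of the two sides. -/
theorem exists_sides {i₀ j₀ : Fin n} (hne : i₀ ≠ j₀) (hxy : x i₀ = y j₀) :
    ∃ β < n.size, ∃ c < 2, ∃ (j : Fin n) (I : Finset (Fin n)), j ∉ I ∧
      (∀ i ∈ I, entryAt x y (2 ^ β) c i = entryAt x y (2 ^ β) c j) ∧
      freq (entryAt x y (2 ^ β) c) (entryAt x y (2 ^ β) c j) ≤ 2 * I.card ∧
      ∀ i ∈ I, x j = y i ∨ x i = y j := by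
  obtain ⟨β, hβ, hbit⟩ := exists_bit_ne (k := n.size) (i₀.2.trans (Nat.lt_size_self n))
    (j₀.2.trans (Nat.lt_size_self n)) fun h => hne (Fin.ext h)
  -- The orientation is chosen such that `i₀` is read from `x` and `j₀` from `y`.
  obtain ⟨c, hc, hi, hj⟩ : ∃ c < 2, ((i₀ : ℕ) / 2 ^ β + c) % 2 = 0 ∧
      ¬ ((j₀ : ℕ) / 2 ^ β + c) % 2 = 0 := by
    rcases Nat.mod_two_eq_zero_or_one ((i₀ : ℕ) / 2 ^ β) with h | h
    · exact ⟨0, by norm_num, by omega, by omega⟩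
    · exact ⟨1, by norm_num, by omega, by omega⟩
  refine ⟨β, hβ, c, hc, ?_⟩
  set z := entryAt x y (2 ^ β) c with hz
  have hzi : z i₀ = x i₀ := if_pos hi
  have hzj : z j₀ = x i₀ := (if_neg hj).trans hxy.symm
  set X := univ.filter fun u : Fin n => z u = x i₀ ∧ ((u : ℕ) / 2 ^ β + c) % 2 = 0 with hX
  set Y := univ.filter fun u : Fin n => z u = x i₀ ∧ ¬ ((u : ℕ) / 2 ^ β + c) % 2 = 0 with hY
  have hXz : ∀ u ∈ X, z u = x i₀ ∧ x u = x i₀ := by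
    intro u hu
    have h := (Finset.mem_filter.1 hu).2
    have e : z u = x u := if_pos h.2
    exact ⟨h.1, e.symm.trans h.1⟩
  have hYz : ∀ u ∈ Y, z u = x i₀ ∧ y u = x i₀ := by
    intro u hu
    have h := (Finset.mem_filter.1 hu).2
    have e : z u = y u := if_neg h.2
    exact ⟨h.1, e.symm.trans h.1⟩
  have hfreq : freq z (x i₀) ≤ X.card + Y.card := by
    refine le_trans (Finset.card_le_card fun u hu => ?_) (Finset.card_union_le _ _)
    have hu' := (Finset.mem_filter.1 hu).2
    rw [Finset.mem_union, Finset.mem_filter, Finset.mem_filter]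
    by_cases hb : ((u : ℕ) / 2 ^ β + c) % 2 = 0
    · exact Or.inl ⟨Finset.mem_univ u, hu', hb⟩
    · exact Or.inr ⟨Finset.mem_univ u, hu', hb⟩
  -- The larger class serves as `I` and contains at least half of the occurrences. The fixed index
  -- is taken from the other class, so each of its pairs with `I` is a solution.
  rcases le_total Y.card X.card with h | h
  · refine ⟨j₀, X, fun hm => hj (Finset.mem_filter.1 hm).2.2, fun i hm => ?_, ?_, fun i hm => ?_⟩
    · rw [(hXz i hm).1, hzj]
    · rw [hzj]
      omega
    · right
      rw [(hXz i hm).2, hxy]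
  · refine ⟨i₀, Y, fun hm => (Finset.mem_filter.1 hm).2.2 hi, fun i hm => ?_, ?_, fun i hm => ?_⟩
    · rw [(hYz i hm).1, hzi]
    · rw [hzi]
      omega
    · left
      rw [(hYz i hm).2]

theorem roundSuccess_of_blockSucceeds (hn : 0 < n) {h : Fin m → Fin n} {ω : ℕ → Bool}
    {W d S e c β it u : ℕ} {K : ℕ} {j : Fin n} {I : Finset (Fin n)} (h₁ : it % 3 = e)
    (h₂ : it / 3 % 2 = c) (h₃ : it / 6 % n.size = β)
    (hz : ∀ i ∈ I, entryAt x y (2 ^ β) c i = entryAt x y (2 ^ β) c j) (hj : j ∉ I)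
    (hxy : ∀ i ∈ I, x j = y i ∨ x i = y j)
    (hs : BlockSucceeds (shift hn (n * m).size) (startVertex hn) (entryAt x y (2 ^ β) c)
      (stopSet n d e) (fun v => (v : ℕ) % W) K j I
      ((fun i => ω (u + i), fun i => ω (u + ((n * m).size + i))),
        fun (q : Fin S) i => ω (u + (2 * (n * m).size + q * n.size + i))) h) :
    RoundSuccess ⟨oracle x, oracle y, oracle h, ω⟩ n m W K d S n.size (n * m) (n * m).size it u := by
  unfold RoundSuccess
  rw [h₁, h₂, h₃, coinsVal_eq_num, coinsVal_eq_num]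
  simp only [Nat.add_assoc]
  refine HasPattern.success (z := fun u => (entryAt x y (2 ^ β) c u : ℕ))
    (fun u => roundEntry_eq x y _ _ u) (fun v => ?_) (fun q => ?_)
    (fun i hi => by rw [hz i hi]) hj (fun i hi => ?_) hs
  · exact roundNext_eq x y hn h (fun i => ω (u + i), fun i => ω (u + ((n * m).size + i))) (2 ^ β) c v
  · rw [startOf_eq _ hn]
    simp only [Nat.add_assoc, Function.comp_apply]
  · simp only [oracle_apply, Fin.val_inj]
    exact hxy i hi

end entries

/-- If there is a common value, then some round succeeds with a constant probability. -/
theorem le_law_of_roundSuccess {n m W p τ : ℕ} {x y : Fin n → Fin m} (hn : 2 ≤ n) (hW : 0 < W)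
    (hp : 2 * n ≤ p) (hWp : W * p ≤ n ^ 2) (hτ : IsTau n W p τ) (hsq : sqFreq x y ≤ p)
    {i₀ j₀ : Fin n} (hne : i₀ ≠ j₀) (hxy : x i₀ = y j₀)
    (A : Set ((Fin m → Fin n) × (ℕ → Bool)))
    (hA : ∀ h ω, ∀ it < 6 * n.size * (n * n / ((W * τ) * (W * τ)) + 1),
      RoundSuccess ⟨oracle x, oracle y, oracle h, ω⟩ n m W (2 * τ) (n / (16 * τ) + 1) (W / 64 + 2)
        n.size (n * m) (n * m).size it (it * (2 * (n * m).size + (W / 64 + 2) * n.size)) →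
      (h, ω) ∈ A) : 1 / 2 ^ 28 ≤ (law n m).real A := by
  have hn0 : 0 < n := by omega
  obtain ⟨β, hβ, c, hc, j, I, hjI, hz, hI, hxyI⟩ := exists_sides x y hne hxy
  set R := n * n / ((W * τ) * (W * τ)) + 1 with hR
  have hR2 : n ^ 2 ≤ R * (W * τ) ^ 2 := by
    have hpos : 0 < (W * τ) * (W * τ) :=
      Nat.mul_pos (Nat.mul_pos hW hτ.pos) (Nat.mul_pos hW hτ.pos)
    calc n ^ 2 = n * n := sq n
      _ ≤ (W * τ) * (W * τ) * R := (Nat.lt_mul_div_succ _ hpos).le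
      _ = R * (W * τ) ^ 2 := by ring
  obtain ⟨e, he, I', hI', hprob⟩ := exists_le_expect_exists_blockSucceeds
    (tw := shift hn0 (n * m).size) (st := startVertex hn0) (z := entryAt x y (2 ^ β) c) hn hW hp hWp
    hτ (le_expect_startVertex hn0) (expect_startVertex_le hn0) (shift_bijective hn0)
    (expect_shift_le hn0) (fun ζ ζ' u u' v v' h => expect_shift₂_le hn0 ζ ζ' u u' v v' h)
    ((freqSum_entryAt_le x y _ _).trans (Nat.mul_le_mul_left 2 hsq)) j I hjI hz hI R
    (Nat.succ_pos _) hR2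
  set κ := 2 * (n * m).size + (W / 64 + 2) * n.size with hκ
  -- Only the rounds with the right interval, orientation and bit are used; they are `6 * n.size`
  -- rounds apart, and there are `R` of them.
  refine hprob.trans (expect_exists_le_law hn0
    (pos := fun r => (e + 3 * c + 6 * (β + n.size * r)) * κ) (fun r r' hlt => ?_) _ A
    fun h ω r hr hs => ?_)
  · have h₁ : n.size * (r + 1) ≤ n.size * r' := Nat.mul_le_mul_left _ hlt
    have h₂ : n.size * (r + 1) = n.size * r + n.size := by ring
    calc (e + 3 * c + 6 * (β + n.size * r)) * κ + κ
        = (e + 3 * c + 6 * (β + n.size * r) + 1) * κ := by ring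
      _ ≤ _ := Nat.mul_le_mul_right κ (by omega)
  · have h₁ : n.size * (r + 1) ≤ n.size * R := Nat.mul_le_mul_left _ hr
    have h₂ : n.size * (r + 1) = n.size * r + n.size := by ring
    refine hA h ω (e + 3 * c + 6 * (β + n.size * r)) ?_ ?_
    · rw [Nat.mul_assoc]
      omega
    · refine roundSuccess_of_blockSucceeds x y hn0 (by omega) (by omega) ?_
        (fun i hi => by rw [hz i (hI' hi)]) (fun h => hjI (hI' h)) (fun i hi => hxyI i (hI' hi)) hs
      rw [show (e + 3 * c + 6 * (β + n.size * r)) / 6 = β + n.size * r by omega,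
        Nat.add_mul_mod_self_left, Nat.mod_eq_of_lt hβ]

end ListDisjointness

/-! # The running time and the space -/

namespace ListDisjointness

open RAM

section steps

variable (a b : Exp)

theorem steps_sub : (a - b).steps = a.steps + (b.steps + 1) := rfl
theorem steps_div : (a / b).steps = a.steps + (b.steps + 1) := rfl

variable (Z : ℕ) (ρ : ℕ → ℕ)

theorem initCmd_steps_le : initCmd.steps Z ρ ≤ 200 * (Z + ρ 0 + 1) := by
  simp [initCmd, incCmd, Cmd.steps, Exp.steps, steps_div]
  omega

theorem setupCmd_steps_le : setupCmd.steps Z ρ ≤ 200 * (1 + ρ 10 + ρ 12) := by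
  simp [setupCmd, sampleCmd, incCmd, Cmd.steps, Exp.steps, steps_div]
  omega

theorem trialCmd_steps_le : trialCmd.steps Z ρ ≤ 1000 * (1 + ρ 10 + ρ 6) := by
  simp [trialCmd, compareCmd, walkCmd, stepCmd, mergeStepCmd, checkCmd, nextExp, entryExp,
    sampleCmd, incCmd, Cmd.steps, Exp.steps, steps_sub, steps_div]
  omega

theorem mainCmd_steps_le : mainCmd.steps Z ρ ≤
    3000 * (1 + ρ 0 + ρ 9 * (1 + ρ 10 + ρ 12 + ρ 8 * (1 + ρ 10 + ρ 6))) := by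
  have h₁ := setupCmd_steps_le Z ρ
  have h₂ := Nat.mul_le_mul_left (ρ 8) (trialCmd_steps_le Z ρ)
  have h₃ : roundCmd.steps Z ρ + 3 ≤
      3000 * (1 + ρ 10 + ρ 12 + ρ 8 * (1 + ρ 10 + ρ 6)) := by
    simp only [roundCmd, incCmd, Cmd.steps, Exp.steps]
    nlinarith
  have h₄ := Nat.mul_le_mul_left (ρ 9) h₃
  have h₅ : diagCmd.steps Z ρ ≤ 100 * (1 + ρ 0) := by
    simp [diagCmd, checkCmd, incCmd, Cmd.steps, Exp.steps]
    omega
  simp only [mainCmd, Cmd.steps, Exp.steps]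
  nlinarith

end steps

/-- The program for List Disjointness. -/
def listDisjointnessProg : Prog :=
  .seq ((Cmd.set 4 boundExp).compile 0) (.seq (initCmd.compile 0) (.seq (mainCmd.compile 0)
    (.seq (.instr (.const 40 0)) (.seq (.instr (.op .add 0 19 40))
      (.seq (.instr (.op .add 1 20 40)) (.instr (.op .add 2 21 40)))))))

theorem initial_mem (n m s p a : ℕ) : (initial n m s p).mem a =
    if a = 0 then n else if a = 1 then m else if a = 2 then s else if a = 3 then p else 0 := by
  simp only [initial, Finsupp.add_apply, Finsupp.single_apply]
  split_ifs <;> omega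

/-- The variables that the program does not change after the choice of the parameters. -/
def isParam (v : ℕ) : Bool := decide (v < 13) && decide (v ≠ 3) && decide (v ≠ 5)

theorem mainCmd_ok : mainCmd.ok isParam = true := by decide

/-- What the program does on an input within the range of the parameters. -/
theorem exists_reach {n m W p : ℕ} (hn : 2 ≤ n) (hm : 0 < m) (hW : 0 < W) (hWn : W ≤ n)
    (hp : 0 < p) (hpn : p ≤ n ^ 2) {E : Env} (hE : E.Good (100 * n * n * n * n * m)) :
    ∃ σ τ, IsTau n W p τ ∧
      Reach E (80 + W) ((100 * n * n * n * n * m) ^ 8) listDisjointnessProg (initial n m W p)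
        (3000 * ((100 * n * n * n * n * m).size + 2 * n + 3 +
          6 * n.size * (n * n / ((W * τ) * (W * τ)) + 1) *
            (1 + n.size + (n * m).size + (W / 64 + 2) * (1 + n.size + 2 * τ)))) σ ∧
      (σ.mem 0 ≠ 0 → σ.mem 1 < n ∧ σ.mem 2 < n ∧ E.x (σ.mem 1) = E.y (σ.mem 2)) ∧
      ((∃ i < n, E.x i = E.y i) → σ.mem 0 ≠ 0) ∧
      ∀ it < 6 * n.size * (n * n / ((W * τ) * (W * τ)) + 1),
        RoundSuccess E n m W (2 * τ) (n / (16 * τ) + 1) (W / 64 + 2)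
          n.size (n * m) (n * m).size it (it * (2 * (n * m).size + (W / 64 + 2) * n.size)) →
        σ.mem 0 ≠ 0 := by
  set V := 100 * n * n * n * n * m with hVdef
  have hnm : n ≤ n * m := Nat.le_mul_of_pos_right n hm
  have hn3 : 8 ≤ n * n * n := by nlinarith [Nat.mul_le_mul hn hn]
  have hV4 : V = 100 * (n * n * n) * (n * m) := by rw [hVdef]; ring
  have hVnm : 800 * (n * m) ≤ V := by rw [hV4]; nlinarith
  have hVn4 : 100 * (n * n * n) * n ≤ V := by rw [hV4]; exact Nat.mul_le_mul_left _ hnm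
  have hVm : m ≤ V := (Nat.le_mul_of_pos_left m (by omega)).trans (by omega : n * m ≤ V)
  have hVn3 : 200 * (n * n * n) ≤ V := by nlinarith
  have hnn : n * n * 2 ≤ n * n * n := Nat.mul_le_mul_left _ hn
  have hVp : p ≤ V := by nlinarith
  have hV1 : V ≤ V ^ 8 := Nat.le_self_pow (by norm_num) V
  -- the initial state
  set s₀ : Store := ⟨(initial n m W p).mem, fun _ => 0, 0⟩ with hs₀
  have hle : ∀ a, (initial n m W p).mem a ≤ V := fun a => by
    rw [initial_mem]
    split_ifs <;> omega
  have hf₀ : (initial n m W p).Fits (80 + W) (V ^ 8) :=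
    ⟨fun a ha => by rw [initial_mem]; split_ifs <;> omega, fun a => (hle a).trans hV1⟩
  have hr₀ : Rel W s₀ (initial n m W p) :=
    ⟨fun _ _ => rfl, fun i _ => by rw [initial_mem]; split_ifs <;> first | omega | rfl, rfl⟩
  have hg₀ : s₀.Good (fun v => decide (v < 4)) V W := by
    refine ⟨hle, fun _ => Nat.zero_le _, fun v hv => ?_, by simp [hs₀, initial_mem], hW⟩
    simp only [decide_eq_true_eq] at hv
    simp only [hs₀, initial_mem]
    split_ifs <;> omega
  have hb : boundExp.eval E s₀ = V := by
    simp [boundExp, hs₀, initial_mem, hVdef]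
  obtain ⟨σ₁, r₁, hr₁, hg₁, hf₁, -⟩ := Cmd.reach_set (l := 0) (v := 4) (by omega) hE hg₀ hr₀ hf₀
    rfl (by norm_num) rfl boundExp_ok boundExp_depth hb.le
  set s₁ := (Cmd.set 4 boundExp).eval E s₀ with hs₁
  have hs₁' : s₁ = s₀.set 4 V := by rw [hs₁, Cmd.eval, hb]
  have hv₁ : ∀ v, s₁.var v = if v = 4 then V else (initial n m W p).mem v := fun v => by
    rw [hs₁', Store.set_var]
  have hg₁' : s₁.Good (fun v => decide (v < 5)) V W := by
    refine ⟨hg₁.var_le, hg₁.arr_le, fun v hv => ?_, hg₁.len, hW⟩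
    simp only [decide_eq_true_eq] at hv
    rw [hv₁, initial_mem]
    split_ifs <;> omega
  obtain ⟨σ₂, r₂, hr₂, hg₂, hf₂, -⟩ := Cmd.reach (by omega) hE rfl s₁.var initCmd initCmd_ok 0
    (by simpa using initCmd_nest) s₁ σ₁ (fun _ _ => rfl) hg₁' hr₁ hf₁
  obtain ⟨hu₂, h19, τ, hτ, hpar⟩ := eval_initCmd (E := E) (s := s₁) (by simp [hv₁, initial_mem])
    (by simp [hv₁, initial_mem]) (by simp [hv₁, initial_mem]) (by simp [hv₁, initial_mem])
    (by simp [hv₁]) (by simp [hv₁, initial_mem]) hVdef hn hm hW hp hWn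
  set s₂ := initCmd.eval E s₁ with hs₂
  have hτn := hτ.le hW hp (by omega)
  have hτ1 := hτ.pos
  have hsize : n.size ≤ n := Nat.size_le.2 n.lt_two_pow_self
  have hsize0 : 0 < n.size := Nat.size_pos.2 (by omega)
  have hsize2 : 0 < (n * m).size := Nat.size_pos.2 (by omega)
  set R := 6 * n.size * (n * n / ((W * τ) * (W * τ)) + 1) with hR
  have hR0 : 0 < R := Nat.mul_pos (by omega) (Nat.succ_pos _)
  have hRV : R < V := by
    have h₁ : n * n / ((W * τ) * (W * τ)) ≤ n * n := Nat.div_le_self _ _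
    have h₂ : R ≤ 6 * n * (n * n + 1) := Nat.mul_le_mul (Nat.mul_le_mul_left 6 hsize) (by omega)
    nlinarith
  have hg₂' : s₂.Good isParam V W := by
    refine ⟨hg₂.var_le, hg₂.arr_le, fun v hv => ?_, hg₂.len, hW⟩
    simp only [isParam, ne_eq, Bool.and_eq_true, decide_eq_true_eq] at hv
    obtain ⟨⟨hv, h3⟩, h5⟩ := hv
    interval_cases v
    · rw [hpar.h0]; omega
    · rw [hpar.h1]; omega
    · rw [hpar.h2]; omega
    · exact absurd rfl h3
    · rw [hpar.h4]; omega
    · exact absurd rfl h5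
    · rw [hpar.h6]; omega
    · rw [hpar.h7]; exact Nat.succ_pos _
    · rw [hpar.h8]; omega
    · rw [hpar.h9]; omega
    · rw [hpar.h10]; omega
    · rw [hpar.h11]; omega
    · rw [hpar.h12]; omega
  obtain ⟨σ₃, r₃, hr₃, hg₃, hf₃, -⟩ := Cmd.reach (by omega) hE rfl s₂.var mainCmd
    mainCmd_ok 0 (by simpa using mainCmd_nest) s₂ σ₂ (fun _ _ => rfl) hg₂' hr₂ hf₂
  have h2n := two_pow_size_le (n := n) (by omega)
  have h2nm := two_pow_size_le (n := n * m) (by omega)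
  obtain ⟨hsound, hdiag, hround⟩ := eval_mainCmd (E := E) hpar (by omega) hsize0 (by omega)
    (by omega) (by omega) (by omega) hRV h19
  set s₃ := mainCmd.eval E s₂ with hs₃
  have hm₃ := hr₃.var
  -- the output
  have r₄ := Reach.const (E := E) hf₃ (d := 40) (c := 0) (by omega) (Nat.zero_le _)
  have f₄ := hf₃.write (d := 40) (v := 0) (by omega) (Nat.zero_le _)
  have out : ∀ {σ : State} {d a : ℕ}, σ.Fits (80 + W) (V ^ 8) → σ.mem 40 = 0 → d < 40 →
      Reach E (80 + W) (V ^ 8) (.instr (.op .add d a 40)) σ 1 (σ.write d (σ.mem a)) ∧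
      (σ.write d (σ.mem a)).Fits (80 + W) (V ^ 8) ∧ (σ.write d (σ.mem a)).mem 40 = 0 := by
    intro σ d a hσ h40 hd
    have he : Op.add.eval (σ.mem a) (σ.mem 40) = σ.mem a := by rw [h40]; rfl
    refine ⟨?_, hσ.write (by omega) (hσ.le a), ?_⟩
    · have := Reach.op (E := E) hσ (o := .add) (d := d) (a := a) (b := 40) (by omega)
        (by rw [he]; exact hσ.le a)
      rwa [he] at this
    · rw [State.write_mem, if_neg (by omega), h40]
  obtain ⟨r₅, f₅, z₅⟩ := out (d := 0) (a := 19) f₄ (by simp [State.write_mem]) (by norm_num)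
  obtain ⟨r₆, f₆, z₆⟩ := out (d := 1) (a := 20) f₅ z₅ (by norm_num)
  obtain ⟨r₇, f₇, z₇⟩ := out (d := 2) (a := 21) f₆ z₆ (by norm_num)
  refine ⟨_, τ, hτ, (r₁.seq (r₂.seq (r₃.seq (r₄.seq (r₅.seq (r₆.seq r₇)))))).mono ?_, ?_⟩
  · have k₁ : boundExp.steps ≤ 100 := by decide
    have k₂ := initCmd_steps_le V.size s₁.var
    have k₃ := mainCmd_steps_le V.size s₂.var
    rw [hpar.h0, hpar.h9, hpar.h10, hpar.h12, hpar.h8, hpar.h6] at k₃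
    rw [show s₁.var 0 = n by simp [hv₁, initial_mem]] at k₂
    rw [← hR]
    omega
  · simp only [State.write_mem, hm₃ 19 (by norm_num), hm₃ 20 (by norm_num), hm₃ 21 (by norm_num)]
    refine ⟨hsound, hdiag, fun it hit h => hround it hit ?_⟩
    rwa [hu₂, hs₁', show (s₀.set 4 V).used = 0 from rfl, Nat.zero_add]

end ListDisjointness

/-! # Time and space in terms of the parameters -/

namespace ListDisjointness

open RAM MeasureTheory

theorem IsTau.le_of_isTau {n s p τ τ' : ℕ} (h : IsTau n s p τ) (h' : IsTau n s p τ') : τ' ≤ τ := by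
  rcases h'.lower with h₁ | h₁
  · rw [h₁]
    exact h.pos
  · by_contra! hlt
    have h₂ : τ ≤ τ' - 1 := by omega
    refine absurd (h.upper.trans_le (le_trans ?_ h₁)) (lt_irrefl _)
    gcongr

/-- `exists_reach` yields a `τ` for each `h` and each sequence of coins. The probability estimate
needs that they are all the same. -/
theorem IsTau.unique {n s p τ τ' : ℕ} (h : IsTau n s p τ) (h' : IsTau n s p τ') : τ = τ' :=
  le_antisymm (h'.le_of_isTau h) (h.le_of_isTau h')

/-- If `τ` is not 1, then the lower condition and `W ≤ p` give `64 * W * (τ - 1) ≤ n`, and `τ ≤ 2 *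
(τ - 1)`. -/
theorem IsTau.mul_le {n W p τ : ℕ} (hτ : IsTau n W p τ) (hWn : W ≤ n) (hWp : W ≤ p) :
    W * τ ≤ n := by
  rcases hτ.lower with h | h
  · rw [h, Nat.mul_one]
    exact hWn
  · by_contra! hlt
    obtain ⟨u, rfl⟩ : ∃ u, τ = u + 1 := ⟨τ - 1, by have := hτ.pos; omega⟩
    rw [Nat.add_sub_cancel] at h
    rcases Nat.eq_zero_or_pos u with rfl | hu
    · omega
    · have h₁ : 64 * 64 * u * u * W * W ≤ n * n := (Nat.mul_le_mul_left _ hWp).trans h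
      have h₂ : n ≤ 2 * (W * u) := by nlinarith
      have h₃ : n * n ≤ (2 * (W * u)) * (2 * (W * u)) := Nat.mul_le_mul h₂ h₂
      have h₄ : 0 < W * u := by
        rcases Nat.eq_zero_or_pos W with rfl | hW
        · omega
        · exact Nat.mul_pos hW hu
      nlinarith [Nat.mul_pos h₄ h₄]

theorem IsTau.le_mul_sqrt {n W p τ : ℕ} (hτ : IsTau n W p τ) (hW : 0 < W) :
    (n : ℝ) ≤ 64 * (W * τ) * √((p : ℝ) / W) := by
  have hW' : (0 : ℝ) < W := by exact_mod_cast hW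
  have h : (n : ℝ) * n < 64 * 64 * τ * τ * W * p := by exact_mod_cast hτ.upper
  refine le_of_sq_le_sq ?_ (by positivity)
  rw [mul_pow, Real.sq_sqrt (by positivity)]
  calc (n : ℝ) ^ 2 ≤ 64 * 64 * τ * τ * W * p := by rw [sq]; exact h.le
    _ = (64 * (W * τ)) ^ 2 * (p / W) := by
      field_simp

/-- Up to logarithms, `n² / (Wτ)² + 1` rounds of `Wτ` steps take `n² / (Wτ) + Wτ` steps. The first
term is at most `64 * T` by `IsTau.le_mul_sqrt`, the second at most `n ≤ T`. One factor `Z` comes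
from the number of bit positions, the other from drawing random numbers. -/
theorem prog_steps_le {n W p τ Z B B₂ : ℕ} (hn : 0 < n) (hτ : IsTau n W p τ) (hW : 0 < W) (hWn : W ≤ n)
    (hWp : W ≤ p) (hB : B ≤ Z) (hB₂ : B₂ ≤ Z) (hZ : 0 < Z) :
    ((3000 * (Z + 2 * n + 3 + 6 * B * (n * n / ((W * τ) * (W * τ)) + 1) *
      (1 + B + B₂ + (W / 64 + 2) * (1 + B + 2 * τ))) : ℕ) : ℝ) ≤
      18000000 * Z ^ 2 * (n * √((p : ℝ) / W)) := by
  set T : ℝ := n * √((p : ℝ) / W) with hT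
  set u : ℝ := W * τ with hu
  have hn' : (1 : ℝ) ≤ n := by exact_mod_cast hn
  have hZ' : (1 : ℝ) ≤ Z := by exact_mod_cast hZ
  have hW' : (1 : ℝ) ≤ W := by exact_mod_cast hW
  have hτ' : (1 : ℝ) ≤ τ := by exact_mod_cast hτ.pos
  have hB' : (B : ℝ) ≤ Z := by exact_mod_cast hB
  have hB₂' : (B₂ : ℝ) ≤ Z := by exact_mod_cast hB₂
  have hu1 : 1 ≤ u := by nlinarith
  have hun : u ≤ n := by
    rw [hu]
    exact_mod_cast hτ.mul_le hWn hWp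
  have hnT : (n : ℝ) ≤ T := by
    refine le_mul_of_one_le_right (by positivity) (Real.one_le_sqrt.2 ?_)
    rw [le_div_iff₀ (by positivity), one_mul]
    exact_mod_cast hWp
  have hdiv : ((n * n / ((W * τ) * (W * τ)) : ℕ) : ℝ) ≤ n * n / (u * u) := by
    refine Nat.cast_div_le.trans_eq ?_
    push_cast
    rfl
  have hnu : (n : ℝ) * n / u ≤ 64 * T := by
    rw [div_le_iff₀ (by positivity)]
    have := mul_le_mul_of_nonneg_left (hτ.le_mul_sqrt hW) (by positivity : (0 : ℝ) ≤ n)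
    calc (n : ℝ) * n ≤ n * (64 * u * √((p : ℝ) / W)) := this
      _ = 64 * T * u := by rw [hT]; ring
  have hS : ((W / 64 + 2 : ℕ) : ℝ) ≤ 3 * W := by exact_mod_cast (by omega : W / 64 + 2 ≤ 3 * W)
  have h₁ : (1 : ℝ) + B + 2 * τ ≤ 4 * (Z * τ) := by nlinarith
  have h₂ : ((W / 64 + 2 : ℕ) : ℝ) * (1 + B + 2 * τ) ≤ 12 * (Z * u) := by
    calc ((W / 64 + 2 : ℕ) : ℝ) * (1 + B + 2 * τ) ≤ 3 * W * (4 * (Z * τ)) :=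
          mul_le_mul hS h₁ (by positivity) (by positivity)
      _ = 12 * (Z * u) := by rw [hu]; ring
  have h₃ : (1 : ℝ) + B + B₂ + ((W / 64 + 2 : ℕ) : ℝ) * (1 + B + 2 * τ) ≤ 15 * (Z * u) := by
    nlinarith
  have h₄ : 6 * (B : ℝ) * (((n * n / ((W * τ) * (W * τ)) : ℕ) : ℝ) + 1) *
      (1 + B + B₂ + ((W / 64 + 2 : ℕ) : ℝ) * (1 + B + 2 * τ)) ≤ 5850 * (Z ^ 2 * T) := by
    calc 6 * (B : ℝ) * (((n * n / ((W * τ) * (W * τ)) : ℕ) : ℝ) + 1) *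
          (1 + B + B₂ + ((W / 64 + 2 : ℕ) : ℝ) * (1 + B + 2 * τ))
        ≤ 6 * (Z : ℝ) * (n * n / (u * u) + 1) * (15 * (Z * u)) := by
          gcongr
      _ = 90 * (Z ^ 2 * (n * n / u + u)) := by
          field_simp
          ring
      _ ≤ 90 * (Z ^ 2 * (64 * T + T)) := by
          gcongr
          exact hun.trans hnT
      _ = 5850 * (Z ^ 2 * T) := by ring
  have hZ2 : (Z : ℝ) ≤ Z ^ 2 := by nlinarith
  have hT1 : 1 ≤ T := hn'.trans hnT
  have h₅ : (Z : ℝ) + 2 * n + 3 ≤ 6 * (Z ^ 2 * T) := by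
    have a₁ : (Z : ℝ) ≤ Z ^ 2 * T := by nlinarith
    have a₂ : T ≤ Z ^ 2 * T := by nlinarith
    linarith
  have h₆ : 0 ≤ Z ^ 2 * T := by positivity
  push_cast at h₄ ⊢
  linarith

theorem size_le_log {n : ℕ} (hn : 2 ≤ n) : (n.size : ℝ) ≤ 3 * Real.log n := by
  have h := two_pow_size_le (n := n) (by omega)
  have h' : (2 : ℝ) ^ n.size ≤ (n : ℝ) ^ 2 := by
    calc (2 : ℝ) ^ n.size ≤ 2 * n := by exact_mod_cast h
      _ ≤ (n : ℝ) ^ 2 := by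
        have : (2 : ℝ) ≤ n := by exact_mod_cast hn
        nlinarith
  have h₁ := Real.log_le_log (by positivity) h'
  rw [Real.log_pow, Real.log_pow] at h₁
  have h₂ := Real.log_two_gt_d9
  have h₃ : (0 : ℝ) ≤ n.size := Nat.cast_nonneg _
  push_cast at h₁
  nlinarith

theorem Polynomial.eval_le_eval_one_mul_pow (q : Polynomial ℕ) {n : ℕ} (hn : 0 < n) :
    q.eval n ≤ q.eval 1 * n ^ q.natDegree := by
  rw [Polynomial.eval_eq_sum_range, Polynomial.eval_eq_sum_range, Finset.sum_mul]
  refine Finset.sum_le_sum fun i hi => ?_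
  rw [one_pow, mul_one]
  exact Nat.mul_le_mul_left _ (Nat.pow_le_pow_right hn (Finset.mem_range_succ_iff.1 hi))

/-- As `2 ≤ n`, constants become powers of `n`: `100 ≤ n ^ 7`, and the sum `q.eval 1` of the
coefficients is at most `n ^ q.eval 1`. -/
theorem size_bound_le {q : Polynomial ℕ} {n m : ℕ} (hn : 2 ≤ n) (hm : m ≤ q.eval n) :
    (100 * n * n * n * n * m).size ≤ (11 + q.eval 1 + q.natDegree) * n.size := by
  have h₁ : 100 ≤ n ^ 7 := (by norm_num : 100 ≤ 2 ^ 7).trans (Nat.pow_le_pow_left hn 7)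
  have h₂ : q.eval 1 ≤ n ^ q.eval 1 :=
    (Nat.lt_two_pow_self).le.trans (Nat.pow_le_pow_left hn _)
  have h₃ : m ≤ n ^ q.eval 1 * n ^ q.natDegree :=
    (hm.trans (Polynomial.eval_le_eval_one_mul_pow q (by omega))).trans (Nat.mul_le_mul_right _ h₂)
  refine Nat.size_le.2 ?_
  calc 100 * n * n * n * n * m = 100 * n ^ 4 * m := by ring
    _ ≤ n ^ 7 * n ^ 4 * (n ^ q.eval 1 * n ^ q.natDegree) :=
        Nat.mul_le_mul (Nat.mul_le_mul_right _ h₁) h₃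
    _ = n ^ (11 + q.eval 1 + q.natDegree) := by ring
    _ < (2 ^ n.size) ^ (11 + q.eval 1 + q.natDegree) :=
        Nat.pow_lt_pow_left (Nat.lt_size_self n) (by omega)
    _ = 2 ^ ((11 + q.eval 1 + q.natDegree) * n.size) := by rw [← pow_mul, mul_comm]

/-- The frequencies in each list add up to `n`, and squaring does not decrease them. So `p` is at
least `2 * n`, which together with `s ≤ n ^ 2 / p` bounds `s` by `n / 2`. -/
theorem two_mul_le_sqFreq {n m : ℕ} (x y : Fin n → Fin m) : 2 * n ≤ sqFreq x y := by
  have h : ∀ z : Fin n → Fin m,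
      n ≤ ∑ v, (Finset.univ.filter fun i => z i = v).card ^ 2 := fun z => by
    calc n = ∑ v, (Finset.univ.filter fun i => z i = v).card := by
          rw [← Finset.card_eq_sum_card_fiberwise fun _ _ => Finset.mem_univ _, Finset.card_univ,
            Fintype.card_fin]
      _ ≤ _ := Finset.sum_le_sum fun v _ => Nat.le_self_pow (by norm_num) _
  rw [sqFreq, Finset.sum_add_distrib, two_mul]
  exact Nat.add_le_add (h x) (h y)

theorem oracle_le {a b : ℕ} (f : Fin a → Fin b) (i : ℕ) : oracle f i ≤ b := by
  unfold oracle
  split_ifs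
  exacts [Fin.is_lt _ |>.le, Nat.zero_le _]

end ListDisjointness

/-! ### Assembling the theorem -/

open ListDisjointness

theorem theorem3 :
    ∃ (P : RAM.Prog) (δ : ℝ) (k : ℕ), 0 < δ ∧
      ∀ q : Polynomial ℕ, ∃ C : ℝ,
        ∀ (n m s p : ℕ) (x y : Fin n → Fin m),
          m ≤ q.eval n → 0 < s → 0 < p →
          ListDisjointness.sqFreq x y ≤ p → (s : ℝ) ≤ (n : ℝ) ^ 2 / p →
          -- for all `h` and all coins: resource bounds, and no false positives
          (∀ (h : Fin m → Fin n) (ω : ℕ → Bool), ∃ (σ : RAM.State) (t b : ℕ),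
            ListDisjointness.Runs P x y s p h ω σ t b ∧
            (t : ℝ) ≤ C * (n * √((p : ℝ) / s)) * Real.log (n * √((p : ℝ) / s)) ^ k ∧
            (b : ℝ) ≤ C * (s * Real.log n) ∧
            ∀ ab, ListDisjointness.answer σ = some ab → ListDisjointness.IsSolution x y ab) ∧
          -- false negatives have probability at most `1 - δ`
          ((∃ i j, x i = y j) →
            δ ≤ (ListDisjointness.law n m).real {hω | ∃ (σ : RAM.State) (t b : ℕ),
              ListDisjointness.Runs P x y s p hω.1 hω.2 σ t b ∧
              (ListDisjointness.answer σ).isSome}) := by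
  -- Two of the four logarithmic factors come from the number of steps, the other two from the cost
  -- of a step.
  refine ⟨listDisjointnessProg, 1 / 2 ^ 28, 4, by positivity, fun q => ?_⟩
  set D := 11 + q.eval 1 + q.natDegree with hD
  -- The first summand serves the time, with `1458000000 = 18000000 * 81`. The second serves the
  -- space, with `2187 = 81 * 9 * 3`: there are `80 + s ≤ 81 * s` cells, each with at most `9 *
  -- V.size` bits, and the last factor 3 comes from `size_le_log`.
  refine ⟨1458000000 * (3 * D) ^ 4 + 2187 * D, fun n m s p x y hm hs hp hsq hsp => ?_⟩
  have hp' : (0 : ℝ) < p := by exact_mod_cast hp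
  have hsp' : s * p ≤ n ^ 2 := by
    rw [le_div_iff₀ hp'] at hsp
    exact_mod_cast hsp
  have hnp : 2 * n ≤ p := (two_mul_le_sqFreq x y).trans hsq
  have hn0 : 0 < n := by
    rcases Nat.eq_zero_or_pos n with rfl | h
    · nlinarith [Nat.mul_pos hs hp]
    · exact h
  have hsn : 2 * s ≤ n := by
    have := Nat.mul_le_mul_left s hnp
    nlinarith
  have hn : 2 ≤ n := by omega
  have hpn : p ≤ n ^ 2 := (Nat.le_mul_of_pos_left p hs).trans hsp'
  have hm0 : 0 < m := (Nat.zero_le _).trans_lt (x ⟨0, hn0⟩).2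
  set V := 100 * n * n * n * n * m with hV
  have hV1 : 100 * (n * n * n) * n ≤ V := by
    rw [hV, show 100 * n * n * n * n * m = 100 * (n * n * n) * n * m by ring]
    exact Nat.le_mul_of_pos_right _ hm0
  have hn3 : 8 ≤ n * n * n := by nlinarith [Nat.mul_le_mul hn hn]
  have hVn : 800 * n ≤ V := by nlinarith
  have hVnm : n * m ≤ V := by
    rw [hV, show 100 * n * n * n * n * m = 100 * (n * n * n) * (n * m) by ring]
    exact Nat.le_mul_of_pos_left _ (by omega)
  have hVm : m ≤ V := (Nat.le_mul_of_pos_left m hn0).trans hVnm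
  have hE : ∀ (h : Fin m → Fin n) (ω : ℕ → Bool),
      RAM.Env.Good V ⟨oracle x, oracle y, oracle h, ω⟩ := fun h ω =>
    ⟨fun i => (oracle_le x i).trans hVm, fun i => (oracle_le y i).trans hVm,
      fun i => (oracle_le h i).trans (by omega)⟩
  have key := fun h ω => exists_reach hn hm0 hs (by omega) hp hpn (hE h ω)
  simp only [← hV] at key
  have hlogn : (0 : ℝ) ≤ Real.log n := Real.log_natCast_nonneg n
  have hZ0 : 0 < V.size := Nat.size_pos.2 (by omega)
  have hZD : (V.size : ℝ) ≤ 3 * D * Real.log n := by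
    calc (V.size : ℝ) ≤ D * n.size := by exact_mod_cast size_bound_le hn hm
      _ ≤ D * (3 * Real.log n) := by gcongr; exact size_le_log hn
      _ = 3 * D * Real.log n := by ring
  have hV8 : (V ^ 8).size ≤ 8 * V.size := by
    refine Nat.size_le.2 ?_
    rw [mul_comm, pow_mul]
    exact Nat.pow_lt_pow_left (Nat.lt_size_self V) (by norm_num)
  refine ⟨fun h ω => ?_, ?_⟩
  · obtain ⟨σ, τ, hτ, ⟨t, b, hex, ht, hb⟩, hsound, -, -⟩ := key h ω
    refine ⟨σ, t, b, hex, ?_, ?_, fun ab hab => ?_⟩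
    · have hk := prog_steps_le (Z := V.size) hn0 hτ hs (by omega) (by omega)
        (Nat.size_le_size (by omega : n ≤ V)) (Nat.size_le_size hVnm) hZ0
      set T : ℝ := n * √((p : ℝ) / s) with hT
      have hnT : (n : ℝ) ≤ T := by
        refine le_mul_of_one_le_right (by positivity) (Real.one_le_sqrt.2 ?_)
        rw [le_div_iff₀ (by exact_mod_cast hs), one_mul]
        exact_mod_cast (by omega : s ≤ p)
      have hlog : Real.log n ≤ Real.log T :=
        Real.log_le_log (by exact_mod_cast hn0) hnT
      have hT0 : 0 ≤ T := (Nat.cast_nonneg n).trans hnT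
      have hsz : (((1 + (V ^ 8).size) ^ 2 : ℕ) : ℝ) ≤ 81 * V.size ^ 2 := by
        have : (1 + (V ^ 8).size) ^ 2 ≤ (9 * V.size) ^ 2 := Nat.pow_le_pow_left (by omega) 2
        calc (((1 + (V ^ 8).size) ^ 2 : ℕ) : ℝ) ≤ ((9 * V.size) ^ 2 : ℕ) := by exact_mod_cast this
          _ = 81 * V.size ^ 2 := by push_cast; ring
      calc (t : ℝ) ≤ _ := Nat.cast_le.2 ht
        _ ≤ 18000000 * V.size ^ 2 * T * (81 * V.size ^ 2) := by
            rw [Nat.cast_mul]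
            exact mul_le_mul hk hsz (Nat.cast_nonneg _) (by positivity)
        _ = 1458000000 * (V.size : ℝ) ^ 4 * T := by ring
        _ ≤ 1458000000 * (3 * D * Real.log T) ^ 4 * T := by
            gcongr
            exact hZD.trans (by gcongr)
        _ = 1458000000 * (3 * D) ^ 4 * T * Real.log T ^ 4 := by ring
        _ ≤ _ := by
            have : 0 ≤ Real.log T := hlogn.trans hlog
            gcongr
            exact le_add_of_nonneg_right (by positivity)
    · have hs' : (1 : ℝ) ≤ s := by exact_mod_cast hs
      have hb' : b ≤ 81 * s * (9 * V.size) := by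
        refine hb.trans (Nat.mul_le_mul (by omega) ?_)
        have := Nat.size_le_size (by omega : 80 + s ≤ V)
        omega
      calc (b : ℝ) ≤ ((81 * s * (9 * V.size) : ℕ) : ℝ) := Nat.cast_le.2 hb'
        _ = 729 * s * V.size := by push_cast; ring
        _ ≤ 729 * s * (3 * D * Real.log n) := by gcongr
        _ = 2187 * D * (s * Real.log n) := by ring
        _ ≤ _ := by
            gcongr
            exact le_add_of_nonneg_left (by positivity)
    · unfold answer at hab
      split_ifs at hab with h0
      obtain rfl := Option.some.inj hab
      obtain ⟨h₁, h₂, h₃⟩ := hsound h0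
      refine ⟨⟨σ.mem 1, h₁⟩, ⟨σ.mem 2, h₂⟩, rfl, rfl, Fin.ext ?_⟩
      rw [← oracle_apply x, ← oracle_apply y]
      exact h₃
  · rintro ⟨i, j, hij⟩
    have hsome : ∀ σ : RAM.State, σ.mem 0 ≠ 0 → (answer σ).isSome := fun σ h0 => by
      rw [answer, if_neg h0]
      rfl
    -- A solution with two equal indices is found with certainty. Otherwise the two indices of the
    -- given solution differ, and the random walks apply.
    by_cases hdiag : ∃ u < n, oracle x u = oracle y u
    · have := isProbabilityMeasure_law (m := m) hn0
      rw [Set.eq_univ_of_forall (s := {hω | _}) fun hω => ?_, MeasureTheory.probReal_univ]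
      · norm_num
      · obtain ⟨σ, τ, hτ, ⟨t, b, hex, -, -⟩, -, hd, -⟩ := key hω.1 hω.2
        exact ⟨σ, t, b, hex, hsome σ (hd hdiag)⟩
    · have hne : i ≠ j := by
        rintro rfl
        exact hdiag ⟨i, i.2, by rw [oracle_apply, oracle_apply, hij]⟩
      -- Any function and any coins will do here; they only serve to obtain `τ`.
      obtain ⟨-, τ, hτ, -⟩ := key (fun _ => i) fun _ => false
      refine le_law_of_roundSuccess hn hs hnp hsp' hτ hsq hne hij _ fun h ω it hit hsucc => ?_
      obtain ⟨σ, τ', hτ', ⟨t, b, hex, -, -⟩, -, -, hr⟩ := key h ω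
      obtain rfl := hτ.unique hτ'
      exact ⟨σ, t, b, hex, hsome σ (hr it hit hsucc)⟩
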